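/- \textbf{Proposition (Read-Once is Easy).} Let $Q$ be a connected self-join-free Boolean conjunctive query with at least one variable. For a database $D$ let $W$ be the set of witnesses (satisfying valuations) and $\mathrm{Prov}(Q,D)$ the DNF $\bigvee_{w\in W}\bigwedge_i R_i(w(\vec x_i))$. The length of a positive Boolean formula is its number of literal occurrences; a formula is read-once if it is equivalent to one that repeats no literal (read-once form); a minimal factorization of it is an equivalent formula of minimum length. A variable elimination order (VEO) is a rooted tree whose node labels partition the variables and which comes from a legal query plan (the variables of each atom lie on one root path; projections and joins alternate). A prefix of a VEO is a path from the root; the table prefix of an atom is the smallest one containing its variables. A VEO is minimal if the dissociation that adds to each atom the variables of its table prefix is minimal, under componentwise inclusion, among the dissociations that make $Q$ hierarchical; $\mathrm{mveo}(Q)$ is the set of minimal VEOs. A choice $f:W\to\mathrm{mveo}(Q)$ defines a factorization of $\mathrm{Prov}(Q,D)$, in which equal prefix instances (a prefix with the values of a witness) are written once. A nested ordering $\Omega$ is an expression built from (partial) VEOs, its leaves, by sequences $(\Omega_1,\Omega_2)$ of alternatives and products $\Omega_1\times\Omega_2$ of independent choices, that offers each element of $\mathrm{mveo}(Q)$ exactly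 once; a linear ordering is a sequence of VEOs. It is running-prefixes (RP) if the leaves having any given prefix form one contiguous run (in a linear ordering: a prefix of $q_i$ and $q_j$ is a prefix of everything between them), where a prefix occurring in both factors of a product belongs to all leaves of that product, and a run that reaches beyond a product contains all of its leaves. The factorization flow graph $F$ has, for each $w\in W$, a copy of $\Omega$ between source and target: sequences are in series (with connectors in between), products are in parallel, and each leaf is a plan node of weight $0$. For each instance of a table prefix $p$ there is one node, shared by all witnesses with that instance, attached for each of them to the connectors around the first and the last leaf that has $p$ as a prefix; its weight is the number of atoms with table prefix $p$. Connectors and edges cannot be cut. A choice $f$ selects, for each witness $w$, the plan nodes and the table-prefix nodes of $f(w)$. There is leakage if for no choice $f$ that defines a minimal factorization the selected nodes form a cut; a leakage path is a source-target path that avoids all selected nodes of some such $f$. Then $Q$ has a (nested) RP-ordering, and for every (nested) RP-ordering $\Omega$ of $\mathrm{mveo}(Q)$: \begin{enumerate} \item For every database $D$ such that $\mathrm{Prov}(Q,D)$ is read-once, $F$ has no leakage and no leakage path. Every minimum-weight cut $C$ of $F$ contains the nodes selected by some choice $f:W\to\mathrm{mveo}(Q)$, and for every such $f$ the factorization defined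 by $f$ is in read-once form, is a minimal factorization of $\mathrm{Prov}(Q,D)$, and its length is the weight of $C$. \item There is an algorithm (depending only on $Q$ and $\Omega$) that runs in time polynomial in the size of $D$ on every database $D$ and that, whenever $\mathrm{Prov}(Q,D)$ is read-once, outputs a minimum-weight cut of $F$ together with a factorization that it yields as in 1, i.e. a read-once, minimal factorization of $\mathrm{Prov}(Q,D)$. \end{enumerate} -/

import Mathlib

/-! ## Positive Boolean formulas -/

/-- Positive Boolean formulas over tokens `T`.  The constants have length `0`. -/
inductive Form (T : Type) : Type
  | bot : Form T
  | top : Form T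
  | lit (t : T) : Form T
  | and (φ ψ : Form T) : Form T
  | or (φ ψ : Form T) : Form T

namespace Form

variable {T : Type}

/-- Truth of a formula in the world in which exactly the tokens with `ν t` are present. -/
def Holds (ν : T → Prop) : Form T → Prop
  | bot => False
  | top => True
  | lit t => ν t
  | and φ ψ => φ.Holds ν ∧ ψ.Holds ν
  | or φ ψ => φ.Holds ν ∨ ψ.Holds ν

/-- The literals of a formula, from left to right, with repetitions. -/
def lits : Form T → List T
  | bot => []
  | top => []
  | lit t => [t]
  | and φ ψ => φ.lits ++ ψ.lits
  | or φ ψ => φ.lits ++ ψ.lits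

/-- The length of a formula: the number of its literals, counted with repetitions. -/
def len (φ : Form T) : ℕ := φ.lits.length

/-- Logical equivalence. -/
def Equivalent (φ ψ : Form T) : Prop := ∀ ν : T → Prop, φ.Holds ν ↔ ψ.Holds ν

/-- The expression is in read-once form: no literal is repeated. -/
def InReadOnceForm (φ : Form T) : Prop := φ.lits.Nodup

/-- `φ` is read-once: some equivalent expression is in read-once form. -/
def IsReadOnce (φ : Form T) : Prop := ∃ ψ : Form T, ψ.Equivalent φ ∧ ψ.InReadOnceForm

/-- `φ` is a minimal factorization of `ψ`: an equivalent formula with the fewest literals. -/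
def IsMinimalFor (φ ψ : Form T) : Prop :=
  φ.Equivalent ψ ∧ ∀ χ : Form T, χ.Equivalent ψ → φ.len ≤ χ.len

/-- Conjunction of a list. -/
def bigAnd : List (Form T) → Form T
  | [] => top
  | [φ] => φ
  | φ :: ψ :: l => and φ (bigAnd (ψ :: l))

/-- Disjunction of a list. -/
def bigOr : List (Form T) → Form T
  | [] => bot
  | [φ] => φ
  | φ :: ψ :: l => or φ (bigOr (ψ :: l))

end Form

/-! ## Queries, databases, witnesses, provenance -/

/-- A self-join-free Boolean conjunctive query: every atom `i` has its own relation symbol, of arity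
`arity i`, and the argument list `args i`; the variables are those that occur in some atom. -/
structure CQ where
  numVars : ℕ
  numAtoms : ℕ
  arity : Fin numAtoms → ℕ
  args : (i : Fin numAtoms) → Fin (arity i) → Fin numVars
  covers : ∀ x : Fin numVars, ∃ i j, args i j = x

namespace CQ

abbrev Var (Q : CQ) : Type := Fin Q.numVars

abbrev Atom (Q : CQ) : Type := Fin Q.numAtoms

/-- The set of variables of atom `i`. -/
def vars (Q : CQ) (i : Q.Atom) : Finset Q.Var := Finset.univ.image (Q.args i)

/-- Any two atoms are linked by a chain of atoms in which neighbours share a variable. -/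
def Connected (Q : CQ) : Prop :=
  ∀ i j : Q.Atom, Relation.ReflTransGen (fun a b => (Q.vars a ∩ Q.vars b).Nonempty) i j

/-- A database instance: one finite relation for each relation symbol. -/
abbrev Database (Q : CQ) : Type := (i : Q.Atom) → Finset (Fin (Q.arity i) → ℕ)

/-- A valuation of the variables by constants. -/
abbrev Valuation (Q : CQ) : Type := Q.Var → ℕ

/-- The provenance tokens: possible tuples, tagged by their relation symbol. -/
abbrev Token (Q : CQ) : Type := (i : Q.Atom) × (Fin (Q.arity i) → ℕ)

/-- The active domain. -/
def adom (Q : CQ) (D : Q.Database) : Finset ℕ :=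
  Finset.univ.biUnion fun i => (D i).biUnion fun t => Finset.univ.image t

/-- The witnesses: valuations into the active domain that satisfy every atom. -/
def witnesses (Q : CQ) (D : Q.Database) : Finset Q.Valuation :=
  (Fintype.piFinset fun _ => Q.adom D).filter fun w => ∀ i, (fun j => w (Q.args i j)) ∈ D i

/-- The DNF provenance of `Q` on `D`. -/
noncomputable def provenance (Q : CQ) (D : Q.Database) : Form Q.Token :=
  Form.bigOr ((Q.witnesses D).toList.map fun w =>
    Form.bigAnd ((List.finRange Q.numAtoms).map fun i => Form.lit ⟨i, fun j => w (Q.args i j)⟩))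

/-! ## Dissociations and minimal variable elimination orders -/

/-- `Δ` adds to each atom `i` a set `Δ i` of variables that do not occur in it. -/
def IsDissociation (Q : CQ) (Δ : Q.Atom → Finset Q.Var) : Prop :=
  ∀ i, Disjoint (Δ i) (Q.vars i)

/-- The atoms of the dissociated query that contain `x`. -/
def atomsOf (Q : CQ) (Δ : Q.Atom → Finset Q.Var) (x : Q.Var) : Finset Q.Atom :=
  Finset.univ.filter fun i => x ∈ Q.vars i ∪ Δ i

/-- The dissociated query is hierarchical. -/
def IsHierarchical (Q : CQ) (Δ : Q.Atom → Finset Q.Var) : Prop :=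
  ∀ x y : Q.Var, Q.atomsOf Δ x ⊆ Q.atomsOf Δ y ∨ Q.atomsOf Δ y ⊆ Q.atomsOf Δ x ∨
    Disjoint (Q.atomsOf Δ x) (Q.atomsOf Δ y)

/-- `Δ` is minimal among the hierarchical dissociations, in the order of componentwise inclusion. -/
def IsMinimalHierarchical (Q : CQ) (Δ : Q.Atom → Finset Q.Var) : Prop :=
  Q.IsDissociation Δ ∧ Q.IsHierarchical Δ ∧
    ∀ Δ', Q.IsDissociation Δ' → Q.IsHierarchical Δ' → (∀ i, Δ' i ⊆ Δ i) → Δ' = Δ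

/-- A prefix `S₁ ← S₂ ← … ← Sₖ` (a path that starts in the root), as the list of its node labels,
the root first. -/
abbrev Path (Q : CQ) : Type := List (Finset Q.Var)

/-- A rooted tree with labelled nodes, as the set of its root-to-node paths, one for each node. -/
abbrev Tree (Q : CQ) : Type := Finset Q.Path

/-- The variables on a path. -/
def pathVars (Q : CQ) (p : Q.Path) : Finset Q.Var := p.foldr (· ∪ ·) ∅

/-- The atoms whose table prefix is `p`: all their variables lie on `p`, and on no shorter prefix
of `p`.  In a tree whose labels are disjoint, `p` is then the smallest path to the root that
contains the variables of the atom. -/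
def tablesAt (Q : CQ) (p : Q.Path) : Finset Q.Atom :=
  Finset.univ.filter fun i => Q.vars i ⊆ Q.pathVars p ∧ ¬ Q.vars i ⊆ Q.pathVars p.dropLast

/-- `v` is a legal variable elimination order: a rooted tree whose labels are nonempty and partition
the variables, and that comes from a legal query plan, in which the node `p` is the projection that
eliminates the last label of `p` from the join of the atoms in `tablesAt p` and the plans of the
children of `p`.  Legality means that the variables of every atom lie on one path and that
projections and joins alternate (no node has a single child and no atom). -/
structure IsVEO (Q : CQ) (v : Q.Tree) : Prop where
  ne_nil : ∀ p ∈ v, p ≠ []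
  label_nonempty : ∀ p ∈ v, ∅ ∉ p
  prefix_closed : ∀ (p : Q.Path) (S : Finset Q.Var), p ≠ [] → p ++ [S] ∈ v → p ∈ v
  one_root : ∀ p ∈ v, ∀ p' ∈ v, p.head? = p'.head?
  partition : ∀ x : Q.Var, ∃! p : Q.Path, p ∈ v ∧ ∃ S : Finset Q.Var, p.getLast? = some S ∧ x ∈ S
  atoms_on_paths : ∀ i : Q.Atom, ∃ p ∈ v, Q.vars i ⊆ Q.pathVars p
  alternating : ∀ p ∈ v, (Q.tablesAt p).Nonempty ∨
    ∃ S S' : Finset Q.Var, S ≠ S' ∧ p ++ [S] ∈ v ∧ p ++ [S'] ∈ v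

/-- The dissociation that corresponds to `v`: atom `i` receives the variables on its table prefix
that it does not contain. -/
def dissociationOf (Q : CQ) (v : Q.Tree) (i : Q.Atom) : Finset Q.Var :=
  (v.filter fun p => i ∈ Q.tablesAt p).biUnion Q.pathVars \ Q.vars i

/-- The minimal variable elimination orders of `Q`. -/
def mveo (Q : CQ) : Set Q.Tree :=
  {v | Q.IsVEO v ∧ Q.IsMinimalHierarchical (Q.dissociationOf v)}

/-! ## Factorizations -/

/-- An instance of a prefix: the prefix with a constant for each of its variables. -/
abbrev PInst (Q : CQ) : Type := Q.Path × (Q.Var → Option ℕ)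

/-- The instance of `p` for the witness `w`. -/
def inst (Q : CQ) (w : Q.Valuation) (p : Q.Path) : Q.PInst :=
  (p, fun x => if x ∈ Q.pathVars p then some (w x) else none)

/-- `f` chooses a minimal variable elimination order for each witness. -/
def IsAssignment (Q : CQ) (D : Q.Database) (f : Q.Valuation → Q.Tree) : Prop :=
  ∀ w ∈ Q.witnesses D, f w ∈ Q.mveo

/-- All prefix instances of the chosen orders. -/
def prefixInstances (Q : CQ) (D : Q.Database) (f : Q.Valuation → Q.Tree) : Finset Q.PInst :=
  (Q.witnesses D).biUnion fun w => (f w).image (Q.inst w)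

/-- The variables that are linked to `S` in the query with the variables in `X` removed. -/
def component (Q : CQ) (X S : Finset Q.Var) : Set Q.Var :=
  {y | ∃ x ∈ S, Relation.ReflTransGen
    (fun a b => a ∉ X ∧ b ∉ X ∧ ∃ i, a ∈ Q.vars i ∧ b ∈ Q.vars i) x y}

/-- `π'` extends `π` by one node. -/
def IsChild (Q : CQ) (π π' : Q.PInst) : Prop :=
  (∃ S, π'.1 = π.1 ++ [S]) ∧ ∀ x ∈ Q.pathVars π.1, π'.2 x = π.2 x

/-- The literals that are written at the prefix instance `π`. -/
def tokensAt (Q : CQ) (π : Q.PInst) : List (Form Q.Token) :=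
  ((List.finRange Q.numAtoms).filter fun i => decide (i ∈ Q.tablesAt π.1)).map fun i =>
    Form.lit ⟨i, fun j => (π.2 (Q.args i j)).getD 0⟩

open Classical in
/-- The factor written at `π`, given the list `L` of the prefix instances in use: the literals at
`π`, in conjunction with, for each component of the rest of the query, the disjunction of the
factors of the children of `π` that eliminate this component.  The numeral bounds the depth. -/
noncomputable def factorAt (Q : CQ) (L : List Q.PInst) : ℕ → Q.PInst → Form Q.Token
  | 0, π => Form.bigAnd (Q.tokensAt π)
  | k + 1, π =>
    let children := L.filter fun π' => decide (Q.IsChild π π')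
    let comp := fun π' : Q.PInst => Q.component (Q.pathVars π.1) (π'.1.getLastD ∅)
    Form.bigAnd (Q.tokensAt π ++ (children.map comp).dedup.map fun K =>
      Form.bigOr ((children.filter fun π' => decide (comp π' = K)).map (factorAt Q L k)))

/-- The factorized formula for the list `L` of the prefix instances in use. -/
noncomputable def factor (Q : CQ) (L : List Q.PInst) : Form Q.Token :=
  Form.bigOr ((L.filter fun π => decide (π.1.length = 1)).map (Q.factorAt L Q.numVars))

/-- `φ` is the factorization of the witnesses that the choice `f` defines (up to the order in which
it is written). -/
def IsFactorizationOf (Q : CQ) (D : Q.Database) (f : Q.Valuation → Q.Tree)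
    (φ : Form Q.Token) : Prop :=
  ∃ L : List Q.PInst, L.Nodup ∧ (∀ π, π ∈ L ↔ π ∈ Q.prefixInstances D f) ∧ φ = Q.factor L

/-- `f` defines a minimal factorization of the provenance. -/
def IsMinimalAssignment (Q : CQ) (D : Q.Database) (f : Q.Valuation → Q.Tree) : Prop :=
  Q.IsAssignment D f ∧ ∀ φ, Q.IsFactorizationOf D f φ → φ.IsMinimalFor (Q.provenance D)

/-! ## Running-prefixes orderings, linear and nested -/

/-- Expressions for (nested) orderings: a single (partial) elimination order, alternatives in
sequence `(Ω₁, Ω₂)`, and independent choices `Ω₁ × Ω₂`.  A linear ordering is a sequence of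
singles; the leaves of an independent choice are partial trees. -/
inductive Ordering (Q : CQ) : Type
  | single (v : Finset (List (Finset (Fin Q.numVars)))) : Ordering Q
  | seq (a b : Ordering Q) : Ordering Q
  | par (a b : Ordering Q) : Ordering Q

namespace Ordering

variable {Q : CQ}

/-- The choices that an ordering offers, each with the set of the leaves that it uses (a leaf is
named by its address in the expression) and the tree that these form together. -/
def choices : Q.Ordering → List Bool → List (Finset (List Bool) × Q.Tree)
  | single v, α => [({α}, v)]
  | seq a b, α => a.choices (false :: α) ++ b.choices (true :: α)
  | par a b, α => (a.choices (false :: α)).flatMap fun c =>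
      (b.choices (true :: α)).map fun d => (c.1 ∪ d.1, c.2 ∪ d.2)

/-- `p` is a prefix of some leaf. -/
def Occurs (p : Q.Path) : Q.Ordering → Prop
  | single v => p ∈ v
  | seq a b => a.Occurs p ∨ b.Occurs p
  | par a b => a.Occurs p ∨ b.Occurs p

/-- `p` is a prefix of every leaf. -/
def Full (p : Q.Path) : Q.Ordering → Prop
  | single v => p ∈ v
  | seq a b => a.Full p ∧ b.Full p
  | par a b => a.Full p ∧ b.Full p

/-- `p` occurs, and exactly in an initial run of the leaves. -/
def Initial (p : Q.Path) : Q.Ordering → Prop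
  | single v => p ∈ v
  | seq a b => (a.Full p ∧ b.Initial p) ∨ (a.Initial p ∧ ¬ b.Occurs p)
  | par a b => a.Full p ∧ b.Full p

/-- `p` occurs, and exactly in a final run of the leaves. -/
def Final (p : Q.Path) : Q.Ordering → Prop
  | single v => p ∈ v
  | seq a b => (a.Final p ∧ b.Full p) ∨ (¬ a.Occurs p ∧ b.Final p)
  | par a b => a.Full p ∧ b.Full p

/-- The leaves of which `p` is a prefix form one run: if `p` is a prefix of two alternatives, then
also of everything between them, and it occurs on both sides of an independent choice only if it is
common to the whole of it. -/
def Running (p : Q.Path) : Q.Ordering → Prop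
  | single _ => True
  | seq a b => a.Running p ∧ b.Running p ∧ (a.Occurs p → b.Occurs p → a.Final p ∧ b.Initial p)
  | par a b => a.Running p ∧ b.Running p ∧ (a.Occurs p → b.Occurs p → a.Full p ∧ b.Full p)

/-- `Ω` is a (nested) running-prefixes ordering of the minimal variable elimination orders: it
offers each of them exactly once, and every prefix runs. -/
structure IsRunningPrefixes (Ω : Q.Ordering) : Prop where
  nodup : ((Ω.choices []).map Prod.snd).Nodup
  enumerates : ∀ v : Q.Tree, v ∈ (Ω.choices []).map Prod.snd ↔ v ∈ Q.mveo
  running : ∀ p : Q.Path, Ω.Running p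

end Ordering

/-! ## The factorization flow graph -/

/-- Places for connector nodes: the two ends, and one between the two parts of each sequence. -/
inductive Pos : Type
  | start : Pos
  | finish : Pos
  | mid (α : List Bool) : Pos

/-- Nodes of the flow graph: source, target, connectors, query plan variables (for a witness and a
leaf of the ordering), prefix variables (shared by all witnesses with the same instance). -/
inductive FlowNode (Q : CQ) : Type
  | src : FlowNode Q
  | tgt : FlowNode Q
  | conn (w : Fin Q.numVars → ℕ) (c : Pos) : FlowNode Q
  | plan (w : Fin Q.numVars → ℕ) (α : List Bool) : FlowNode Q
  | pre (π : List (Finset (Fin Q.numVars)) × (Fin Q.numVars → Option ℕ)) : FlowNode Q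

namespace Ordering

variable {Q : CQ}

/-- The leaves (given by their addresses) with the connectors before and after them: sequences are
in series and independent choices are in parallel. -/
def leaves : Q.Ordering → List Bool → Pos → Pos → List (List Bool × Pos × Pos)
  | single _, α, l, r => [(α, l, r)]
  | seq a b, α, l, r => a.leaves (false :: α) l (.mid α) ++ b.leaves (true :: α) (.mid α) r
  | par a b, α, l, r => a.leaves (false :: α) l r ++ b.leaves (true :: α) l r

open Classical in
/-- The connector before the first leaf and the one after the last leaf of which `p` is a prefix. -/
noncomputable def span (p : Q.Path) : Q.Ordering → List Bool → Pos → Pos → Option (Pos × Pos)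
  | single v, _, l, r => if p ∈ v then some (l, r) else none
  | seq a b, α, l, r =>
    match a.span p (false :: α) l (.mid α), b.span p (true :: α) (.mid α) r with
    | some s, some t => some (s.1, t.2)
    | some s, none => some s
    | none, t => t
  | par a b, α, l, r =>
    match a.span p (false :: α) l r, b.span p (true :: α) l r with
    | some _, some _ => some (l, r)
    | some s, none => some s
    | none, t => t

/-- The edges of the factorization flow graph of the witnesses of `D` under `Ω`.  Only prefixes
that are the table prefix of some atom have a node. -/
inductive Edge (Ω : Q.Ordering) (D : Q.Database) : Q.FlowNode → Q.FlowNode → Prop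
  | source (w : Q.Valuation) (hw : w ∈ Q.witnesses D) : Edge Ω D .src (.conn w .start)
  | target (w : Q.Valuation) (hw : w ∈ Q.witnesses D) : Edge Ω D (.conn w .finish) .tgt
  | toPlan (w : Q.Valuation) (hw : w ∈ Q.witnesses D) (α : List Bool) (l r : Pos)
      (h : (α, l, r) ∈ Ω.leaves [] .start .finish) : Edge Ω D (.conn w l) (.plan w α)
  | fromPlan (w : Q.Valuation) (hw : w ∈ Q.witnesses D) (α : List Bool) (l r : Pos)
      (h : (α, l, r) ∈ Ω.leaves [] .start .finish) : Edge Ω D (.plan w α) (.conn w r)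
  | toPre (w : Q.Valuation) (hw : w ∈ Q.witnesses D) (p : Q.Path) (hp : (Q.tablesAt p).Nonempty)
      (l r : Pos) (h : Ω.span p [] .start .finish = some (l, r)) :
      Edge Ω D (.conn w l) (.pre (Q.inst w p))
  | fromPre (w : Q.Valuation) (hw : w ∈ Q.witnesses D) (p : Q.Path) (hp : (Q.tablesAt p).Nonempty)
      (l r : Pos) (h : Ω.span p [] .start .finish = some (l, r)) :
      Edge Ω D (.pre (Q.inst w p)) (.conn w r)

/-- There is a path from source to target that uses no node of `C`. -/
def HasPathAvoiding (Ω : Q.Ordering) (D : Q.Database) (C : Set Q.FlowNode) : Prop :=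
  Relation.ReflTransGen (fun a b => Ω.Edge D a b ∧ b ∉ C) .src .tgt

/-- The plan and prefix nodes of the graph; the other nodes and the edges have infinite capacity. -/
def IsCuttable (Ω : Q.Ordering) (D : Q.Database) : Q.FlowNode → Prop
  | .src => False
  | .tgt => False
  | .conn _ _ => False
  | .plan w α => ∃ n, Ω.Edge D (.plan w α) n
  | .pre π => ∃ n, Ω.Edge D (.pre π) n

/-- `C` is a cut: a set of cuttable nodes that meets every path from source to target. -/
def IsCut (Ω : Q.Ordering) (D : Q.Database) (C : Set Q.FlowNode) : Prop :=
  C.Finite ∧ (∀ n ∈ C, Ω.IsCuttable D n) ∧ ¬ Ω.HasPathAvoiding D C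

/-- The weight of a prefix node is the number of atoms with this table prefix; plan nodes have
weight `0`. -/
def nodeWeight : Q.FlowNode → ℕ
  | .pre π => (Q.tablesAt π.1).card
  | _ => 0

/-- The weight of a finite set of nodes. -/
noncomputable def cutWeight (C : Set Q.FlowNode) : ℕ := ∑ᶠ n ∈ C, nodeWeight n

/-- A minimum-weight cut. -/
def IsMinCut (Ω : Q.Ordering) (D : Q.Database) (C : Set Q.FlowNode) : Prop :=
  Ω.IsCut D C ∧ ∀ C', Ω.IsCut D C' → cutWeight C ≤ cutWeight C'

/-- The nodes that the choice `f` selects: for each witness the plan nodes of its elimination order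
and the prefix nodes of all its table prefixes. -/
def selected (Ω : Q.Ordering) (D : Q.Database) (f : Q.Valuation → Q.Tree) : Set Q.FlowNode :=
  {n | ∃ w ∈ Q.witnesses D,
    (∃ c ∈ Ω.choices [], c.2 = f w ∧ ∃ α ∈ c.1, n = .plan w α) ∨
    (∃ p ∈ f w, (Q.tablesAt p).Nonempty ∧ n = .pre (Q.inst w p))}

/-- Leakage: no minimal factorization is a cut of the flow graph. -/
def HasLeakage (Ω : Q.Ordering) (D : Q.Database) : Prop :=
  ¬ ∃ f, Q.IsMinimalAssignment D f ∧ Ω.IsCut D (Ω.selected D f)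

/-- A leakage path: a path from source to target that avoids all nodes of some minimal
factorization. -/
def HasLeakagePath (Ω : Q.Ordering) (D : Q.Database) : Prop :=
  ∃ f, Q.IsMinimalAssignment D f ∧ Ω.HasPathAvoiding D (Ω.selected D f)

end Ordering

end CQ

/-! ## A machine model with a step count -/

/-- Data: binary trees. -/
inductive Data : Type
  | nil : Data
  | cons (a b : Data) : Data
  deriving DecidableEq

namespace Data

/-- The number of nodes. -/
def size : Data → ℕ
  | nil => 1
  | cons a b => a.size + b.size + 1

def hd : Data → Data
  | nil => nil
  | cons a _ => a

def tl : Data → Data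
  | nil => nil
  | cons _ b => b

/-- A tree read as a list, along its right spine. -/
def toList : Data → List Data
  | nil => []
  | cons a b => a :: b.toList

def ofBool : Bool → Data
  | false => nil
  | true => cons nil nil

def ofList {A : Type} (e : A → Data) : List A → Data
  | [] => nil
  | a :: l => cons (e a) (ofList e l)

/-- Numbers are encoded in binary. -/
def ofNat (k : ℕ) : Data := ofList ofBool k.bits

def ofOption {A : Type} (e : A → Data) : Option A → Data
  | none => nil
  | some a => cons nil (e a)

end Data

/-- Loop programs on binary trees, each with one input and one output. -/
inductive Prog : Type
  | id : Prog
  | nil : Prog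
  | hd : Prog
  | tl : Prog
  | eq : Prog
  | cons (f g : Prog) : Prog
  | comp (f g : Prog) : Prog
  | ite (c f g : Prog) : Prog
  | fold (f : Prog) : Prog

namespace Prog

/-- The output of a program.  `eq` compares the two parts of its input; `ite c f g` runs `f` if
`c` returns a tree other than `nil`, and `g` otherwise; on `cons a l`, `fold f` starts with `a` and
replaces, for each entry `e` of the list `l`, the current value `s` by the output of `f` on
`cons s e`. -/
def eval : Prog → Data → Data
  | id, x => x
  | nil, _ => .nil
  | hd, x => x.hd
  | tl, x => x.tl
  | eq, x => Data.ofBool (decide (x.hd = x.tl))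
  | cons f g, x => .cons (f.eval x) (g.eval x)
  | comp f g, x => f.eval (g.eval x)
  | ite c f g, x => if c.eval x = .nil then g.eval x else f.eval x
  | fold f, x => x.tl.toList.foldl (fun s e => f.eval (.cons s e)) x.hd

/-- The number of steps of a program: each basic instruction costs the time to read its whole
input, and composed programs cost one step more than the parts that are executed. -/
def time : Prog → Data → ℕ
  | id, x => x.size + 1
  | nil, x => x.size + 1
  | hd, x => x.size + 1
  | tl, x => x.size + 1
  | eq, x => x.size + 1
  | cons f g, x => f.time x + g.time x + 1
  | comp f g, x => g.time x + f.time (g.eval x) + 1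
  | ite c f g, x => c.time x + (if c.eval x = .nil then g.time x else f.time x) + 1
  | fold f, x => x.size + 1 + (x.tl.toList.foldl
      (fun (s : Data × ℕ) e => (f.eval (.cons s.1 e), s.2 + f.time (.cons s.1 e) + 1)) (x.hd, 0)).2

end Prog

namespace CQ

/-! ## Input and output of programs -/

/-- A listing of a database: each relation as a list of tuples. -/
abbrev Listing (Q : CQ) : Type := (i : Q.Atom) → List (Fin (Q.arity i) → ℕ)

/-- The database that is listed. -/
def Listing.toDatabase {Q : CQ} (I : Q.Listing) : Q.Database := fun i => (I i).toFinset

def encTuple {a : ℕ} (t : Fin a → ℕ) : Data := Data.ofList Data.ofNat (List.ofFn t)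

/-- The input of a program. -/
def encListing (Q : CQ) (I : Q.Listing) : Data :=
  Data.ofList (fun d => d) (List.ofFn fun i => Data.ofList encTuple (I i))

def encForm (Q : CQ) : Form Q.Token → Data
  | .bot => .cons (Data.ofNat 0) .nil
  | .top => .cons (Data.ofNat 1) .nil
  | .lit t => .cons (Data.ofNat 2) (.cons (Data.ofNat t.1) (encTuple t.2))
  | .and φ ψ => .cons (Data.ofNat 3) (.cons (Q.encForm φ) (Q.encForm ψ))
  | .or φ ψ => .cons (Data.ofNat 4) (.cons (Q.encForm φ) (Q.encForm ψ))

/-- A set of variables is encoded as its bit vector. -/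
def encPInst (Q : CQ) (π : Q.PInst) : Data :=
  .cons
    (Data.ofList
      (fun S : Finset Q.Var => Data.ofList Data.ofBool (List.ofFn fun x => decide (x ∈ S))) π.1)
    (Data.ofList (Data.ofOption Data.ofNat) (List.ofFn π.2))

def encPos : Pos → Data
  | .start => .cons (Data.ofNat 0) .nil
  | .finish => .cons (Data.ofNat 1) .nil
  | .mid α => .cons (Data.ofNat 2) (Data.ofList Data.ofBool α)

def encNode (Q : CQ) : Q.FlowNode → Data
  | .src => .cons (Data.ofNat 0) .nil
  | .tgt => .cons (Data.ofNat 1) .nil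
  | .conn w c => .cons (Data.ofNat 2) (.cons (encTuple w) (encPos c))
  | .plan w α => .cons (Data.ofNat 3) (.cons (encTuple w) (Data.ofList Data.ofBool α))
  | .pre π => .cons (Data.ofNat 4) (Q.encPInst π)

/-- The output of a program: a list of flow graph nodes and a formula. -/
def encOutput (Q : CQ) (C : List Q.FlowNode) (φ : Form Q.Token) : Data :=
  .cons (Data.ofList Q.encNode C) (Q.encForm φ)

end CQ

/-! Elimination orders. A VEO is minimal exactly if it is canonical (`mem_mveo_iff`): each node has
one child for each connected component that remains below it once the variables of the path are
removed, and the label of the child is an inclusion-minimal set whose removal uncovers an atom or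
disconnects the component. In canonical trees the decisions made in different components are
independent. Hence parts can be exchanged between trees (`IsCanonical.exchange`), every rule that
picks a minimal separator for each path and component yields a tree (`isCanonical_strategyTree`),
and offering the labels of a component in sequence and the components in parallel gives a nested
RP-ordering (`exists_isRunningPrefixes`).

Every cut contains a choice, on every database (`exists_selected_subset`). Fix a cut and one
witness, and call a node open if it is not in the cut. If each tree used an open node, a path would
lead through this witness's copy of the ordering (`path_of_open`): along a sequence, jump over the
longest run of an open prefix that starts at the current place; in a product that no open prefix
covers as a whole, one factor has something open in each of its choices. The jumps fit together
because runs of prefixes do not cross (`Context.not_crossing`): from a crossing, an exchange of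
parts would produce a tree with no place in the ordering. The weight of the selected nodes is the
length of the factorization (`len_factor`, `cutWeight_selected`).

Read-once databases. Each token of the provenance occurs in every equivalent formula, so the number
of tokens bounds all lengths from below. The bound is attained. For a component `K`, setting the
tokens of the atoms that miss `K` to true keeps the formula read-once. The minimal models of a
read-once formula lie in token-disjoint blocks, each of which is a single token or a product of two
families with disjoint supports (`InReadOnceForm.hasModels`). Any two members of a block are linked
by two sharings of tokens, and the variables of `K` on which a whole block agrees separate `K`
(`isSep_agreement`), since a variable common to atoms on both sides of the product is constant on
the block. The tree that eliminates only such variables, `agreeingTree`, is determined by the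
blocks. So witnesses with a common token also share the prefix instance at which it is written, and
each token is written once.

No leakage. If no token is written twice, the selected nodes block all paths
(`not_hasPathAvoiding_selected`). A path could pass the choices only by entering the node of a table
prefix `p` with one witness and leaving it with another. Then `p` lies between the two chosen trees,
which write the token of an atom of `p` at one common prefix `q`. The RP property gives a tree with
both `p` and `q`, whence `p = q`, and the node was selected after all. So the minimum weight of a
cut is the number of tokens, and the claims about minimum cuts follow by comparison.

Algorithm. No flow is computed. Agreement sets are found by testing all triples of witnesses. For a
fixed query there are finitely many functions from sets of variables to sets of variables, so
passing from the agreement function to the tree is a finite case distinction that is built into the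
program. What remains is list processing, covered by closure properties of `PolyTime`. -/

/-! ## Connectivity after the removal of variables -/

namespace CQ

variable {Q : CQ}

/-- Two variables outside of `X` that share an atom. -/
def Linked (Q : CQ) (X : Finset Q.Var) (a b : Q.Var) : Prop :=
  a ∉ X ∧ b ∉ X ∧ ∃ i, a ∈ Q.vars i ∧ b ∈ Q.vars i

/-- Two variables that are connected in the query without the variables in `X`. -/
def Conn (Q : CQ) (X : Finset Q.Var) : Q.Var → Q.Var → Prop :=
  Relation.ReflTransGen (Q.Linked X)

theorem Linked.symm {X : Finset Q.Var} {a b : Q.Var} (h : Q.Linked X a b) : Q.Linked X b a :=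
  ⟨h.2.1, h.1, h.2.2.imp fun _ hi => hi.symm⟩

theorem Conn.refl {X : Finset Q.Var} (a : Q.Var) : Q.Conn X a a := Relation.ReflTransGen.refl

theorem Conn.symm {X : Finset Q.Var} {a b : Q.Var} (h : Q.Conn X a b) : Q.Conn X b a := by
  induction h with
  | refl => exact Conn.refl _
  | tail _ h ih => exact Relation.ReflTransGen.head h.symm ih

theorem Conn.trans {X : Finset Q.Var} {a b c : Q.Var} (h : Q.Conn X a b) (h' : Q.Conn X b c) :
    Q.Conn X a c := Relation.ReflTransGen.trans h h'

theorem Conn.of_atom {X : Finset Q.Var} {a b : Q.Var} {i : Q.Atom} (ha : a ∉ X) (hb : b ∉ X)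
    (hai : a ∈ Q.vars i) (hbi : b ∈ Q.vars i) : Q.Conn X a b :=
  Relation.ReflTransGen.single ⟨ha, hb, i, hai, hbi⟩

theorem Conn.mono {X Y : Finset Q.Var} (hXY : X ⊆ Y) {a b : Q.Var} (h : Q.Conn Y a b) :
    Q.Conn X a b := by
  induction h with
  | refl => exact Conn.refl _
  | tail _ h ih =>
    exact Relation.ReflTransGen.tail ih
      ⟨fun h' => h.1 (hXY h'), fun h' => h.2.1 (hXY h'), h.2.2⟩

theorem Conn.notMem {X : Finset Q.Var} {a b : Q.Var} (h : Q.Conn X a b) (ha : a ∉ X) : b ∉ X := by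
  induction h with
  | refl => exact ha
  | tail _ h _ => exact h.2.1

theorem mem_component {X S : Finset Q.Var} {y : Q.Var} :
    y ∈ Q.component X S ↔ ∃ x ∈ S, Q.Conn X x y := Iff.rfl

theorem subset_component {X S : Finset Q.Var} {y : Q.Var} (h : y ∈ S) : y ∈ Q.component X S :=
  ⟨y, h, Conn.refl y⟩

theorem mem_component_of_conn {X S : Finset Q.Var} {y z : Q.Var} (h : y ∈ Q.component X S)
    (hyz : Q.Conn X y z) : z ∈ Q.component X S :=
  let ⟨x, hx, hxy⟩ := h; ⟨x, hx, hxy.trans hyz⟩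

theorem exists_mem_vars (x : Q.Var) : ∃ i, x ∈ Q.vars i := by
  obtain ⟨i, j, h⟩ := Q.covers x
  exact ⟨i, Finset.mem_image.2 ⟨j, Finset.mem_univ _, h⟩⟩

theorem Connected.conn (hQ : Q.Connected) (x y : Q.Var) : Q.Conn ∅ x y := by
  obtain ⟨i, hi⟩ := exists_mem_vars x
  obtain ⟨j, hj⟩ := exists_mem_vars y
  have key : ∀ j, Relation.ReflTransGen (fun a b => (Q.vars a ∩ Q.vars b).Nonempty) i j →
      ∀ y ∈ Q.vars j, Q.Conn ∅ x y := by
    intro j h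
    induction h with
    | refl => exact fun y hy => Conn.of_atom (by simp) (by simp) hi hy
    | tail _ h ih =>
      intro y hy
      obtain ⟨z, hz⟩ := h
      rw [Finset.mem_inter] at hz
      exact (ih z hz.1).trans (Conn.of_atom (by simp) (by simp) hz.2 hy)
  exact key j (hQ i j) y hj

theorem mem_pathVars {p : Q.Path} {x : Q.Var} : x ∈ Q.pathVars p ↔ ∃ S ∈ p, x ∈ S := by
  unfold pathVars
  induction p with
  | nil => simp
  | cons S p ih => simp [ih]

@[simp] theorem pathVars_nil : Q.pathVars [] = ∅ := rfl

theorem pathVars_append (p r : Q.Path) : Q.pathVars (p ++ r) = Q.pathVars p ∪ Q.pathVars r := by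
  ext x
  simp only [mem_pathVars, List.mem_append, Finset.mem_union]
  constructor
  · rintro ⟨S, h | h, hx⟩
    exacts [Or.inl ⟨S, h, hx⟩, Or.inr ⟨S, h, hx⟩]
  · rintro (⟨S, h, hx⟩ | ⟨S, h, hx⟩)
    exacts [⟨S, Or.inl h, hx⟩, ⟨S, Or.inr h, hx⟩]

@[simp] theorem pathVars_concat (p : Q.Path) (S : Finset Q.Var) :
    Q.pathVars (p ++ [S]) = Q.pathVars p ∪ S := by
  rw [pathVars_append]; simp [pathVars]

theorem pathVars_mono {p r : Q.Path} (h : p <+: r) : Q.pathVars p ⊆ Q.pathVars r := by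
  obtain ⟨t, rfl⟩ := h
  rw [pathVars_append]; exact Finset.subset_union_left

/-- A variable of a path lies in the last label of a prefix of the path. -/
theorem exists_prefix_of_mem_pathVars {p : Q.Path} {x : Q.Var} (h : x ∈ Q.pathVars p) :
    ∃ r S, r ++ [S] <+: p ∧ x ∈ S := by
  obtain ⟨S, hS, hx⟩ := mem_pathVars.1 h
  obtain ⟨r, t, rfl⟩ := List.append_of_mem hS
  exact ⟨r, S, ⟨t, by simp⟩, hx⟩

theorem mem_tablesAt {p : Q.Path} {i : Q.Atom} :
    i ∈ Q.tablesAt p ↔ Q.vars i ⊆ Q.pathVars p ∧ ¬ Q.vars i ⊆ Q.pathVars p.dropLast := by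
  simp [tablesAt]

theorem mem_tablesAt_concat {p : Q.Path} {S : Finset Q.Var} {i : Q.Atom} :
    i ∈ Q.tablesAt (p ++ [S]) ↔ Q.vars i ⊆ Q.pathVars p ∪ S ∧ ¬ Q.vars i ⊆ Q.pathVars p := by
  rw [mem_tablesAt, pathVars_concat, List.dropLast_concat]

theorem exists_mem_of_mem_tablesAt {p : Q.Path} {S : Finset Q.Var} {i : Q.Atom}
    (h : i ∈ Q.tablesAt (p ++ [S])) : ∃ x ∈ Q.vars i, x ∈ S := by
  obtain ⟨h1, h2⟩ := mem_tablesAt_concat.1 h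
  obtain ⟨x, hx, hx'⟩ := Finset.not_subset.1 h2
  exact ⟨x, hx, (Finset.mem_union.1 (h1 hx)).resolve_left hx'⟩

theorem not_mem_tablesAt_nil {i : Q.Atom} : i ∉ Q.tablesAt [] := by
  rw [mem_tablesAt]; simp

/-! ## Separators and canonical trees -/

/-- Removing `S` from the component `K` of the query without `X` uncovers an atom or disconnects
`K`. -/
def IsSep (Q : CQ) (X : Finset Q.Var) (K : Set Q.Var) (S : Finset Q.Var) : Prop :=
  (∃ i, (∃ x ∈ Q.vars i, x ∈ K) ∧ Q.vars i ⊆ X ∪ S) ∨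
    ∃ x ∈ K, ∃ y ∈ K, x ∉ S ∧ y ∉ S ∧ ¬ Q.Conn (X ∪ S) x y

/-- A separator without a proper subset that is a separator. -/
def IsMinSep (Q : CQ) (X : Finset Q.Var) (K : Set Q.Var) (S : Finset Q.Var) : Prop :=
  Q.IsSep X K S ∧ ∀ S', S' ⊂ S → ¬ Q.IsSep X K S'

/-- The variables at and below the last node of `p`. -/
def below (Q : CQ) (p : Q.Path) : Set Q.Var :=
  if p = [] then Set.univ else Q.component (Q.pathVars p.dropLast) (p.getLastD ∅)

@[simp] theorem below_nil : Q.below [] = Set.univ := by simp [below]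

@[simp] theorem below_concat (p : Q.Path) (S : Finset Q.Var) :
    Q.below (p ++ [S]) = Q.component (Q.pathVars p) S := by simp [below]

/-- `S` is the label of a child of `p` in a canonical tree. -/
structure IsLabel (Q : CQ) (p : Q.Path) (S : Finset Q.Var) : Prop where
  nonempty : S.Nonempty
  notMem : ∀ x ∈ S, x ∉ Q.pathVars p
  mem_below : ∀ x ∈ S, x ∈ Q.below p
  conn : ∀ x ∈ S, ∀ y ∈ S, Q.Conn (Q.pathVars p) x y
  minSep : Q.IsMinSep (Q.pathVars p) (Q.component (Q.pathVars p) S) S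

/-- The trees in which each node has one child for each component that remains, labelled with a
minimal separator of this component. -/
structure IsCanonical (Q : CQ) (v : Q.Tree) : Prop where
  nil_notMem : [] ∉ v
  parent : ∀ p S, p ++ [S] ∈ v → p = [] ∨ p ∈ v
  label : ∀ p S, p ++ [S] ∈ v → Q.IsLabel p S
  child : ∀ p, p = [] ∨ p ∈ v → ∀ y ∈ Q.below p, y ∉ Q.pathVars p →
    ∃! S, p ++ [S] ∈ v ∧ y ∈ Q.component (Q.pathVars p) S

theorem IsLabel.notMem_of_mem_component {p : Q.Path} {S : Finset Q.Var} (h : Q.IsLabel p S)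
    {y : Q.Var} (hy : y ∈ Q.component (Q.pathVars p) S) : y ∉ Q.pathVars p :=
  let ⟨x, hx, hxy⟩ := hy; Conn.notMem hxy (h.notMem x hx)

theorem mem_below_of_conn {p : Q.Path} {x y : Q.Var} (hx : x ∈ Q.below p)
    (h : Q.Conn (Q.pathVars p) x y) : y ∈ Q.below p := by
  rcases List.eq_nil_or_concat p with rfl | ⟨r, S, rfl⟩
  · simp
  · rw [List.concat_eq_append] at *
    rw [below_concat] at hx ⊢
    exact mem_component_of_conn hx (h.mono (by simp))

theorem IsLabel.below_subset {p : Q.Path} {S : Finset Q.Var} (h : Q.IsLabel p S) {y : Q.Var}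
    (hy : y ∈ Q.component (Q.pathVars p) S) : y ∈ Q.below p :=
  let ⟨x, hx, hxy⟩ := hy; mem_below_of_conn (h.mem_below x hx) hxy

theorem IsLabel.conn_of_mem {p : Q.Path} {S : Finset Q.Var} (h : Q.IsLabel p S) {x y : Q.Var}
    (hx : x ∈ Q.component (Q.pathVars p) S) (hy : y ∈ Q.component (Q.pathVars p) S) :
    Q.Conn (Q.pathVars p) x y := by
  obtain ⟨a, ha, hax⟩ := mem_component.1 hx
  obtain ⟨b, hb, hby⟩ := mem_component.1 hy
  exact (hax.symm.trans (h.conn a ha b hb)).trans hby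

theorem IsLabel.component_eq {p : Q.Path} {S T : Finset Q.Var} (hS : Q.IsLabel p S)
    (hT : Q.IsLabel p T) {x : Q.Var} (hx : x ∈ Q.component (Q.pathVars p) S)
    (hx' : x ∈ Q.component (Q.pathVars p) T) :
    Q.component (Q.pathVars p) S = Q.component (Q.pathVars p) T := by
  ext y
  exact ⟨fun hy => mem_component_of_conn hx' (hS.conn_of_mem hx hy),
    fun hy => mem_component_of_conn hx (hT.conn_of_mem hx' hy)⟩

/-! ### Positions of variables and atoms in a canonical tree. -/

namespace IsCanonical

variable {v : Q.Tree} (hv : Q.IsCanonical v)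

include hv

theorem ne_nil {p : Q.Path} (hp : p ∈ v) : p ≠ [] := fun h => hv.nil_notMem (h ▸ hp)

theorem prefix_mem {p r : Q.Path} (h : p <+: r) (hr : r = [] ∨ r ∈ v) : p = [] ∨ p ∈ v := by
  obtain ⟨t, rfl⟩ := h
  induction t using List.reverseRecOn with
  | nil => simpa using hr
  | append_singleton t S ih =>
    rcases hr with h | h
    · simp at h
    · exact ih (hv.parent _ S (by simpa using h))

theorem label_of_prefix {p r : Q.Path} {S : Finset Q.Var} (h : p ++ [S] <+: r)
    (hr : r = [] ∨ r ∈ v) : Q.IsLabel p S :=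
  hv.label p S ((hv.prefix_mem h hr).resolve_left (by simp))

theorem below_anti {p r : Q.Path} (h : p <+: r) (hr : r = [] ∨ r ∈ v) {x : Q.Var}
    (hx : x ∈ Q.below r) : x ∈ Q.below p := by
  obtain ⟨t, rfl⟩ := h
  induction t using List.reverseRecOn with
  | nil => simpa using hx
  | append_singleton t S ih =>
    have hm : (p ++ t) ++ [S] ∈ v := (by simpa using hr)
    refine ih (hv.parent _ S hm) ((hv.label _ S hm).below_subset ?_)
    rw [← below_concat]; simpa using hx

theorem notMem_of_mem_below {p : Q.Path} {S : Finset Q.Var} (h : p ++ [S] ∈ v) {x : Q.Var}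
    (hx : x ∈ Q.below (p ++ [S])) : x ∉ Q.pathVars p :=
  (hv.label p S h).notMem_of_mem_component (by simpa using hx)

/-- Two different children of one node eliminate different components, by the uniqueness in `child`.
So paths whose lower parts meet cannot branch apart. -/
theorem comparable {p r : Q.Path} (hp : p = [] ∨ p ∈ v) (hr : r = [] ∨ r ∈ v) {x : Q.Var}
    (hx : x ∈ Q.below p) (hx' : x ∈ Q.below r) : p <+: r ∨ r <+: p := by
  induction p using List.reverseRecOn with
  | nil => exact Or.inl (List.nil_prefix)
  | append_singleton p S ih =>
    have hm : p ++ [S] ∈ v := by simpa using hp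
    have hp' := hv.parent p S hm
    have hxp := (hv.label p S hm).below_subset (by simpa using hx)
    rcases ih hp' hxp with h | h
    · obtain ⟨t, rfl⟩ := h
      cases t with
      | nil => exact Or.inr (by simp)
      | cons T t =>
        have h1 : p ++ [T] <+: p ++ T :: t := ⟨t, by simp⟩
        have h2 := (hv.prefix_mem h1 hr).resolve_left (by simp)
        have := (hv.child p hp' x hxp (hv.notMem_of_mem_below hm hx)).unique
          ⟨hm, by simpa using hx⟩ ⟨h2, by simpa using hv.below_anti h1 hr hx'⟩
        exact Or.inl (this ▸ h1)
    · exact Or.inr (h.trans (List.prefix_append _ _))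

/-- The two nodes are comparable because both lower parts contain `x`. If one were strictly above
the other, `x` would already be on the path to the second, whose label avoids that path. -/
theorem node_unique {p r : Q.Path} {S T : Finset Q.Var} (hp : p ++ [S] ∈ v) (hr : r ++ [T] ∈ v)
    {x : Q.Var} (hx : x ∈ S) (hx' : x ∈ T) : p ++ [S] = r ++ [T] := by
  have hb : x ∈ Q.below (p ++ [S]) := by rw [below_concat]; exact subset_component hx
  have hb' : x ∈ Q.below (r ++ [T]) := by rw [below_concat]; exact subset_component hx'
  rcases hv.comparable (Or.inr hp) (Or.inr hr) hb hb' with h | h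
  · rcases List.prefix_concat_iff.1 h with h' | h'
    · exact h'
    · exact absurd (pathVars_mono h' (by simp [hx])) ((hv.label r T hr).notMem x hx')
  · rcases List.prefix_concat_iff.1 h with h' | h'
    · exact h'.symm
    · exact absurd (pathVars_mono h' (by simp [hx'])) ((hv.label p S hp).notMem x hx)

theorem prefix_of_mem_pathVars {p r : Q.Path} {S : Finset Q.Var} (hp : p ++ [S] ∈ v)
    (hr : r ∈ v) {x : Q.Var} (hx : x ∈ S) (hxr : x ∈ Q.pathVars r) : p ++ [S] <+: r := by
  obtain ⟨r', T, h, hxT⟩ := exists_prefix_of_mem_pathVars hxr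
  have := (hv.prefix_mem h (Or.inr hr)).resolve_left (by simp)
  rw [hv.node_unique hp this hx hxT]; exact h

/-- Descend into the component of `y`. Each step puts a nonempty label on the path, so the number of
variables off the path decreases and `y` is reached. -/
theorem exists_node {p : Q.Path} (hp : p = [] ∨ p ∈ v) {y : Q.Var} (hy : y ∈ Q.below p)
    (hy' : y ∉ Q.pathVars p) : ∃ r S, r ++ [S] ∈ v ∧ p <+: r ∧ y ∈ S := by
  induction hn : (Finset.univ \ Q.pathVars p).card using Nat.strong_induction_on generalizing p with
  | _ n ih =>
    obtain ⟨S, ⟨hS, hyS⟩, -⟩ := hv.child p hp y hy hy'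
    by_cases h : y ∈ S
    · exact ⟨p, S, hS, List.prefix_rfl, h⟩
    · have hl := hv.label p S hS
      obtain ⟨s, hs⟩ := hl.nonempty
      obtain ⟨r, T, h1, h2, h3⟩ := ih _ (by
        rw [← hn]
        refine Finset.card_lt_card (Finset.ssubset_iff_of_subset ?_ |>.2 ⟨s, ?_, ?_⟩)
        · exact Finset.sdiff_subset_sdiff le_rfl (by simp : _ ⊆ Q.pathVars (p ++ [S]))
        · simpa using hl.notMem s hs
        · simp [hs]) (p := p ++ [S]) (Or.inr hS) (by simpa using hyS) (by simp [hy', h]) rfl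
      exact ⟨r, T, h1, (List.prefix_append _ _).trans h2, h3⟩

/-- The variables of `i` that are not yet on the path are pairwise linked by `i` and stay in one
component. The descent into this component ends where the last of them is eliminated. -/
theorem exists_table {p : Q.Path} (hp : p = [] ∨ p ∈ v) {i : Q.Atom}
    (hi : ∀ x ∈ Q.vars i, x ∈ Q.pathVars p ∨ x ∈ Q.below p) (hi' : ¬ Q.vars i ⊆ Q.pathVars p) :
    ∃ r ∈ v, i ∈ Q.tablesAt r := by
  induction hn : (Finset.univ \ Q.pathVars p).card using Nat.strong_induction_on generalizing p with
  | _ n ih =>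
    obtain ⟨y, hyi, hyp⟩ := Finset.not_subset.1 hi'
    obtain ⟨S, ⟨hS, hyS⟩, -⟩ := hv.child p hp y ((hi y hyi).resolve_left hyp) hyp
    by_cases h : Q.vars i ⊆ Q.pathVars p ∪ S
    · exact ⟨_, hS, mem_tablesAt_concat.2 ⟨h, hi'⟩⟩
    · have hl := hv.label p S hS
      obtain ⟨s, hs⟩ := hl.nonempty
      refine ih _ (by
        rw [← hn]
        refine Finset.card_lt_card (Finset.ssubset_iff_of_subset ?_ |>.2 ⟨s, ?_, ?_⟩)
        · exact Finset.sdiff_subset_sdiff le_rfl (by simp : _ ⊆ Q.pathVars (p ++ [S]))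
        · simpa using hl.notMem s hs
        · simp [hs]) (p := p ++ [S]) (Or.inr hS) ?_ (by simpa using h) rfl
      intro x hx
      by_cases hxp : x ∈ Q.pathVars p
      · exact Or.inl (by simp [hxp])
      · right
        rw [below_concat]
        exact mem_component_of_conn hyS (Conn.of_atom hyp hxp hyi hx)

theorem table_prefix_of_mem {p r : Q.Path} (hp : p ∈ v) (hr : r ∈ v) {i : Q.Atom}
    (hi : i ∈ Q.tablesAt p) (hi' : Q.vars i ⊆ Q.pathVars r) : p <+: r := by
  rcases List.eq_nil_or_concat p with rfl | ⟨p, S, rfl⟩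
  · exact List.nil_prefix
  · rw [List.concat_eq_append] at *
    obtain ⟨x, hx, hxS⟩ := exists_mem_of_mem_tablesAt hi
    exact hv.prefix_of_mem_pathVars hp hr hxS (hi' hx)

theorem table_unique {p r : Q.Path} (hp : p ∈ v) (hr : r ∈ v) {i : Q.Atom}
    (hi : i ∈ Q.tablesAt p) (hi' : i ∈ Q.tablesAt r) : p = r :=
  List.IsPrefix.eq_of_length_le (hv.table_prefix_of_mem hp hr hi (mem_tablesAt.1 hi').1)
    (hv.table_prefix_of_mem hr hp hi' (mem_tablesAt.1 hi).1).length_le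

/-- The table prefix of an atom that touches the part below `p` extends `p`. -/
theorem prefix_table_of_mem_below {p r : Q.Path} (hp : p ∈ v) (hr : r ∈ v) {i : Q.Atom}
    (hi : i ∈ Q.tablesAt r) {x : Q.Var} (hx : x ∈ Q.vars i) (hxp : x ∈ Q.below p) : p <+: r := by
  obtain ⟨r', T, h, hxT⟩ := exists_prefix_of_mem_pathVars ((mem_tablesAt.1 hi).1 hx)
  have hm := (hv.prefix_mem h (Or.inr hr)).resolve_left (by simp)
  have hb : x ∈ Q.below (r' ++ [T]) := by rw [below_concat]; exact subset_component hxT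
  rcases hv.comparable (Or.inr hp) (Or.inr hm) hxp hb with h' | h'
  · exact h'.trans h
  · rcases List.eq_nil_or_concat p with rfl | ⟨p, S, rfl⟩
    · exact List.nil_prefix
    · rw [List.concat_eq_append] at *
      rcases List.prefix_concat_iff.1 h' with h'' | h''
      · rw [← h'']; exact h
      · exact absurd (pathVars_mono h'' (by simp [hxT])) (hv.notMem_of_mem_below hp hxp)

end IsCanonical

/-- An atom without variables could not be linked to an atom that contains variable `0`. -/
theorem vars_nonempty (hQ : Q.Connected) (hvar : 0 < Q.numVars) (i : Q.Atom) :
    (Q.vars i).Nonempty := by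
  obtain ⟨j, hj⟩ := exists_mem_vars (Q := Q) ⟨0, hvar⟩
  rcases Relation.ReflTransGen.cases_head (hQ i j) with h | ⟨c, h, -⟩
  · exact ⟨_, h ▸ hj⟩
  · exact h.mono Finset.inter_subset_left

theorem IsCanonical.exists_tablesAt (hQ : Q.Connected) (hvar : 0 < Q.numVars) {v : Q.Tree}
    (hv : Q.IsCanonical v) (i : Q.Atom) : ∃ r ∈ v, i ∈ Q.tablesAt r :=
  hv.exists_table (p := []) (Or.inl rfl) (by simp) (by
    obtain ⟨x, hx⟩ := vars_nonempty hQ hvar i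
    exact fun h => by simpa using h hx)

/-! ## Canonical trees are elimination orders with a minimal dissociation -/

/-- After dissociation an atom consists exactly of the variables on its table prefix. This turns
statements about the dissociation into statements about paths. -/
theorem mem_full_of_canonical {v : Q.Tree} (hv : Q.IsCanonical v) {p : Q.Path} (hp : p ∈ v)
    {i : Q.Atom} (hi : i ∈ Q.tablesAt p) :
    Q.vars i ∪ Q.dissociationOf v i = Q.pathVars p := by
  ext x
  simp only [dissociationOf, Finset.mem_union, Finset.mem_sdiff, Finset.mem_biUnion,
    Finset.mem_filter]
  constructor
  · rintro (h | ⟨⟨r, ⟨hr, hir⟩, hx⟩, -⟩)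
    · exact (mem_tablesAt.1 hi).1 h
    · rwa [hv.table_unique hp hr hi hir]
  · intro h
    by_cases hx : x ∈ Q.vars i
    · exact Or.inl hx
    · exact Or.inr ⟨⟨p, ⟨hp, hi⟩, h⟩, hx⟩

/-- The two ways to be a separator are the two ways to be a legal node: an uncovered atom becomes a
table at the node, and a disconnected component becomes at least two children. -/
theorem IsCanonical.isVEO (hQ : Q.Connected) (hvar : 0 < Q.numVars) {v : Q.Tree}
    (hv : Q.IsCanonical v) : Q.IsVEO v where
  ne_nil p hp := hv.ne_nil hp
  label_nonempty p hp h := by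
    obtain ⟨r, t, rfl⟩ := List.append_of_mem h
    have := hv.label_of_prefix (p := r) (S := ∅) ⟨t, by simp⟩ (Or.inr hp)
    exact Finset.not_nonempty_empty this.nonempty
  prefix_closed p S hp h := (hv.parent p S h).resolve_left hp
  one_root := by
    have key : ∀ p ∈ v, ∃ S r, p = S :: r ∧ [S] ∈ v := by
      intro p hp
      cases p with
      | nil => exact absurd hp hv.nil_notMem
      | cons S r =>
        exact ⟨S, r, rfl, (hv.prefix_mem (p := [S]) ⟨r, by simp⟩ (Or.inr hp)).resolve_left (by simp)⟩
    intro p hp p' hp'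
    obtain ⟨S, r, rfl, hS⟩ := key p hp
    obtain ⟨S', r', rfl, hS'⟩ := key p' hp'
    obtain ⟨x, hx⟩ := (hv.label [] S hS).nonempty
    obtain ⟨y, hy⟩ := (hv.label [] S' hS').nonempty
    have := (hv.child [] (Or.inl rfl) x (by simp) (by simp)).unique
      ⟨hS, subset_component hx⟩ ⟨hS', y, hy, hQ.conn y x⟩
    simp [this]
  partition x := by
    obtain ⟨r, S, h, -, hx⟩ := hv.exists_node (p := []) (Or.inl rfl) (y := x) (by simp) (by simp)
    refine ⟨r ++ [S], ⟨h, S, by simp, hx⟩, ?_⟩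
    rintro p ⟨hp, T, hT, hxT⟩
    obtain ⟨p', rfl⟩ : ∃ p', p = p' ++ [T] := List.getLast?_eq_some_iff.1 hT
    exact hv.node_unique hp h hxT hx
  atoms_on_paths i := by
    obtain ⟨r, hr, hi⟩ := hv.exists_tablesAt hQ hvar i
    exact ⟨r, hr, (mem_tablesAt.1 hi).1⟩
  alternating p hp := by
    rcases List.eq_nil_or_concat p with rfl | ⟨p, S, rfl⟩
    · exact absurd hp hv.nil_notMem
    rw [List.concat_eq_append] at *
    have hl := hv.label p S hp
    rcases hl.minSep.1 with ⟨i, ⟨x, hxi, hxK⟩, hi⟩ | ⟨x, hx, y, hy, hxS, hyS, hxy⟩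
    · exact Or.inl ⟨i, mem_tablesAt_concat.2 ⟨hi, fun h =>
        hl.notMem_of_mem_component hxK (h hxi)⟩⟩
    · right
      have hx' := hl.notMem_of_mem_component hx
      have hy' := hl.notMem_of_mem_component hy
      obtain ⟨T, ⟨hT, hxT⟩, -⟩ := hv.child _ (Or.inr hp) x (by simpa using hx) (by simp [hxS, hx'])
      obtain ⟨T', ⟨hT', hyT⟩, -⟩ := hv.child _ (Or.inr hp) y (by simpa using hy) (by simp [hyS, hy'])
      refine ⟨T, T', ?_, hT, hT'⟩
      rintro rfl
      have := (hv.label _ T hT).conn_of_mem hxT hyT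
      rw [pathVars_concat] at this
      exact hxy this

/-- The set of the variables that a hierarchical dissociation adds to all atoms of a component
separates this component. -/
theorem isSep_of_isHierarchical {Δ : Q.Atom → Finset Q.Var} (hΔ : Q.IsHierarchical Δ)
    {X S : Finset Q.Var} {K : Set Q.Var} (hK : K.Nonempty)
    (hS : ∀ x, x ∈ S ↔ x ∈ K ∧ ∀ i, (∃ y ∈ Q.vars i, y ∈ K) → x ∈ Q.vars i ∪ Δ i)
    (hKc : ∀ x ∈ K, ∀ i, x ∈ Q.vars i → ∀ y ∈ Q.vars i, y ∉ X → y ∈ K) :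
    Q.IsSep X K S := by
  classical
  by_contra hsep
  simp only [IsSep, not_or, not_exists, not_and, not_not] at hsep
  obtain ⟨h1, h2⟩ := hsep
  have ht : ∀ i, (∃ y ∈ Q.vars i, y ∈ K) → ∃ z ∈ Q.vars i, z ∈ K ∧ z ∉ S ∧ z ∉ X := by
    intro i ⟨y, hy, hyK⟩
    obtain ⟨z, hz, hz'⟩ := Finset.not_subset.1 (h1 i ⟨y, hy, hyK⟩)
    rw [Finset.mem_union, not_or] at hz'
    exact ⟨z, hz, hKc y hyK i hy z hz hz'.1, hz'.2, hz'.1⟩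
  obtain ⟨y0, hy0⟩ := hK
  obtain ⟨i0, hi0⟩ := exists_mem_vars y0
  obtain ⟨z0, -, hz0K, hz0S, -⟩ := ht i0 ⟨y0, hi0, hy0⟩
  -- If `S` did not separate, then an element of `K` outside of `S` that lies in the largest number
  -- of dissociated atoms would lie in every atom that touches `K`. It would then belong to `S`. The
  -- hierarchy condition propagates this maximality along links.
  obtain ⟨x, hx, hmax⟩ := Finset.exists_max_image
    (Finset.univ.filter fun x => x ∈ K ∧ x ∉ S) (fun x => (Q.atomsOf Δ x).card)
    ⟨z0, by simp [hz0K, hz0S]⟩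
  simp only [Finset.mem_filter, Finset.mem_univ, true_and] at hx hmax
  have key : ∀ z, Q.Conn (X ∪ S) x z → z ∈ K ∧ z ∉ S ∧ Q.atomsOf Δ z ⊆ Q.atomsOf Δ x := by
    intro z h
    induction h with
    | refl => exact ⟨hx.1, hx.2, subset_rfl⟩
    | @tail z z' _ h ih =>
      obtain ⟨hz1, hz2, i, hzi, hzi'⟩ := h
      rw [Finset.mem_union, not_or] at hz1 hz2
      have hzK := hKc z ih.1 i hzi z' hzi' hz2.1
      refine ⟨hzK, hz2.2, ?_⟩
      have hi : i ∈ Q.atomsOf Δ z := by simp [atomsOf, hzi]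
      have hi' : i ∈ Q.atomsOf Δ z' := by simp [atomsOf, hzi']
      rcases hΔ x z' with h | h | h
      · rw [Finset.eq_of_subset_of_card_le h (hmax z' ⟨hzK, hz2.2⟩)]
      · exact h
      · exact absurd hi' (Finset.disjoint_left.1 h (ih.2.2 hi))
  apply hx.2
  rw [hS]
  refine ⟨hx.1, fun i hi => ?_⟩
  obtain ⟨z, hzi, hzK, hzS, -⟩ := ht i hi
  have := (key z (h2 x hx.1 z hzK hx.2 hzS)).2.2 (by simp [atomsOf, hzi] : i ∈ Q.atomsOf Δ z)
  simpa [atomsOf] using this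

/-- Dissociated atoms are root paths, and an atom contains `x` exactly if its path passes through
the node of `x`. Nodes on a common path give nested sets of atoms, and other nodes give disjoint
ones. -/
theorem IsCanonical.isHierarchical (hQ : Q.Connected) (hvar : 0 < Q.numVars) {v : Q.Tree}
    (hv : Q.IsCanonical v) : Q.IsHierarchical (Q.dissociationOf v) := by
  intro x y
  by_cases hd : Disjoint (Q.atomsOf (Q.dissociationOf v) x) (Q.atomsOf (Q.dissociationOf v) y)
  · exact Or.inr (Or.inr hd)
  obtain ⟨i, hix, hiy⟩ := Finset.not_disjoint_iff.1 hd
  obtain ⟨p, hp, hip⟩ := hv.exists_tablesAt hQ hvar i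
  simp only [atomsOf, Finset.mem_filter, Finset.mem_univ, true_and] at hix hiy
  rw [mem_full_of_canonical hv hp hip] at hix hiy
  obtain ⟨r, S, hr, hxS⟩ := exists_prefix_of_mem_pathVars hix
  obtain ⟨t, T, ht, hyT⟩ := exists_prefix_of_mem_pathVars hiy
  have key : ∀ {r t : Q.Path} {S T : Finset Q.Var} {x y : Q.Var}, x ∈ S → y ∈ T → r ++ [S] <+: p →
      r ++ [S] <+: t ++ [T] → t ++ [T] <+: p →
      Q.atomsOf (Q.dissociationOf v) y ⊆ Q.atomsOf (Q.dissociationOf v) x := by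
    intro r t S T x y hxS hyT _ hrt ht j hj
    obtain ⟨p', hp', hjp⟩ := hv.exists_tablesAt hQ hvar j
    simp only [atomsOf, Finset.mem_filter, Finset.mem_univ, true_and] at hj ⊢
    rw [mem_full_of_canonical hv hp' hjp] at hj ⊢
    have := hv.prefix_of_mem_pathVars
      ((hv.prefix_mem ht (Or.inr hp)).resolve_left (by simp)) hp' hyT hj
    exact pathVars_mono (hrt.trans this) (by simp [hxS])
  rcases List.prefix_or_prefix_of_prefix hr ht with h | h
  · exact Or.inr (Or.inl (key hxS hyT hr h ht))
  · exact Or.inl (key hyT hxS ht h hr)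

/-- A smaller hierarchical dissociation `Δ'` must still add all of each table prefix. Going down the
tree, the variables that `Δ'` makes common to all atoms of a component form a separator inside of
the label, and the label is a minimal separator. -/
theorem IsCanonical.mem_mveo (hQ : Q.Connected) (hvar : 0 < Q.numVars) {v : Q.Tree}
    (hv : Q.IsCanonical v) : v ∈ Q.mveo := by
  classical
  refine ⟨hv.isVEO hQ hvar, fun i => ?_, hv.isHierarchical hQ hvar, ?_⟩
  · exact Finset.sdiff_disjoint
  intro Δ' hd hh hle
  have key : ∀ p, p = [] ∨ p ∈ v → ∀ i, (∃ x ∈ Q.vars i, x ∈ Q.below p) →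
      Q.pathVars p ⊆ Q.vars i ∪ Δ' i := by
    intro p
    induction p using List.reverseRecOn with
    | nil => simp
    | append_singleton p S ih =>
      intro hp
      have hm : p ++ [S] ∈ v := by simpa using hp
      have hl := hv.label p S hm
      set K := Q.component (Q.pathVars p) S with hK
      -- The variables of the component that `Δ'` puts into every atom that touches it.
      set S' : Finset Q.Var := Finset.univ.filter fun x =>
        x ∈ K ∧ ∀ i, (∃ y ∈ Q.vars i, y ∈ K) → x ∈ Q.vars i ∪ Δ' i with hS'
      have hfull : ∀ i r, r ∈ v → i ∈ Q.tablesAt r → Q.vars i ∪ Δ' i ⊆ Q.pathVars r := by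
        intro i r hr hi
        rw [← mem_full_of_canonical hv hr hi]
        exact Finset.union_subset_union le_rfl (hle i)
      -- A variable `x` of `S'` outside of `S` contradicts both forms of separation. An atom covered
      -- by `S` would have to contain `x`. Two variables separated by `S` would each be linked to
      -- `x`, which lies below the same child as either of them.
      have hsub : S' ⊆ S := by
        intro x hx
        simp only [hS', Finset.mem_filter, Finset.mem_univ, true_and] at hx
        have hxp := hl.notMem_of_mem_component hx.1
        by_contra hxS
        rcases hl.minSep.1 with ⟨i, hi, hi'⟩ | ⟨a, ha, b, hb, haS, hbS, hab⟩
        · have hit : i ∈ Q.tablesAt (p ++ [S]) := by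
            obtain ⟨y, hy, hyK⟩ := hi
            exact mem_tablesAt_concat.2 ⟨hi', fun h => hl.notMem_of_mem_component hyK (h hy)⟩
          have := hfull i _ hm hit (hx.2 i hi)
          simp [hxp, hxS] at this
        · have step : ∀ a ∈ K, a ∉ S → Q.Conn (Q.pathVars p ∪ S) a x := by
            intro a ha haS
            have hap := hl.notMem_of_mem_component ha
            obtain ⟨T, ⟨hT, haT⟩, -⟩ := hv.child _ (Or.inr hm) a (by simpa using ha)
              (by simp [hap, haS])
            obtain ⟨i, hi⟩ := exists_mem_vars a
            obtain ⟨r, hr, hir⟩ := hv.exists_tablesAt hQ hvar i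
            have hxr := hfull i r hr hir (hx.2 i ⟨a, hi, ha⟩)
            obtain ⟨r', U, hU, hxU⟩ := exists_prefix_of_mem_pathVars hxr
            have hUm := (hv.prefix_mem hU (Or.inr hr)).resolve_left (by simp)
            have hTr : (p ++ [S]) ++ [T] <+: r := hv.prefix_table_of_mem_below hT hr hir hi
              (by rw [below_concat]; exact haT)
            have hcmp : (p ++ [S]) ++ [T] <+: r' ++ [U] := by
              rcases List.prefix_or_prefix_of_prefix hTr hU with h | h
              · exact h
              · rcases List.prefix_concat_iff.1 h with h' | h'
                · rw [h']
                · have := pathVars_mono h' (by simp [hxU] : x ∈ Q.pathVars (r' ++ [U]))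
                  simp [hxp, hxS] at this
            have hxb : x ∈ Q.below ((p ++ [S]) ++ [T]) := hv.below_anti hcmp (Or.inr hUm)
              (by rw [below_concat]; exact subset_component hxU)
            rw [below_concat] at hxb
            have := (hv.label _ T hT).conn_of_mem haT hxb
            simpa using this
          exact hab ((step a ha haS).trans (step b hb hbS).symm)
      have hsep : Q.IsSep (Q.pathVars p) K S' := by
        refine isSep_of_isHierarchical hh ?_
          (fun x => by simp [hS']) ?_
        · obtain ⟨s, hs⟩ := hl.nonempty
          exact ⟨s, subset_component hs⟩
        · intro x hx i hxi y hyi hyp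
          exact mem_component_of_conn hx
            (Conn.of_atom (hl.notMem_of_mem_component hx) hyp hxi hyi)
      have heq : S' = S := by
        by_contra hne
        exact hl.minSep.2 S' (Finset.ssubset_iff_subset_ne.2 ⟨hsub, hne⟩) hsep
      intro i hi
      rw [below_concat] at hi
      rw [pathVars_concat]
      refine Finset.union_subset (ih (hv.parent p S hm) i ?_) ?_
      · obtain ⟨x, hx, hxK⟩ := hi
        exact ⟨x, hx, hl.below_subset hxK⟩
      · intro s hs
        rw [← heq] at hs
        simp only [hS', Finset.mem_filter, Finset.mem_univ, true_and] at hs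
        exact hs.2 i hi
  funext i
  refine Finset.Subset.antisymm (hle i) fun x hx => ?_
  obtain ⟨p, hp, hi⟩ := hv.exists_tablesAt hQ hvar i
  have hx' : x ∈ Q.pathVars p := by
    rw [← mem_full_of_canonical hv hp hi]; exact Finset.mem_union_right _ hx
  have hxi : x ∉ Q.vars i := (Finset.mem_sdiff.1 hx).2
  have : Q.pathVars p ⊆ Q.vars i ∪ Δ' i := by
    refine key p (Or.inr hp) i ?_
    rcases List.eq_nil_or_concat p with rfl | ⟨p, S, rfl⟩
    · exact absurd hp hv.nil_notMem
    rw [List.concat_eq_append] at *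
    obtain ⟨y, hy, hyS⟩ := exists_mem_of_mem_tablesAt hi
    exact ⟨y, hy, by rw [below_concat]; exact subset_component hyS⟩
  exact (Finset.mem_union.1 (this hx')).resolve_left hxi

end CQ

/-! ## Minimal elimination orders are canonical -/

namespace CQ

variable {Q : CQ}

namespace IsVEO

variable {v : Q.Tree} (hv : Q.IsVEO v)

include hv

theorem prefix_mem {p r : Q.Path} (h : p <+: r) (hr : r ∈ v) (hp : p ≠ []) : p ∈ v := by
  obtain ⟨t, rfl⟩ := h
  induction t using List.reverseRecOn with
  | nil => simpa using hr
  | append_singleton t S ih =>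
    exact ih (hv.prefix_closed _ S (by simp [hp]) (by simpa using hr))

theorem node_unique {p r : Q.Path} {S T : Finset Q.Var} (hp : p ++ [S] ∈ v) (hr : r ++ [T] ∈ v)
    {x : Q.Var} (hx : x ∈ S) (hx' : x ∈ T) : p ++ [S] = r ++ [T] :=
  (hv.partition x).unique ⟨hp, S, by simp, hx⟩ ⟨hr, T, by simp, hx'⟩

theorem exists_node (x : Q.Var) : ∃ p S, p ++ [S] ∈ v ∧ x ∈ S := by
  obtain ⟨p, ⟨hp, S, hS, hx⟩, -⟩ := hv.partition x
  obtain ⟨p', rfl⟩ := List.getLast?_eq_some_iff.1 hS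
  exact ⟨p', S, hp, hx⟩

theorem prefix_of_mem_pathVars {p r : Q.Path} {S : Finset Q.Var} (hp : p ++ [S] ∈ v)
    (hr : r ∈ v) {x : Q.Var} (hx : x ∈ S) (hxr : x ∈ Q.pathVars r) : p ++ [S] <+: r := by
  obtain ⟨r', T, h, hxT⟩ := exists_prefix_of_mem_pathVars hxr
  rw [hv.node_unique hp (hv.prefix_mem h hr (by simp)) hx hxT]; exact h

theorem notMem_label {p : Q.Path} {S : Finset Q.Var} (hp : p ++ [S] ∈ v) {x : Q.Var}
    (hx : x ∈ S) : x ∉ Q.pathVars p := by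
  intro h
  obtain ⟨r', T, h, hxT⟩ := exists_prefix_of_mem_pathVars h
  have := hv.node_unique hp (hv.prefix_mem (h.trans (List.prefix_append _ _)) hp (by simp)) hx hxT
  have h' := h.length_le
  rw [← this] at h'
  simp at h'

theorem exists_tablesAt (hQ : Q.Connected) (hvar : 0 < Q.numVars) (i : Q.Atom) :
    ∃ p ∈ v, i ∈ Q.tablesAt p := by
  obtain ⟨p, hp, hi⟩ := hv.atoms_on_paths i
  obtain ⟨x, hx⟩ := vars_nonempty hQ hvar i
  induction p using List.reverseRecOn with
  | nil => simpa using hi hx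
  | append_singleton p S ih =>
    by_cases h : Q.vars i ⊆ Q.pathVars p
    · by_cases hp' : p = []
      · subst hp'; simpa using h hx
      · exact ih (hv.prefix_closed p S hp' hp) h
    · exact ⟨_, hp, mem_tablesAt_concat.2 ⟨by simpa using hi, h⟩⟩

theorem table_unique {p r : Q.Path} (hp : p ∈ v) (hr : r ∈ v) {i : Q.Atom}
    (hi : i ∈ Q.tablesAt p) (hi' : i ∈ Q.tablesAt r) : p = r := by
  have key : ∀ {p r : Q.Path}, p ∈ v → r ∈ v → i ∈ Q.tablesAt p → i ∈ Q.tablesAt r → p <+: r := by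
    intro p r hp hr hi hi'
    rcases List.eq_nil_or_concat p with rfl | ⟨p, S, rfl⟩
    · exact List.nil_prefix
    · rw [List.concat_eq_append] at *
      obtain ⟨x, hx, hxS⟩ := exists_mem_of_mem_tablesAt hi
      exact hv.prefix_of_mem_pathVars hp hr hxS ((mem_tablesAt.1 hi').1 hx)
  exact (key hp hr hi hi').eq_of_length_le (key hr hp hi' hi).length_le

theorem full_eq {p : Q.Path} (hp : p ∈ v) {i : Q.Atom} (hi : i ∈ Q.tablesAt p) :
    Q.vars i ∪ Q.dissociationOf v i = Q.pathVars p := by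
  ext x
  simp only [dissociationOf, Finset.mem_union, Finset.mem_sdiff, Finset.mem_biUnion,
    Finset.mem_filter]
  constructor
  · rintro (h | ⟨⟨r, ⟨hr, hir⟩, hx⟩, -⟩)
    · exact (mem_tablesAt.1 hi).1 h
    · rwa [hv.table_unique hp hr hi hir]
  · intro h
    by_cases hx : x ∈ Q.vars i
    · exact Or.inl hx
    · exact Or.inr ⟨⟨p, ⟨hp, hi⟩, h⟩, hx⟩

/-- Variables that share an atom lie on one path. -/
theorem comparable_of_atom {p r : Q.Path} {S T : Finset Q.Var} (hp : p ++ [S] ∈ v)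
    (hr : r ++ [T] ∈ v) {x y : Q.Var} (hx : x ∈ S) (hy : y ∈ T) {i : Q.Atom} {t : Q.Path}
    (ht : t ∈ v) (hi : i ∈ Q.tablesAt t) (hxi : x ∈ Q.vars i ∪ Q.dissociationOf v i)
    (hyi : y ∈ Q.vars i ∪ Q.dissociationOf v i) : p ++ [S] <+: r ++ [T] ∨ r ++ [T] <+: p ++ [S] := by
  rw [hv.full_eq ht hi] at hxi hyi
  exact List.prefix_or_prefix_of_prefix (hv.prefix_of_mem_pathVars hp ht hx hxi)
    (hv.prefix_of_mem_pathVars hr ht hy hyi)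

end IsVEO

/-- The variables of the subtree of `v` with the root `p`. -/
def subtreeVars (Q : CQ) (v : Q.Tree) (p : Q.Path) : Set Q.Var :=
  {x | ∃ r S, r ++ [S] ∈ v ∧ x ∈ S ∧ p <+: r ++ [S]}

theorem mem_full_iff (hQ : Q.Connected) (hvar : 0 < Q.numVars) {v : Q.Tree} (hv : Q.IsVEO v)
    {i : Q.Atom} {x : Q.Var} : x ∈ Q.vars i ∪ Q.dissociationOf v i ↔
      ∃ p ∈ v, i ∈ Q.tablesAt p ∧ x ∈ Q.pathVars p := by
  obtain ⟨p, hp, hi⟩ := hv.exists_tablesAt hQ hvar i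
  rw [hv.full_eq hp hi]
  exact ⟨fun h => ⟨p, hp, hi, h⟩, fun ⟨r, hr, hir, h⟩ => by rwa [hv.table_unique hp hr hi hir]⟩

/-- If the dissociation of `v` is minimal, then the label of a node cannot be reduced to `S'`. -/
theorem conn_of_minimal (hQ : Q.Connected) (hvar : 0 < Q.numVars) {v : Q.Tree}
    (hm : v ∈ Q.mveo) {p : Q.Path} {S S' : Finset Q.Var} (hp : p ++ [S] ∈ v) (hS' : S' ⊆ S)
    {i : Q.Atom} {x : Q.Var} (hx : x ∈ Q.vars i ∪ Q.dissociationOf v i)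
    (hxU : x ∈ Q.subtreeVars v (p ++ [S])) (hxS : x ∉ S') :
    ∃ z ∈ Q.vars i, z ∉ Q.pathVars p ∪ S' ∧ Q.Conn (Q.pathVars p ∪ S') z x := by
  classical
  obtain ⟨hv, -, hh, hmin⟩ := hm
  set U := Q.subtreeVars v (p ++ [S]) with hU
  set X := Q.pathVars p ∪ S' with hX
  have hUp : ∀ y ∈ U, y ∉ Q.pathVars p := by
    rintro y ⟨r, T, hr, hy, hpre⟩ h
    obtain ⟨r', T', h', hy'⟩ := exists_prefix_of_mem_pathVars h
    have := hv.node_unique hr (hv.prefix_mem (h'.trans (List.prefix_append _ _)) hp (by simp))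
      hy hy'
    have h1 := h'.length_le
    have h2 := hpre.length_le
    rw [this] at h2
    simp at h1 h2
    omega
  -- The dissociation that results if the label is cut down to `S'` and the rest of the subtree is
  -- split into components: an atom keeps a variable below `S'` only if the atom itself reaches into
  -- its component.
  let keep : Q.Atom → Q.Var → Prop := fun i x =>
    x ∉ U ∨ x ∈ S' ∨ ∃ z ∈ Q.vars i, z ∉ X ∧ Q.Conn X z x
  let full : Q.Atom → Finset Q.Var := fun i => Q.vars i ∪ Q.dissociationOf v i
  let Δ : Q.Atom → Finset Q.Var := fun i => ((full i).filter (keep i)) \ Q.vars i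
  have hfull : ∀ i x, x ∈ Q.vars i ∪ Δ i ↔ x ∈ full i ∧ keep i x := by
    intro i x
    simp only [Δ, Finset.mem_union, Finset.mem_sdiff, Finset.mem_filter]
    constructor
    · rintro (h | h)
      · refine ⟨Finset.mem_union_left _ h, ?_⟩
        by_cases hU' : x ∈ U
        · by_cases hS'' : x ∈ S'
          · exact Or.inr (Or.inl hS'')
          · exact Or.inr (Or.inr ⟨x, h, by simp [hX, hS'', hUp x hU'], Conn.refl x⟩)
        · exact Or.inl hU'
      · exact h.1
    · intro h
      by_cases hx : x ∈ Q.vars i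
      · exact Or.inl hx
      · exact Or.inr ⟨h, hx⟩
  have hsubS : ∀ x ∈ S, ∀ i y, y ∈ full i → y ∈ U → x ∈ full i := by
    intro x hx i y hy ⟨r, T, hr, hyT, hpre⟩
    obtain ⟨t, ht, hi, hyt⟩ := (mem_full_iff hQ hvar hv).1 hy
    refine (mem_full_iff hQ hvar hv).2 ⟨t, ht, hi, ?_⟩
    exact pathVars_mono (hpre.trans (hv.prefix_of_mem_pathVars hr ht hyT hyt)) (by simp [hx])
  -- A variable outside of the subtree that shares a dissociated atom with one inside lies above it.
  -- It then lies in all dissociated atoms of the inner variable, and it is never removed.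
  have hout : ∀ x y, x ∈ U → y ∉ U → (∀ i, x ∈ full i → y ∈ full i) ∨
      ∀ i, x ∈ full i → y ∉ full i := by
    intro x y ⟨r, T, hr, hxT, hpre⟩ hy
    by_cases h : ∃ i, x ∈ full i ∧ y ∈ full i
    · left
      obtain ⟨i, hxi, hyi⟩ := h
      obtain ⟨r', T', hr', hyT'⟩ := hv.exists_node y
      obtain ⟨t, ht, hi⟩ := hv.exists_tablesAt hQ hvar i
      have hle : r' ++ [T'] <+: r ++ [T] := by
        rcases hv.comparable_of_atom hr hr' hxT hyT' ht hi hxi hyi with h' | h'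
        · exact absurd ⟨r', T', hr', hyT', hpre.trans h'⟩ hy
        · exact h'
      intro j hj
      obtain ⟨t', ht', hjt, hxt⟩ := (mem_full_iff hQ hvar hv).1 hj
      exact (mem_full_iff hQ hvar hv).2 ⟨t', ht', hjt, pathVars_mono
        (hle.trans (hv.prefix_of_mem_pathVars hr ht' hxT hxt)) (by simp [hyT'])⟩
    · right
      push Not at h
      exact h
  have hD : Δ = Q.dissociationOf v := by
    refine hmin Δ (fun i => Finset.sdiff_disjoint) ?_ ?_
    · intro x y
      have hat : ∀ x i, i ∈ Q.atomsOf Δ x ↔ x ∈ full i ∧ keep i x := by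
        intro x i; simp only [atomsOf, Finset.mem_filter, Finset.mem_univ, true_and]; exact hfull i x
      have hat' : ∀ x i, i ∈ Q.atomsOf (Q.dissociationOf v) x ↔ x ∈ full i := by
        intro x i; simp [atomsOf, full]
      have hin : ∀ x y, x ∈ U → y ∉ U → Q.atomsOf Δ x ⊆ Q.atomsOf Δ y ∨
          Disjoint (Q.atomsOf Δ x) (Q.atomsOf Δ y) := by
        intro x y hx hy
        rcases hout x y hx hy with h | h
        · left; intro i hi
          rw [hat] at hi ⊢
          exact ⟨h i hi.1, Or.inl hy⟩
        · right
          refine Finset.disjoint_left.2 fun i hi hi' => ?_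
          rw [hat] at hi hi'
          exact h i hi.1 hi'.1
      have hS'' : ∀ x y, x ∈ S' → y ∈ U → Q.atomsOf Δ y ⊆ Q.atomsOf Δ x := by
        intro x y hx hy i hi
        rw [hat] at hi ⊢
        exact ⟨hsubS x (hS' hx) i y hi.1 hy, Or.inr (Or.inl hx)⟩
      by_cases hx : x ∈ U <;> by_cases hy : y ∈ U
      · by_cases hxS : x ∈ S'
        · exact Or.inr (Or.inl (hS'' x y hxS hy))
        by_cases hyS : y ∈ S'
        · exact Or.inl (hS'' y x hyS hx)
        have hk : ∀ x, x ∈ U → x ∉ S' → ∀ i, keep i x ↔ ∃ z ∈ Q.vars i, z ∉ X ∧ Q.Conn X z x :=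
          fun x hx hxS i => by simp [keep, hx, hxS]
        -- Linked variables are kept by the same atoms, so the old comparison survives. Unlinked
        -- ones no longer share an atom, because an atom that keeps both would link them.
        by_cases hc : Q.Conn X x y
        · have hkk : ∀ i, keep i x ↔ keep i y := fun i => by
            rw [hk x hx hxS, hk y hy hyS]
            exact ⟨fun ⟨z, h1, h2, h3⟩ => ⟨z, h1, h2, h3.trans hc⟩,
              fun ⟨z, h1, h2, h3⟩ => ⟨z, h1, h2, h3.trans hc.symm⟩⟩
          rcases hh x y with h | h | h
          · left; intro i hi
            rw [hat] at hi ⊢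
            exact ⟨(hat' y i).1 (h ((hat' x i).2 hi.1)), (hkk i).1 hi.2⟩
          · right; left; intro i hi
            rw [hat] at hi ⊢
            exact ⟨(hat' x i).1 (h ((hat' y i).2 hi.1)), (hkk i).2 hi.2⟩
          · right; right
            refine Finset.disjoint_left.2 fun i hi hi' => ?_
            rw [hat] at hi hi'
            exact Finset.disjoint_left.1 h ((hat' x i).2 hi.1) ((hat' y i).2 hi'.1)
        · right; right
          refine Finset.disjoint_left.2 fun i hi hi' => hc ?_
          rw [hat, hk x hx hxS] at hi
          rw [hat, hk y hy hyS] at hi'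
          obtain ⟨-, z, hz, hzX, hzx⟩ := hi
          obtain ⟨-, z', hz', hzX', hzy⟩ := hi'
          exact (hzx.symm.trans (Conn.of_atom hzX hzX' hz hz')).trans hzy
      · rcases hin x y hx hy with h | h
        exacts [Or.inl h, Or.inr (Or.inr h)]
      · rcases hin y x hy hx with h | h
        exacts [Or.inr (Or.inl h), Or.inr (Or.inr h.symm)]
      · rcases hh x y with h | h | h
        · left; intro i hi
          rw [hat] at hi ⊢
          exact ⟨(hat' y i).1 (h ((hat' x i).2 hi.1)), Or.inl hy⟩
        · right; left; intro i hi
          rw [hat] at hi ⊢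
          exact ⟨(hat' x i).1 (h ((hat' y i).2 hi.1)), Or.inl hx⟩
        · right; right
          refine Finset.disjoint_left.2 fun i hi hi' => ?_
          rw [hat] at hi hi'
          exact Finset.disjoint_left.1 h ((hat' x i).2 hi.1) ((hat' y i).2 hi'.1)
    · intro i x hx
      simp only [Δ, full, Finset.mem_sdiff, Finset.mem_filter, Finset.mem_union] at hx
      exact hx.1.1.resolve_left hx.2
  have hx' : x ∈ Q.vars i ∪ Δ i := by rw [hD]; exact hx
  rcases ((hfull i x).1 hx').2 with h | h | h
  · exact absurd hxU h
  · exact absurd h hxS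
  · exact h

/-- `conn_of_minimal` with `S' = ∅` shows that each subtree is a connected component. With a proper
subset of the label it shows that this subset is not a separator. -/
theorem isCanonical_of_mem_mveo (hQ : Q.Connected) (hvar : 0 < Q.numVars) {v : Q.Tree}
    (hm : v ∈ Q.mveo) : Q.IsCanonical v := by
  classical
  have hv := hm.1
  have hself : ∀ {p S x}, p ++ [S] ∈ v → x ∈ S → x ∈ Q.subtreeVars v (p ++ [S]) :=
    fun hp hx => ⟨_, _, hp, hx, List.prefix_rfl⟩
  have hfullS : ∀ {p S}, p ++ [S] ∈ v → ∀ {x i y}, x ∈ S → y ∈ Q.subtreeVars v (p ++ [S]) →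
      y ∈ Q.vars i → x ∈ Q.vars i ∪ Q.dissociationOf v i := by
    rintro p S hp x i y hx ⟨r, T, hr, hyT, hpre⟩ hy
    obtain ⟨t, ht, hi⟩ := hv.exists_tablesAt hQ hvar i
    refine (mem_full_iff hQ hvar hv).2 ⟨t, ht, hi, ?_⟩
    exact pathVars_mono (hpre.trans (hv.prefix_of_mem_pathVars hr ht hyT
      ((mem_tablesAt.1 hi).1 hy))) (by simp [hx])
  have hnot : ∀ {p S x}, p ++ [S] ∈ v → x ∈ Q.subtreeVars v (p ++ [S]) → x ∉ Q.pathVars p := by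
    rintro p S x hp ⟨r, T, hr, hx, hpre⟩ h
    exact hv.notMem_label hr hx (pathVars_mono (by
      rcases List.prefix_concat_iff.1 hpre with h' | h'
      · rw [List.append_inj_left' h' rfl]
      · exact (List.prefix_append _ _).trans h') h)
  have hconn : ∀ {p S x y}, p ++ [S] ∈ v → x ∈ S → y ∈ Q.subtreeVars v (p ++ [S]) →
      Q.Conn (Q.pathVars p) x y := by
    intro p S x y hp hx hy
    obtain ⟨j, hj⟩ := exists_mem_vars y
    obtain ⟨z, hz, hzX, hzx⟩ := conn_of_minimal hQ hvar hm hp (Finset.empty_subset S)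
      (hfullS hp hx hy hj) (hself hp hx) (by simp)
    rw [Finset.union_empty] at hzX hzx
    exact hzx.symm.trans (Conn.of_atom hzX (hnot hp hy) hz hj)
  -- The variables of an atom lie on one path, so a link cannot lead out of the subtree except to a
  -- variable above it, and those are removed.
  have hclosed : ∀ {p S x y}, p ++ [S] ∈ v → x ∈ Q.subtreeVars v (p ++ [S]) →
      Q.Conn (Q.pathVars p) x y → y ∈ Q.subtreeVars v (p ++ [S]) := by
    intro p S x y hp hx h
    induction h with
    | refl => exact hx
    | @tail a b _ h ih =>
      obtain ⟨-, hb, i, hai, hbi⟩ := h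
      obtain ⟨r, T, hr, haT, hpre⟩ := ih
      obtain ⟨r', T', hr', hbT⟩ := hv.exists_node b
      obtain ⟨t, ht, hi⟩ := hv.exists_tablesAt hQ hvar i
      refine ⟨r', T', hr', hbT, ?_⟩
      rcases hv.comparable_of_atom hr hr' haT hbT ht hi (Finset.mem_union_left _ hai)
        (Finset.mem_union_left _ hbi) with h | h
      · exact hpre.trans h
      · rcases List.prefix_or_prefix_of_prefix hpre h with h' | h'
        · exact h'
        · rcases List.prefix_concat_iff.1 h' with h'' | h''
          · rw [h'']
          · exact absurd (pathVars_mono h'' (by simp [hbT])) hb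
  have hsub : ∀ {p S}, p ++ [S] ∈ v →
      Q.subtreeVars v (p ++ [S]) = Q.component (Q.pathVars p) S := by
    intro p S hp
    obtain ⟨s, hs⟩ := Finset.nonempty_iff_ne_empty.2
      fun h : S = ∅ => hv.label_nonempty _ hp (by simp [h])
    ext y
    exact ⟨fun hy => ⟨s, hs, hconn hp hs hy⟩,
      fun ⟨x, hx, hxy⟩ => hclosed hp (hself hp hx) hxy⟩
  have hbelow : ∀ {p}, p = [] ∨ p ∈ v → ∀ {r S x}, r ++ [S] ∈ v → x ∈ S →
      (x ∈ Q.below p ↔ p <+: r ++ [S]) := by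
    intro p hp r S x hr hx
    rcases List.eq_nil_or_concat p with rfl | ⟨p, T, rfl⟩
    · simp
    rw [List.concat_eq_append] at *
    have hp : p ++ [T] ∈ v := by simpa using hp
    rw [below_concat, ← hsub hp]
    constructor
    · rintro ⟨r', S', hr', hx', h⟩
      rwa [hv.node_unique hr hr' hx hx']
    · exact fun h => ⟨r, S, hr, hx, h⟩
  have hpar : ∀ p S, p ++ [S] ∈ v → p = [] ∨ p ∈ v := by
    intro p S h
    by_cases hp : p = []
    · exact Or.inl hp
    · exact Or.inr (hv.prefix_closed p S hp h)
  refine ⟨fun h => hv.ne_nil _ h rfl, hpar, ?_, ?_⟩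
  · intro p S hp
    obtain ⟨s, hs⟩ := Finset.nonempty_iff_ne_empty.2
      fun h : S = ∅ => hv.label_nonempty _ hp (by simp [h])
    refine ⟨⟨s, hs⟩, fun x hx => hv.notMem_label hp hx, fun x hx => ?_, fun x hx y hy =>
      hconn hp hx (hself hp hy), ?_, ?_⟩
    · exact (hbelow (hpar p S hp) hp hx).2 (List.prefix_append _ _)
    · rcases hv.alternating _ hp with ⟨i, hi⟩ | ⟨T, T', hne, hT, hT'⟩
      · obtain ⟨x, hx, hxS⟩ := exists_mem_of_mem_tablesAt hi
        exact Or.inl ⟨i, ⟨x, hx, subset_component hxS⟩, (mem_tablesAt_concat.1 hi).1⟩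
      · right
        have hex : ∀ {T}, (p ++ [S]) ++ [T] ∈ v → ∃ x ∈ T, x ∈ Q.component (Q.pathVars p) S ∧ x ∉ S := by
          intro T hT
          obtain ⟨x, hx⟩ := Finset.nonempty_iff_ne_empty.2
            fun h : T = ∅ => hv.label_nonempty _ hT (by simp [h])
          refine ⟨x, hx, ?_, fun h => hv.notMem_label hT hx (by simp [h])⟩
          rw [← hsub hp]
          exact ⟨_, T, hT, hx, List.prefix_append _ _⟩
        obtain ⟨x, hx, hx1, hx2⟩ := hex hT
        obtain ⟨y, hy, hy1, hy2⟩ := hex hT'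
        refine ⟨x, hx1, y, hy1, hx2, hy2, fun h => hne ?_⟩
        have : y ∈ Q.subtreeVars v ((p ++ [S]) ++ [T]) :=
          hclosed hT (hself hT hx) (by simpa using h)
        obtain ⟨r, U, hr, hyU, hpre⟩ := this
        rw [hv.node_unique hr hT' hyU hy] at hpre
        have := hpre.eq_of_length (by simp)
        simpa using this
    -- A variable `x` of the label outside of `S'` is linked to every atom of the component without
    -- `S'`. So `S'` neither covers an atom nor disconnects anything.
    · intro S' hS' hsep
      obtain ⟨x, hx, hxS'⟩ := Finset.exists_of_ssubset hS'
      have hz : ∀ i y, y ∈ Q.vars i → y ∈ Q.component (Q.pathVars p) S →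
          ∃ z ∈ Q.vars i, z ∉ Q.pathVars p ∪ S' ∧ Q.Conn (Q.pathVars p ∪ S') z x := by
        intro i y hy hyK
        rw [← hsub hp] at hyK
        exact conn_of_minimal hQ hvar hm hp hS'.1 (hfullS hp hx hyK hy) (hself hp hx) hxS'
      rcases hsep with ⟨i, ⟨y, hy, hyK⟩, hi⟩ | ⟨a, ha, b, hb, haS, hbS, hab⟩
      · obtain ⟨z, hz, hzX, -⟩ := hz i y hy hyK
        exact hzX (hi hz)
      · have step : ∀ a, a ∈ Q.component (Q.pathVars p) S → a ∉ S' →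
            Q.Conn (Q.pathVars p ∪ S') a x := by
          intro a ha haS
          obtain ⟨i, hi⟩ := exists_mem_vars a
          obtain ⟨z, hzi, hzX, hzx⟩ := hz i a hi ha
          rw [← hsub hp] at ha
          exact (Conn.of_atom (by simp [haS, hnot hp ha]) hzX hi hzi).trans hzx
        exact hab ((step a ha haS).trans (step b hb hbS).symm)
  · intro p hp y hy hyp
    obtain ⟨r, T, hr, hyT⟩ := hv.exists_node y
    have hpre := (hbelow hp hr hyT).1 hy
    obtain ⟨t, ht⟩ := hpre
    cases t with
    | nil =>
      rw [List.append_nil] at ht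
      exact absurd (by simp [ht, hyT]) hyp
    | cons S t =>
      have hpre' : p ++ [S] <+: r ++ [T] := ⟨t, by simpa using ht⟩
      have hS := hv.prefix_mem hpre' hr (by simp)
      refine ⟨S, ⟨hS, ?_⟩, ?_⟩
      · rw [← hsub hS]; exact ⟨r, T, hr, hyT, hpre'⟩
      · rintro S' ⟨hS', hy'⟩
        rw [← below_concat, hbelow (Or.inr hS') hr hyT] at hy'
        have := (List.prefix_of_prefix_length_le hy' hpre' (by simp)).eq_of_length (by simp)
        simpa using this

theorem mem_mveo_iff (hQ : Q.Connected) (hvar : 0 < Q.numVars) {v : Q.Tree} :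
    v ∈ Q.mveo ↔ Q.IsCanonical v :=
  ⟨isCanonical_of_mem_mveo hQ hvar, fun h => h.mem_mveo hQ hvar⟩

end CQ

/-! ## Exchange of parts and trees from strategies -/

namespace CQ

variable {Q : CQ}

/-- `p` continues `q` into the component `C`. -/
def InPart (Q : CQ) (q : Q.Path) (C : Set Q.Var) (p : Q.Path) : Prop :=
  ∃ S t, p = q ++ S :: t ∧ Q.component (Q.pathVars q) S = C

theorem not_inPart_of_prefix {q p : Q.Path} {C : Set Q.Var} (h : p <+: q) : ¬ Q.InPart q C p := by
  rintro ⟨S, t, rfl, -⟩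
  have := h.length_le
  simp at this

theorem InPart.concat {q p : Q.Path} {C : Set Q.Var} (h : Q.InPart q C p) (S : Finset Q.Var) :
    Q.InPart q C (p ++ [S]) :=
  let ⟨T, t, h, h'⟩ := h; ⟨T, t ++ [S], by simp [h], h'⟩

theorem inPart_concat_iff {q p : Q.Path} {C : Set Q.Var} {S : Finset Q.Var} :
    Q.InPart q C (p ++ [S]) ↔ Q.InPart q C p ∨ p = q ∧ Q.component (Q.pathVars q) S = C := by
  constructor
  · rintro ⟨T, t, h, hC⟩
    rcases List.eq_nil_or_concat t with rfl | ⟨t, U, rfl⟩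
    · obtain ⟨h1, h2⟩ := List.append_inj' h rfl
      simp only [List.cons.injEq, and_true] at h2
      exact Or.inr ⟨h1, h2 ▸ hC⟩
    · rw [List.concat_eq_append, ← List.cons_append, ← List.append_assoc] at h
      obtain ⟨h1, -⟩ := List.append_inj' h rfl
      exact Or.inl ⟨T, t, h1, hC⟩
  · rintro (h | ⟨rfl, h⟩)
    · exact h.concat S
    · exact ⟨S, [], rfl, h⟩

theorem InPart.component_eq {q p : Q.Path} {C C' : Set Q.Var} (h : Q.InPart q C p)
    (h' : Q.InPart q C' p) : C = C' := by
  obtain ⟨S, t, rfl, hC⟩ := h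
  obtain ⟨S', t', h, hC'⟩ := h'
  have := List.append_cancel_left h
  simp only [List.cons.injEq] at this
  rw [← hC, ← hC', this.1]

open Classical in
/-- The tree `v` in which the part below `q` in the component `C` is replaced by that of `v'`. -/
noncomputable def exchange (Q : CQ) (q : Q.Path) (C : Set Q.Var) (v v' : Q.Tree) : Q.Tree :=
  v.filter (fun p => ¬ Q.InPart q C p) ∪ v'.filter (fun p => Q.InPart q C p)

theorem mem_exchange {q p : Q.Path} {C : Set Q.Var} {v v' : Q.Tree} :
    p ∈ Q.exchange q C v v' ↔ (p ∈ v ∧ ¬ Q.InPart q C p) ∨ (p ∈ v' ∧ Q.InPart q C p) := by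
  simp [exchange]

/-- Only at `q` do both trees contribute children. There both have one child for each component, and
for every component exactly one of the two is taken. -/
theorem IsCanonical.exchange {q : Q.Path} {C : Set Q.Var} {v v' : Q.Tree} (hv : Q.IsCanonical v)
    (hv' : Q.IsCanonical v') (hq : q = [] ∨ q ∈ v) (hq' : q = [] ∨ q ∈ v') :
    Q.IsCanonical (Q.exchange q C v v') where
  nil_notMem h := by
    rcases mem_exchange.1 h with h | h
    exacts [hv.nil_notMem h.1, hv'.nil_notMem h.1]
  parent p S h := by
    rw [mem_exchange]
    rcases mem_exchange.1 h with h | h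
    · have := hv.parent p S h.1
      exact this.imp id fun h' => Or.inl ⟨h', fun h'' => h.2 (h''.concat S)⟩
    · rcases inPart_concat_iff.1 h.2 with h' | ⟨rfl, -⟩
      · exact (hv'.parent p S h.1).imp id fun h'' => Or.inr ⟨h'', h'⟩
      · exact hq.imp id fun h' => Or.inl ⟨h', not_inPart_of_prefix List.prefix_rfl⟩
  label p S h := by
    rcases mem_exchange.1 h with h | h
    exacts [hv.label p S h.1, hv'.label p S h.1]
  child p hp y hy hy' := by
    by_cases hpart : Q.InPart q C p
    · have hp' : p = [] ∨ p ∈ v' := hp.imp id fun h =>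
        ((mem_exchange.1 h).resolve_left fun h => h.2 hpart).1
      obtain ⟨S, ⟨hS, hyS⟩, hu⟩ := hv'.child p hp' y hy hy'
      refine ⟨S, ⟨mem_exchange.2 (Or.inr ⟨hS, hpart.concat S⟩), hyS⟩, ?_⟩
      rintro T ⟨hT, hyT⟩
      exact hu T ⟨((mem_exchange.1 hT).resolve_left fun h => h.2 (hpart.concat T)).1, hyT⟩
    · have hp' : p = [] ∨ p ∈ v := hp.imp id fun h =>
        ((mem_exchange.1 h).resolve_right fun h => hpart h.2).1
      obtain ⟨S, ⟨hS, hyS⟩, hu⟩ := hv.child p hp' y hy hy'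
      by_cases hpq : p = q
      · subst hpq
        obtain ⟨S', ⟨hS', hyS'⟩, hu'⟩ := hv'.child p hq' y hy hy'
        have hSS' := (hv.label p S hS).component_eq (hv'.label p S' hS') hyS hyS'
        by_cases hC : Q.component (Q.pathVars p) S = C
        · refine ⟨S', ⟨mem_exchange.2 (Or.inr ⟨hS', inPart_concat_iff.2
            (Or.inr ⟨rfl, hSS' ▸ hC⟩)⟩), hyS'⟩, ?_⟩
          rintro T ⟨hT, hyT⟩
          rcases mem_exchange.1 hT with h | h
          · exact absurd (inPart_concat_iff.2 (Or.inr ⟨rfl, (hv.label p T h.1).component_eq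
              (hv.label p S hS) hyT hyS ▸ hC⟩)) h.2
          · exact hu' T ⟨h.1, hyT⟩
        · refine ⟨S, ⟨mem_exchange.2 (Or.inl ⟨hS, ?_⟩), hyS⟩, ?_⟩
          · rw [inPart_concat_iff]
            rintro (h | h)
            exacts [hpart h, hC h.2]
          rintro T ⟨hT, hyT⟩
          rcases mem_exchange.1 hT with h | h
          · exact hu T ⟨h.1, hyT⟩
          · rcases inPart_concat_iff.1 h.2 with h' | h'
            · exact absurd h' hpart
            · refine absurd ?_ hC
              rw [hSS', (hv'.label p S' hS').component_eq (hv'.label p T h.1) hyS' hyT]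
              exact h'.2
      · have hn : ∀ T, ¬ Q.InPart q C (p ++ [T]) := by
          intro T h
          rcases inPart_concat_iff.1 h with h' | h'
          exacts [hpart h', hpq h'.1]
        refine ⟨S, ⟨mem_exchange.2 (Or.inl ⟨hS, hn S⟩), hyS⟩, ?_⟩
        rintro T ⟨hT, hyT⟩
        exact hu T ⟨((mem_exchange.1 hT).resolve_right fun h => hn T h.2).1, hyT⟩

/-- Where a path leaves a tree, the tree has another child in the same component. -/
theorem IsCanonical.exists_divergence {v v' : Q.Tree} (hv : Q.IsCanonical v)
    (hv' : Q.IsCanonical v') {p q : Q.Path} (hp : p ∈ v) (hp' : p ∉ v') (hqp : q <+: p)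
    (hq : q = [] ∨ q ∈ v') :
    ∃ r S S', q <+: r ∧ r ++ [S] <+: p ∧ r ++ [S'] ∈ v' ∧ r ++ [S'] ∉ v ∧
      Q.component (Q.pathVars r) S' = Q.component (Q.pathVars r) S := by
  obtain ⟨t, rfl⟩ := hqp
  induction t using List.reverseRecOn with
  | nil =>
    rcases hq with rfl | hq
    · exact absurd hp hv.nil_notMem
    · exact absurd (by simpa using hq) hp'
  | append_singleton t S ih =>
    rw [← List.append_assoc] at hp hp' ⊢
    by_cases h : q ++ t = [] ∨ q ++ t ∈ v'
    · have hl := hv.label _ S hp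
      obtain ⟨s, hs⟩ := hl.nonempty
      obtain ⟨S', ⟨hS', hsS'⟩, -⟩ := hv'.child _ h s (hl.mem_below s hs) (hl.notMem s hs)
      refine ⟨q ++ t, S, S', List.prefix_append _ _, List.prefix_rfl, hS', fun hm => ?_,
        (hv'.label _ S' hS').component_eq hl hsS' (subset_component hs)⟩
      have := (hv.child _ (hv.parent _ S hp) s (hl.mem_below s hs) (hl.notMem s hs)).unique
        ⟨hp, subset_component hs⟩ ⟨hm, hsS'⟩
      exact hp' (this ▸ hS')
    · have hm := (hv.parent _ S hp).resolve_left fun h' => h (Or.inl h')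
      obtain ⟨r, T, T', h1, h2, h3⟩ := ih hm fun h' => h (Or.inr h')
      exact ⟨r, T, T', h1, h2.trans (List.prefix_append _ _), h3⟩

/-- If `v` shares one path with `v₁` only and another one with `v₂` only, then some canonical tree
contains paths of `v₁` and of `v₂` that are not in `v`. -/
theorem IsCanonical.exists_mixed {v₁ v v₂ : Q.Tree} (h1 : Q.IsCanonical v₁) (hv : Q.IsCanonical v)
    (h2 : Q.IsCanonical v₂) {p₁ p₂ : Q.Path} (hp1 : p₁ ∈ v₁) (hpv : p₁ ∈ v) (hp2 : p₁ ∉ v₂)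
    (hr1 : p₂ ∉ v₁) (hrv : p₂ ∈ v) (hr2 : p₂ ∈ v₂) :
    ∃ t, Q.IsCanonical t ∧ ∃ m₁ ∈ t, ∃ m₂ ∈ t, m₁ ∈ v₁ ∧ m₁ ∉ v ∧ m₂ ∈ v₂ ∧ m₂ ∉ v := by
  -- The two paths branch at `q`. Neither is a prefix of the other, since each of `v₁` and `v₂` is
  -- closed under prefixes and contains only one of them.
  obtain ⟨q, S₁, t₁, S₂, t₂, rfl, rfl, hS⟩ : ∃ q S₁ t₁ S₂ t₂, p₁ = q ++ S₁ :: t₁ ∧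
      p₂ = q ++ S₂ :: t₂ ∧ S₁ ≠ S₂ := by
    have n1 : ¬ p₁ <+: p₂ := fun h =>
      hp2 ((h2.prefix_mem h (Or.inr hr2)).resolve_left (h1.ne_nil hp1))
    have n2 : ¬ p₂ <+: p₁ := fun h =>
      hr1 ((h1.prefix_mem h (Or.inr hp1)).resolve_left (h2.ne_nil hr2))
    clear hp1 hpv hp2 hr1 hrv hr2
    induction p₁ generalizing p₂ with
    | nil => exact absurd List.nil_prefix n1
    | cons a l ih =>
      cases p₂ with
      | nil => exact absurd List.nil_prefix n2
      | cons b m =>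
        by_cases hab : a = b
        · subst hab
          obtain ⟨q, S₁, t₁, S₂, t₂, rfl, rfl, h⟩ := ih
            (fun h => n1 (by simpa using h)) (fun h => n2 (by simpa using h))
          exact ⟨a :: q, S₁, t₁, S₂, t₂, rfl, rfl, h⟩
        · exact ⟨[], a, l, b, m, rfl, rfl, hab⟩
  have hq1 : q = [] ∨ q ∈ v₁ := h1.prefix_mem (List.prefix_append _ _) (Or.inr hp1)
  have hq2 : q = [] ∨ q ∈ v₂ := h2.prefix_mem (List.prefix_append _ _) (Or.inr hr2)
  have hqv : q = [] ∨ q ∈ v := hv.prefix_mem (List.prefix_append _ _) (Or.inr hrv)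
  have hS1 : q ++ [S₁] ∈ v := (hv.prefix_mem ⟨t₁, by simp⟩ (Or.inr hpv)).resolve_left (by simp)
  have hS2 : q ++ [S₂] ∈ v := (hv.prefix_mem ⟨t₂, by simp⟩ (Or.inr hrv)).resolve_left (by simp)
  have hC : Q.component (Q.pathVars q) S₁ ≠ Q.component (Q.pathVars q) S₂ := by
    intro h
    have hl := hv.label q S₁ hS1
    obtain ⟨s, hs⟩ := hl.nonempty
    exact hS ((hv.child q hqv s (hl.mem_below s hs) (hl.notMem s hs)).unique
      ⟨hS1, subset_component hs⟩ ⟨hS2, h ▸ subset_component hs⟩)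
  have hin : ∀ {r S S' S₀ t₀}, q <+: r → r ++ [S] <+: q ++ S₀ :: t₀ →
      Q.component (Q.pathVars r) S' = Q.component (Q.pathVars r) S →
      Q.InPart q (Q.component (Q.pathVars q) S₀) (r ++ [S']) := by
    rintro r S S' S₀ t₀ ⟨u, rfl⟩ h hc
    cases u with
    | nil =>
      rw [List.append_nil] at h hc ⊢
      rw [List.prefix_append_right_inj] at h
      rw [List.cons_prefix_cons] at h
      refine ⟨S', [], rfl, ?_⟩
      rw [hc, h.1]
    | cons U u =>
      rw [List.append_assoc, List.prefix_append_right_inj, List.cons_append,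
        List.cons_prefix_cons] at h
      exact ⟨U, u ++ [S'], by simp, by rw [h.1]⟩
  -- `v₂` leaves `p₁` inside of the component of `S₁`, and `v₁` leaves `p₂` inside of the component
  -- of `S₂`. As these components differ, both deviations fit into one tree.
  obtain ⟨r, T, T', hr1', hr2', hr3, hr4, hr5⟩ := hv.exists_divergence h2 hpv hp2
    (List.prefix_append _ _) hq2
  obtain ⟨u, U, U', hu1, hu2, hu3, hu4, hu5⟩ := hv.exists_divergence h1 hrv hr1
    (List.prefix_append _ _) hq1
  refine ⟨Q.exchange q (Q.component (Q.pathVars q) S₁) v₁ v₂, h1.exchange h2 hq1 hq2,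
    u ++ [U'], ?_, r ++ [T'], ?_, hu3, hu4, hr3, hr4⟩
  · exact mem_exchange.2 (Or.inl ⟨hu3, fun h => hC (h.component_eq (hin hu1 hu2 hu5))⟩)
  · exact mem_exchange.2 (Or.inr ⟨hr3, hin hr1' hr2' hr5⟩)

/-! ### Trees from strategies -/

/-- A strategy gives a minimal separator for each component that may remain below a path. -/
def IsStrategy (Q : CQ) (σ : Q.Path → Set Q.Var → Finset Q.Var) : Prop :=
  ∀ p, ∀ y, y ∉ Q.pathVars p →
    (∀ x ∈ σ p {z | Q.Conn (Q.pathVars p) y z}, Q.Conn (Q.pathVars p) y x) ∧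
    Q.IsMinSep (Q.pathVars p) {z | Q.Conn (Q.pathVars p) y z} (σ p {z | Q.Conn (Q.pathVars p) y z})

/-- A path all of whose labels are admissible. -/
def IsLegal (Q : CQ) (p : Q.Path) : Prop := ∀ r S, r ++ [S] <+: p → Q.IsLabel r S

theorem IsLegal.of_prefix {p r : Q.Path} (h : Q.IsLegal p) (hr : r <+: p) : Q.IsLegal r :=
  fun _ _ h' => h _ _ (h'.trans hr)

theorem IsLegal.length_le_card {p : Q.Path} (h : Q.IsLegal p) :
    p.length ≤ (Q.pathVars p).card := by
  induction p using List.reverseRecOn with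
  | nil => simp
  | append_singleton p S ih =>
    have hl := h p S List.prefix_rfl
    rw [pathVars_concat, Finset.card_union_of_disjoint
      (Finset.disjoint_right.2 fun x hx => hl.notMem x hx), List.length_append]
    exact Nat.add_le_add (ih (h.of_prefix (List.prefix_append _ _))) hl.nonempty.card_pos

theorem IsLegal.length_le {p : Q.Path} (h : Q.IsLegal p) : p.length ≤ Q.numVars :=
  h.length_le_card.trans (by simpa using Finset.card_le_univ (Q.pathVars p))

theorem IsCanonical.isLegal {v : Q.Tree} (hv : Q.IsCanonical v) {p : Q.Path} (hp : p ∈ v) :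
    Q.IsLegal p := fun _ _ h => hv.label_of_prefix h (Or.inr hp)

/-- Labels along a legal path are nonempty and disjoint, so its length is at most the number of
variables, and there are only finitely many labels. -/
theorem finite_isLegal (Q : CQ) : {p : Q.Path | Q.IsLegal p}.Finite :=
  (List.finite_length_le _ Q.numVars).subset fun _ hp => hp.length_le

/-- The paths along which the labels are those that the strategy `σ` gives. -/
def Follows (Q : CQ) (σ : Q.Path → Set Q.Var → Finset Q.Var) (p : Q.Path) : Prop :=
  ∀ r S, r ++ [S] <+: p → Q.IsLabel r S ∧ S = σ r (Q.component (Q.pathVars r) S)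

open Classical in
/-- The tree that follows the strategy `σ`. -/
noncomputable def strategyTree (Q : CQ) (σ : Q.Path → Set Q.Var → Finset Q.Var) : Q.Tree :=
  (Q.finite_isLegal.toFinset).filter fun p => p ≠ [] ∧ Q.Follows σ p

theorem mem_strategyTree {σ : Q.Path → Set Q.Var → Finset Q.Var} {p : Q.Path} :
    p ∈ Q.strategyTree σ ↔ p ≠ [] ∧ Q.Follows σ p := by
  simp only [strategyTree, Finset.mem_filter, Set.Finite.mem_toFinset, Set.mem_ofPred_eq,
    and_iff_right_iff_imp]
  exact fun h r S hr => (h.2 r S hr).1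

theorem not_isSep_empty {X : Finset Q.Var} {y : Q.Var} (hy : y ∉ X) :
    ¬ Q.IsSep X {z | Q.Conn X y z} ∅ := by
  rintro (⟨i, ⟨x, hx, hxK⟩, hi⟩ | ⟨a, ha, b, hb, -, -, h⟩)
  · exact hxK.notMem hy (by simpa using hi hx)
  · rw [Finset.union_empty] at h
    exact h (Conn.trans (Conn.symm ha) hb)

theorem IsMinSep.nonempty {X S : Finset Q.Var} {y : Q.Var} (hy : y ∉ X)
    (h : Q.IsMinSep X {z | Q.Conn X y z} S) : S.Nonempty := by
  rw [Finset.nonempty_iff_ne_empty]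
  rintro rfl
  exact not_isSep_empty hy h.1

theorem component_eq_of_conn {X S : Finset Q.Var} {y : Q.Var} (hS : S.Nonempty)
    (h : ∀ x ∈ S, Q.Conn X y x) : Q.component X S = {z | Q.Conn X y z} := by
  ext z
  constructor
  · rintro ⟨x, hx, hxz⟩
    exact (h x hx).trans hxz
  · intro hz
    obtain ⟨s, hs⟩ := hS
    exact ⟨s, hs, (h s hs).symm.trans hz⟩

/-- The label of a child is a function of the path and the component, which gives existence and
uniqueness of the child for each component. -/
theorem isCanonical_strategyTree {σ : Q.Path → Set Q.Var → Finset Q.Var} (hσ : Q.IsStrategy σ) :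
    Q.IsCanonical (Q.strategyTree σ) where
  nil_notMem h := (mem_strategyTree.1 h).1 rfl
  parent p S h := by
    by_cases hp : p = []
    · exact Or.inl hp
    · exact Or.inr (mem_strategyTree.2 ⟨hp, fun r T hr =>
        (mem_strategyTree.1 h).2 r T (hr.trans (List.prefix_append _ _))⟩)
  label p S h := ((mem_strategyTree.1 h).2 p S List.prefix_rfl).1
  child p hp y hy hy' := by
    obtain ⟨hsub, hsep⟩ := hσ p y hy'
    set S := σ p {z | Q.Conn (Q.pathVars p) y z} with hS
    have hK : Q.component (Q.pathVars p) S = {z | Q.Conn (Q.pathVars p) y z} :=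
      component_eq_of_conn (hsep.nonempty hy') hsub
    have hl : Q.IsLabel p S := by
      refine ⟨hsep.nonempty hy', fun x hx => (hsub x hx).notMem hy',
        fun x hx => mem_below_of_conn hy (hsub x hx),
        fun x hx z hz => (hsub x hx).symm.trans (hsub z hz), ?_⟩
      rw [hK]; exact hsep
    refine ⟨S, ⟨mem_strategyTree.2 ⟨by simp, fun r T hr => ?_⟩, ?_⟩, ?_⟩
    · rcases List.prefix_concat_iff.1 hr with h | h
      · obtain ⟨rfl, h2⟩ := List.append_inj' h rfl
        simp only [List.cons.injEq, and_true] at h2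
        subst h2
        exact ⟨hl, by rw [hK]⟩
      · rcases hp with rfl | hp
        · simp at h
        · exact (mem_strategyTree.1 hp).2 r T h
    · rw [hK]; exact Conn.refl y
    · rintro T ⟨hT, hyT⟩
      obtain ⟨hlT, hT'⟩ := (mem_strategyTree.1 hT).2 p T List.prefix_rfl
      rw [hT', hlT.component_eq hl hyT (by rw [hK]; exact Conn.refl y), hK]

theorem IsSep.exists_isMinSep {X : Finset Q.Var} {K : Set Q.Var} {S : Finset Q.Var}
    (h : Q.IsSep X K S) : ∃ S' ⊆ S, Q.IsMinSep X K S' := by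
  induction S using Finset.strongInduction with
  | H S ih =>
    by_cases hm : ∃ S' ⊂ S, Q.IsSep X K S'
    · obtain ⟨S', hS', hsep⟩ := hm
      obtain ⟨T, hT, hmin⟩ := ih S' hS' hsep
      exact ⟨T, hT.trans hS'.1, hmin⟩
    · exact ⟨S, subset_rfl, h, fun S' hS' hsep => hm ⟨S', hS', hsep⟩⟩

/-- The whole component covers each atom that contains `y`, hence it is a separator and contains a
minimal one. -/
theorem exists_isMinSep {X : Finset Q.Var} {y : Q.Var} (hy : y ∉ X) :
    ∃ S : Finset Q.Var, (∀ x ∈ S, Q.Conn X y x) ∧ Q.IsMinSep X {z | Q.Conn X y z} S := by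
  classical
  have : Q.IsSep X {z | Q.Conn X y z} (Finset.univ.filter fun z => Q.Conn X y z) := by
    obtain ⟨i, hi⟩ := exists_mem_vars y
    refine Or.inl ⟨i, ⟨y, hi, Conn.refl y⟩, fun z hz => ?_⟩
    by_cases hzX : z ∈ X
    · exact Finset.mem_union_left _ hzX
    · exact Finset.mem_union_right _ (by simpa using Conn.of_atom hy hzX hi hz)
  obtain ⟨S, hS, hmin⟩ := this.exists_isMinSep
  exact ⟨S, fun x hx => by simpa using hS hx, hmin⟩

open Classical in
/-- A minimal separator of the component `K`, inside of `D` if possible. -/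
noncomputable def pickSep (Q : CQ) (X : Finset Q.Var) (K D : Set Q.Var) : Finset Q.Var :=
  if h : ∃ S : Finset Q.Var, (∀ x ∈ S, x ∈ K ∧ x ∈ D) ∧ Q.IsMinSep X K S then h.choose
  else if h : ∃ S : Finset Q.Var, (∀ x ∈ S, x ∈ K) ∧ Q.IsMinSep X K S then h.choose
  else ∅

/-- The strategy that prefers separators of the component `K` inside of `c K`. -/
noncomputable def preferring (Q : CQ) (c : Set Q.Var → Set Q.Var) (p : Q.Path) (K : Set Q.Var) :
    Finset Q.Var := Q.pickSep (Q.pathVars p) K (c K)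

theorem isStrategy_preferring (c : Set Q.Var → Set Q.Var) : Q.IsStrategy (Q.preferring c) := by
  intro p y hy
  unfold preferring pickSep
  split_ifs with h h'
  · exact ⟨fun x hx => (h.choose_spec.1 x hx).1, h.choose_spec.2⟩
  · exact ⟨fun x hx => h'.choose_spec.1 x hx, h'.choose_spec.2⟩
  · exact absurd (exists_isMinSep hy) h'

/-- If some separator lies in the preferred set, then so does a minimal one, and the first case of
`pickSep` applies. -/
theorem preferring_mem {c : Set Q.Var → Set Q.Var} {p : Q.Path} {K : Set Q.Var}
    {S : Finset Q.Var} (hS : ∀ x ∈ S, x ∈ K ∧ x ∈ c K) (h : Q.IsSep (Q.pathVars p) K S)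
    {x : Q.Var} (hx : x ∈ Q.preferring c p K) : x ∈ c K := by
  have h' : ∃ S : Finset Q.Var, (∀ x ∈ S, x ∈ K ∧ x ∈ c K) ∧ Q.IsMinSep (Q.pathVars p) K S := by
    obtain ⟨S', hS', hm⟩ := h.exists_isMinSep
    exact ⟨S', fun x hx => hS x (hS' hx), hm⟩
  rw [preferring, pickSep, dif_pos h'] at hx
  exact (h'.choose_spec.1 x hx).2

theorem preferring_congr {c c' : Set Q.Var → Set Q.Var} {p : Q.Path} {K : Set Q.Var}
    (h : c K = c' K) : Q.preferring c p K = Q.preferring c' p K := by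
  simp only [preferring, h]

end CQ

/-! ## Existence of a nested running-prefixes ordering -/

namespace CQ

variable {Q : CQ}

namespace Ordering

/-- The trees that an ordering offers. -/
def trees : Q.Ordering → List Q.Tree
  | single v => [v]
  | seq a b => a.trees ++ b.trees
  | par a b => a.trees.flatMap fun c => b.trees.map fun d => c ∪ d

theorem map_snd_choices (Ω : Q.Ordering) (α : List Bool) :
    (Ω.choices α).map Prod.snd = Ω.trees := by
  induction Ω generalizing α with
  | single v => rfl
  | seq a b iha ihb => simp [choices, trees, iha, ihb]
  | par a b iha ihb =>
    simp only [choices, trees, List.map_flatMap, List.map_map, ← iha (false :: α),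
      ← ihb (true :: α), List.flatMap_map]
    rfl

theorem exists_mem_trees (Ω : Q.Ordering) : ∃ t, t ∈ Ω.trees := by
  induction Ω with
  | single v => exact ⟨v, by simp [trees]⟩
  | seq a b iha _ => exact iha.imp fun t ht => by simp [trees, ht]
  | par a b iha ihb =>
    obtain ⟨c, hc⟩ := iha
    obtain ⟨d, hd⟩ := ihb
    exact ⟨c ∪ d, by simp only [trees, List.mem_flatMap, List.mem_map]; exact ⟨c, hc, d, hd, rfl⟩⟩

theorem occurs_iff {p : Q.Path} {Ω : Q.Ordering} : Ω.Occurs p ↔ ∃ t ∈ Ω.trees, p ∈ t := by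
  induction Ω with
  | single v => simp [Occurs, trees]
  | seq a b iha ihb => simp [Occurs, trees, iha, ihb, or_and_right, exists_or]
  | par a b iha ihb =>
    simp only [Occurs, trees, iha, ihb, List.mem_flatMap, List.mem_map]
    constructor
    · rintro (⟨c, hc, hp⟩ | ⟨d, hd, hp⟩)
      · obtain ⟨d, hd⟩ := exists_mem_trees b
        exact ⟨_, ⟨c, hc, d, hd, rfl⟩, Finset.mem_union_left _ hp⟩
      · obtain ⟨c, hc⟩ := exists_mem_trees a
        exact ⟨_, ⟨c, hc, d, hd, rfl⟩, Finset.mem_union_right _ hp⟩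
    · rintro ⟨_, ⟨c, hc, d, hd, rfl⟩, hp⟩
      rcases Finset.mem_union.1 hp with h | h
      exacts [Or.inl ⟨c, hc, h⟩, Or.inr ⟨d, hd, h⟩]

theorem Full.occurs {p : Q.Path} {Ω : Q.Ordering} (h : Ω.Full p) : Ω.Occurs p := by
  induction Ω with
  | single v => exact h
  | seq a b iha _ => exact Or.inl (iha h.1)
  | par a b iha _ => exact Or.inl (iha h.1)

theorem Full.final {p : Q.Path} {Ω : Q.Ordering} (h : Ω.Full p) : Ω.Final p := by
  induction Ω with
  | single v => exact h
  | seq a b iha _ => exact Or.inl ⟨iha h.1, h.2⟩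
  | par a b _ _ => exact h

theorem Full.initial {p : Q.Path} {Ω : Q.Ordering} (h : Ω.Full p) : Ω.Initial p := by
  induction Ω with
  | single v => exact h
  | seq a b _ ihb => exact Or.inl ⟨h.1, ihb h.2⟩
  | par a b _ _ => exact h

theorem Full.running {p : Q.Path} {Ω : Q.Ordering} (h : Ω.Full p) : Ω.Running p := by
  induction Ω with
  | single v => trivial
  | seq a b iha ihb => exact ⟨iha h.1, ihb h.2, fun _ _ => ⟨h.1.final, h.2.initial⟩⟩
  | par a b iha ihb => exact ⟨iha h.1, ihb h.2, fun _ _ => h⟩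

/-- Alternatives in sequence. -/
def seqList : List Q.Ordering → Q.Ordering
  -- A default that never matters, since the list of labels of a component is not empty.
  | [] => single ∅
  | [a] => a
  | a :: b :: l => seq a (seqList (b :: l))

/-- Independent choices; `v` is used if there are none. -/
def parList (v : Q.Tree) : List Q.Ordering → Q.Ordering
  | [] => single v
  | [a] => a
  | a :: b :: l => par a (parList v (b :: l))

theorem trees_seqList {l : List Q.Ordering} (hl : l ≠ []) :
    (seqList l).trees = l.flatMap trees := by
  induction l with
  | nil => exact absurd rfl hl
  | cons a l ih =>
    cases l with
    | nil => simp [seqList]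
    | cons b l => simp [seqList, trees, ih]

theorem full_seqList {p : Q.Path} {l : List Q.Ordering} (hl : l ≠ []) (h : ∀ a ∈ l, a.Full p) :
    (seqList l).Full p := by
  induction l with
  | nil => exact absurd rfl hl
  | cons a l ih =>
    cases l with
    | nil => simpa [seqList] using h
    | cons b l => exact ⟨h a (by simp), ih (by simp) fun c hc => h c (by simp [hc])⟩

theorem full_parList {p : Q.Path} {v : Q.Tree} {l : List Q.Ordering} (hv : p ∈ v)
    (h : ∀ a ∈ l, a.Full p) : (parList v l).Full p := by
  induction l with
  | nil => exact hv
  | cons a l ih =>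
    cases l with
    | nil => simpa [parList] using h
    | cons b l => exact ⟨h a (by simp), ih fun c hc => h c (by simp [hc])⟩

theorem occurs_seqList {p : Q.Path} {l : List Q.Ordering} (h : (seqList l).Occurs p) :
    ∃ a ∈ l, a.Occurs p := by
  induction l with
  | nil => simp [seqList, Occurs] at h
  | cons a l ih =>
    cases l with
    | nil => exact ⟨a, by simp, h⟩
    | cons b l =>
      rcases h with h | h
      · exact ⟨a, by simp, h⟩
      · obtain ⟨c, hc, h⟩ := ih h
        exact ⟨c, by simp [hc], h⟩

theorem occurs_parList {p : Q.Path} {v : Q.Tree} {l : List Q.Ordering}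
    (h : (parList v l).Occurs p) : p ∈ v ∨ ∃ a ∈ l, a.Occurs p := by
  induction l with
  | nil => exact Or.inl h
  | cons a l ih =>
    cases l with
    | nil => exact Or.inr ⟨a, by simp, h⟩
    | cons b l =>
      rcases h with h | h
      · exact Or.inr ⟨a, by simp, h⟩
      · rcases ih h with h | ⟨c, hc, h⟩
        · exact Or.inl h
        · exact Or.inr ⟨c, by simp [hc], h⟩

/-- A prefix that occurs in only one alternative imposes no condition at the joints of the sequence.
Prefixes common to all alternatives are treated by `Full.running`. -/
theorem running_seqList {p : Q.Path} {l : List Q.Ordering} (h : ∀ a ∈ l, a.Running p)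
    (h' : l.Pairwise fun a b => a.Occurs p → ¬ b.Occurs p) : (seqList l).Running p := by
  induction l with
  | nil => trivial
  | cons a l ih =>
    cases l with
    | nil => simpa [seqList] using h
    | cons b l =>
      rw [List.pairwise_cons] at h'
      refine ⟨h a (by simp), ih (fun c hc => h c (by simp [hc])) h'.2, fun ha hb => ?_⟩
      obtain ⟨c, hc, hcp⟩ := occurs_seqList hb
      exact absurd hcp (h'.1 c hc ha)

theorem running_parList {p : Q.Path} {v : Q.Tree} {l : List Q.Ordering}
    (h : ∀ a ∈ l, a.Running p) (hv : p ∉ v)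
    (h' : l.Pairwise fun a b => a.Occurs p → ¬ b.Occurs p) : (parList v l).Running p := by
  induction l with
  | nil => trivial
  | cons a l ih =>
    cases l with
    | nil => simpa [parList] using h
    | cons b l =>
      rw [List.pairwise_cons] at h'
      refine ⟨h a (by simp), ih (fun c hc => h c (by simp [hc])) h'.2, fun ha hb => ?_⟩
      rcases occurs_parList hb with hb | ⟨c, hc, hcp⟩
      · exact absurd hb hv
      · exact absurd hcp (h'.1 c hc ha)

end Ordering

/-! ### The nested ordering of the parts of elimination orders. -/

open Classical in
/-- The part of the tree `v` that lies below `p` in the component `K`, with the path to it. -/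
noncomputable def restrictTree (Q : CQ) (p : Q.Path) (K : Set Q.Var) (v : Q.Tree) : Q.Tree :=
  v.filter fun r => r <+: p ∨ Q.InPart p K r

theorem mem_restrictTree {p r : Q.Path} {K : Set Q.Var} {v : Q.Tree} :
    r ∈ Q.restrictTree p K v ↔ r ∈ v ∧ (r <+: p ∨ Q.InPart p K r) := by
  simp [restrictTree]

open Classical in
/-- The labels that minimal elimination orders use below `p` for the component `K`. -/
noncomputable def labelSet (Q : CQ) (p : Q.Path) (K : Set Q.Var) : Finset (Finset Q.Var) :=
  Finset.univ.filter fun S =>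
    Q.component (Q.pathVars p) S = K ∧ ∃ v, Q.IsCanonical v ∧ p ++ [S] ∈ v

theorem mem_labelSet {p : Q.Path} {K : Set Q.Var} {S : Finset Q.Var} :
    S ∈ Q.labelSet p K ↔
      Q.component (Q.pathVars p) S = K ∧ ∃ v, Q.IsCanonical v ∧ p ++ [S] ∈ v := by
  simp [labelSet]

open Classical in
/-- The components that remain below `p`. -/
noncomputable def componentsBelow (Q : CQ) (p : Q.Path) : Finset (Set Q.Var) :=
  (Finset.univ.filter fun y => y ∈ Q.below p ∧ y ∉ Q.pathVars p).image
    fun y => {z | Q.Conn (Q.pathVars p) y z}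

theorem mem_componentsBelow {p : Q.Path} {K : Set Q.Var} : K ∈ Q.componentsBelow p ↔
    ∃ y ∈ Q.below p, y ∉ Q.pathVars p ∧ {z | Q.Conn (Q.pathVars p) y z} = K := by
  simp [componentsBelow, and_assoc]

/-- The nonempty prefixes of a path. -/
def pathTree (Q : CQ) (p : Q.Path) : Q.Tree := (p.inits.filter (· ≠ [])).toFinset

theorem mem_pathTree {p r : Q.Path} : r ∈ Q.pathTree p ↔ r <+: p ∧ r ≠ [] := by
  simp [pathTree]

/-- The nested ordering of the parts of the minimal elimination orders below `p` in the component
`K`; the numeral bounds the depth. -/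
noncomputable def nestedOrdering (Q : CQ) : ℕ → Q.Path → Set Q.Var → Q.Ordering
  | 0, _, _ => .single ∅
  | n + 1, p, K => Ordering.seqList ((Q.labelSet p K).toList.map fun S =>
      Ordering.parList (Q.pathTree (p ++ [S])) ((Q.componentsBelow (p ++ [S])).toList.map
        (nestedOrdering Q n (p ++ [S]))))

theorem IsCanonical.component_eq {v : Q.Tree} (hv : Q.IsCanonical v) {p : Q.Path}
    {S : Finset Q.Var} (h : p ++ [S] ∈ v) {y : Q.Var} (hy : y ∈ Q.component (Q.pathVars p) S) :
    Q.component (Q.pathVars p) S = {z | Q.Conn (Q.pathVars p) y z} := by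
  have hl := hv.label p S h
  ext z
  exact ⟨fun hz => hl.conn_of_mem hy hz, fun hz => mem_component_of_conn hy hz⟩

theorem IsCanonical.component_mem {v : Q.Tree} (hv : Q.IsCanonical v) {p : Q.Path}
    {S : Finset Q.Var} (h : p ++ [S] ∈ v) :
    Q.component (Q.pathVars p) S ∈ Q.componentsBelow p := by
  have hl := hv.label p S h
  obtain ⟨s, hs⟩ := hl.nonempty
  exact mem_componentsBelow.2 ⟨s, hl.mem_below s hs, hl.notMem s hs,
    (hv.component_eq h (subset_component hs)).symm⟩

theorem IsCanonical.exists_child {v : Q.Tree} (hv : Q.IsCanonical v) {p : Q.Path}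
    (hp : p = [] ∨ p ∈ v) {K : Set Q.Var} (hK : K ∈ Q.componentsBelow p) :
    ∃ S, p ++ [S] ∈ v ∧ Q.component (Q.pathVars p) S = K := by
  obtain ⟨y, hy, hy', rfl⟩ := mem_componentsBelow.1 hK
  obtain ⟨S, ⟨hS, hyS⟩, -⟩ := hv.child p hp y hy hy'
  exact ⟨S, hS, hv.component_eq hS hyS⟩

theorem IsCanonical.child_unique {v : Q.Tree} (hv : Q.IsCanonical v) {p : Q.Path}
    {S T : Finset Q.Var} (hS : p ++ [S] ∈ v) (hT : p ++ [T] ∈ v)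
    (h : Q.component (Q.pathVars p) S = Q.component (Q.pathVars p) T) : S = T := by
  have hl := hv.label p S hS
  obtain ⟨s, hs⟩ := hl.nonempty
  exact (hv.child p (hv.parent p S hS) s (hl.mem_below s hs) (hl.notMem s hs)).unique
    ⟨hS, subset_component hs⟩ ⟨hT, h ▸ subset_component hs⟩

theorem InPart.exists_prefix {p r : Q.Path} {K : Set Q.Var} (h : Q.InPart p K r) :
    ∃ S, p ++ [S] <+: r ∧ Q.component (Q.pathVars p) S = K :=
  let ⟨S, t, h, hK⟩ := h; ⟨S, ⟨t, by simp [h]⟩, hK⟩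

theorem inPart_of_prefix {p r : Q.Path} {S : Finset Q.Var} (h : p ++ [S] <+: r) :
    Q.InPart p (Q.component (Q.pathVars p) S) r := by
  obtain ⟨t, rfl⟩ := h
  exact ⟨S, t, by simp, rfl⟩

/-- The restriction of a tree to several components below `q`. -/
theorem trees_parList {q : Q.Path} (hex : ∃ v, Q.IsCanonical v ∧ q ∈ v)
    (rec : Set Q.Var → Q.Ordering) {l : List (Set Q.Var)} (hl : l.Nodup)
    (hrec : ∀ K ∈ l, (∀ t, t ∈ (rec K).trees ↔
      ∃ v, Q.IsCanonical v ∧ q ∈ v ∧ t = Q.restrictTree q K v) ∧ (rec K).trees.Nodup) :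
    (∀ t, t ∈ (Ordering.parList (Q.pathTree q) (l.map rec)).trees ↔ ∃ v, Q.IsCanonical v ∧ q ∈ v ∧
      ∀ r, r ∈ t ↔ r ∈ v ∧ (r <+: q ∨ ∃ K ∈ l, Q.InPart q K r)) ∧
    (Ordering.parList (Q.pathTree q) (l.map rec)).trees.Nodup := by
  classical
  induction l with
  | nil =>
    simp only [List.map_nil, Ordering.parList, Ordering.trees, List.mem_singleton,
      List.not_mem_nil, false_and, exists_false, or_false, List.nodup_singleton, and_true]
    intro t
    have key : ∀ v, Q.IsCanonical v → q ∈ v → ∀ r, r ∈ Q.pathTree q ↔ r ∈ v ∧ r <+: q := by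
      intro v hv hqv r
      rw [mem_pathTree]
      constructor
      · exact fun h => ⟨(hv.prefix_mem h.1 (Or.inr hqv)).resolve_left h.2, h.1⟩
      · exact fun h => ⟨h.2, hv.ne_nil h.1⟩
    constructor
    · rintro rfl
      obtain ⟨v, hv, hqv⟩ := hex
      exact ⟨v, hv, hqv, key v hv hqv⟩
    · rintro ⟨v, hv, hqv, h⟩
      ext r
      rw [h, key v hv hqv]
  | cons K l ih =>
    obtain ⟨hK, hl⟩ := List.nodup_cons.1 hl
    obtain ⟨hrK, hrKn⟩ := hrec K (by simp)
    obtain ⟨ih1, ih2⟩ := ih hl fun K' hK' => hrec K' (by simp [hK'])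
    cases l with
    | nil =>
      simp only [List.map_cons, List.map_nil, Ordering.parList, List.mem_singleton, exists_eq_left]
      refine ⟨fun t => ?_, hrKn⟩
      rw [hrK]
      refine exists_congr fun v => and_congr_right fun _ => and_congr_right fun _ => ?_
      rw [Finset.ext_iff]
      simp only [mem_restrictTree]
    | cons K' l =>
      set L := K' :: l with hL
      have htr : (Ordering.parList (Q.pathTree q) ((K :: L).map rec)).trees =
          (rec K).trees.flatMap fun c =>
            (Ordering.parList (Q.pathTree q) (L.map rec)).trees.map fun d => c ∪ d := rfl
      rw [htr]
      constructor
      · intro t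
        simp only [List.mem_flatMap, List.mem_map]
        constructor
        · rintro ⟨c, hc, d, hd, rfl⟩
          obtain ⟨v₁, hv₁, hq₁, rfl⟩ := (hrK c).1 hc
          obtain ⟨v₂, hv₂, hq₂, hd⟩ := (ih1 d).1 hd
          -- Independent parts come from different trees. The exchange at `q` merges them into one
          -- canonical tree that shows both.
          refine ⟨Q.exchange q K v₂ v₁, hv₂.exchange hv₁ (Or.inr hq₂) (Or.inr hq₁),
            mem_exchange.2 (Or.inl ⟨hq₂, not_inPart_of_prefix List.prefix_rfl⟩), fun r => ?_⟩
          rw [Finset.mem_union, mem_restrictTree, hd, mem_exchange]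
          constructor
          · rintro (⟨h1, h2 | h2⟩ | ⟨h1, h2 | ⟨K₁, hK₁, h2⟩⟩)
            · refine ⟨Or.inl ⟨?_, not_inPart_of_prefix h2⟩, Or.inl h2⟩
              exact (hv₂.prefix_mem h2 (Or.inr hq₂)).resolve_left (hv₁.ne_nil h1)
            · exact ⟨Or.inr ⟨h1, h2⟩, Or.inr ⟨K, by simp, h2⟩⟩
            · exact ⟨Or.inl ⟨h1, not_inPart_of_prefix h2⟩, Or.inl h2⟩
            · refine ⟨Or.inl ⟨h1, fun h => hK ?_⟩, Or.inr ⟨K₁, List.mem_cons_of_mem _ hK₁, h2⟩⟩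
              rw [h.component_eq h2]; exact hK₁
          · rintro ⟨⟨h1, h2⟩ | ⟨h1, h2⟩, h3⟩
            · refine Or.inr ⟨h1, h3.imp id fun ⟨K₁, hK₁, h⟩ => ⟨K₁, ?_, h⟩⟩
              rcases List.mem_cons.1 hK₁ with rfl | h'
              exacts [absurd h h2, h']
            · exact Or.inl ⟨h1, Or.inr h2⟩
        · rintro ⟨v, hv, hqv, ht⟩
          refine ⟨Q.restrictTree q K v, (hrK _).2 ⟨v, hv, hqv, rfl⟩,
            v.filter fun r => r <+: q ∨ ∃ K ∈ L, Q.InPart q K r,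
            (ih1 _).2 ⟨v, hv, hqv, by simp⟩, ?_⟩
          ext r
          rw [Finset.mem_union, mem_restrictTree, ht, Finset.mem_filter, ← and_or_left]
          refine and_congr_right fun _ => ?_
          constructor
          · rintro ((h | h) | (h | ⟨K₁, hK₁, h⟩))
            exacts [Or.inl h, Or.inr ⟨K, by simp, h⟩, Or.inl h,
              Or.inr ⟨K₁, List.mem_cons_of_mem _ hK₁, h⟩]
          · rintro (h | ⟨K₁, hK₁, h⟩)
            · exact Or.inl (Or.inl h)
            · rcases List.mem_cons.1 hK₁ with rfl | h'
              exacts [Or.inl (Or.inr h), Or.inr (Or.inr ⟨K₁, h', h⟩)]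
      -- Both parts can be read off from their union, because below `q` they lie in different
      -- components. So no combination is offered twice.
      · have hc : ∀ c ∈ (rec K).trees, ∀ d ∈ (Ordering.parList (Q.pathTree q) (L.map rec)).trees,
            (c ∪ d).filter (fun r => r <+: q ∨ Q.InPart q K r) = c ∧
            (c ∪ d).filter (fun r => r <+: q ∨ ∃ K ∈ L, Q.InPart q K r) = d := by
          intro c hc d hd
          obtain ⟨v₁, hv₁, hq₁, rfl⟩ := (hrK c).1 hc
          obtain ⟨v₂, hv₂, hq₂, hd⟩ := (ih1 d).1 hd
          have hpre : ∀ r, r <+: q → (r ∈ v₁ ↔ r ∈ v₂) := by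
            intro r h
            exact ⟨fun h' => (hv₂.prefix_mem h (Or.inr hq₂)).resolve_left (hv₁.ne_nil h'),
              fun h' => (hv₁.prefix_mem h (Or.inr hq₁)).resolve_left (hv₂.ne_nil h')⟩
          constructor
          · ext r
            simp only [Finset.mem_filter, Finset.mem_union, mem_restrictTree, hd]
            constructor
            · rintro ⟨⟨h1, h2⟩ | ⟨h1, h2⟩, h3⟩
              · exact ⟨h1, h2⟩
              · rcases h3 with h3 | h3
                · exact ⟨(hpre r h3).2 h1, Or.inl h3⟩
                · rcases h2 with h2 | ⟨K₁, hK₁, h2⟩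
                  · exact absurd h3 (not_inPart_of_prefix h2)
                  · rw [← h3.component_eq h2] at hK₁; exact absurd hK₁ hK
            · exact fun h => ⟨Or.inl h, h.2⟩
          · ext r
            simp only [Finset.mem_filter, Finset.mem_union, mem_restrictTree, hd]
            constructor
            · rintro ⟨⟨h1, h2⟩ | ⟨h1, h2⟩, h3⟩
              · rcases h3 with h3 | ⟨K₁, hK₁, h3⟩
                · exact ⟨(hpre r h3).1 h1, Or.inl h3⟩
                · rcases h2 with h2 | h2
                  · exact absurd h3 (not_inPart_of_prefix h2)
                  · rw [← h2.component_eq h3] at hK₁; exact absurd hK₁ hK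
              · exact ⟨h1, h2⟩
            · exact fun h => ⟨Or.inr h, h.2⟩
        rw [List.nodup_flatMap]
        constructor
        · intro c hcm
          refine (List.nodup_map_iff_inj_on ih2).2 fun d hd d' hd' h => ?_
          rw [← (hc c hcm d hd).2, h, (hc c hcm d' hd').2]
        · refine hrKn.pairwise_of_forall_ne fun c hcm c' hcm' hne => ?_
          intro t ht ht'
          obtain ⟨d, hd, rfl⟩ := List.mem_map.1 ht
          obtain ⟨d', hd', h⟩ := List.mem_map.1 ht'
          apply hne
          rw [← (hc c hcm d hd).1, ← h, (hc c' hcm' d' hd').1]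

/-- Fixing the label `S` of the component makes the choices in the components below `S` independent.
The four claims are proved together because the induction for runs needs to know which prefixes
occur in an alternative and which ones are in all of it. -/
theorem trees_nestedOrdering (n : ℕ) {p : Q.Path} {K : Set Q.Var}
    (hn : Q.numVars ≤ n + (Q.pathVars p).card) (hp : ∃ v, Q.IsCanonical v ∧ (p = [] ∨ p ∈ v))
    (hK : K ∈ Q.componentsBelow p) :
    (∀ t, t ∈ (Q.nestedOrdering n p K).trees ↔
      ∃ v, Q.IsCanonical v ∧ (p = [] ∨ p ∈ v) ∧ t = Q.restrictTree p K v) ∧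
    (Q.nestedOrdering n p K).trees.Nodup ∧
    (∀ q, q ≠ [] → q <+: p → (Q.nestedOrdering n p K).Full q) ∧
    ∀ q, (Q.nestedOrdering n p K).Running q := by
  classical
  induction n generalizing p K with
  | zero =>
    -- The depth bound suffices: at depth `0` all variables would be on the path, but `K` contains
    -- one that is not.
    exfalso
    obtain ⟨y, -, hy, -⟩ := mem_componentsBelow.1 hK
    have h : (Q.pathVars p).card < (Finset.univ : Finset Q.Var).card :=
      Finset.card_lt_card (Finset.ssubset_univ_iff.2 fun h => hy (by simp [h]))
    simp at h
    omega
  | succ n ih =>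
    obtain ⟨v₀, hv₀, hp₀⟩ := hp
    set part : Finset Q.Var → Q.Ordering := fun S =>
      Ordering.parList (Q.pathTree (p ++ [S])) ((Q.componentsBelow (p ++ [S])).toList.map
        (Q.nestedOrdering n (p ++ [S]))) with hpart
    have hne : (Q.labelSet p K).toList.map part ≠ [] := by
      obtain ⟨S, hS, hSK⟩ := hv₀.exists_child hp₀ hK
      have : S ∈ Q.labelSet p K := mem_labelSet.2 ⟨hSK, v₀, hv₀, hS⟩
      intro h
      rw [List.map_eq_nil_iff, Finset.toList_eq_nil] at h
      rw [h] at this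
      simp at this
    have hcard : ∀ S ∈ Q.labelSet p K, Q.numVars ≤ n + (Q.pathVars (p ++ [S])).card := by
      intro S hS
      obtain ⟨-, v, hv, hpv⟩ := mem_labelSet.1 hS
      have hl := hv.label p S hpv
      rw [pathVars_concat, Finset.card_union_of_disjoint
        (Finset.disjoint_right.2 fun x hx => hl.notMem x hx)]
      have := hl.nonempty.card_pos
      omega
    have hsub : ∀ S ∈ Q.labelSet p K, ∀ K' ∈ Q.componentsBelow (p ++ [S]), _ :=
      fun S hS K' hK' => ih (hcard S hS)
        (by obtain ⟨-, v, hv, hpv⟩ := mem_labelSet.1 hS; exact ⟨v, hv, Or.inr hpv⟩) hK'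
    have hpt := fun S (hS : S ∈ Q.labelSet p K) => trees_parList (q := p ++ [S])
      (mem_labelSet.1 hS).2 (Q.nestedOrdering n (p ++ [S]))
      (l := (Q.componentsBelow (p ++ [S])).toList) (Finset.nodup_toList _) (fun K' hK' => by
        obtain ⟨h1, h2, -⟩ := hsub S hS K' (by simpa using hK')
        exact ⟨fun t => by rw [h1]; simp, h2⟩)
    -- The alternative for `S` offers exactly the parts of those trees that continue `p` with `S`.
    have htS : ∀ S ∈ Q.labelSet p K, ∀ t, t ∈ (part S).trees ↔
        ∃ v, Q.IsCanonical v ∧ p ++ [S] ∈ v ∧ t = Q.restrictTree p K v := by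
      intro S hS t
      rw [(hpt S hS).1 t]
      refine exists_congr fun v => and_congr_right fun hv => and_congr_right fun hSv => ?_
      obtain ⟨hSK, -⟩ := mem_labelSet.1 hS
      rw [Finset.ext_iff]
      refine forall_congr' fun r => ?_
      rw [mem_restrictTree]
      have : r ∈ v → ((r <+: p ++ [S] ∨ ∃ K' ∈ (Q.componentsBelow (p ++ [S])).toList,
          Q.InPart (p ++ [S]) K' r) ↔ (r <+: p ∨ Q.InPart p K r)) := by
        intro hr
        constructor
        · rintro (h | ⟨K', -, h⟩)
          · rcases List.prefix_concat_iff.1 h with rfl | h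
            · exact Or.inr ⟨S, [], rfl, hSK⟩
            · exact Or.inl h
          · obtain ⟨T, hT, -⟩ := h.exists_prefix
            right
            rw [← hSK]
            exact inPart_of_prefix ((List.prefix_append _ _).trans hT)
        · rintro (h | h)
          · exact Or.inl (h.trans (List.prefix_append _ _))
          · obtain ⟨T, t, rfl, hT⟩ := h
            have hTm : p ++ [T] ∈ v :=
              (hv.prefix_mem ⟨t, by simp⟩ (Or.inr hr)).resolve_left (by simp)
            obtain rfl := hv.child_unique hTm hSv (hT.trans hSK.symm)
            cases t with
            | nil => exact Or.inl List.prefix_rfl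
            | cons U t =>
              have hU : (p ++ [T]) ++ [U] <+: p ++ T :: U :: t := ⟨t, by simp⟩
              have hUm := (hv.prefix_mem hU (Or.inr hr)).resolve_left (by simp)
              exact Or.inr ⟨_, by simpa using hv.component_mem hUm, inPart_of_prefix hU⟩
      constructor
      · intro h; rw [h]; exact and_congr_right this
      · intro h; rw [h]; exact and_congr_right fun hr => (this hr).symm
    have hfull : ∀ S ∈ Q.labelSet p K, ∀ q, q ≠ [] → q <+: p ++ [S] → (part S).Full q := by
      intro S hS q hq hqp
      refine Ordering.full_parList (mem_pathTree.2 ⟨hqp, hq⟩) fun a ha => ?_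
      obtain ⟨K', hK', rfl⟩ := List.mem_map.1 ha
      exact (hsub S hS K' (by simpa using hK')).2.2.1 q hq hqp
    have hocc : ∀ S ∈ Q.labelSet p K, ∀ q, (part S).Occurs q → q ≠ [] ∧ (q <+: p ∨ p ++ [S] <+: q) := by
      intro S hS q hq
      obtain ⟨t, ht, hqt⟩ := Ordering.occurs_iff.1 hq
      obtain ⟨v, hv, hSv, h⟩ := ((hpt S hS).1 t).1 ht
      obtain ⟨hqv, h'⟩ := (h q).1 hqt
      refine ⟨hv.ne_nil hqv, ?_⟩
      rcases h' with h' | ⟨K', -, h'⟩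
      · rcases List.prefix_concat_iff.1 h' with rfl | h'
        exacts [Or.inr List.prefix_rfl, Or.inl h']
      · obtain ⟨T, hT, -⟩ := h'.exists_prefix
        exact Or.inr ((List.prefix_append _ _).trans hT)
    have hinj : ∀ S T q, p ++ [S] <+: q → p ++ [T] <+: q → S = T := by
      intro S T q h h'
      have := (List.prefix_of_prefix_length_le h h' (by simp)).eq_of_length (by simp)
      simpa using this
    have hroot : ∀ S ∈ Q.labelSet p K, ∀ t ∈ (part S).trees, ∀ T, p ++ [T] ∈ t → T = S := by
      intro S hS t ht T hT
      have := (hocc S hS (p ++ [T]) (Ordering.occurs_iff.2 ⟨t, ht, hT⟩)).2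
      rcases this with h | h
      · have := h.length_le
        simp at this
      · exact hinj T S _ List.prefix_rfl h
    have hroot' : ∀ S ∈ Q.labelSet p K, ∀ t ∈ (part S).trees, p ++ [S] ∈ t := by
      intro S hS t ht
      obtain ⟨v, hv, hSv, h⟩ := ((hpt S hS).1 t).1 ht
      exact (h _).2 ⟨hSv, Or.inl List.prefix_rfl⟩
    refine ⟨fun t => ?_, ?_, ?_, ?_⟩
    · rw [nestedOrdering, Ordering.trees_seqList hne]
      simp only [List.mem_flatMap, List.mem_map]
      constructor
      · rintro ⟨_, ⟨S, hS, rfl⟩, ht⟩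
        obtain ⟨v, hv, hSv, rfl⟩ := (htS S (by simpa using hS) t).1 ht
        exact ⟨v, hv, hv.parent p S hSv, rfl⟩
      · rintro ⟨v, hv, hpv, rfl⟩
        obtain ⟨S, hS, hSK⟩ := hv.exists_child hpv hK
        have : S ∈ Q.labelSet p K := mem_labelSet.2 ⟨hSK, v, hv, hS⟩
        exact ⟨_, ⟨S, by simpa using this, rfl⟩, (htS S this _).2 ⟨v, hv, hS, rfl⟩⟩
    · rw [nestedOrdering, Ordering.trees_seqList hne, List.flatMap_map, List.nodup_flatMap]
      refine ⟨fun S hS => (hpt S (by simpa using hS)).2, ?_⟩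
      refine (Finset.nodup_toList _).pairwise_of_forall_ne fun S hS T hT hne => ?_
      intro t ht ht'
      exact hne (hroot T (by simpa using hT) t ht' S (hroot' S (by simpa using hS) t ht))
    · intro q hq hqp
      refine Ordering.full_seqList hne fun a ha => ?_
      obtain ⟨S, hS, rfl⟩ := List.mem_map.1 ha
      exact hfull S (by simpa using hS) q hq (hqp.trans (List.prefix_append _ _))
    · intro q
      -- Prefixes of `p` are common to all leaves. Any other prefix that occurs starts with some `p
      -- ++ [S]`, so it occurs in one alternative only, and strictly below `S` in one component
      -- only.
      by_cases hq : q ≠ [] ∧ q <+: p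
      · refine Ordering.Full.running (Ordering.full_seqList hne fun a ha => ?_)
        obtain ⟨S, hS, rfl⟩ := List.mem_map.1 ha
        exact hfull S (by simpa using hS) q hq.1 (hq.2.trans (List.prefix_append _ _))
      · refine Ordering.running_seqList (fun a ha => ?_) ?_
        · obtain ⟨S, hS, rfl⟩ := List.mem_map.1 ha
          have hS : S ∈ Q.labelSet p K := by simpa using hS
          by_cases hq' : q ≠ [] ∧ q <+: p ++ [S]
          · exact (hfull S hS q hq'.1 hq'.2).running
          · refine Ordering.running_parList (fun b hb => ?_)
              (fun h => hq' (mem_pathTree.1 h).symm) ?_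
            · obtain ⟨K', hK', rfl⟩ := List.mem_map.1 hb
              exact (hsub S hS K' (by simpa using hK')).2.2.2 q
            · rw [List.pairwise_map]
              refine (Finset.nodup_toList _).pairwise_of_forall_ne fun K₁ h₁ K₂ h₂ hne h h' => hne ?_
              have key : ∀ K' ∈ (Q.componentsBelow (p ++ [S])).toList,
                  (Q.nestedOrdering n (p ++ [S]) K').Occurs q → Q.InPart (p ++ [S]) K' q := by
                intro K' hK' h
                obtain ⟨t, ht, hqt⟩ := Ordering.occurs_iff.1 h
                obtain ⟨v, hv, hv', rfl⟩ := ((hsub S hS K' (by simpa using hK')).1 t).1 ht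
                rw [mem_restrictTree] at hqt
                exact hqt.2.resolve_left fun h => hq' ⟨hv.ne_nil hqt.1, h⟩
              exact (key K₁ h₁ h).component_eq (key K₂ h₂ h')
        · rw [List.pairwise_map]
          refine (Finset.nodup_toList _).pairwise_of_forall_ne fun S hS T hT hne h h' => hne ?_
          obtain ⟨h1, h2⟩ := hocc S (by simpa using hS) q h
          obtain ⟨-, h3⟩ := hocc T (by simpa using hT) q h'
          exact hinj S T q (h2.resolve_left fun h => hq ⟨h1, h⟩)
            (h3.resolve_left fun h => hq ⟨h1, h⟩)

theorem exists_isRunningPrefixes (hQ : Q.Connected) (hvar : 0 < Q.numVars) :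
    ∃ Ω : Q.Ordering, Ω.IsRunningPrefixes := by
  have hK : Set.univ ∈ Q.componentsBelow [] := mem_componentsBelow.2 ⟨⟨0, hvar⟩, by simp, by simp,
    by ext z; simpa using hQ.conn _ z⟩
  obtain ⟨h1, h2, -, h4⟩ := trees_nestedOrdering (Q := Q) Q.numVars (p := []) (K := Set.univ)
    (by simp) ⟨_, isCanonical_strategyTree (isStrategy_preferring fun _ => ∅), Or.inl rfl⟩ hK
  refine ⟨Q.nestedOrdering Q.numVars [] Set.univ, ?_, ?_, h4⟩
  · rw [Ordering.map_snd_choices]; exact h2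
  · intro v
    rw [Ordering.map_snd_choices, h1, mem_mveo_iff hQ hvar]
    -- By connectedness the root eliminates the single component of all variables, so the part below
    -- the empty path is the whole tree.
    have hres : ∀ v, Q.IsCanonical v → Q.restrictTree [] Set.univ v = v := by
      intro v hv
      ext r
      rw [mem_restrictTree, and_iff_left_iff_imp]
      intro hr
      cases r with
      | nil => exact Or.inl List.prefix_rfl
      | cons S t =>
        have hS : [] ++ [S] ∈ v :=
          (hv.prefix_mem ⟨t, by simp⟩ (Or.inr hr)).resolve_left (by simp)
        obtain ⟨s, hs⟩ := (hv.label [] S hS).nonempty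
        refine Or.inr ⟨S, t, rfl, Set.eq_univ_of_forall fun z => ⟨s, hs, hQ.conn s z⟩⟩
    constructor
    · rintro ⟨w, hw, -, rfl⟩
      rw [hres w hw]; exact hw
    · exact fun hv => ⟨v, hv, Or.inl rfl, (hres v hv).symm⟩

end CQ

/-! ## Choices of an ordering and their sides -/

namespace CQ

namespace Ordering

variable {Q : CQ}

/-- The choices that an ordering offers. -/
inductive Choice {Q : CQ} : Q.Ordering → Type
  | single (v : Q.Tree) : Choice (single v)
  | inl {a b : Q.Ordering} (x : Choice a) : Choice (seq a b)
  | inr {a b : Q.Ordering} (x : Choice b) : Choice (seq a b)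
  | pair {a b : Q.Ordering} (x : Choice a) (y : Choice b) : Choice (par a b)

namespace Choice

/-- The tree that is chosen. -/
def tree : {Ω : Q.Ordering} → Choice Ω → Q.Tree
  | _, single v => v
  | _, inl x => x.tree
  | _, inr x => x.tree
  | _, pair x y => x.tree ∪ y.tree

/-- The leaves that are chosen. -/
def leafSet : {Ω : Q.Ordering} → Choice Ω → List Bool → Finset (List Bool)
  | _, single _, α => {α}
  | _, inl x, α => x.leafSet (false :: α)
  | _, inr x, α => x.leafSet (true :: α)
  | _, pair x y, α => x.leafSet (false :: α) ∪ y.leafSet (true :: α)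

/-- The addresses of the connectors before the chosen leaves. -/
def side : {Ω : Q.Ordering} → Choice Ω → List Bool → List Bool → Prop
  | _, single _, _, _ => False
  -- A choice on the left puts the middle connector and all of the right alternative behind it. A
  -- choice on the right puts the middle connector and all of the left alternative before it.
  | _, inl x, α, β => false :: α <:+ β ∧ x.side (false :: α) β
  | _, inr x, α, β => β = α ∨ false :: α <:+ β ∨ true :: α <:+ β ∧ x.side (true :: α) β
  | _, pair x y, α, β => false :: α <:+ β ∧ x.side (false :: α) β ∨
      true :: α <:+ β ∧ y.side (true :: α) β

end Choice

theorem mem_choices {Ω : Q.Ordering} {α : List Bool} {c : Finset (List Bool) × Q.Tree} :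
    c ∈ Ω.choices α ↔ ∃ x : Choice Ω, c = (x.leafSet α, x.tree) := by
  induction Ω generalizing α c with
  | single v =>
    simp only [choices, List.mem_singleton]
    exact ⟨fun h => ⟨.single v, h⟩, fun ⟨x, h⟩ => by cases x; exact h⟩
  | seq a b iha ihb =>
    simp only [choices, List.mem_append, iha, ihb]
    constructor
    · rintro (⟨x, h⟩ | ⟨x, h⟩)
      exacts [⟨.inl x, h⟩, ⟨.inr x, h⟩]
    · rintro ⟨x, h⟩
      cases x with
      | inl x => exact Or.inl ⟨x, h⟩
      | inr x => exact Or.inr ⟨x, h⟩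
  | par a b iha ihb =>
    simp only [choices, List.mem_flatMap, List.mem_map, iha, ihb]
    constructor
    · rintro ⟨_, ⟨x, rfl⟩, _, ⟨y, rfl⟩, rfl⟩
      exact ⟨.pair x y, rfl⟩
    · rintro ⟨x, h⟩
      cases x with
      | pair x y => exact ⟨_, ⟨x, rfl⟩, _, ⟨y, rfl⟩, h.symm⟩

theorem mem_trees {Ω : Q.Ordering} {t : Q.Tree} : t ∈ Ω.trees ↔ ∃ x : Choice Ω, x.tree = t := by
  rw [← map_snd_choices Ω [], List.mem_map]
  constructor
  · rintro ⟨c, hc, rfl⟩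
    obtain ⟨x, rfl⟩ := mem_choices.1 hc
    exact ⟨x, rfl⟩
  · rintro ⟨x, rfl⟩
    exact ⟨_, mem_choices.2 ⟨x, rfl⟩, rfl⟩

theorem occurs_iff_choice {Ω : Q.Ordering} {p : Q.Path} :
    Ω.Occurs p ↔ ∃ x : Choice Ω, p ∈ x.tree := by
  rw [occurs_iff]
  constructor
  · rintro ⟨t, ht, hp⟩
    obtain ⟨x, rfl⟩ := mem_trees.1 ht
    exact ⟨x, hp⟩
  · rintro ⟨x, hp⟩
    exact ⟨_, mem_trees.2 ⟨x, rfl⟩, hp⟩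

theorem nonempty_choice (Ω : Q.Ordering) : Nonempty (Choice Ω) :=
  let ⟨_, ht⟩ := exists_mem_trees Ω; let ⟨x, _⟩ := mem_trees.1 ht; ⟨x⟩

theorem Full.mem_tree {p : Q.Path} {Ω : Q.Ordering} (h : Ω.Full p) (x : Choice Ω) :
    p ∈ x.tree := by
  induction x with
  | single v => exact h
  | inl x ih => exact ih h.1
  | inr x ih => exact ih h.2
  | pair x y ih _ => exact Finset.mem_union_left _ (ih h.1)

theorem span_eq_none_iff {p : Q.Path} {Ω : Q.Ordering} {α : List Bool} {l r : Pos} :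
    Ω.span p α l r = none ↔ ¬ Ω.Occurs p := by
  induction Ω generalizing α l r with
  | single v => simp [span, Occurs]
  | seq a b iha ihb =>
    simp only [span, Occurs, not_or, ← iha (α := false :: α) (l := l) (r := .mid α),
      ← ihb (α := true :: α) (l := .mid α) (r := r)]
    split <;> simp_all
  | par a b iha ihb =>
    simp only [span, Occurs, not_or, ← iha (α := false :: α) (l := l) (r := r),
      ← ihb (α := true :: α) (l := l) (r := r)]
    split <;> simp_all

theorem occurs_of_span {p : Q.Path} {Ω : Q.Ordering} {α : List Bool} {l r : Pos} {s : Pos × Pos}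
    (h : Ω.span p α l r = some s) : Ω.Occurs p := by
  by_contra h'
  rw [span_eq_none_iff.2 h'] at h
  simp at h

theorem exists_span {p : Q.Path} {Ω : Q.Ordering} (h : Ω.Occurs p) (α : List Bool) (l r : Pos) :
    ∃ s t, Ω.span p α l r = some (s, t) := by
  cases hs : Ω.span p α l r with
  | none => exact absurd h (span_eq_none_iff.1 hs)
  | some s => exact ⟨s.1, s.2, rfl⟩

theorem span_seq_left {p : Q.Path} {a b : Q.Ordering} (h : ¬ b.Occurs p) (α : List Bool)
    (l r : Pos) : (seq a b).span p α l r = a.span p (false :: α) l (.mid α) := by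
  rw [span, span_eq_none_iff.2 h]
  split <;> simp_all

theorem span_seq_right {p : Q.Path} {a b : Q.Ordering} (h : ¬ a.Occurs p) (α : List Bool)
    (l r : Pos) : (seq a b).span p α l r = b.span p (true :: α) (.mid α) r := by
  rw [span, span_eq_none_iff.2 h]

theorem span_seq_both {p : Q.Path} {a b : Q.Ordering} {α : List Bool} {l r s t s' t' : Pos}
    (ha : a.span p (false :: α) l (.mid α) = some (s, t))
    (hb : b.span p (true :: α) (.mid α) r = some (s', t')) :
    (seq a b).span p α l r = some (s, t') := by
  rw [span, ha, hb]

theorem span_par_left {p : Q.Path} {a b : Q.Ordering} (h : ¬ b.Occurs p) (α : List Bool)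
    (l r : Pos) : (par a b).span p α l r = a.span p (false :: α) l r := by
  rw [span, span_eq_none_iff.2 h]
  split <;> simp_all

theorem span_par_right {p : Q.Path} {a b : Q.Ordering} (h : ¬ a.Occurs p) (α : List Bool)
    (l r : Pos) : (par a b).span p α l r = b.span p (true :: α) l r := by
  rw [span, span_eq_none_iff.2 h]

theorem span_par_both {p : Q.Path} {a b : Q.Ordering} (ha : a.Occurs p) (hb : b.Occurs p)
    (α : List Bool) (l r : Pos) : (par a b).span p α l r = some (l, r) := by
  obtain ⟨s, t, h⟩ := exists_span ha (false :: α) l r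
  obtain ⟨s', t', h'⟩ := exists_span hb (true :: α) l r
  rw [span, h, h']

theorem Full.span {p : Q.Path} {Ω : Q.Ordering} (h : Ω.Full p) (α : List Bool) (l r : Pos) :
    Ω.span p α l r = some (l, r) := by
  induction Ω generalizing α l r with
  | single v => simp only [Ordering.span]; exact if_pos h
  | seq a b iha ihb => exact span_seq_both (iha h.1 _ _ _) (ihb h.2 _ _ _)
  | par a b iha ihb => exact span_par_both h.1.occurs h.2.occurs _ _ _

/-- A connector that belongs to the expression at `α` or to its ends. -/
def Within (α : List Bool) (l r s : Pos) : Prop := s = l ∨ s = r ∨ ∃ β, α <:+ β ∧ s = .mid β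

theorem within_cons {α : List Bool} {b : Bool} {l r l' r' s : Pos} (hl : Within α l r l')
    (hr : Within α l r r') (h : Within (b :: α) l' r' s) : Within α l r s := by
  rcases h with rfl | rfl | ⟨β, h, rfl⟩
  · exact hl
  · exact hr
  · exact Or.inr (Or.inr ⟨β, (List.suffix_cons b α).trans h, rfl⟩)

theorem within_mid (α : List Bool) (l r : Pos) : Within α l r (.mid α) :=
  Or.inr (Or.inr ⟨α, List.suffix_rfl, rfl⟩)

theorem within_leaves {Ω : Q.Ordering} {α β : List Bool} {l r s t : Pos}
    (h : (β, s, t) ∈ Ω.leaves α l r) : Within α l r s ∧ Within α l r t := by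
  induction Ω generalizing α l r with
  | single v =>
    simp only [leaves, List.mem_singleton, Prod.mk.injEq] at h
    exact ⟨Or.inl h.2.1, Or.inr (Or.inl h.2.2)⟩
  | seq a b iha ihb =>
    rcases List.mem_append.1 h with h | h
    · exact (iha h).imp (within_cons (Or.inl rfl) (within_mid α l r))
        (within_cons (Or.inl rfl) (within_mid α l r))
    · exact (ihb h).imp (within_cons (within_mid α l r) (Or.inr (Or.inl rfl)))
        (within_cons (within_mid α l r) (Or.inr (Or.inl rfl)))
  | par a b iha ihb =>
    rcases List.mem_append.1 h with h | h
    · exact (iha h).imp (within_cons (Or.inl rfl) (Or.inr (Or.inl rfl)))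
        (within_cons (Or.inl rfl) (Or.inr (Or.inl rfl)))
    · exact (ihb h).imp (within_cons (Or.inl rfl) (Or.inr (Or.inl rfl)))
        (within_cons (Or.inl rfl) (Or.inr (Or.inl rfl)))

theorem within_span {p : Q.Path} {Ω : Q.Ordering} {α : List Bool} {l r s t : Pos}
    (h : Ω.span p α l r = some (s, t)) : Within α l r s ∧ Within α l r t := by
  induction Ω generalizing α l r s t with
  | single v =>
    simp only [span] at h
    split_ifs at h
    simp only [Option.some.injEq, Prod.mk.injEq] at h
    exact ⟨Or.inl h.1.symm, Or.inr (Or.inl h.2.symm)⟩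
  | seq a b iha ihb =>
    have ca : ∀ {s}, Within (false :: α) l (.mid α) s → Within α l r s :=
      within_cons (Or.inl rfl) (within_mid α l r)
    have cb : ∀ {s}, Within (true :: α) (.mid α) r s → Within α l r s :=
      within_cons (within_mid α l r) (Or.inr (Or.inl rfl))
    by_cases ha : a.Occurs p
    · by_cases hb : b.Occurs p
      · obtain ⟨s₁, t₁, h₁⟩ := exists_span ha (false :: α) l (.mid α)
        obtain ⟨s₂, t₂, h₂⟩ := exists_span hb (true :: α) (.mid α) r
        rw [span_seq_both h₁ h₂] at h
        simp only [Option.some.injEq, Prod.mk.injEq] at h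
        obtain ⟨rfl, rfl⟩ := h
        exact ⟨ca (iha h₁).1, cb (ihb h₂).2⟩
      · rw [span_seq_left hb] at h
        exact (iha h).imp ca ca
    · rw [span_seq_right ha] at h
      exact (ihb h).imp cb cb
  | par a b iha ihb =>
    have ca : ∀ {c s}, Within (c :: α) l r s → Within α l r s :=
      within_cons (Or.inl rfl) (Or.inr (Or.inl rfl))
    by_cases ha : a.Occurs p
    · by_cases hb : b.Occurs p
      · rw [span_par_both ha hb] at h
        simp only [Option.some.injEq, Prod.mk.injEq] at h
        exact ⟨Or.inl h.1.symm, Or.inr (Or.inl h.2.symm)⟩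
      · rw [span_par_left hb] at h
        exact (iha h).imp ca ca
    · rw [span_par_right ha] at h
      exact (ihb h).imp ca ca

/-- Addresses grow at the front, so the addresses inside of the expression at `α` are those with
suffix `α`. The two parts of an expression have no address in common. -/
theorem suffix_ne {α β : List Bool} (h : false :: α <:+ β) (h' : true :: α <:+ β) : False := by
  have := (List.suffix_of_suffix_length_le h h' (by simp)).eq_of_length (by simp)
  simp at this

theorem not_cons_suffix {α : List Bool} {b : Bool} (h : b :: α <:+ α) : False := by
  have := h.length_le
  simp at this

theorem Final.span {p : Q.Path} {Ω : Q.Ordering} (h : Ω.Final p) (α : List Bool) (l r : Pos) :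
    ∃ s, Ω.span p α l r = some (s, r) := by
  induction Ω generalizing α l r with
  | single v => exact ⟨l, Full.span (Ω := .single v) h α l r⟩
  | seq a b iha ihb =>
    rcases h with ⟨ha, hb⟩ | ⟨ha, hb⟩
    · obtain ⟨s, hs⟩ := iha ha (false :: α) l (.mid α)
      exact ⟨s, span_seq_both hs (hb.span _ _ _)⟩
    · rw [span_seq_right ha]
      exact ihb hb _ _ _
  | par a b _ _ => exact ⟨l, Full.span (Ω := .par a b) h α l r⟩

theorem Initial.span {p : Q.Path} {Ω : Q.Ordering} (h : Ω.Initial p) (α : List Bool) (l r : Pos) :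
    ∃ t, Ω.span p α l r = some (l, t) := by
  induction Ω generalizing α l r with
  | single v => exact ⟨r, Full.span (Ω := .single v) h α l r⟩
  | seq a b iha ihb =>
    rcases h with ⟨ha, hb⟩ | ⟨ha, hb⟩
    · obtain ⟨t, ht⟩ := ihb hb (true :: α) (.mid α) r
      exact ⟨t, span_seq_both (ha.span _ _ _) ht⟩
    · rw [span_seq_left hb]
      exact iha ha _ _ _
  | par a b _ _ => exact ⟨r, Full.span (Ω := .par a b) h α l r⟩

/-! ### The two sides of a choice and the prefixes between choices. -/

/-- `B` is the set of the connectors before the choice `x`. -/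
structure Before {Ω : Q.Ordering} (x : Choice Ω) (α : List Bool) (l r : Pos) (B : Pos → Prop) :
    Prop where
  left : B l
  right : ¬ B r
  mid : ∀ β, α <:+ β → (B (.mid β) ↔ x.side α β)

namespace Before

variable {a b : Q.Ordering} {α : List Bool} {l r : Pos} {B : Pos → Prop}

theorem inl {x : Choice a} (h : Before (.inl x : Choice (seq a b)) α l r B) :
    Before x (false :: α) l (.mid α) B ∧ ∀ s, Within (true :: α) (.mid α) r s → ¬ B s := by
  have hm : ¬ B (.mid α) := by
    rw [h.mid α List.suffix_rfl]
    exact fun h' => not_cons_suffix h'.1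
  refine ⟨⟨h.left, hm, fun β hβ => ?_⟩, ?_⟩
  · rw [h.mid β ((List.suffix_cons _ _).trans hβ)]
    simp [Choice.side, hβ]
  · rintro s (rfl | rfl | ⟨β, hβ, rfl⟩)
    · exact hm
    · exact h.right
    · rw [h.mid β ((List.suffix_cons _ _).trans hβ)]
      exact fun h' => suffix_ne h'.1 hβ

theorem inr {x : Choice b} (h : Before (.inr x : Choice (seq a b)) α l r B) :
    Before x (true :: α) (.mid α) r B ∧ ∀ s, Within (false :: α) l (.mid α) s → B s := by
  have hm : B (.mid α) := by
    rw [h.mid α List.suffix_rfl]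
    exact Or.inl rfl
  refine ⟨⟨hm, h.right, fun β hβ => ?_⟩, ?_⟩
  · rw [h.mid β ((List.suffix_cons _ _).trans hβ)]
    have h1 : β ≠ α := by rintro rfl; exact not_cons_suffix hβ
    have h2 : ¬ false :: α <:+ β := fun h' => suffix_ne h' hβ
    simp [Choice.side, hβ, h1, h2]
  · rintro s (rfl | rfl | ⟨β, hβ, rfl⟩)
    · exact h.left
    · exact hm
    · rw [h.mid β ((List.suffix_cons _ _).trans hβ)]
      exact Or.inr (Or.inl hβ)

theorem pair {x : Choice a} {y : Choice b} (h : Before (.pair x y : Choice (par a b)) α l r B) :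
    Before x (false :: α) l r B ∧ Before y (true :: α) l r B := by
  refine ⟨⟨h.left, h.right, fun β hβ => ?_⟩, ⟨h.left, h.right, fun β hβ => ?_⟩⟩
  · rw [h.mid β ((List.suffix_cons _ _).trans hβ)]
    have h2 : ¬ true :: α <:+ β := fun h' => suffix_ne hβ h'
    simp [Choice.side, hβ, h2]
  · rw [h.mid β ((List.suffix_cons _ _).trans hβ)]
    have h2 : ¬ false :: α <:+ β := fun h' => suffix_ne h' hβ
    simp [Choice.side, hβ, h2]

end Before

/-- Only the chosen leaves lead from one side of a choice to the other. -/
theorem Before.mem_leafSet {Ω : Q.Ordering} {x : Choice Ω} {α β : List Bool} {l r s t : Pos}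
    {B : Pos → Prop} (hB : Before x α l r B) (h : (β, s, t) ∈ Ω.leaves α l r) (hs : B s)
    (ht : ¬ B t) : β ∈ x.leafSet α := by
  induction x generalizing α l r with
  | single v =>
    simp only [leaves, List.mem_singleton, Prod.mk.injEq] at h
    simp [Choice.leafSet, h.1]
  | inl x ih =>
    rcases List.mem_append.1 h with h | h
    · exact ih hB.inl.1 h
    · exact absurd hs (hB.inl.2 s (within_leaves h).1)
  | inr x ih =>
    rcases List.mem_append.1 h with h | h
    · exact absurd (hB.inr.2 t (within_leaves h).2) ht
    · exact ih hB.inr.1 h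
  | pair x y ihx ihy =>
    rcases List.mem_append.1 h with h | h
    · exact Finset.mem_union_left _ (ihx hB.pair.1 h)
    · exact Finset.mem_union_right _ (ihy hB.pair.2 h)

/-- Only the prefixes of the chosen tree lead from one side of a choice to the other. -/
theorem Before.mem_tree {Ω : Q.Ordering} {x : Choice Ω} {α : List Bool} {l r s t : Pos}
    {B : Pos → Prop} (hB : Before x α l r B) {p : Q.Path} (hp : Ω.Running p)
    (h : Ω.span p α l r = some (s, t)) (hs : B s) (ht : ¬ B t) : p ∈ x.tree := by
  induction x generalizing α l r s t with
  | single v => exact occurs_of_span h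
  | @inl a b x ih =>
    by_cases ha : a.Occurs p
    · by_cases hb : b.Occurs p
      · obtain ⟨s₁, h₁⟩ := (hp.2.2 ha hb).1.span (false :: α) l (.mid α)
        obtain ⟨t₂, h₂⟩ := (hp.2.2 ha hb).2.span (true :: α) (.mid α) r
        rw [span_seq_both h₁ h₂] at h
        simp only [Option.some.injEq, Prod.mk.injEq] at h
        exact ih hB.inl.1 hp.1 h₁ (h.1 ▸ hs) hB.inl.1.right
      · rw [span_seq_left hb] at h
        exact ih hB.inl.1 hp.1 h hs ht
    · rw [span_seq_right ha] at h
      exact absurd hs (hB.inl.2 s (within_span h).1)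
  | @inr a b x ih =>
    by_cases hb : b.Occurs p
    · by_cases ha : a.Occurs p
      · obtain ⟨s₁, h₁⟩ := (hp.2.2 ha hb).1.span (false :: α) l (.mid α)
        obtain ⟨t₂, h₂⟩ := (hp.2.2 ha hb).2.span (true :: α) (.mid α) r
        rw [span_seq_both h₁ h₂] at h
        simp only [Option.some.injEq, Prod.mk.injEq] at h
        exact ih hB.inr.1 hp.2.1 h₂ hB.inr.1.left (h.2 ▸ ht)
      · rw [span_seq_right ha] at h
        exact ih hB.inr.1 hp.2.1 h hs ht
    · rw [span_seq_left hb] at h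
      exact absurd (hB.inr.2 t (within_span h).2) ht
  | @pair a b x y ihx ihy =>
    by_cases ha : a.Occurs p
    · by_cases hb : b.Occurs p
      · exact (Full.mem_tree (Ω := .par a b) (hp.2.2 ha hb) (.pair x y))
      · rw [span_par_left hb] at h
        exact Finset.mem_union_left _ (ihx hB.pair.1 hp.1 h hs ht)
    · rw [span_par_right ha] at h
      exact Finset.mem_union_right _ (ihy hB.pair.2 hp.2.1 h hs ht)

/-- The prefix `q` reaches from `x` to the end of the ordering, and the span of `p` starts behind
`x`. So `p` occurs where `q` is present, and a common choice exists there. -/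
theorem Before.exists_of_final {Ω : Q.Ordering} {x : Choice Ω} {α : List Bool} {l r s t : Pos}
    {B : Pos → Prop} (hB : Before x α l r B) {p q : Q.Path} (h : Ω.span p α l r = some (s, t))
    (hs : ¬ B s) (hq : q ∈ x.tree) (hq' : Ω.Final q) :
    ∃ y : Choice Ω, p ∈ y.tree ∧ q ∈ y.tree := by
  have hfull : ∀ {Ω : Q.Ordering}, Ω.Full q → Ω.Occurs p → ∃ y : Choice Ω, p ∈ y.tree ∧ q ∈ y.tree :=
    fun hf ho => (occurs_iff_choice.1 ho).imp fun y hy => ⟨hy, hf.mem_tree y⟩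
  induction x generalizing α l r s t with
  | single v => exact hfull hq' (occurs_of_span h)
  | @inl a b x ih =>
    obtain ⟨hqa, hqb⟩ : a.Final q ∧ b.Full q :=
      hq'.resolve_right fun h' => h'.1 (occurs_iff_choice.2 ⟨x, hq⟩)
    by_cases ha : a.Occurs p
    · obtain ⟨s₁, t₁, h₁⟩ := exists_span ha (false :: α) l (.mid α)
      have hs₁ : s = s₁ := by
        by_cases hb : b.Occurs p
        · obtain ⟨s₂, t₂, h₂⟩ := exists_span hb (true :: α) (.mid α) r
          rw [span_seq_both h₁ h₂] at h
          simp only [Option.some.injEq, Prod.mk.injEq] at h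
          exact h.1.symm
        · rw [span_seq_left hb, h₁] at h
          simp only [Option.some.injEq, Prod.mk.injEq] at h
          exact h.1.symm
      subst hs₁
      obtain ⟨y, hy⟩ := ih hB.inl.1 h₁ hs hq hqa
      exact ⟨.inl y, hy⟩
    · obtain ⟨y, hy⟩ := hfull hqb ((occurs_of_span h).resolve_left ha)
      exact ⟨.inr y, hy⟩
  | @inr a b x ih =>
    have hqb : b.Final q := by
      rcases hq' with h' | h'
      exacts [h'.2.final, h'.2]
    by_cases ha : a.Occurs p
    · obtain ⟨s₁, t₁, h₁⟩ := exists_span ha (false :: α) l (.mid α)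
      have hs₁ : s = s₁ := by
        by_cases hb : b.Occurs p
        · obtain ⟨s₂, t₂, h₂⟩ := exists_span hb (true :: α) (.mid α) r
          rw [span_seq_both h₁ h₂] at h
          simp only [Option.some.injEq, Prod.mk.injEq] at h
          exact h.1.symm
        · rw [span_seq_left hb, h₁] at h
          simp only [Option.some.injEq, Prod.mk.injEq] at h
          exact h.1.symm
      subst hs₁
      exact absurd (hB.inr.2 s (within_span h₁).1) hs
    · rw [span_seq_right ha] at h
      obtain ⟨y, hy⟩ := ih hB.inr.1 h hs hq hqb
      exact ⟨.inr y, hy⟩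
  | pair x y _ _ => exact hfull hq' (occurs_of_span h)

/-- The mirror image of `Before.exists_of_final`: `q` reaches from the start of the ordering to `x`,
and the span of `p` ends before `x`. -/
theorem Before.exists_of_initial {Ω : Q.Ordering} {x : Choice Ω} {α : List Bool} {l r s t : Pos}
    {B : Pos → Prop} (hB : Before x α l r B) {p q : Q.Path} (h : Ω.span p α l r = some (s, t))
    (ht : B t) (hq : q ∈ x.tree) (hq' : Ω.Initial q) :
    ∃ y : Choice Ω, p ∈ y.tree ∧ q ∈ y.tree := by
  have hfull : ∀ {Ω : Q.Ordering}, Ω.Full q → Ω.Occurs p → ∃ y : Choice Ω, p ∈ y.tree ∧ q ∈ y.tree :=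
    fun hf ho => (occurs_iff_choice.1 ho).imp fun y hy => ⟨hy, hf.mem_tree y⟩
  induction x generalizing α l r s t with
  | single v => exact hfull hq' (occurs_of_span h)
  | @inr a b x ih =>
    obtain ⟨hqa, hqb⟩ : a.Full q ∧ b.Initial q :=
      hq'.resolve_right fun h' => h'.2 (occurs_iff_choice.2 ⟨x, hq⟩)
    by_cases hb : b.Occurs p
    · obtain ⟨s₂, t₂, h₂⟩ := exists_span hb (true :: α) (.mid α) r
      have ht₂ : t = t₂ := by
        by_cases ha : a.Occurs p
        · obtain ⟨s₁, t₁, h₁⟩ := exists_span ha (false :: α) l (.mid α)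
          rw [span_seq_both h₁ h₂] at h
          simp only [Option.some.injEq, Prod.mk.injEq] at h
          exact h.2.symm
        · rw [span_seq_right ha, h₂] at h
          simp only [Option.some.injEq, Prod.mk.injEq] at h
          exact h.2.symm
      subst ht₂
      obtain ⟨y, hy⟩ := ih hB.inr.1 h₂ ht hq hqb
      exact ⟨.inr y, hy⟩
    · obtain ⟨y, hy⟩ := hfull hqa ((occurs_of_span h).resolve_right hb)
      exact ⟨.inl y, hy⟩
  | @inl a b x ih =>
    have hqa : a.Initial q := by
      rcases hq' with h' | h'
      exacts [h'.1.initial, h'.1]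
    by_cases hb : b.Occurs p
    · obtain ⟨s₂, t₂, h₂⟩ := exists_span hb (true :: α) (.mid α) r
      have ht₂ : t = t₂ := by
        by_cases ha : a.Occurs p
        · obtain ⟨s₁, t₁, h₁⟩ := exists_span ha (false :: α) l (.mid α)
          rw [span_seq_both h₁ h₂] at h
          simp only [Option.some.injEq, Prod.mk.injEq] at h
          exact h.2.symm
        · rw [span_seq_right ha, h₂] at h
          simp only [Option.some.injEq, Prod.mk.injEq] at h
          exact h.2.symm
      subst ht₂
      exact absurd ht (hB.inl.2 t (within_span h₂).2)
    · rw [span_seq_left hb] at h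
      obtain ⟨y, hy⟩ := ih hB.inl.1 h ht hq hqa
      exact ⟨.inl y, hy⟩
  | pair x y _ _ => exact hfull hq' (occurs_of_span h)

/-- A prefix of two choices is common with everything that lies between them. -/
theorem exists_common_of_between {Ω : Q.Ordering} {x x' : Choice Ω} {α : List Bool}
    {l r s t : Pos} {B B' : Pos → Prop} (hB : Before x α l r B) (hB' : Before x' α l r B')
    {p q : Q.Path} (h : Ω.span p α l r = some (s, t)) (ht : B t) (hs : ¬ B' s)
    (hq : q ∈ x.tree) (hq' : q ∈ x'.tree) (hrun : Ω.Running q) :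
    ∃ y : Choice Ω, p ∈ y.tree ∧ q ∈ y.tree := by
  induction Ω generalizing α l r s t with
  | single v =>
    simp only [span] at h
    split_ifs at h
    simp only [Option.some.injEq, Prod.mk.injEq] at h
    exact absurd (h.2 ▸ ht) hB.right
  | seq a b iha ihb =>
    have hb_inl : ∀ x₁ : Choice a, Before (.inl x₁ : Choice (seq a b)) α l r B → ¬ b.Occurs p := by
      intro x₁ hB hb
      obtain ⟨s₂, t₂, h₂⟩ := exists_span hb (true :: α) (.mid α) r
      have : t = t₂ := by
        by_cases ha : a.Occurs p
        · obtain ⟨s₁, t₁, h₁⟩ := exists_span ha (false :: α) l (.mid α)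
          rw [span_seq_both h₁ h₂] at h
          simp only [Option.some.injEq, Prod.mk.injEq] at h
          exact h.2.symm
        · rw [span_seq_right ha, h₂] at h
          simp only [Option.some.injEq, Prod.mk.injEq] at h
          exact h.2.symm
      exact hB.inl.2 t (this ▸ (within_span h₂).2) ht
    have ha_inr : ∀ x₁ : Choice b, Before (.inr x₁ : Choice (seq a b)) α l r B' → ¬ a.Occurs p := by
      intro x₁ hB' ha
      obtain ⟨s₁, t₁, h₁⟩ := exists_span ha (false :: α) l (.mid α)
      have : s = s₁ := by
        by_cases hb : b.Occurs p
        · obtain ⟨s₂, t₂, h₂⟩ := exists_span hb (true :: α) (.mid α) r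
          rw [span_seq_both h₁ h₂] at h
          simp only [Option.some.injEq, Prod.mk.injEq] at h
          exact h.1.symm
        · rw [span_seq_left hb, h₁] at h
          simp only [Option.some.injEq, Prod.mk.injEq] at h
          exact h.1.symm
      exact hs (hB'.inr.2 s (this ▸ (within_span h₁).1))
    cases x with
    | inl x =>
      have hb := hb_inl x hB
      cases x' with
      | inl x' =>
        rw [span_seq_left hb] at h
        obtain ⟨y, hy⟩ := iha hB.inl.1 hB'.inl.1 h ht hs hq hq' hrun.1
        exact ⟨.inl y, hy⟩
      | inr x' =>
        rcases occurs_of_span h with h' | h'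
        exacts [absurd h' (ha_inr x' hB'), absurd h' hb]
    | inr x =>
      cases x' with
      | inr x' =>
        rw [span_seq_right (ha_inr x' hB')] at h
        obtain ⟨y, hy⟩ := ihb hB.inr.1 hB'.inr.1 h ht hs hq hq' hrun.2.1
        exact ⟨.inr y, hy⟩
      | inl x' =>
        -- Here `x'` is on the left and `x` on the right. By the RP property `q` is final on the
        -- left and initial on the right, so it covers everything between the two choices.
        obtain ⟨hf, hi⟩ := hrun.2.2 (occurs_iff_choice.2 ⟨x', hq'⟩) (occurs_iff_choice.2 ⟨x, hq⟩)
        by_cases ha : a.Occurs p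
        · obtain ⟨s₁, t₁, h₁⟩ := exists_span ha (false :: α) l (.mid α)
          have hs₁ : s = s₁ := by
            by_cases hb : b.Occurs p
            · obtain ⟨s₂, t₂, h₂⟩ := exists_span hb (true :: α) (.mid α) r
              rw [span_seq_both h₁ h₂] at h
              simp only [Option.some.injEq, Prod.mk.injEq] at h
              exact h.1.symm
            · rw [span_seq_left hb, h₁] at h
              simp only [Option.some.injEq, Prod.mk.injEq] at h
              exact h.1.symm
          subst hs₁
          obtain ⟨y, hy⟩ := hB'.inl.1.exists_of_final h₁ hs hq' hf
          exact ⟨.inl y, hy⟩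
        · rw [span_seq_right ha] at h
          obtain ⟨y, hy⟩ := hB.inr.1.exists_of_initial h ht hq hi
          exact ⟨.inr y, hy⟩
  | par a b iha ihb =>
    cases x with
    | pair x₁ x₂ =>
    cases x' with
    | pair x₁' x₂' =>
    -- If `q` occurs in both factors, it belongs to every leaf of the product. Otherwise it lives in
    -- one factor, and a `p` in the other factor can be combined with it freely.
    by_cases hqb : a.Occurs q ∧ b.Occurs q
    · obtain ⟨y, hy⟩ := occurs_iff_choice.1 (occurs_of_span h)
      exact ⟨y, hy, Full.mem_tree (Ω := .par a b) (hrun.2.2 hqb.1 hqb.2) y⟩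
    by_cases ha : a.Occurs p
    · by_cases hb : b.Occurs p
      · rw [span_par_both ha hb] at h
        simp only [Option.some.injEq, Prod.mk.injEq] at h
        exact absurd (h.2 ▸ ht) hB.right
      · rw [span_par_left hb] at h
        by_cases hqa : a.Occurs q
        · have hqn : ¬ b.Occurs q := fun h' => hqb ⟨hqa, h'⟩
          obtain ⟨y, hy⟩ := iha hB.pair.1 hB'.pair.1 h ht hs
            ((Finset.mem_union.1 hq).resolve_right fun h' => hqn (occurs_iff_choice.2 ⟨_, h'⟩))
            ((Finset.mem_union.1 hq').resolve_right fun h' => hqn (occurs_iff_choice.2 ⟨_, h'⟩))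
            hrun.1
          exact ⟨.pair y x₂, Finset.mem_union_left _ hy.1, Finset.mem_union_left _ hy.2⟩
        · obtain ⟨y, hy⟩ := occurs_iff_choice.1 ha
          exact ⟨.pair y x₂, Finset.mem_union_left _ hy, Finset.mem_union_right _
            ((Finset.mem_union.1 hq).resolve_left fun h' => hqa (occurs_iff_choice.2 ⟨_, h'⟩))⟩
    · rw [span_par_right ha] at h
      by_cases hqa : a.Occurs q
      · have hqn : ¬ b.Occurs q := fun h' => hqb ⟨hqa, h'⟩
        obtain ⟨y, hy⟩ := occurs_iff_choice.1 (occurs_of_span h)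
        exact ⟨.pair x₁ y, Finset.mem_union_right _ hy, Finset.mem_union_left _
          ((Finset.mem_union.1 hq).resolve_right fun h' => hqn (occurs_iff_choice.2 ⟨_, h'⟩))⟩
      · obtain ⟨y, hy⟩ := ihb hB.pair.2 hB'.pair.2 h ht hs
          ((Finset.mem_union.1 hq).resolve_left fun h' => hqa (occurs_iff_choice.2 ⟨_, h'⟩))
          ((Finset.mem_union.1 hq').resolve_left fun h' => hqa (occurs_iff_choice.2 ⟨_, h'⟩))
          hrun.2.1
        exact ⟨.pair x₁ y, Finset.mem_union_right _ hy.1, Finset.mem_union_right _ hy.2⟩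

end Ordering

end CQ

/-! ## Blocked graphs of a single witness contain a choice -/

namespace CQ

namespace Ordering

variable {Q : CQ}

/-- The number of alternatives, if nested sequences are flattened. -/
def slotCount : Q.Ordering → ℕ
  | seq a b => a.slotCount + b.slotCount
  | _ => 1

/-- The alternatives of the flattened sequence, with their addresses. -/
def slot : Q.Ordering → List Bool → ℕ → Q.Ordering × List Bool
  | seq a b, α, k =>
    if k < a.slotCount then a.slot (false :: α) k else b.slot (true :: α) (k - a.slotCount)
  | Ω, α, _ => (Ω, α)

/-- The connectors between the alternatives of the flattened sequence. -/
def slotPos : Q.Ordering → List Bool → Pos → Pos → ℕ → Pos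
  | seq a b, α, l, r, k =>
    if k ≤ a.slotCount then a.slotPos (false :: α) l (.mid α) k
    else b.slotPos (true :: α) (.mid α) r (k - a.slotCount)
  | _, _, l, r, k => if k = 0 then l else r

theorem slotCount_pos (Ω : Q.Ordering) : 0 < Ω.slotCount := by
  induction Ω with
  | single v => exact Nat.one_pos
  | seq a b iha _ => exact Nat.add_pos_left iha _
  | par a b => exact Nat.one_pos

@[simp] theorem slotPos_zero (Ω : Q.Ordering) (α : List Bool) (l r : Pos) :
    Ω.slotPos α l r 0 = l := by
  induction Ω generalizing α l r with
  | single v => rfl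
  | seq a b iha _ => simp [slotPos, iha]
  | par a b => rfl

@[simp] theorem slotPos_slotCount (Ω : Q.Ordering) (α : List Bool) (l r : Pos) :
    Ω.slotPos α l r Ω.slotCount = r := by
  induction Ω generalizing α l r with
  | single v => rfl
  | seq a b _ ihb =>
    have hb := slotCount_pos b
    have h : ¬ (seq a b).slotCount ≤ a.slotCount := by simp only [slotCount]; omega
    have h' : (seq a b).slotCount - a.slotCount = b.slotCount := by simp only [slotCount]; omega
    rw [slotPos, if_neg h, h', ihb]
  | par a b => rfl

theorem slot_left {a b : Q.Ordering} {α : List Bool} {k : ℕ} (hk : k < a.slotCount) :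
    (seq a b).slot α k = a.slot (false :: α) k := if_pos hk

theorem slot_right {a b : Q.Ordering} {α : List Bool} (k : ℕ) :
    (seq a b).slot α (a.slotCount + k) = b.slot (true :: α) k := by
  rw [slot, if_neg (by omega), Nat.add_sub_cancel_left]

theorem slotPos_left {a b : Q.Ordering} {α : List Bool} {l r : Pos} {k : ℕ}
    (hk : k ≤ a.slotCount) :
    (seq a b).slotPos α l r k = a.slotPos (false :: α) l (.mid α) k := if_pos hk

theorem slotPos_right {a b : Q.Ordering} {α : List Bool} {l r : Pos} (k : ℕ) :
    (seq a b).slotPos α l r (a.slotCount + k) = b.slotPos (true :: α) (.mid α) r k := by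
  rcases Nat.eq_zero_or_pos k with rfl | hk
  · rw [Nat.add_zero, slotPos_left le_rfl, slotPos_slotCount, slotPos_zero]
  · rw [slotPos, if_neg (by omega), Nat.add_sub_cancel_left]

theorem slot_cases {a : Q.Ordering} (b : Q.Ordering) {k : ℕ} (hk : k < (seq a b).slotCount) :
    k < a.slotCount ∨ ∃ j, j < b.slotCount ∧ k = a.slotCount + j := by
  by_cases h : k < a.slotCount
  · exact Or.inl h
  · exact Or.inr ⟨k - a.slotCount, by simp only [slotCount] at hk; omega, by omega⟩

theorem leaves_slot {Ω : Q.Ordering} {α β : List Bool} {l r s t : Pos} {k : ℕ}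
    (hk : k < Ω.slotCount)
    (h : (β, s, t) ∈ (Ω.slot α k).1.leaves (Ω.slot α k).2 (Ω.slotPos α l r k)
      (Ω.slotPos α l r (k + 1))) : (β, s, t) ∈ Ω.leaves α l r := by
  induction Ω generalizing α l r k with
  | single v =>
    obtain rfl : k = 0 := by simp only [slotCount] at hk; omega
    exact h
  | seq a b iha ihb =>
    rw [leaves, List.mem_append]
    rcases slot_cases b hk with hk | ⟨j, hj, rfl⟩
    · rw [slot_left hk, slotPos_left hk.le, slotPos_left hk] at h
      exact Or.inl (iha hk h)
    · rw [slot_right, add_assoc, slotPos_right, slotPos_right] at h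
      exact Or.inr (ihb hj h)
  | par a b =>
    obtain rfl : k = 0 := by simp only [slotCount] at hk; omega
    exact h

theorem exists_choice_of_slot {Ω : Q.Ordering} {α : List Bool} {k : ℕ} (hk : k < Ω.slotCount)
    (x : Choice (Ω.slot α k).1) :
    ∃ y : Choice Ω, y.tree = x.tree ∧ y.leafSet α = x.leafSet (Ω.slot α k).2 := by
  induction Ω generalizing α k with
  | single v => exact ⟨x, rfl, rfl⟩
  | seq a b iha ihb =>
    rcases slot_cases b hk with hk | ⟨j, hj, rfl⟩
    · revert x
      rw [slot_left hk]
      intro x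
      obtain ⟨y, hy⟩ := iha hk x
      exact ⟨.inl y, hy⟩
    · revert x
      rw [slot_right]
      intro x
      obtain ⟨y, hy⟩ := ihb hj x
      exact ⟨.inr y, hy⟩
  | par a b => exact ⟨x, rfl, rfl⟩

theorem exists_slot_of_choice {Ω : Q.Ordering} (α : List Bool) (y : Choice Ω) :
    ∃ k < Ω.slotCount, ∃ x : Choice (Ω.slot α k).1, y.tree = x.tree := by
  induction y generalizing α with
  | single v => exact ⟨0, Nat.one_pos, .single v, rfl⟩
  | @inl a b y ih =>
    obtain ⟨k, hk, x, hx⟩ := ih (false :: α)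
    refine ⟨k, by simp only [slotCount]; omega, ?_⟩
    rw [slot_left hk]
    exact ⟨x, hx⟩
  | @inr a b y ih =>
    obtain ⟨k, hk, x, hx⟩ := ih (true :: α)
    refine ⟨a.slotCount + k, by simp only [slotCount]; omega, ?_⟩
    rw [slot_right]
    exact ⟨x, hx⟩
  | pair x y => exact ⟨0, Nat.one_pos, .pair x y, rfl⟩

theorem running_slot {p : Q.Path} {Ω : Q.Ordering} (α : List Bool) {k : ℕ} (hk : k < Ω.slotCount)
    (h : Ω.Running p) : (Ω.slot α k).1.Running p := by
  induction Ω generalizing α k with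
  | single v => exact h
  | seq a b iha ihb =>
    rcases slot_cases b hk with hk | ⟨j, hj, rfl⟩
    · rw [slot_left hk]; exact iha _ hk h.1
    · rw [slot_right]; exact ihb _ hj h.2.1
  | par a b => exact h

theorem full_slot {p : Q.Path} {Ω : Q.Ordering} (α : List Bool) {k : ℕ} (hk : k < Ω.slotCount)
    (h : Ω.Full p) : (Ω.slot α k).1.Full p := by
  induction Ω generalizing α k with
  | single v => exact h
  | seq a b iha ihb =>
    rcases slot_cases b hk with hk | ⟨j, hj, rfl⟩
    · rw [slot_left hk]; exact iha _ hk h.1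
    · rw [slot_right]; exact ihb _ hj h.2
  | par a b => exact h

theorem occurs_slot {p : Q.Path} {Ω : Q.Ordering} (α : List Bool) {k : ℕ} (hk : k < Ω.slotCount)
    (h : (Ω.slot α k).1.Occurs p) : Ω.Occurs p := by
  obtain ⟨x, hx⟩ := occurs_iff_choice.1 h
  obtain ⟨y, hy, -⟩ := exists_choice_of_slot hk x
  exact occurs_iff_choice.2 ⟨y, hy ▸ hx⟩

/-- After flattening, each alternative is a leaf or a product. -/
theorem slot_ne_seq (Ω : Q.Ordering) (α : List Bool) (k : ℕ) {a b : Q.Ordering} :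
    (Ω.slot α k).1 ≠ seq a b := by
  induction Ω generalizing α k with
  | single v => simp [slot]
  | seq c d ihc ihd =>
    rw [slot]
    split_ifs
    exacts [ihc _ _, ihd _ _]
  | par c d => simp [slot]

theorem sizeOf_slot (Ω : Q.Ordering) (α : List Bool) (k : ℕ) :
    sizeOf (Ω.slot α k).1 ≤ sizeOf Ω := by
  induction Ω generalizing α k with
  | single v => simp [slot]
  | seq c d ihc ihd =>
    rw [slot]
    split_ifs
    · exact (ihc _ _).trans (by simp; omega)
    · exact (ihd _ _).trans (by simp)
  | par c d => simp [slot]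

/-- The alternatives in which a final prefix occurs. -/
theorem Final.exists_run {p : Q.Path} {Ω : Q.Ordering} (h : Ω.Final p) (α : List Bool)
    (l r : Pos) : ∃ s < Ω.slotCount, (∀ k < Ω.slotCount, (Ω.slot α k).1.Occurs p → s ≤ k) ∧
      (∀ k < Ω.slotCount, s ≤ k → (Ω.slot α k).1.Full p) ∧
      Ω.span p α l r = some (Ω.slotPos α l r s, r) := by
  induction Ω generalizing α l r with
  | single v => exact ⟨0, Nat.one_pos, by simp, fun _ _ _ => h, Full.span (Ω := .single v) h α l r⟩
  | seq a b iha ihb =>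
    rcases h with ⟨ha, hb⟩ | ⟨ha, hb⟩
    · obtain ⟨s, hs, h1, h2, h3⟩ := iha ha (false :: α) l (.mid α)
      refine ⟨s, by simp only [slotCount]; omega, fun k hk hk' => ?_, fun k hk hk' => ?_, ?_⟩
      · rcases slot_cases b hk with hk | ⟨j, hj, rfl⟩
        · rw [slot_left hk] at hk'; exact h1 k hk hk'
        · omega
      · rcases slot_cases b hk with hk | ⟨j, hj, rfl⟩
        · rw [slot_left hk]; exact h2 k hk hk'
        · rw [slot_right]; exact full_slot _ hj hb
      · rw [span_seq_both h3 (hb.span _ _ _), slotPos_left hs.le]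
    · obtain ⟨s, hs, h1, h2, h3⟩ := ihb hb (true :: α) (.mid α) r
      refine ⟨a.slotCount + s, by simp only [slotCount]; omega, fun k hk hk' => ?_,
        fun k hk hk' => ?_, ?_⟩
      · rcases slot_cases b hk with hk | ⟨j, hj, rfl⟩
        · rw [slot_left hk] at hk'; exact absurd (occurs_slot _ hk hk') ha
        · rw [slot_right] at hk'; exact Nat.add_le_add_left (h1 j hj hk') _
      · rcases slot_cases b hk with hk | ⟨j, hj, rfl⟩
        · omega
        · rw [slot_right]; exact h2 j hj (by omega)
      · rw [span_seq_right ha, h3, slotPos_right]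
  | par a b => exact ⟨0, Nat.one_pos, by simp, fun _ _ _ => h, Full.span (Ω := .par a b) h α l r⟩

/-- The alternatives in which an initial prefix occurs. -/
theorem Initial.exists_run {p : Q.Path} {Ω : Q.Ordering} (h : Ω.Initial p) (α : List Bool)
    (l r : Pos) : ∃ t < Ω.slotCount, (∀ k < Ω.slotCount, (Ω.slot α k).1.Occurs p → k ≤ t) ∧
      (∀ k < Ω.slotCount, k ≤ t → (Ω.slot α k).1.Full p) ∧
      Ω.span p α l r = some (l, Ω.slotPos α l r (t + 1)) := by
  induction Ω generalizing α l r with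
  | single v => exact ⟨0, Nat.one_pos, by simp [slotCount], fun _ _ _ => h,
      Full.span (Ω := .single v) h α l r⟩
  | seq a b iha ihb =>
    rcases h with ⟨ha, hb⟩ | ⟨ha, hb⟩
    · obtain ⟨s, hs, h1, h2, h3⟩ := ihb hb (true :: α) (.mid α) r
      refine ⟨a.slotCount + s, by simp only [slotCount]; omega, fun k hk hk' => ?_,
        fun k hk hk' => ?_, ?_⟩
      · rcases slot_cases b hk with hk | ⟨j, hj, rfl⟩
        · omega
        · rw [slot_right] at hk'; exact Nat.add_le_add_left (h1 j hj hk') _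
      · rcases slot_cases b hk with hk | ⟨j, hj, rfl⟩
        · rw [slot_left hk]; exact full_slot _ hk ha
        · rw [slot_right]; exact h2 j hj (by omega)
      · rw [span_seq_both (ha.span _ _ _) h3, add_assoc, slotPos_right]
    · obtain ⟨s, hs, h1, h2, h3⟩ := iha ha (false :: α) l (.mid α)
      refine ⟨s, by simp only [slotCount]; omega, fun k hk hk' => ?_, fun k hk hk' => ?_, ?_⟩
      · rcases slot_cases b hk with hk | ⟨j, hj, rfl⟩
        · rw [slot_left hk] at hk'; exact h1 k hk hk'
        · rw [slot_right] at hk'; exact absurd (occurs_slot _ hj hk') hb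
      · rcases slot_cases b hk with hk | ⟨j, hj, rfl⟩
        · rw [slot_left hk]; exact h2 k hk hk'
        · omega
      · rw [span_seq_left hb, h3, slotPos_left hs]
  | par a b => exact ⟨0, Nat.one_pos, by simp [slotCount], fun _ _ _ => h,
      Full.span (Ω := .par a b) h α l r⟩

/-- A prefix that runs occurs in one alternative, or it is full in a run of alternatives. -/
theorem Running.exists_run {p : Q.Path} {Ω : Q.Ordering} (hr : Ω.Running p) (ho : Ω.Occurs p)
    (α : List Bool) (l r : Pos) :
    (∃ k < Ω.slotCount, (∀ j < Ω.slotCount, (Ω.slot α j).1.Occurs p → j = k) ∧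
      Ω.span p α l r = (Ω.slot α k).1.span p (Ω.slot α k).2 (Ω.slotPos α l r k)
        (Ω.slotPos α l r (k + 1))) ∨
    ∃ s t, s ≤ t ∧ t < Ω.slotCount ∧
      (∀ k < Ω.slotCount, (Ω.slot α k).1.Occurs p → s ≤ k ∧ k ≤ t) ∧
      (∀ k < Ω.slotCount, s ≤ k → k ≤ t → (Ω.slot α k).1.Full p) ∧
      Ω.span p α l r = some (Ω.slotPos α l r s, Ω.slotPos α l r (t + 1)) := by
  induction Ω generalizing α l r with
  | single v =>
    refine Or.inl ⟨0, Nat.one_pos, fun j hj _ => ?_, rfl⟩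
    simp only [slotCount] at hj; omega
  | seq a b iha ihb =>
    by_cases ha : a.Occurs p
    · by_cases hb : b.Occurs p
      · obtain ⟨hf, hi⟩ := hr.2.2 ha hb
        obtain ⟨s, hs, h1, h2, h3⟩ := hf.exists_run (false :: α) l (.mid α)
        obtain ⟨t, ht, h4, h5, h6⟩ := hi.exists_run (true :: α) (.mid α) r
        refine Or.inr ⟨s, a.slotCount + t, by omega, by simp only [slotCount]; omega,
          fun k hk hk' => ?_, fun k hk hk1 hk2 => ?_, ?_⟩
        · rcases slot_cases b hk with hk | ⟨j, hj, rfl⟩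
          · rw [slot_left hk] at hk'; exact ⟨h1 k hk hk', by omega⟩
          · rw [slot_right] at hk'; exact ⟨by omega, Nat.add_le_add_left (h4 j hj hk') _⟩
        · rcases slot_cases b hk with hk | ⟨j, hj, rfl⟩
          · rw [slot_left hk]; exact h2 k hk hk1
          · rw [slot_right]; exact h5 j hj (by omega)
        · rw [span_seq_both h3 h6, slotPos_left hs.le, add_assoc, slotPos_right]
      · rcases iha hr.1 ha (false :: α) l (.mid α) with ⟨k, hk, h1, h2⟩ | ⟨s, t, hst, ht, h1, h2, h3⟩
        · refine Or.inl ⟨k, by simp only [slotCount]; omega, fun j hj hj' => ?_, ?_⟩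
          · rcases slot_cases b hj with hi | ⟨i, hi, rfl⟩
            · rw [slot_left hi] at hj'; exact h1 j hi hj'
            · rw [slot_right] at hj'; exact absurd (occurs_slot _ hi hj') hb
          · rw [span_seq_left hb, h2, slot_left hk, slotPos_left hk.le, slotPos_left hk]
        · refine Or.inr ⟨s, t, hst, by simp only [slotCount]; omega, fun k hk hk' => ?_,
            fun k hk hk1 hk2 => ?_, ?_⟩
          · rcases slot_cases b hk with hk | ⟨j, hj, rfl⟩
            · rw [slot_left hk] at hk'; exact h1 k hk hk'
            · rw [slot_right] at hk'; exact absurd (occurs_slot _ hj hk') hb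
          · rw [slot_left (by omega)]; exact h2 k (by omega) hk1 hk2
          · rw [span_seq_left hb, h3, slotPos_left (by omega), slotPos_left (by omega)]
    · have hb : b.Occurs p := ho.resolve_left ha
      rcases ihb hr.2.1 hb (true :: α) (.mid α) r with ⟨k, hk, h1, h2⟩ | ⟨s, t, hst, ht, h1, h2, h3⟩
      · refine Or.inl ⟨a.slotCount + k, by simp only [slotCount]; omega, fun j hj hj' => ?_, ?_⟩
        · rcases slot_cases b hj with hi | ⟨i, hi, rfl⟩
          · rw [slot_left hi] at hj'; exact absurd (occurs_slot _ hi hj') ha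
          · rw [slot_right] at hj'; rw [h1 i hi hj']
        · rw [span_seq_right ha, h2, slot_right, add_assoc, slotPos_right, slotPos_right]
      · refine Or.inr ⟨a.slotCount + s, a.slotCount + t, by omega, by simp only [slotCount]; omega,
          fun k hk hk' => ?_, fun k hk hk1 hk2 => ?_, ?_⟩
        · rcases slot_cases b hk with hk | ⟨j, hj, rfl⟩
          · rw [slot_left hk] at hk'; exact absurd (occurs_slot _ hk hk') ha
          · rw [slot_right] at hk'
            have := h1 j hj hk'
            omega
        · rcases slot_cases b hk with hk | ⟨j, hj, rfl⟩
          · omega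
          · rw [slot_right]; exact h2 j hj (by omega) (by omega)
        · rw [span_seq_right ha, h3, add_assoc, slotPos_right, slotPos_right]
  | par a b =>
    refine Or.inl ⟨0, Nat.one_pos, fun j hj _ => ?_, rfl⟩
    simp only [slotCount] at hj; omega

/-- A prefix that occurs in two alternatives is full in everything between them. -/
theorem Running.full_between {p : Q.Path} {Ω : Q.Ordering} (hr : Ω.Running p) (α : List Bool)
    {i j : ℕ} (hi : i < Ω.slotCount) (hj : j < Ω.slotCount) (hne : i ≠ j)
    (hpi : (Ω.slot α i).1.Occurs p) (hpj : (Ω.slot α j).1.Occurs p) {k : ℕ}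
    (hk : i ≤ k ∧ k ≤ j ∨ j ≤ k ∧ k ≤ i) : (Ω.slot α k).1.Full p := by
  rcases hr.exists_run (occurs_slot α hi hpi) α .start .finish with
    ⟨m, -, h, -⟩ | ⟨s, t, -, ht, h1, h2, -⟩
  · exact absurd ((h i hi hpi).trans (h j hj hpj).symm) hne
  · have := h1 i hi hpi
    have := h1 j hj hpj
    exact h2 k (by omega) (by omega) (by omega)

/-! ### Non-crossing runs, and a path through an ordering in which each choice is open. -/

/-- `p` is a prefix of some, but not of all leaves. -/
def Partial (Ω : Q.Ordering) (p : Q.Path) : Prop := Ω.Occurs p ∧ ¬ Ω.Full p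

/-- The place of an expression inside of an ordering of the family `M` of trees. -/
structure Context (M : Set Q.Tree) (Ω : Q.Ordering) : Prop where
  -- `R` collects the choices made outside of the expression. Any choice inside completes it to a
  -- tree of the family.
  extend : ∃ R : Q.Tree, ∀ x : Choice Ω, x.tree ∪ R ∈ M ∧ ∀ p, Ω.Partial p → p ∉ R
  -- Conversely, a tree that uses a prefix peculiar to a part of the expression passes through the
  -- expression, and shows one of its choices there.
  restrict : ∀ t ∈ M, (∃ m, Ω.Partial m ∧ m ∈ t) →
    ∃ x : Choice Ω, ∀ m, Ω.Partial m → (m ∈ t ↔ m ∈ x.tree)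

/-- A prefix that is partial in one alternative occurs in no other, since a run that reaches further
would contain the whole alternative. So a tree with this prefix must pass through the alternative.
-/
theorem Context.slot {M : Set Q.Tree} {Ω : Q.Ordering} (h : Context M Ω)
    (hr : ∀ p, Ω.Running p) (α : List Bool) {k : ℕ} (hk : k < Ω.slotCount) :
    Context M (Ω.slot α k).1 := by
  have hp : ∀ p, (Ω.slot α k).1.Partial p → Ω.Partial p := fun p hp =>
    ⟨occurs_slot α hk hp.1, fun hf => hp.2 (full_slot α hk hf)⟩
  constructor
  · obtain ⟨R, hR⟩ := h.extend
    refine ⟨R, fun x => ?_⟩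
    obtain ⟨y, hy, -⟩ := exists_choice_of_slot hk x
    rw [← hy]
    exact ⟨(hR y).1, fun p hp' => (hR y).2 p (hp p hp')⟩
  · rintro t ht ⟨m, hm, hmt⟩
    obtain ⟨y, hy⟩ := h.restrict t ht ⟨m, hp m hm, hmt⟩
    obtain ⟨j, hj, x, hx⟩ := exists_slot_of_choice α y
    have hmx : m ∈ x.tree := by rw [← hx, ← hy m (hp m hm)]; exact hmt
    obtain rfl : j = k := by
      by_contra hne
      exact hm.2 ((hr m).full_between α hj hk hne (occurs_iff_choice.2 ⟨x, hmx⟩) hm.1 (by omega))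
    exact ⟨x, fun m' hm' => by rw [hy m' (hp m' hm'), hx]⟩

/-- A prefix that is partial in one factor does not occur in the other one, so an arbitrary choice
of the other factor can be added to the fixed rest of the tree. -/
theorem Context.left {M : Set Q.Tree} {a b : Q.Ordering} (h : Context M (par a b))
    (hr : ∀ p, (par a b).Running p) : Context M a := by
  have hp : ∀ p, a.Partial p → (par a b).Partial p ∧ ¬ b.Occurs p := fun p hp =>
    ⟨⟨Or.inl hp.1, fun h => hp.2 h.1⟩, fun h => hp.2 ((hr p).2.2 hp.1 h).1⟩
  constructor
  · obtain ⟨R, hR⟩ := h.extend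
    obtain ⟨y⟩ := nonempty_choice b
    refine ⟨y.tree ∪ R, fun x => ?_⟩
    rw [← Finset.union_assoc]
    refine ⟨(hR (.pair x y)).1, fun p hp' hm => ?_⟩
    rcases Finset.mem_union.1 hm with h' | h'
    · exact (hp p hp').2 (occurs_iff_choice.2 ⟨y, h'⟩)
    · exact (hR (.pair x y)).2 p (hp p hp').1 h'
  · rintro t ht ⟨m, hm, hmt⟩
    obtain ⟨z, hz⟩ := h.restrict t ht ⟨m, (hp m hm).1, hmt⟩
    cases z with
    | pair x y =>
      refine ⟨x, fun m' hm' => ?_⟩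
      rw [hz m' (hp m' hm').1, Choice.tree, Finset.mem_union, or_iff_left]
      exact fun h => (hp m' hm').2 (occurs_iff_choice.2 ⟨y, h⟩)

theorem Context.right {M : Set Q.Tree} {a b : Q.Ordering} (h : Context M (par a b))
    (hr : ∀ p, (par a b).Running p) : Context M b := by
  have hp : ∀ p, b.Partial p → (par a b).Partial p ∧ ¬ a.Occurs p := fun p hp =>
    ⟨⟨Or.inr hp.1, fun h => hp.2 h.2⟩, fun h => hp.2 ((hr p).2.2 h hp.1).2⟩
  constructor
  · obtain ⟨R, hR⟩ := h.extend
    obtain ⟨y⟩ := nonempty_choice a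
    refine ⟨y.tree ∪ R, fun x => ?_⟩
    rw [← Finset.union_assoc, Finset.union_comm x.tree]
    refine ⟨(hR (.pair y x)).1, fun p hp' hm => ?_⟩
    rcases Finset.mem_union.1 hm with h' | h'
    · exact (hp p hp').2 (occurs_iff_choice.2 ⟨y, h'⟩)
    · exact (hR (.pair y x)).2 p (hp p hp').1 h'
  · rintro t ht ⟨m, hm, hmt⟩
    obtain ⟨z, hz⟩ := h.restrict t ht ⟨m, (hp m hm).1, hmt⟩
    cases z with
    | pair y x =>
      refine ⟨x, fun m' hm' => ?_⟩
      rw [hz m' (hp m' hm').1, Choice.tree, Finset.mem_union, or_iff_right]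
      exact fun h => (hp m' hm').2 (occurs_iff_choice.2 ⟨y, h⟩)

/-- The mixing property of the family of the minimal elimination orders. -/
def Mixing (M : Set Q.Tree) : Prop :=
  ∀ v₁ ∈ M, ∀ v ∈ M, ∀ v₂ ∈ M, ∀ p₁ p₂, p₁ ∈ v₁ → p₁ ∈ v → p₁ ∉ v₂ → p₂ ∉ v₁ → p₂ ∈ v → p₂ ∈ v₂ →
    ∃ t ∈ M, ∃ m₁ ∈ t, ∃ m₂ ∈ t, m₁ ∈ v₁ ∧ m₁ ∉ v ∧ m₂ ∈ v₂ ∧ m₂ ∉ v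

/-- The runs of two prefixes do not cross. -/
theorem Context.not_crossing {M : Set Q.Tree} {Ω : Q.Ordering} (h : Context M Ω) (hM : Mixing M)
    (hr : ∀ p, Ω.Running p) (α : List Bool) {i j k : ℕ} (hij : i < j) (hjk : j < k)
    (hk : k < Ω.slotCount) {p₁ p₂ : Q.Path} (h1i : (Ω.slot α i).1.Full p₁)
    (h1j : (Ω.slot α j).1.Full p₁) (h1k : ¬ (Ω.slot α k).1.Full p₁)
    (h2i : ¬ (Ω.slot α i).1.Full p₂) (h2j : (Ω.slot α j).1.Full p₂)
    (h2k : (Ω.slot α k).1.Full p₂) : False := by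
  have hi : i < Ω.slotCount := by omega
  have hj : j < Ω.slotCount := by omega
  have o1 : ¬ (Ω.slot α k).1.Occurs p₁ := fun h => h1k
    ((hr p₁).full_between α hi hk (by omega) h1i.occurs h (by omega))
  have o2 : ¬ (Ω.slot α i).1.Occurs p₂ := fun h => h2i
    ((hr p₂).full_between α hi hk (by omega) h h2k.occurs (by omega))
  obtain ⟨R, hR⟩ := h.extend
  obtain ⟨d₁⟩ := nonempty_choice (Ω.slot α i).1
  obtain ⟨d⟩ := nonempty_choice (Ω.slot α j).1
  obtain ⟨d₂⟩ := nonempty_choice (Ω.slot α k).1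
  obtain ⟨x₁, hx₁, -⟩ := exists_choice_of_slot hi d₁
  obtain ⟨x, hx, -⟩ := exists_choice_of_slot hj d
  obtain ⟨x₂, hx₂, -⟩ := exists_choice_of_slot hk d₂
  have hP1 : Ω.Partial p₁ := ⟨occurs_slot α hi h1i.occurs, fun h => h1k (full_slot α hk h)⟩
  have hP2 : Ω.Partial p₂ := ⟨occurs_slot α hk h2k.occurs, fun h => h2i (full_slot α hi h)⟩
  have n1 := (hR x).2 p₁ hP1
  have n2 := (hR x).2 p₂ hP2
  -- The trees of the alternatives `i`, `j` and `k` are in the position required for mixing. The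
  -- resulting tree `t` shares with `i` and with `k` some prefix that is missing at `j`.
  obtain ⟨t, ht, m₁, hm₁t, m₂, hm₂t, hm₁, hm₁', hm₂, hm₂'⟩ := hM _ (hR x₁).1 _ (hR x).1 _ (hR x₂).1
    p₁ p₂ (by rw [hx₁]; exact Finset.mem_union_left _ (h1i.mem_tree _))
    (by rw [hx]; exact Finset.mem_union_left _ (h1j.mem_tree _))
    (by
      rw [hx₂, Finset.mem_union, not_or]
      exact ⟨fun h => o1 (occurs_iff_choice.2 ⟨d₂, h⟩), n1⟩)
    (by
      rw [hx₁, Finset.mem_union, not_or]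
      exact ⟨fun h => o2 (occurs_iff_choice.2 ⟨d₁, h⟩), n2⟩)
    (by rw [hx]; exact Finset.mem_union_left _ (h2j.mem_tree _))
    (by rw [hx₂]; exact Finset.mem_union_left _ (h2k.mem_tree _))
  rw [Finset.mem_union, hx, not_or] at hm₁' hm₂'
  rw [Finset.mem_union, hx₁, or_iff_left hm₁'.2] at hm₁
  rw [Finset.mem_union, hx₂, or_iff_left hm₂'.2] at hm₂
  have f1 : ¬ (Ω.slot α j).1.Full m₁ := fun h => hm₁'.1 (h.mem_tree d)
  have f2 : ¬ (Ω.slot α j).1.Full m₂ := fun h => hm₂'.1 (h.mem_tree d)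
  have e1 := occurs_iff_choice.2 ⟨d₁, hm₁⟩
  have e2 := occurs_iff_choice.2 ⟨d₂, hm₂⟩
  have hQ1 : Ω.Partial m₁ := ⟨occurs_slot α hi e1, fun h => f1 (full_slot α hj h)⟩
  have hQ2 : Ω.Partial m₂ := ⟨occurs_slot α hk e2, fun h => f2 (full_slot α hj h)⟩
  obtain ⟨y, hy⟩ := h.restrict t ht ⟨m₁, hQ1, hm₁t⟩
  obtain ⟨c, hc, z, hz⟩ := exists_slot_of_choice α y
  have g1 := occurs_iff_choice.2 ⟨z, hz ▸ (hy m₁ hQ1).1 hm₁t⟩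
  have g2 := occurs_iff_choice.2 ⟨z, hz ▸ (hy m₂ hQ2).1 hm₂t⟩
  -- Wherever `t` is placed, one of its two prefixes would have to run across `j`.
  by_cases hcj : c < j
  · exact f2 ((hr m₂).full_between α hc hk (by omega) g2 e2 (by omega))
  · exact f1 ((hr m₁).full_between α hi hc (by omega) e1 g1 (by omega))

/-- The connectors that are linked by an open leaf or by an open prefix. -/
def Step (Ω : Q.Ordering) (U : Q.Path → Prop) (V : List Bool → Prop) (α : List Bool) (l r : Pos)
    (s t : Pos) : Prop :=
  (∃ β, (β, s, t) ∈ Ω.leaves α l r ∧ V β) ∨ ∃ p, U p ∧ Ω.span p α l r = some (s, t)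

/-- If each choice uses something open, then the graph is not blocked. -/
theorem path_of_open {M : Set Q.Tree} (hM : Mixing M) (U : Q.Path → Prop) (V : List Bool → Prop)
    (n : ℕ) {Ω : Q.Ordering} (hn : sizeOf Ω ≤ n) (hc : Context M Ω) (hr : ∀ p, Ω.Running p)
    (α : List Bool) (l r : Pos)
    (hopen : ∀ x : Choice Ω, (∃ β ∈ x.leafSet α, V β) ∨ ∃ p ∈ x.tree, U p) :
    Relation.ReflTransGen (Ω.Step U V α l r) l r := by
  induction n generalizing Ω α l r with
  | zero => cases Ω <;> simp at hn
  | succ n ih =>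
  -- An alternative that is not covered by an open prefix as a whole can be passed within itself.
  have item : ∀ k < Ω.slotCount, (∀ p, U p → ¬ (Ω.slot α k).1.Full p) →
      Relation.ReflTransGen (Ω.Step U V α l r) (Ω.slotPos α l r k) (Ω.slotPos α l r (k + 1)) := by
    intro k hk hU
    have hop : ∀ x : Choice (Ω.slot α k).1, (∃ β ∈ x.leafSet (Ω.slot α k).2, V β) ∨
        ∃ p ∈ x.tree, U p := by
      intro x
      obtain ⟨y, hy, hy'⟩ := exists_choice_of_slot hk x
      rw [← hy, ← hy']
      exact hopen y
    have hleaf := fun β s t => leaves_slot (Ω := Ω) (α := α) (β := β) (l := l) (r := r) (s := s)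
      (t := t) hk
    -- An open prefix that occurs in the alternative has its whole span there. A longer run would
    -- make it full in the alternative, which is excluded.
    have hspan : ∀ p, U p → ∀ s, (Ω.slot α k).1.span p (Ω.slot α k).2 (Ω.slotPos α l r k)
        (Ω.slotPos α l r (k + 1)) = some s → Ω.span p α l r = some s := by
      intro p hp s hs
      have ho := occurs_of_span hs
      rcases (hr p).exists_run (occurs_slot α hk ho) α l r with ⟨j, -, h1, h2⟩ | ⟨s, t, -, -, h1, h2, -⟩
      · obtain rfl := h1 k hk ho
        rw [h2, hs]
      · exact absurd (h2 k hk (h1 k hk ho).1 (h1 k hk ho).2) (hU p hp)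
    have hck := hc.slot hr α hk
    have hrk := fun p => running_slot α hk (hr p)
    have hne := fun a b => slot_ne_seq Ω α k (a := a) (b := b)
    have hsz := (sizeOf_slot Ω α k).trans hn
    generalize Ω.slotPos α l r k = l' at *
    generalize Ω.slotPos α l r (k + 1) = r' at *
    generalize Ω.slot α k = e at *
    obtain ⟨e, γ⟩ := e
    dsimp only at *
    cases e with
    | seq a b => exact absurd rfl (hne a b)
    | single v =>
      refine Relation.ReflTransGen.single (Or.inl ⟨γ, hleaf γ l' r' (by simp [leaves]), ?_⟩)
      rcases hop (.single v) with ⟨β, hβ, h⟩ | ⟨p, hp, h⟩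
      · rwa [Finset.mem_singleton.1 hβ] at h
      · exact absurd hp (hU p h)
    | par a b =>
      have hdis : ∀ p, U p → a.Occurs p → ¬ b.Occurs p := fun p hp ha hb =>
        hU p hp ((hrk p).2.2 ha hb)
      -- If each factor had a choice without anything open, the pair of them would be a choice of
      -- the product without anything open.
      have hab : (∀ x : Choice a, (∃ β ∈ x.leafSet (false :: γ), V β) ∨ ∃ p ∈ x.tree, U p) ∨
          ∀ x : Choice b, (∃ β ∈ x.leafSet (true :: γ), V β) ∨ ∃ p ∈ x.tree, U p := by
        by_contra hcon
        rw [not_or, not_forall, not_forall] at hcon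
        obtain ⟨⟨x, hx⟩, y, hy⟩ := hcon
        rcases hop (.pair x y) with ⟨β, hβ, h⟩ | ⟨p, hp, h⟩
        · rcases Finset.mem_union.1 hβ with h' | h'
          exacts [hx (Or.inl ⟨β, h', h⟩), hy (Or.inl ⟨β, h', h⟩)]
        · rcases Finset.mem_union.1 hp with h' | h'
          exacts [hx (Or.inr ⟨p, h', h⟩), hy (Or.inr ⟨p, h', h⟩)]
      simp only [par.sizeOf_spec] at hsz
      rcases hab with hab | hab
      · have := ih (by omega) (hck.left hrk) (fun p => (hrk p).1) (false :: γ) l' r' hab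
        refine Relation.ReflTransGen.mono ?_ _ _ this
        rintro s t (⟨β, hβ, h⟩ | ⟨p, hp, h⟩)
        · exact Or.inl ⟨β, hleaf β s t (List.mem_append_left _ hβ), h⟩
        · refine Or.inr ⟨p, hp, hspan p hp _ ?_⟩
          rw [span_par_left (hdis p hp (occurs_of_span h)), h]
      · have := ih (by omega) (hck.right hrk) (fun p => (hrk p).2.1) (true :: γ) l' r' hab
        refine Relation.ReflTransGen.mono ?_ _ _ this
        rintro s t (⟨β, hβ, h⟩ | ⟨p, hp, h⟩)
        · exact Or.inl ⟨β, hleaf β s t (List.mem_append_right _ hβ), h⟩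
        · refine Or.inr ⟨p, hp, hspan p hp _ ?_⟩
          rw [span_par_right (fun h' => hdis p hp h' (occurs_of_span h)), h]
  -- The walk from left to right. Its invariant is that no open prefix is full on both sides of the
  -- current place, so the open prefixes that are full in the next alternative start exactly here.
  have main : ∀ d k, k + d = Ω.slotCount →
      (∀ p, U p → k < Ω.slotCount → 0 < k → (Ω.slot α (k - 1)).1.Full p →
        ¬ (Ω.slot α k).1.Full p) →
      Relation.ReflTransGen (Ω.Step U V α l r) (Ω.slotPos α l r k) r := by
    intro d
    induction d using Nat.strong_induction_on with
    | _ d ihd =>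
    intro k hk hinv
    rcases Nat.eq_zero_or_pos d with rfl | hd
    · rw [Nat.add_zero] at hk
      rw [hk, slotPos_slotCount]
    have hk' : k < Ω.slotCount := by omega
    by_cases hU : ∃ p, U p ∧ (Ω.slot α k).1.Full p
    · have hP : ∃ m, ∃ p, U p ∧ (Ω.slot α k).1.Full p ∧ (Ω.slot α (k + m)).1.Full p ∧
          k + m < Ω.slotCount := by
        obtain ⟨p, hp, hf⟩ := hU
        exact ⟨0, p, hp, hf, hf, hk'⟩
      classical
      -- Among the open prefixes that start here, take one that reaches farthest.
      obtain ⟨m, ⟨p, hp, hf, hfm, hm⟩, hmax⟩ : ∃ m, (∃ p, U p ∧ (Ω.slot α k).1.Full p ∧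
          (Ω.slot α (k + m)).1.Full p ∧ k + m < Ω.slotCount) ∧
          ∀ m', (∃ p, U p ∧ (Ω.slot α k).1.Full p ∧ (Ω.slot α (k + m')).1.Full p ∧
            k + m' < Ω.slotCount) → m' ≤ m := by
        obtain ⟨m₀, hm₀⟩ := hP
        refine ⟨_, Nat.findGreatest_spec (P := fun m => ∃ p, U p ∧ (Ω.slot α k).1.Full p ∧
          (Ω.slot α (k + m)).1.Full p ∧ k + m < Ω.slotCount) (n := Ω.slotCount)
          (by obtain ⟨_, _, _, _, h⟩ := hm₀; omega : m₀ ≤ _) hm₀, fun m' hm' => ?_⟩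
        exact Nat.le_findGreatest (by obtain ⟨_, _, _, _, h⟩ := hm'; omega) hm'
      have hstep : Ω.Step U V α l r (Ω.slotPos α l r k) (Ω.slotPos α l r (k + m + 1)) := by
        right
        refine ⟨p, hp, ?_⟩
        rcases (hr p).exists_run (occurs_slot α hk' hf.occurs) α l r with
          ⟨j, -, h1, h2⟩ | ⟨s, t, hst, ht, h1, h2, h3⟩
        · obtain rfl := h1 k hk' hf.occurs
          have := h1 (k + m) hm hfm.occurs
          rw [h2, this]
          exact hf.span _ _ _
        · have a1 := h1 k hk' hf.occurs
          have a2 := h1 (k + m) hm hfm.occurs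
          have hs : s = k := by
            by_contra hne
            exact hinv p hp hk' (by omega) (h2 (k - 1) (by omega) (by omega) (by omega)) hf
          have htm : t = k + m := by
            have := hmax (t - k) ⟨p, hp, hf, h2 _ (by omega) (by omega) (by omega), by omega⟩
            omega
          rw [h3, hs, htm]
      refine Relation.ReflTransGen.head hstep (ihd (d - (m + 1)) (by omega) (k + m + 1) (by omega) ?_)
      intro p' hp' hlt _ h1 h2
      rw [Nat.add_sub_cancel] at h1
      by_cases hfk : (Ω.slot α k).1.Full p'
      · have := hmax (m + 1) ⟨p', hp', hfk, h2, hlt⟩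
        omega
      · have hm0 : 0 < m := by
          rcases Nat.eq_zero_or_pos m with rfl | h
          · exact absurd h1 hfk
          · exact h
        -- An open prefix that spans the landing place either starts no later than the one just
        -- used, against its maximality, or its run crosses that run.
        refine hc.not_crossing hM hr α (i := k) (j := k + m) (k := k + m + 1) (by omega) (by omega)
          hlt hf hfm (fun h => ?_) hfk h1 h2
        have := hmax (m + 1) ⟨p, hp, hf, h, hlt⟩
        omega
    · push Not at hU
      refine (item k hk' hU).trans (ihd (d - 1) (by omega) (k + 1) (by omega) ?_)
      intro p hp _ _ h
      exact absurd h (by simpa using hU p hp)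
  simpa using main Ω.slotCount 0 (by omega) (by intro p _ _ h; omega)

end Ordering

end CQ

/-! ## Meaning and length of factorizations -/

namespace Form

variable {T : Type}

theorem holds_bigAnd {ν : T → Prop} {l : List (Form T)} :
    (bigAnd l).Holds ν ↔ ∀ φ ∈ l, φ.Holds ν := by
  induction l with
  | nil => simp [bigAnd, Holds]
  | cons φ l ih =>
    cases l with
    | nil => simp [bigAnd]
    | cons ψ l => rw [bigAnd, Holds, ih, List.forall_mem_cons (a := φ)]

theorem holds_bigOr {ν : T → Prop} {l : List (Form T)} :
    (bigOr l).Holds ν ↔ ∃ φ ∈ l, φ.Holds ν := by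
  induction l with
  | nil => simp [bigOr, Holds]
  | cons φ l ih =>
    cases l with
    | nil => simp [bigOr]
    | cons ψ l => rw [bigOr, Holds, ih]; simp

theorem len_bigAnd (l : List (Form T)) : (bigAnd l).len = (l.map len).sum := by
  induction l with
  | nil => rfl
  | cons φ l ih =>
    cases l with
    | nil => simp [bigAnd]
    | cons ψ l =>
      rw [List.map_cons, List.sum_cons, ← ih]
      simp [len, bigAnd, lits]

theorem len_bigOr (l : List (Form T)) : (bigOr l).len = (l.map len).sum := by
  induction l with
  | nil => rfl
  | cons φ l ih =>
    cases l with
    | nil => simp [bigOr]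
    | cons ψ l =>
      rw [List.map_cons, List.sum_cons, ← ih]
      simp [len, bigOr, lits]

/-- The truth value depends on the tokens of the literals only. -/
theorem holds_congr {ν ν' : T → Prop} {φ : Form T} (h : ∀ t ∈ φ.lits, ν t → ν' t)
    (hφ : φ.Holds ν) : φ.Holds ν' := by
  induction φ with
  | bot => exact hφ
  | top => trivial
  | lit t => exact h t (by simp [lits]) hφ
  | and φ ψ ih1 ih2 =>
    exact ⟨ih1 (fun t ht => h t (by simp [lits, ht])) hφ.1,
      ih2 (fun t ht => h t (by simp [lits, ht])) hφ.2⟩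
  | or φ ψ ih1 ih2 =>
    exact hφ.imp (ih1 (fun t ht => h t (by simp [lits, ht])))
      (ih2 (fun t ht => h t (by simp [lits, ht])))

end Form

/-- A sum over a list can be split by the values of a key. -/
theorem List.sum_map_filter_key {A B : Type*} [DecidableEq B] (key : A → B) (g : A → ℕ)
    {ks : List B} (hks : ks.Nodup) {l : List A} (hl : ∀ a ∈ l, key a ∈ ks) :
    (ks.map fun k => ((l.filter fun a => decide (key a = k)).map g).sum).sum = (l.map g).sum := by
  induction l with
  | nil => simp
  | cons a l ih =>
    have h1 : ∀ k, (((a :: l).filter fun a => decide (key a = k)).map g).sum =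
        (if k = key a then g a else 0) + ((l.filter fun a => decide (key a = k)).map g).sum := by
      intro k
      by_cases h : key a = k
      · simp [h]
      · simp [h, Ne.symm h]
    simp only [h1, List.sum_map_add]
    rw [ih fun a' ha' => hl a' (List.mem_cons_of_mem _ ha'), List.map_cons, List.sum_cons]
    congr 1
    rw [← List.sum_toFinset _ hks, Finset.sum_ite_eq', if_pos]
    simpa using hl a (by simp)

namespace CQ

variable {Q : CQ}

/-- The token of atom `i` that the witness `w` uses. -/
def tok (Q : CQ) (w : Q.Valuation) (i : Q.Atom) : Q.Token := ⟨i, fun j => w (Q.args i j)⟩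

theorem tok_eq_iff {w u : Q.Valuation} {i : Q.Atom} :
    Q.tok w i = Q.tok u i ↔ ∀ x ∈ Q.vars i, w x = u x := by
  simp only [tok, Sigma.mk.injEq, heq_eq_eq, true_and, funext_iff, vars, Finset.mem_image,
    Finset.mem_univ, true_and, forall_exists_index, forall_apply_eq_imp_iff]

/-- The restriction to the active domain is automatic, since every variable occurs in some atom. -/
theorem mem_witnesses {D : Q.Database} {w : Q.Valuation} :
    w ∈ Q.witnesses D ↔ ∀ i, (fun j => w (Q.args i j)) ∈ D i := by
  simp only [witnesses, Finset.mem_filter, Fintype.mem_piFinset, and_iff_right_iff_imp]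
  intro h x
  obtain ⟨i, j, rfl⟩ := Q.covers x
  simp only [adom, Finset.mem_biUnion, Finset.mem_univ, true_and]
  exact ⟨i, _, h i, Finset.mem_image.2 ⟨j, Finset.mem_univ _, rfl⟩⟩

/-- Being a witness is checked atom by atom. This allows gluing of witnesses. -/
theorem witness_of_tok {D : Q.Database} {u : Q.Valuation}
    (h : ∀ i, ∃ w ∈ Q.witnesses D, Q.tok u i = Q.tok w i) : u ∈ Q.witnesses D := by
  rw [mem_witnesses]
  intro i
  obtain ⟨w, hw, hi⟩ := h i
  have := mem_witnesses.1 hw i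
  simp only [tok, Sigma.mk.injEq, heq_eq_eq, true_and] at hi
  rwa [hi]

theorem holds_provenance {D : Q.Database} {ν : Q.Token → Prop} :
    (Q.provenance D).Holds ν ↔ ∃ w ∈ Q.witnesses D, ∀ i, ν (Q.tok w i) := by
  simp only [provenance, Form.holds_bigOr, List.mem_map, Finset.mem_toList]
  constructor
  · rintro ⟨_, ⟨w, hw, rfl⟩, h⟩
    rw [Form.holds_bigAnd] at h
    exact ⟨w, hw, fun i => h _ (List.mem_map.2 ⟨i, List.mem_finRange i, rfl⟩)⟩
  · rintro ⟨w, hw, h⟩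
    refine ⟨_, ⟨w, hw, rfl⟩, Form.holds_bigAnd.2 fun φ hφ => ?_⟩
    obtain ⟨i, -, rfl⟩ := List.mem_map.1 hφ
    exact h i

theorem inst_apply {w : Q.Valuation} {p : Q.Path} {x : Q.Var} (hx : x ∈ Q.pathVars p) :
    (Q.inst w p).2 x = some (w x) := if_pos hx

theorem inst_eq_iff {w u : Q.Valuation} {p : Q.Path} :
    Q.inst w p = Q.inst u p ↔ ∀ x ∈ Q.pathVars p, w x = u x := by
  constructor
  · intro h x hx
    have := congrFun (congrArg Prod.snd h) x
    rwa [inst_apply hx, inst_apply hx, Option.some.injEq] at this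
  · intro h
    refine Prod.ext rfl (funext fun x => ?_)
    by_cases hx : x ∈ Q.pathVars p
    · rw [inst_apply hx, inst_apply hx, h x hx]
    · simp [inst, hx]

theorem mem_prefixInstances {D : Q.Database} {f : Q.Valuation → Q.Tree} {π : Q.PInst} :
    π ∈ Q.prefixInstances D f ↔ ∃ w ∈ Q.witnesses D, ∃ p ∈ f w, Q.inst w p = π := by
  simp [prefixInstances]

theorem isChild_inst {w u : Q.Valuation} {p p' : Q.Path} :
    Q.IsChild (Q.inst w p) (Q.inst u p') ↔
      (∃ S, p' = p ++ [S]) ∧ ∀ x ∈ Q.pathVars p, u x = w x := by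
  refine and_congr_right fun ⟨S, h⟩ => forall₂_congr fun x hx => ?_
  have h : p' = p ++ [S] := h
  have hx : x ∈ Q.pathVars p := hx
  have hx' : x ∈ Q.pathVars p' := by rw [h]; simp [hx]
  rw [inst_apply hx, inst_apply hx', Option.some.injEq]

/-- Atom `i` has a variable at or below the last node of `p`. -/
def Touches (Q : CQ) (p : Q.Path) (i : Q.Atom) : Prop := ∃ x ∈ Q.vars i, x ∈ Q.below p

theorem holds_tokensAt {w : Q.Valuation} {p : Q.Path} {ν : Q.Token → Prop} :
    (∀ φ ∈ Q.tokensAt (Q.inst w p), φ.Holds ν) ↔ ∀ i ∈ Q.tablesAt p, ν (Q.tok w i) := by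
  have key : ∀ i ∈ Q.tablesAt p, (⟨i, fun j => ((Q.inst w p).2 (Q.args i j)).getD 0⟩ : Q.Token) =
      Q.tok w i := by
    intro i hi
    simp only [tok, Sigma.mk.injEq, heq_eq_eq, true_and]
    funext j
    rw [inst_apply ((mem_tablesAt.1 hi).1 (Finset.mem_image_of_mem _ (Finset.mem_univ j)))]
    rfl
  constructor
  · intro h i hi
    have := h _ (List.mem_map.2 ⟨i, by
      rw [List.mem_filter]
      exact ⟨List.mem_finRange i, decide_eq_true (show i ∈ Q.tablesAt (Q.inst w p).1 from hi)⟩,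
      rfl⟩)
    rwa [key i hi] at this
  · intro h φ hφ
    obtain ⟨i, hi, rfl⟩ := List.mem_map.1 hφ
    have hi : i ∈ Q.tablesAt (Q.inst w p).1 := of_decide_eq_true (List.mem_filter.1 hi).2
    change i ∈ Q.tablesAt p at hi
    rw [key i hi]
    exact h i hi

/-- An atom that touches the component at the last node of `p` has no variables outside of this
component except on the path above it. If none of its variables remains below the last label, its
table prefix is `p`. -/
theorem tablesAt_of_touches {v : Q.Tree} (hv : Q.IsCanonical v) {p : Q.Path} (hp : p ∈ v)
    {i : Q.Atom} (hi : Q.Touches p i) (h : ∀ x ∈ Q.vars i, x ∈ Q.below p → x ∈ Q.pathVars p) :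
    i ∈ Q.tablesAt p := by
  rcases List.eq_nil_or_concat p with rfl | ⟨p, S, rfl⟩
  · exact absurd hp hv.nil_notMem
  rw [List.concat_eq_append] at *
  obtain ⟨x, hx, hxp⟩ := hi
  have hxn := hv.notMem_of_mem_below hp hxp
  refine mem_tablesAt_concat.2 ⟨fun z hz => ?_, fun h' => hxn (h' hx)⟩
  rw [← pathVars_concat]
  by_cases hzp : z ∈ Q.pathVars p
  · simp [hzp]
  · refine h z hz ?_
    rw [below_concat] at hxp ⊢
    exact mem_component_of_conn hxp (Conn.of_atom hxn hzp hx hz)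

theorem touches_of_mem_tablesAt {p : Q.Path} {i : Q.Atom} (hi : i ∈ Q.tablesAt p) :
    Q.Touches p i := by
  rcases List.eq_nil_or_concat p with rfl | ⟨p, S, rfl⟩
  · exact absurd hi not_mem_tablesAt_nil
  rw [List.concat_eq_append] at *
  obtain ⟨y, hy, hyS⟩ := exists_mem_of_mem_tablesAt hi
  exact ⟨y, hy, by rw [below_concat]; exact subset_component hyS⟩

/-- `f` chooses a canonical tree for each witness. -/
def IsCanonicalChoice (Q : CQ) (D : Q.Database) (f : Q.Valuation → Q.Tree) : Prop :=
  ∀ w ∈ Q.witnesses D, Q.IsCanonical (f w)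

section Meaning

variable {D : Q.Database} {f : Q.Valuation → Q.Tree} (hf : Q.IsCanonicalChoice D f)
  {L : List Q.PInst} (hL : ∀ π, π ∈ L ↔ π ∈ Q.prefixInstances D f)

include hf hL

/-- The disjuncts for different components may come from different witnesses with different trees.
They all agree on the path, and each atom outside of it meets only one component, so they can be
glued to one witness. The assumption on `k` ensures that the depth bound of `factorAt` never cuts
off the formula. -/
theorem exists_witness_of_holds {ν : Q.Token → Prop} (k : ℕ) {w : Q.Valuation}
    (hw : w ∈ Q.witnesses D) {p : Q.Path} (hp : p ∈ f w) (hk : Q.numVars < k + p.length)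
    (h : (Q.factorAt L k (Q.inst w p)).Holds ν) :
    ∃ u ∈ Q.witnesses D, (∀ x ∈ Q.pathVars p, u x = w x) ∧
      ∀ i, Q.Touches p i → ν (Q.tok u i) := by
  classical
  induction k generalizing w p with
  | zero => exact absurd ((hf w hw).isLegal hp).length_le (by omega)
  | succ k ih =>
    have hv := hf w hw
    rw [factorAt, Form.holds_bigAnd] at h
    have htab := holds_tokensAt.1 fun φ hφ => h φ (List.mem_append_left _ hφ)
    have hex : ∀ K, K ∈ Q.componentsBelow p → ∃ u ∈ Q.witnesses D,
        (∀ x ∈ Q.pathVars p, u x = w x) ∧ ∀ i, (∃ x ∈ Q.vars i, x ∈ K) → ν (Q.tok u i) := by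
      intro K hK
      obtain ⟨S, hS, hSK⟩ := hv.exists_child (Or.inr hp) hK
      have hSL : Q.inst w (p ++ [S]) ∈ L := (hL _).2 (mem_prefixInstances.2 ⟨w, hw, _, hS, rfl⟩)
      have hSc : Q.IsChild (Q.inst w p) (Q.inst w (p ++ [S])) :=
        isChild_inst.2 ⟨⟨S, rfl⟩, fun _ _ => rfl⟩
      have := h _ (List.mem_append_right _ (List.mem_map.2 ⟨K, List.mem_dedup.2 (List.mem_map.2
        ⟨Q.inst w (p ++ [S]), by simp [hSL, hSc], by simp [inst, hSK]⟩), rfl⟩))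
      obtain ⟨φ, hφ, hφ'⟩ := Form.holds_bigOr.1 this
      obtain ⟨π, hπ, rfl⟩ := List.mem_map.1 hφ
      simp only [List.mem_filter, decide_eq_true_eq] at hπ
      obtain ⟨u, hu, p', hp', rfl⟩ := mem_prefixInstances.1 ((hL _).1 hπ.1.1)
      obtain ⟨⟨S', rfl⟩, hag⟩ := isChild_inst.1 hπ.1.2
      have hK' : Q.component (Q.pathVars p) S' = K := by simpa [inst] using hπ.2
      obtain ⟨u', hu', hag', hν⟩ := ih hu hp' (by simp; omega) hφ'
      refine ⟨u', hu', fun x hx => ?_, fun i ⟨x, hx, hxK⟩ => hν i ⟨x, hx, ?_⟩⟩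
      · rw [hag' x (by simp [hx]), hag x hx]
      · rw [below_concat, hK']; exact hxK
    choose! g hgW hga hgν using hex
    let cls : Q.Var → Set Q.Var := fun x => {z | Q.Conn (Q.pathVars p) x z}
    have hcls : ∀ {x}, x ∈ Q.below p → x ∉ Q.pathVars p → cls x ∈ Q.componentsBelow p :=
      fun hx hx' => mem_componentsBelow.2 ⟨_, hx, hx', rfl⟩
    -- On each component below `p` use the witness found for it, and `w` elsewhere.
    let u : Q.Valuation := fun x => if x ∈ Q.below p ∧ x ∉ Q.pathVars p then g (cls x) x else w x
    have hu1 : ∀ i y, y ∈ Q.vars i → y ∈ Q.below p → y ∉ Q.pathVars p →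
        Q.tok u i = Q.tok (g (cls y)) i := by
      intro i y hy hyp hyn
      rw [tok_eq_iff]
      intro x hx
      by_cases hxp : x ∈ Q.pathVars p
      · rw [hga _ (hcls hyp hyn) x hxp]
        simp [u, hxp]
      · have hc : Q.Conn (Q.pathVars p) y x := Conn.of_atom hyn hxp hy hx
        have hxb := mem_below_of_conn hyp hc
        have : cls x = cls y := by
          ext z; exact ⟨fun h => Conn.trans hc h, fun h => Conn.trans hc.symm h⟩
        simp [u, hxp, hxb, this]
    have hu2 : ∀ i, (∀ x ∈ Q.vars i, x ∈ Q.below p → x ∈ Q.pathVars p) →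
        Q.tok u i = Q.tok w i := by
      intro i hi
      rw [tok_eq_iff]
      intro x hx
      have : ¬ (x ∈ Q.below p ∧ x ∉ Q.pathVars p) := fun h => h.2 (hi x hx h.1)
      simp only [u, if_neg this]
    refine ⟨u, witness_of_tok fun i => ?_, fun x hx => by simp [u, hx], fun i hi => ?_⟩
    · by_cases hi : ∀ x ∈ Q.vars i, x ∈ Q.below p → x ∈ Q.pathVars p
      · exact ⟨w, hw, hu2 i hi⟩
      · push Not at hi
        obtain ⟨y, hy, hyp, hyn⟩ := hi
        exact ⟨_, hgW _ (hcls hyp hyn), hu1 i y hy hyp hyn⟩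
    · by_cases hi' : ∀ x ∈ Q.vars i, x ∈ Q.below p → x ∈ Q.pathVars p
      · rw [hu2 i hi']
        exact htab i (tablesAt_of_touches hv hp hi hi')
      · push Not at hi'
        obtain ⟨y, hy, hyp, hyn⟩ := hi'
        rw [hu1 i y hy hyp hyn]
        exact hgν _ (hcls hyp hyn) i ⟨y, hy, Conn.refl y⟩

/-- A component may enter the conjunction because of another witness. The tree of `w` has a child
for this component as well, and its disjunct is the one that holds. -/
theorem holds_of_witness {ν : Q.Token → Prop} (k : ℕ) {w : Q.Valuation}
    (hw : w ∈ Q.witnesses D) {p : Q.Path} (hp : p ∈ f w) (hk : Q.numVars < k + p.length)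
    (h : ∀ i, Q.Touches p i → ν (Q.tok w i)) : (Q.factorAt L k (Q.inst w p)).Holds ν := by
  classical
  induction k generalizing p with
  | zero => exact absurd ((hf w hw).isLegal hp).length_le (by omega)
  | succ k ih =>
    have hv := hf w hw
    rw [factorAt, Form.holds_bigAnd]
    intro φ hφ
    rcases List.mem_append.1 hφ with hφ | hφ
    · exact holds_tokensAt.2 (fun i hi => h i (touches_of_mem_tablesAt hi)) φ hφ
    · obtain ⟨K, hK, rfl⟩ := List.mem_map.1 hφ
      obtain ⟨π, hπ, rfl⟩ := List.mem_map.1 (List.mem_dedup.1 hK)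
      simp only [List.mem_filter, decide_eq_true_eq] at hπ
      obtain ⟨u, hu, p', hp', rfl⟩ := mem_prefixInstances.1 ((hL _).1 hπ.1)
      obtain ⟨⟨S', rfl⟩, -⟩ := isChild_inst.1 hπ.2
      obtain ⟨S, hS, hSK⟩ := hv.exists_child (Or.inr hp) ((hf u hu).component_mem hp')
      have hSL : Q.inst w (p ++ [S]) ∈ L := (hL _).2 (mem_prefixInstances.2 ⟨w, hw, _, hS, rfl⟩)
      have hSc : Q.IsChild (Q.inst w p) (Q.inst w (p ++ [S])) :=
        isChild_inst.2 ⟨⟨S, rfl⟩, fun _ _ => rfl⟩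
      refine Form.holds_bigOr.2 ⟨_, List.mem_map.2 ⟨Q.inst w (p ++ [S]), ?_, rfl⟩, ?_⟩
      · simp only [List.mem_filter, decide_eq_true_eq]
        exact ⟨⟨hSL, hSc⟩, by simp [inst, hSK]⟩
      · refine ih hS (by simp; omega) fun i ⟨x, hx, hxb⟩ => h i ⟨x, hx, ?_⟩
        exact hv.below_anti (List.prefix_append _ _) (Or.inr hS) hxb

/-- Each atom touches the part below the root, because the query is connected and every atom has a
variable. Roots have length `1`, so the depth `Q.numVars` is just enough. -/
theorem factor_equivalent (hQ : Q.Connected) (hvar : 0 < Q.numVars) :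
    (Q.factor L).Equivalent (Q.provenance D) := by
  intro ν
  rw [holds_provenance, factor, Form.holds_bigOr]
  have hroot : ∀ {w S}, w ∈ Q.witnesses D → [S] ∈ f w → ∀ i, Q.Touches [S] i := by
    intro w S hw hS i
    obtain ⟨x, hx⟩ := vars_nonempty hQ hvar i
    obtain ⟨s, hs⟩ := ((hf w hw).label [] S hS).nonempty
    refine ⟨x, hx, ?_⟩
    rw [← List.nil_append [S], below_concat]
    exact ⟨s, hs, hQ.conn s x⟩
  constructor
  · rintro ⟨φ, hφ, h⟩
    obtain ⟨π, hπ, rfl⟩ := List.mem_map.1 hφ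
    simp only [List.mem_filter, decide_eq_true_eq] at hπ
    obtain ⟨w, hw, p, hp, rfl⟩ := mem_prefixInstances.1 ((hL _).1 hπ.1)
    obtain ⟨S, rfl⟩ := List.length_eq_one_iff.1 hπ.2
    obtain ⟨u, hu, -, hν⟩ := exists_witness_of_holds hf hL Q.numVars hw hp (by simp) h
    exact ⟨u, hu, fun i => hν i (hroot hw hp i)⟩
  · rintro ⟨w, hw, h⟩
    obtain ⟨S, ⟨hS, -⟩, -⟩ := (hf w hw).child [] (Or.inl rfl) ⟨0, hvar⟩ (by simp) (by simp)
    refine ⟨_, List.mem_map.2 ⟨Q.inst w [S], ?_, rfl⟩,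
      holds_of_witness hf hL Q.numVars hw hS (by simp) fun i _ => h i⟩
    simp only [List.mem_filter, decide_eq_true_eq]
    exact ⟨(hL _).2 (mem_prefixInstances.2 ⟨w, hw, _, hS, rfl⟩), rfl⟩

end Meaning

/-! ### The length of a factorization and the weight of the selected nodes. -/

theorem len_tokensAt (π : Q.PInst) :
    ((Q.tokensAt π).map Form.len).sum = (Q.tablesAt π.1).card := by
  have h : (Q.tokensAt π).map Form.len =
      ((List.finRange Q.numAtoms).filter fun i => decide (i ∈ Q.tablesAt π.1)).map fun _ => 1 := by
    rw [tokensAt, List.map_map]; rfl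
  rw [h, List.map_const', List.sum_replicate, smul_eq_mul, mul_one, ← List.toFinset_card_of_nodup
    ((List.nodup_finRange _).filter _)]
  congr 1
  ext i
  simp

-- Grouping the children by components changes the shape of the formula, but not the sum of the
-- lengths.
open Classical in
theorem len_factorAt_succ (L : List Q.PInst) (k : ℕ) (π : Q.PInst) :
    (Q.factorAt L (k + 1) π).len = (Q.tablesAt π.1).card +
      ((L.filter fun π' => decide (Q.IsChild π π')).map fun π' => (Q.factorAt L k π').len).sum := by
  rw [factorAt, Form.len_bigAnd, List.map_append, List.sum_append, len_tokensAt, List.map_map]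
  congr 1
  have : (Form.len ∘ fun K => Form.bigOr (((L.filter fun π' => decide (Q.IsChild π π')).filter
        fun π' => decide (Q.component (Q.pathVars π.1) (π'.1.getLastD ∅) = K)).map
          (Q.factorAt L k))) =
      fun K => (((L.filter fun π' => decide (Q.IsChild π π')).filter
        fun π' => decide (Q.component (Q.pathVars π.1) (π'.1.getLastD ∅) = K)).map
          fun π' => (Q.factorAt L k π').len).sum := by
    funext K
    rw [Function.comp_apply, Form.len_bigOr, List.map_map]
    rfl
  rw [this]
  refine List.sum_map_filter_key _ _ (List.nodup_dedup _) fun a ha => ?_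
  exact List.mem_dedup.2 (List.mem_map_of_mem ha)

/-- Each prefix instance in use beyond the roots is the child of exactly one instance in use, so its
literals are written exactly once. -/
theorem len_factor {D : Q.Database} {f : Q.Valuation → Q.Tree} (hf : Q.IsCanonicalChoice D f)
    {L : List Q.PInst} (hn : L.Nodup) (hL : ∀ π, π ∈ L ↔ π ∈ Q.prefixInstances D f) :
    (Q.factor L).len = ∑ π ∈ Q.prefixInstances D f, (Q.tablesAt π.1).card := by
  classical
  set P := Q.prefixInstances D f with hP
  have hsum : ∀ (c : Q.PInst → Prop) [DecidablePred c] (g : Q.PInst → ℕ),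
      ((L.filter fun π => decide (c π)).map g).sum = ∑ π ∈ P.filter c, g π := by
    intro c _ g
    rw [← List.sum_toFinset _ (hn.filter _)]
    congr 1
    ext π
    simp [hL]
  have hlen : ∀ π ∈ P, 1 ≤ π.1.length ∧ π.1.length ≤ Q.numVars := by
    intro π hπ
    obtain ⟨w, hw, p, hp, rfl⟩ := mem_prefixInstances.1 hπ
    exact ⟨List.length_pos_iff.2 ((hf w hw).ne_nil hp), ((hf w hw).isLegal hp).length_le⟩
  -- The total length of the factors at level `j` counts the tables of all instances at level `j` or
  -- deeper.
  have key : ∀ k j, 1 ≤ j → Q.numVars < k + j →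
      ∑ π ∈ P.filter (fun π => π.1.length = j), (Q.factorAt L k π).len =
        ∑ π ∈ P.filter (fun π => j ≤ π.1.length), (Q.tablesAt π.1).card := by
    intro k
    induction k with
    | zero =>
      intro j _ hj
      rw [Finset.filter_false_of_mem, Finset.filter_false_of_mem, Finset.sum_empty, Finset.sum_empty]
      · intro π hπ h
        have := (hlen π hπ).2
        omega
      · intro π hπ h
        have := (hlen π hπ).2
        omega
    | succ k ih =>
      intro j hj hk
      simp only [len_factorAt_succ, Finset.sum_add_distrib, hsum]
      rw [Finset.sum_comm' (t' := P.filter fun π => π.1.length = j + 1)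
        (s' := fun π' => P.filter fun π => π.1.length = j ∧ Q.IsChild π π')]
      -- The parent is the same valuation restricted to the shorter path, so it is unique even if
      -- several witnesses use it.
      · have hone : ∀ π' ∈ P.filter (fun π => π.1.length = j + 1),
            (P.filter fun π => π.1.length = j ∧ Q.IsChild π π').card = 1 := by
          intro π' hπ'
          rw [Finset.mem_filter] at hπ'
          obtain ⟨w, hw, p, hp, rfl⟩ := mem_prefixInstances.1 hπ'.1
          rcases List.eq_nil_or_concat p with rfl | ⟨p, S, rfl⟩
          · exact absurd hp (hf w hw).nil_notMem
          rw [List.concat_eq_append] at *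
          have hpl : p.length = j := by simpa [inst] using hπ'.2
          have hpw : p ∈ f w := ((hf w hw).parent p S hp).resolve_left
            (by rintro rfl; simp at hpl; omega)
          refine Finset.card_eq_one.2 ⟨Q.inst w p, ?_⟩
          ext π
          rw [Finset.mem_filter, Finset.mem_singleton]
          constructor
          · rintro ⟨hπ, -, hc⟩
            obtain ⟨u, hu, p', hp', rfl⟩ := mem_prefixInstances.1 hπ
            obtain ⟨⟨T, hT⟩, hag⟩ := isChild_inst.1 hc
            obtain ⟨rfl, -⟩ := List.append_inj' hT rfl
            exact inst_eq_iff.2 fun x hx => (hag x hx).symm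
          · rintro rfl
            exact ⟨mem_prefixInstances.2 ⟨w, hw, p, hpw, rfl⟩, hpl,
              isChild_inst.2 ⟨⟨S, rfl⟩, fun _ _ => rfl⟩⟩
        have hrw : ∑ π' ∈ P.filter (fun π => π.1.length = j + 1),
            ∑ _π ∈ P.filter (fun π => π.1.length = j ∧ Q.IsChild π π'), (Q.factorAt L k π').len =
            ∑ π' ∈ P.filter (fun π => π.1.length = j + 1), (Q.factorAt L k π').len :=
          Finset.sum_congr rfl fun π' hπ' => by
            rw [Finset.sum_const, hone π' hπ', one_smul]
        rw [hrw, ih (j + 1) (by omega) (by omega), ← Finset.sum_union]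
        · refine Finset.sum_congr ?_ fun _ _ => rfl
          ext π
          simp only [Finset.mem_union, Finset.mem_filter, ← and_or_left]
          exact and_congr_right fun _ => by omega
        · refine Finset.disjoint_filter.2 fun π _ h h' => by omega
      · intro π π'
        simp only [Finset.mem_filter]
        constructor
        · rintro ⟨⟨h1, h2⟩, h3, h4⟩
          obtain ⟨⟨S, hS⟩, -⟩ := id h4
          exact ⟨⟨h1, h2, h4⟩, h3, by rw [hS]; simp [h2]⟩
        · rintro ⟨⟨h1, h2, h3⟩, h4, -⟩
          exact ⟨⟨h1, h2⟩, h4, h3⟩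
  rw [factor, Form.len_bigOr, List.map_map]
  have := hsum (fun π => π.1.length = 1) (Form.len ∘ Q.factorAt L Q.numVars)
  rw [this]
  have := key Q.numVars 1 le_rfl (by omega)
  simp only [Function.comp_apply]
  rw [this, Finset.filter_true_of_mem fun π hπ => (hlen π hπ).1]

/-- Plan nodes weigh nothing, and a prefix without tables contributes nothing to either side. -/
theorem cutWeight_selected (Ω : Q.Ordering) (D : Q.Database) (f : Q.Valuation → Q.Tree) :
    Ordering.cutWeight (Ω.selected D f) = ∑ π ∈ Q.prefixInstances D f, (Q.tablesAt π.1).card := by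
  classical
  rw [Ordering.cutWeight, finsum_mem_eq_sum_of_inter_support_eq (t :=
    (Q.prefixInstances D f).image FlowNode.pre)]
  · rw [Finset.sum_image fun a _ b _ h => by simpa using h]
    rfl
  · ext n
    simp only [Set.mem_inter_iff, Function.mem_support, Finset.coe_image, Set.mem_image,
      Finset.mem_coe]
    refine and_congr_left fun hn => ?_
    constructor
    · rintro ⟨w, hw, ⟨c, -, -, α, -, rfl⟩ | ⟨p, hp, -, rfl⟩⟩
      · exact absurd rfl hn
      · exact ⟨_, mem_prefixInstances.2 ⟨w, hw, p, hp, rfl⟩, rfl⟩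
    · rintro ⟨π, hπ, rfl⟩
      obtain ⟨w, hw, p, hp, rfl⟩ := mem_prefixInstances.1 hπ
      exact ⟨w, hw, Or.inr ⟨p, hp, Finset.card_pos.1 (Nat.pos_of_ne_zero hn), rfl⟩⟩

/-! ### The tokens that occur in witnesses -/

open Classical in
/-- The tokens of the provenance. -/
noncomputable def tokens (Q : CQ) (D : Q.Database) : Finset Q.Token :=
  (Q.witnesses D).biUnion fun w => Finset.univ.image (Q.tok w)

theorem mem_tokens {D : Q.Database} {t : Q.Token} :
    t ∈ Q.tokens D ↔ ∃ w ∈ Q.witnesses D, ∃ i, Q.tok w i = t := by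
  simp [tokens]

/-- In the world that consists of the tokens of `w`, the token of atom `i` is indispensable: any
witness there would need a token for `i`, and there is no other one. A formula that does not mention
it could not notice its removal. -/
theorem mem_lits_of_equivalent {D : Q.Database} {χ : Form Q.Token}
    (h : χ.Equivalent (Q.provenance D)) {t : Q.Token} (ht : t ∈ Q.tokens D) : t ∈ χ.lits := by
  by_contra hn
  obtain ⟨w, hw, i, rfl⟩ := mem_tokens.1 ht
  have h1 := (h fun t => ∃ j, t = Q.tok w j).2 (holds_provenance.2 ⟨w, hw, fun j => ⟨j, rfl⟩⟩)
  have h2 : χ.Holds fun t => (∃ j, t = Q.tok w j) ∧ t ≠ Q.tok w i :=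
    Form.holds_congr (fun t ht h => ⟨h, fun h' => hn (h' ▸ ht)⟩) h1
  obtain ⟨u, -, hu⟩ := holds_provenance.1 ((h _).1 h2)
  obtain ⟨⟨j, hj⟩, hne⟩ := hu i
  have : i = j := congrArg Sigma.fst hj
  exact hne (this ▸ hj)

theorem card_tokens_le {D : Q.Database} {χ : Form Q.Token}
    (h : χ.Equivalent (Q.provenance D)) : (Q.tokens D).card ≤ χ.len := by
  classical
  calc (Q.tokens D).card ≤ χ.lits.toFinset.card :=
        Finset.card_le_card fun t ht => List.mem_toFinset.2 (mem_lits_of_equivalent h ht)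
    _ ≤ χ.len := List.toFinset_card_le _

theorem inReadOnceForm_of_len_le {D : Q.Database} {χ : Form Q.Token}
    (h : χ.Equivalent (Q.provenance D)) (hl : χ.len ≤ (Q.tokens D).card) : χ.InReadOnceForm := by
  classical
  have h1 : (Q.tokens D).card ≤ χ.lits.toFinset.card :=
    Finset.card_le_card fun t ht => List.mem_toFinset.2 (mem_lits_of_equivalent h ht)
  have h2 : χ.lits.toFinset.card = χ.lits.length :=
    le_antisymm (List.toFinset_card_le _) (hl.trans h1)
  exact Multiset.toFinset_card_eq_card_iff_nodup.1 h2

/-- The occurrences of literals in the factorization that `f` defines. -/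
def occurrences (Q : CQ) (D : Q.Database) (f : Q.Valuation → Q.Tree) :
    Finset ((_ : Q.PInst) × Q.Atom) :=
  (Q.prefixInstances D f).sigma fun π => Q.tablesAt π.1

/-- The token that is written at an occurrence. -/
def occurrenceToken (Q : CQ) (o : (_ : Q.PInst) × Q.Atom) : Q.Token :=
  ⟨o.2, fun j => (o.1.2 (Q.args o.2 j)).getD 0⟩

theorem occurrenceToken_inst {w : Q.Valuation} {p : Q.Path} {i : Q.Atom} (hi : i ∈ Q.tablesAt p) :
    Q.occurrenceToken ⟨Q.inst w p, i⟩ = Q.tok w i := by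
  simp only [occurrenceToken, tok, Sigma.mk.injEq, heq_eq_eq, true_and]
  funext j
  rw [inst_apply ((mem_tablesAt.1 hi).1 (Finset.mem_image_of_mem _ (Finset.mem_univ j)))]
  rfl

theorem mem_occurrences {D : Q.Database} {f : Q.Valuation → Q.Tree}
    {o : (_ : Q.PInst) × Q.Atom} : o ∈ Q.occurrences D f ↔
      ∃ w ∈ Q.witnesses D, ∃ p ∈ f w, ∃ i ∈ Q.tablesAt p, o = ⟨Q.inst w p, i⟩ := by
  obtain ⟨π, i⟩ := o
  rw [occurrences, Finset.mem_sigma, mem_prefixInstances]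
  constructor
  · rintro ⟨⟨w, hw, p, hp, rfl⟩, hi⟩
    exact ⟨w, hw, p, hp, i, hi, rfl⟩
  · rintro ⟨w, hw, p, hp, i, hi, h⟩
    simp only [Sigma.mk.injEq, heq_eq_eq] at h
    obtain ⟨rfl, rfl⟩ := h
    exact ⟨⟨w, hw, p, hp, rfl⟩, hi⟩

/-- Each token is written at least once. So the length equals the number of tokens exactly if the
map from occurrences to tokens is injective. -/
theorem image_occurrences (hQ : Q.Connected) (hvar : 0 < Q.numVars) {D : Q.Database}
    {f : Q.Valuation → Q.Tree} (hf : Q.IsCanonicalChoice D f) [DecidableEq Q.Token] :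
    (Q.occurrences D f).image Q.occurrenceToken = Q.tokens D := by
  ext t
  rw [Finset.mem_image, mem_tokens]
  constructor
  · rintro ⟨o, ho, rfl⟩
    obtain ⟨w, hw, p, hp, i, hi, rfl⟩ := mem_occurrences.1 ho
    exact ⟨w, hw, i, (occurrenceToken_inst hi).symm⟩
  · rintro ⟨w, hw, i, rfl⟩
    obtain ⟨p, hp, hi⟩ := (hf w hw).exists_tablesAt hQ hvar i
    exact ⟨_, mem_occurrences.2 ⟨w, hw, p, hp, i, hi, rfl⟩, occurrenceToken_inst hi⟩

theorem card_occurrences (D : Q.Database) (f : Q.Valuation → Q.Tree) :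
    (Q.occurrences D f).card = ∑ π ∈ Q.prefixInstances D f, (Q.tablesAt π.1).card :=
  Finset.card_sigma _ _

end CQ

/-! ## Minimal models of read-once formulas -/

/-- A block of a family of sets: a singleton, or a product of two families with disjoint
supports. -/
def IsBlock {T : Type} (B : Set (Set T)) : Prop :=
  (∃ t, B = {{t}}) ∨ ∃ (B₁ B₂ : Set (Set T)) (U₁ U₂ : Set T), Disjoint U₁ U₂ ∧
    (∀ a ∈ B₁, a.Nonempty ∧ a ⊆ U₁) ∧ (∀ b ∈ B₂, b.Nonempty ∧ b ⊆ U₂) ∧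
    B = {m | ∃ a ∈ B₁, ∃ b ∈ B₂, m = a ∪ b}

namespace Form

variable {T : Type}

/-- `F` is the family of the minimal models of `φ`; every model lies in a block that contains all
models with which its members share a token. -/
structure HasModels (φ : Form T) (F : Set (Set T)) : Prop where
  holds : ∀ ν : T → Prop, φ.Holds ν ↔ ∃ m ∈ F, ∀ t ∈ m, ν t
  mem_lits : ∀ m ∈ F, ∀ t ∈ m, t ∈ φ.lits
  nonempty : F.Nonempty
  member_nonempty : ∀ m ∈ F, m.Nonempty
  antichain : ∀ m ∈ F, ∀ m' ∈ F, m ⊆ m' → m = m'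
  block : ∀ m ∈ F, ∃ B ⊆ F, m ∈ B ∧ (∀ a ∈ B, ∀ b ∈ F, (∃ t ∈ a, t ∈ b) → b ∈ B) ∧ IsBlock B

theorem HasModels.lit (t : T) : (lit t).HasModels {{t}} where
  holds ν := by simp [Holds]
  mem_lits := by simp [lits]
  nonempty := ⟨_, rfl⟩
  member_nonempty := by simp
  antichain := by simp
  block m hm := ⟨{{t}}, subset_rfl, hm, fun _ _ b hb _ => hb, Or.inl ⟨t, rfl⟩⟩

/-- Models of different disjuncts have no token in common, so the blocks of the disjuncts remain
closed under sharing. -/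
theorem HasModels.or {φ ψ : Form T} {F G : Set (Set T)} (hF : φ.HasModels F) (hG : ψ.HasModels G)
    (hd : φ.lits.Disjoint ψ.lits) : (or φ ψ).HasModels (F ∪ G) where
  holds ν := by
    rw [Holds, hF.holds, hG.holds]
    simp only [Set.mem_union, or_and_right, exists_or]
  mem_lits := by
    rintro m (hm | hm) t ht
    · simp [lits, hF.mem_lits m hm t ht]
    · simp [lits, hG.mem_lits m hm t ht]
  nonempty := hF.nonempty.inl
  member_nonempty := by
    rintro m (hm | hm)
    exacts [hF.member_nonempty m hm, hG.member_nonempty m hm]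
  antichain := by
    rintro m (hm | hm) m' (hm' | hm') h
    · exact hF.antichain m hm m' hm' h
    · obtain ⟨t, ht⟩ := hF.member_nonempty m hm
      exact absurd (hG.mem_lits m' hm' t (h ht)) (hd (hF.mem_lits m hm t ht))
    · obtain ⟨t, ht⟩ := hG.member_nonempty m hm
      exact absurd (hG.mem_lits m hm t ht) (hd (hF.mem_lits m' hm' t (h ht)))
    · exact hG.antichain m hm m' hm' h
  block := by
    rintro m (hm | hm)
    · obtain ⟨B, hBF, hmB, hcl, hB⟩ := hF.block m hm
      refine ⟨B, hBF.trans Set.subset_union_left, hmB, ?_, hB⟩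
      rintro a ha b (hb | hb) hab
      · exact hcl a ha b hb hab
      · obtain ⟨t, hta, htb⟩ := hab
        exact absurd (hG.mem_lits b hb t htb) (hd (hF.mem_lits a (hBF ha) t hta))
    · obtain ⟨B, hBG, hmB, hcl, hB⟩ := hG.block m hm
      refine ⟨B, hBG.trans Set.subset_union_right, hmB, ?_, hB⟩
      rintro a ha b (hb | hb) hab
      · obtain ⟨t, hta, htb⟩ := hab
        exact absurd (hG.mem_lits a (hBG ha) t hta) (hd (hF.mem_lits b hb t htb))
      · exact hcl a ha b hb hab

/-- The models of a conjunction of token-disjoint formulas form one block, the product of the two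
families. -/
theorem HasModels.and {φ ψ : Form T} {F G : Set (Set T)} (hF : φ.HasModels F)
    (hG : ψ.HasModels G) (hd : φ.lits.Disjoint ψ.lits) :
    (and φ ψ).HasModels {m | ∃ a ∈ F, ∃ b ∈ G, m = a ∪ b} where
  holds ν := by
    rw [Holds, hF.holds, hG.holds]
    constructor
    · rintro ⟨⟨a, ha, h⟩, b, hb, h'⟩
      exact ⟨_, ⟨a, ha, b, hb, rfl⟩, fun t ht => ht.elim (h t) (h' t)⟩
    · rintro ⟨_, ⟨a, ha, b, hb, rfl⟩, h⟩
      exact ⟨⟨a, ha, fun t ht => h t (Or.inl ht)⟩, b, hb, fun t ht => h t (Or.inr ht)⟩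
  mem_lits := by
    rintro _ ⟨a, ha, b, hb, rfl⟩ t (ht | ht)
    · simp [lits, hF.mem_lits a ha t ht]
    · simp [lits, hG.mem_lits b hb t ht]
  nonempty := by
    obtain ⟨a, ha⟩ := hF.nonempty
    obtain ⟨b, hb⟩ := hG.nonempty
    exact ⟨_, a, ha, b, hb, rfl⟩
  member_nonempty := by
    rintro _ ⟨a, ha, b, hb, rfl⟩
    exact (hF.member_nonempty a ha).inl
  antichain := by
    rintro _ ⟨a, ha, b, hb, rfl⟩ _ ⟨a', ha', b', hb', rfl⟩ h
    rw [hF.antichain a ha a' ha' fun t ht => (h (Or.inl ht)).resolve_right fun ht' =>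
        hd (hF.mem_lits a ha t ht) (hG.mem_lits b' hb' t ht'),
      hG.antichain b hb b' hb' fun t ht => (h (Or.inr ht)).resolve_left fun ht' =>
        hd (hF.mem_lits a' ha' t ht') (hG.mem_lits b hb t ht)]
  block m hm := by
    refine ⟨_, subset_rfl, hm, fun _ _ b hb _ => hb, Or.inr ⟨F, G, {t | t ∈ φ.lits},
      {t | t ∈ ψ.lits}, Set.disjoint_left.2 fun t ht ht' => hd ht ht',
      fun a ha => ⟨hF.member_nonempty a ha, hF.mem_lits a ha⟩,
      fun b hb => ⟨hG.member_nonempty b hb, hG.mem_lits b hb⟩, rfl⟩⟩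

theorem HasModels.of_equivalent {φ ψ : Form T} {F : Set (Set T)} (hF : φ.HasModels F)
    (h : ∀ ν, ψ.Holds ν ↔ φ.Holds ν) (hs : φ.lits ⊆ ψ.lits) : ψ.HasModels F where
  holds ν := (h ν).trans (hF.holds ν)
  mem_lits m hm t ht := hs (hF.mem_lits m hm t ht)
  nonempty := hF.nonempty
  member_nonempty := hF.member_nonempty
  antichain := hF.antichain
  block := hF.block

/-- A formula in read-once form is constant, or has a family of minimal models. -/
theorem InReadOnceForm.hasModels {φ : Form T} (h : φ.InReadOnceForm) :
    (∀ ν, ¬ φ.Holds ν) ∨ (∀ ν, φ.Holds ν) ∨ ∃ F, φ.HasModels F := by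
  induction φ with
  | bot => exact Or.inl fun _ h => h
  | top => exact Or.inr (Or.inl fun _ => trivial)
  | lit t => exact Or.inr (Or.inr ⟨_, HasModels.lit t⟩)
  | and φ ψ ih1 ih2 =>
    have hn := List.nodup_append'.1 h
    rcases ih1 hn.1 with h1 | h1 | ⟨F, hF⟩
    · exact Or.inl fun ν h' => h1 ν h'.1
    · rcases ih2 hn.2.1 with h2 | h2 | ⟨G, hG⟩
      · exact Or.inl fun ν h' => h2 ν h'.2
      · exact Or.inr (Or.inl fun ν => ⟨h1 ν, h2 ν⟩)
      · exact Or.inr (Or.inr ⟨G, hG.of_equivalent (fun ν => and_iff_right (h1 ν))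
          (by simp [lits])⟩)
    · rcases ih2 hn.2.1 with h2 | h2 | ⟨G, hG⟩
      · exact Or.inl fun ν h' => h2 ν h'.2
      · exact Or.inr (Or.inr ⟨F, hF.of_equivalent (fun ν => and_iff_left (h2 ν))
          (by simp [lits])⟩)
      · exact Or.inr (Or.inr ⟨_, hF.and hG hn.2.2⟩)
  | or φ ψ ih1 ih2 =>
    have hn := List.nodup_append'.1 h
    rcases ih1 hn.1 with h1 | h1 | ⟨F, hF⟩
    · rcases ih2 hn.2.1 with h2 | h2 | ⟨G, hG⟩
      · exact Or.inl fun ν h' => h'.elim (h1 ν) (h2 ν)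
      · exact Or.inr (Or.inl fun ν => Or.inr (h2 ν))
      · exact Or.inr (Or.inr ⟨G, hG.of_equivalent (fun ν => or_iff_right (h1 ν))
          (by simp [lits])⟩)
    · exact Or.inr (Or.inl fun ν => Or.inl (h1 ν))
    · rcases ih2 hn.2.1 with h2 | h2 | ⟨G, hG⟩
      · exact Or.inr (Or.inr ⟨F, hF.of_equivalent (fun ν => or_iff_left (h2 ν))
          (by simp [lits])⟩)
      · exact Or.inr (Or.inl fun ν => Or.inr (h2 ν))
      · exact Or.inr (Or.inr ⟨_, hF.or hG hn.2.2⟩)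

/-- Families of minimal models are determined by the meaning of the formula. -/
theorem HasModels.eq_of_antichain {φ : Form T} {F G : Set (Set T)} (hF : φ.HasModels F)
    (hG : ∀ ν : T → Prop, φ.Holds ν ↔ ∃ m ∈ G, ∀ t ∈ m, ν t)
    (ha : ∀ m ∈ G, ∀ m' ∈ G, m ⊆ m' → m = m') : F = G := by
  have key : ∀ m ∈ F, ∃ m' ∈ G, m' ⊆ m := fun m hm =>
    (hG (· ∈ m)).1 ((hF.holds _).2 ⟨m, hm, fun _ h => h⟩)
  have key' : ∀ m ∈ G, ∃ m' ∈ F, m' ⊆ m := fun m hm =>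
    (hF.holds (· ∈ m)).1 ((hG _).2 ⟨m, hm, fun _ h => h⟩)
  ext m
  constructor
  · intro hm
    obtain ⟨m', hm', h⟩ := key m hm
    obtain ⟨m'', hm'', h'⟩ := key' m' hm'
    have := hF.antichain m'' hm'' m hm (h'.trans h)
    subst this
    rwa [h'.antisymm h]
  · intro hm
    obtain ⟨m', hm', h⟩ := key' m hm
    obtain ⟨m'', hm'', h'⟩ := key m' hm'
    have := ha m'' hm'' m hm (h'.trans h)
    subst this
    rwa [h'.antisymm h]

open Classical in
/-- Replace the literals with tokens outside of `A` by true. -/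
noncomputable def restrict (A : Set T) : Form T → Form T
  | bot => bot
  | top => top
  | lit t => if t ∈ A then lit t else top
  | and φ ψ => and (φ.restrict A) (ψ.restrict A)
  | or φ ψ => or (φ.restrict A) (ψ.restrict A)

theorem holds_restrict {A : Set T} {ν : T → Prop} {φ : Form T} :
    (φ.restrict A).Holds ν ↔ φ.Holds fun t => t ∈ A → ν t := by
  induction φ with
  | bot => rfl
  | top => rfl
  | lit t => by_cases h : t ∈ A <;> simp [restrict, h, Holds]
  | and φ ψ ih1 ih2 => exact and_congr ih1 ih2
  | or φ ψ ih1 ih2 => exact or_congr ih1 ih2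

theorem lits_restrict {A : Set T} {φ : Form T} : (φ.restrict A).lits.Sublist φ.lits := by
  induction φ with
  | bot => exact List.Sublist.refl _
  | top => exact List.Sublist.refl _
  | lit t => by_cases h : t ∈ A <;> simp [restrict, h, lits]
  | and φ ψ ih1 ih2 => exact ih1.append ih2
  | or φ ψ ih1 ih2 => exact ih1.append ih2

end Form

/-! ### Blocks and agreement sets of the witnesses of a read-once database. -/

namespace CQ

variable {Q : CQ}

/-- Two valuations agree on an atom with a variable in `K`. -/
def Shares (Q : CQ) (K : Set Q.Var) (w u : Q.Valuation) : Prop :=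
  ∃ i, (∃ x ∈ Q.vars i, x ∈ K) ∧ Q.tok w i = Q.tok u i

/-- The variables on which `w` agrees with all witnesses that are linked to `w` by two sharings. -/
def agreement (Q : CQ) (D : Q.Database) (w : Q.Valuation) (K : Set Q.Var) : Set Q.Var :=
  {x | ∀ u ∈ Q.witnesses D, ∀ w' ∈ Q.witnesses D, Q.Shares K w u → Q.Shares K u w' → w' x = w x}

/-- The tokens of `w` for the atoms with a variable in `K`. -/
def tokensOn (Q : CQ) (K : Set Q.Var) (w : Q.Valuation) : Set Q.Token :=
  {t | ∃ i, (∃ x ∈ Q.vars i, x ∈ K) ∧ Q.tok w i = t}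

theorem eq_of_mem_tokensOn {K : Set Q.Var} {w u : Q.Valuation} {i : Q.Atom}
    (h : Q.tok u i ∈ Q.tokensOn K w) : Q.tok w i = Q.tok u i := by
  obtain ⟨j, -, h⟩ := h
  have : j = i := congrArg Sigma.fst h
  exact this ▸ h

/-- Both sets contain exactly one token for each atom that touches `K`. Hence the token sets of the
witnesses form an antichain and are the minimal models. -/
theorem tokensOn_eq_of_subset {K : Set Q.Var} {w u : Q.Valuation}
    (h : Q.tokensOn K w ⊆ Q.tokensOn K u) : Q.tokensOn K w = Q.tokensOn K u := by
  refine h.antisymm ?_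
  rintro _ ⟨i, hi, rfl⟩
  have := h ⟨i, hi, rfl⟩
  rw [eq_of_mem_tokensOn this]
  exact ⟨i, hi, rfl⟩

theorem shares_iff {K : Set Q.Var} {w u : Q.Valuation} :
    Q.Shares K w u ↔ ∃ t ∈ Q.tokensOn K w, t ∈ Q.tokensOn K u := by
  constructor
  · rintro ⟨i, hi, h⟩
    exact ⟨_, ⟨i, hi, rfl⟩, i, hi, h.symm⟩
  · rintro ⟨_, ⟨i, hi, rfl⟩, h⟩
    exact ⟨i, hi, (eq_of_mem_tokensOn h).symm⟩

/-- In a read-once database, the witnesses linked to `w` form a block. -/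
theorem exists_block {D : Q.Database} (hD : (Q.provenance D).IsReadOnce) {K : Set Q.Var}
    (hK : K.Nonempty) {w : Q.Valuation} (hw : w ∈ Q.witnesses D) :
    ∃ B : Set (Set Q.Token), (∀ m ∈ B, ∃ u ∈ Q.witnesses D, Q.tokensOn K u = m) ∧
      Q.tokensOn K w ∈ B ∧ (∀ u, Q.tokensOn K u ∈ B → ∀ u' ∈ Q.witnesses D,
        Q.Shares K u u' → Q.tokensOn K u' ∈ B) ∧ IsBlock B := by
  obtain ⟨ψ, hψ, hn⟩ := hD
  -- Tokens outside of `A` are set to true. This preserves read-once form, and the models become the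
  -- sets `tokensOn K u`.
  set A : Set Q.Token := {t | ∃ x ∈ Q.vars t.1, x ∈ K} with hA
  obtain ⟨x0, hx0⟩ := hK
  obtain ⟨i0, hi0⟩ := exists_mem_vars x0
  have hh : ∀ ν : Q.Token → Prop, (ψ.restrict A).Holds ν ↔
      ∃ m ∈ {m | ∃ u ∈ Q.witnesses D, Q.tokensOn K u = m}, ∀ t ∈ m, ν t := by
    intro ν
    rw [Form.holds_restrict, hψ, holds_provenance]
    constructor
    · rintro ⟨u, hu, h⟩
      refine ⟨_, ⟨u, hu, rfl⟩, ?_⟩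
      rintro _ ⟨i, hi, rfl⟩
      exact h i hi
    · rintro ⟨_, ⟨u, hu, rfl⟩, h⟩
      exact ⟨u, hu, fun i hi => h _ ⟨i, hi, rfl⟩⟩
  have hro : (ψ.restrict A).InReadOnceForm := hn.sublist Form.lits_restrict
  rcases hro.hasModels with h | h | ⟨F, hF⟩
  · exact absurd ((hh fun _ => True).2 ⟨_, ⟨w, hw, rfl⟩, fun _ _ => trivial⟩) (h _)
  -- The formula is not constantly true, since some atom touches `K` and every model contains one of
  -- its tokens.
  · obtain ⟨_, ⟨u, -, rfl⟩, h⟩ := (hh fun _ => False).1 (h _)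
    exact (h _ ⟨i0, ⟨x0, hi0, hx0⟩, rfl⟩).elim
  · have hFe := hF.eq_of_antichain hh (by
      rintro _ ⟨u, -, rfl⟩ _ ⟨u', -, rfl⟩ h
      exact tokensOn_eq_of_subset h)
    subst hFe
    obtain ⟨B, hBF, hwB, hcl, hB⟩ := hF.block _ ⟨w, hw, rfl⟩
    exact ⟨B, hBF, hwB, fun u hu u' hu' h => hcl _ hu _ ⟨u', hu', rfl⟩ (shares_iff.1 h), hB⟩

/-- Members of one block are linked by two sharings. -/
theorem exists_shares_of_block {D : Q.Database} {K : Set Q.Var} {B : Set (Set Q.Token)}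
    (hBW : ∀ m ∈ B, ∃ u ∈ Q.witnesses D, Q.tokensOn K u = m) (hB : IsBlock B)
    {w w' : Q.Valuation} (hw : Q.tokensOn K w ∈ B) (hw' : Q.tokensOn K w' ∈ B) :
    ∃ u ∈ Q.witnesses D, Q.Shares K w u ∧ Q.Shares K u w' := by
  rcases hB with ⟨t, rfl⟩ | ⟨B₁, B₂, U₁, U₂, -, h1, h2, rfl⟩
  · obtain ⟨u, hu, hut⟩ := hBW _ rfl
    simp only [shares_iff, Set.mem_singleton_iff.1 hw, Set.mem_singleton_iff.1 hw']
    exact ⟨u, hu, ⟨t, rfl, by rw [hut]; rfl⟩, t, by rw [hut]; rfl, rfl⟩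
  · obtain ⟨a, ha, b, hb, hab⟩ := hw
    obtain ⟨a', ha', b', hb', hab'⟩ := hw'
    -- In a product, the mixed model `a ∪ b'` shares `a` with the first witness and `b'` with the
    -- second one.
    obtain ⟨u, hu, hut⟩ := hBW _ ⟨a, ha, b', hb', rfl⟩
    obtain ⟨t, ht⟩ := (h1 a ha).1
    obtain ⟨t', ht'⟩ := (h2 b' hb').1
    refine ⟨u, hu, shares_iff.2 ⟨t, ?_, ?_⟩, shares_iff.2 ⟨t', ?_, ?_⟩⟩
    · rw [hab]; exact Or.inl ht
    · rw [hut]; exact Or.inl ht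
    · rw [hut]; exact Or.inr ht'
    · rw [hab']; exact Or.inr ht'

/-- The witnesses reached by two sharings are exactly those of the block of `w`. So the block can be
tested without the read-once formula. -/
theorem mem_agreement_iff {D : Q.Database} {K : Set Q.Var} {B : Set (Set Q.Token)}
    (hBW : ∀ m ∈ B, ∃ u ∈ Q.witnesses D, Q.tokensOn K u = m) (hB : IsBlock B)
    (hcl : ∀ u, Q.tokensOn K u ∈ B → ∀ u' ∈ Q.witnesses D, Q.Shares K u u' → Q.tokensOn K u' ∈ B)
    {w : Q.Valuation} (hw : Q.tokensOn K w ∈ B) {x : Q.Var} :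
    x ∈ Q.agreement D w K ↔ ∀ w' ∈ Q.witnesses D, Q.tokensOn K w' ∈ B → w' x = w x := by
  constructor
  · intro h w' hw' hwB'
    obtain ⟨u, hu, h1, h2⟩ := exists_shares_of_block hBW hB hw hwB'
    exact h u hu w' hw' h1 h2
  · intro h u hu w' hw' h1 h2
    exact h w' hw' (hcl u (hcl w hw u hu h1) w' hw' h2)

/-- A shared token puts both witnesses into one block, and the agreement set is determined by the
block. -/
theorem agreement_eq {D : Q.Database} (hD : (Q.provenance D).IsReadOnce) {K : Set Q.Var}
    (hK : K.Nonempty) {w w' : Q.Valuation} (hw : w ∈ Q.witnesses D) (hw' : w' ∈ Q.witnesses D)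
    (h : Q.Shares K w w') : Q.agreement D w K = Q.agreement D w' K := by
  obtain ⟨B, hBW, hwB, hcl, hB⟩ := exists_block hD hK hw
  have hwB' := hcl w hwB w' hw' h
  ext x
  rw [mem_agreement_iff hBW hB hcl hwB, mem_agreement_iff hBW hB hcl hwB']
  constructor
  · intro h u hu huB
    rw [h u hu huB, h w' hw' hwB']
  · intro h u hu huB
    rw [h u hu huB, h w hw hwB]

theorem eq_of_mem_agreement {D : Q.Database} {K : Set Q.Var} {w w' : Q.Valuation}
    (hw : w ∈ Q.witnesses D) (hw' : w' ∈ Q.witnesses D) (h : Q.Shares K w w') {x : Q.Var}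
    (hx : x ∈ Q.agreement D w K) : w' x = w x := by
  obtain ⟨i, hi, h'⟩ := id h
  exact hx w hw w' hw' ⟨i, hi, rfl⟩ h

/-- In a read-once database, the agreement set of a component separates it. -/
theorem isSep_agreement {D : Q.Database} (hD : (Q.provenance D).IsReadOnce) {X : Finset Q.Var}
    {K : Set Q.Var} (hK : K.Nonempty)
    (hcl : ∀ i, (∃ x ∈ Q.vars i, x ∈ K) → ∀ y ∈ Q.vars i, y ∉ X → y ∈ K)
    {w : Q.Valuation} (hw : w ∈ Q.witnesses D) {S : Finset Q.Var}
    (hS : ∀ x, x ∈ S ↔ x ∈ K ∧ x ∈ Q.agreement D w K) : Q.IsSep X K S := by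
  obtain ⟨B, hBW, hwB, hshare, hB⟩ := exists_block hD hK hw
  have hagr := fun x => mem_agreement_iff hBW hB hshare hwB (x := x)
  have hsub : ∀ i, (∃ x ∈ Q.vars i, x ∈ K) → (∀ x ∈ Q.vars i, x ∈ K → x ∈ Q.agreement D w K) →
      Q.IsSep X K S := by
    refine fun i hi h => Or.inl ⟨i, hi, fun x hx => Finset.mem_union.2 ?_⟩
    by_cases hxX : x ∈ X
    · exact Or.inl hxX
    · have hxK := hcl i hi x hx hxX
      exact Or.inr ((hS x).2 ⟨hxK, h x hx hxK⟩)
  have hatom : ∀ {t : Q.Token}, t ∈ Q.tokensOn K w →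
      ∃ i, (∃ x ∈ Q.vars i, x ∈ K) ∧ Q.tok w i = t := fun h => h
  rcases id hB with ⟨t, rfl⟩ | ⟨B₁, B₂, U₁, U₂, hdis, h1, h2, rfl⟩
  · obtain ⟨i, hi, rfl⟩ := hatom (by rw [Set.mem_singleton_iff.1 hwB]; rfl : t ∈ Q.tokensOn K w)
    refine hsub i hi fun x hx _ => (hagr x).2 fun w' hw' hwB' => ?_
    have : Q.tok w i ∈ Q.tokensOn K w' := by rw [Set.mem_singleton_iff.1 hwB']; rfl
    exact tok_eq_iff.1 (eq_of_mem_tokensOn this) x hx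
  · obtain ⟨a, ha, b, hb, hab⟩ := hwB
    have hmemU : ∀ i, (∃ x ∈ Q.vars i, x ∈ K) → Q.tok w i ∈ a ∨ Q.tok w i ∈ b := by
      intro i hi
      have : Q.tok w i ∈ Q.tokensOn K w := ⟨i, hi, rfl⟩
      rwa [hab] at this
    -- Let atoms `i` and `j` with tokens in different factors share the variable `x`. For any model
    -- `a' ∪ b'` of the block, the witness of `a ∪ b'` agrees with `w` on `i` and with `w'` on `j`,
    -- so `x` has the same value in `w` and `w'`.
    have hcommon : ∀ i j x, (∃ x ∈ Q.vars j, x ∈ K) → x ∈ Q.vars i → x ∈ Q.vars j →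
        Q.tok w i ∈ a → Q.tok w j ∈ b → x ∈ Q.agreement D w K := by
      intro i j x hj hxi hxj hia hjb
      refine (hagr x).2 fun w' hw' hwB' => ?_
      obtain ⟨a', ha', b', hb', hab'⟩ := id hwB'
      obtain ⟨u, hu, hut⟩ := hBW _ ⟨a, ha, b', hb', rfl⟩
      have hu1 : Q.tok u i = Q.tok w i :=
        eq_of_mem_tokensOn (by rw [hut]; exact Or.inl hia)
      have hw'j : Q.tok w' j ∈ b' := by
        have : Q.tok w' j ∈ Q.tokensOn K w' := ⟨j, hj, rfl⟩
        rw [hab'] at this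
        refine this.resolve_left fun h => ?_
        -- The token of `j` stays in the second factor: otherwise the witness of `a' ∪ b` would use
        -- one token for `j` that lies in both of the disjoint supports.
        obtain ⟨v, hv, hvt⟩ := hBW _ ⟨a', ha', b, hb, rfl⟩
        have e1 : Q.tok v j = Q.tok w' j := eq_of_mem_tokensOn (by rw [hvt]; exact Or.inl h)
        have e2 : Q.tok v j = Q.tok w j := eq_of_mem_tokensOn (by rw [hvt]; exact Or.inr hjb)
        rw [← e1, e2] at h
        exact Set.disjoint_left.1 hdis ((h1 a' ha').2 h) ((h2 b hb).2 hjb)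
      have hu2 : Q.tok u j = Q.tok w' j :=
        eq_of_mem_tokensOn (by rw [hut]; exact Or.inr hw'j)
      rw [← tok_eq_iff.1 hu1 x hxi, tok_eq_iff.1 hu2 x hxj]
    obtain ⟨t1, ht1⟩ := (h1 a ha).1
    obtain ⟨t2, ht2⟩ := (h2 b hb).1
    obtain ⟨i, hi, rfl⟩ := hatom (by rw [hab]; exact Or.inl ht1 : t1 ∈ Q.tokensOn K w)
    obtain ⟨j, hj, rfl⟩ := hatom (by rw [hab]; exact Or.inr ht2 : t2 ∈ Q.tokensOn K w)
    by_cases hxi : ∀ x ∈ Q.vars i, x ∈ K → x ∈ Q.agreement D w K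
    · exact hsub i hi hxi
    by_cases hxj : ∀ x ∈ Q.vars j, x ∈ K → x ∈ Q.agreement D w K
    · exact hsub j hj hxj
    push Not at hxi hxj
    obtain ⟨x, hx, hxK, hxn⟩ := hxi
    obtain ⟨y, hy, hyK, hyn⟩ := hxj
    refine Or.inr ⟨x, hxK, y, hyK, fun h => hxn ((hS x).1 h).2, fun h => hyn ((hS y).1 h).2,
      fun hconn => ?_⟩
    -- Outside of the agreement set, all atoms that contain a given variable lie on the same side of
    -- the product. So links cannot lead from the first side to the second one.
    have hinv : ∀ z, Q.Conn (X ∪ S) x z → z ∈ K ∧ z ∉ Q.agreement D w K ∧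
        ∀ k, z ∈ Q.vars k → Q.tok w k ∈ a := by
      intro z hz
      have hside : ∀ z k, z ∈ K → z ∉ Q.agreement D w K → z ∈ Q.vars k → Q.tok w k ∈ a →
          ∀ k', z ∈ Q.vars k' → Q.tok w k' ∈ a := fun z k hzK hzn hzk hka k' hzk' =>
        (hmemU k' ⟨z, hzk', hzK⟩).resolve_right fun h =>
          hzn (hcommon k k' z ⟨z, hzk', hzK⟩ hzk hzk' hka h)
      induction hz with
      | refl => exact ⟨hxK, hxn, hside x i hxK hxn hx ht1⟩
      | tail _ hl ih =>
        obtain ⟨hzK, hzn, hza⟩ := ih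
        obtain ⟨-, hn, k, hk, hk'⟩ := hl
        rw [Finset.mem_union, not_or] at hn
        have hzK' := hcl k ⟨_, hk, hzK⟩ _ hk' hn.1
        have hzn' : _ ∉ Q.agreement D w K := fun h => hn.2 ((hS _).2 ⟨hzK', h⟩)
        exact ⟨hzK', hzn', hside _ k hzK' hzn' hk' (hza k hk)⟩
    exact Set.disjoint_left.1 hdis ((h1 a ha).2 ((hinv y hconn).2.2 j hy)) ((h2 b hb).2 ht2)

/-! ### A choice of trees that writes each token once. -/

/-- The trees that prefer the agreement sets. -/
noncomputable def agreeingTree (Q : CQ) (D : Q.Database) (w : Q.Valuation) : Q.Tree :=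
  Q.strategyTree (Q.preferring (Q.agreement D w))

theorem isCanonicalChoice_agreeingTree (D : Q.Database) :
    Q.IsCanonicalChoice D (Q.agreeingTree D) :=
  fun _ _ => isCanonical_strategyTree (isStrategy_preferring _)

/-- The atom `i` touches the component at each node of `p`, so the two witnesses share a token
there. They have the same agreement set, which gives the same label, and they take the same values
on it because the label lies inside of that set. -/
theorem agreeingTree_prefix {D : Q.Database} (hD : (Q.provenance D).IsReadOnce)
    {w w' : Q.Valuation} (hw : w ∈ Q.witnesses D) (hw' : w' ∈ Q.witnesses D) {p : Q.Path}
    (hp : p ∈ Q.agreeingTree D w) {i : Q.Atom} (hi : i ∈ Q.tablesAt p)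
    (h : Q.tok w i = Q.tok w' i) :
    p ∈ Q.agreeingTree D w' ∧ Q.inst w p = Q.inst w' p := by
  classical
  have hc := isCanonicalChoice_agreeingTree D w hw
  obtain ⟨hne, hfol⟩ := mem_strategyTree.1 hp
  have hsh : ∀ r S, r ++ [S] <+: p → Q.Shares (Q.component (Q.pathVars r) S) w w' := by
    intro r S hr
    obtain ⟨x, hx, hxp⟩ := touches_of_mem_tablesAt hi
    refine ⟨i, ⟨x, hx, ?_⟩, h⟩
    rw [← below_concat]
    exact hc.below_anti hr (Or.inr hp) hxp
  have hK : ∀ r S, r ++ [S] <+: p → (Q.component (Q.pathVars r) S).Nonempty := by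
    intro r S hr
    obtain ⟨s, hs⟩ := (hfol r S hr).1.nonempty
    exact ⟨s, subset_component hs⟩
  refine ⟨mem_strategyTree.2 ⟨hne, fun r S hr => ⟨(hfol r S hr).1, ?_⟩⟩, inst_eq_iff.2 ?_⟩
  · rw [← preferring_congr (agreement_eq hD (hK r S hr) hw hw' (hsh r S hr))]
    exact (hfol r S hr).2
  · intro x hx
    obtain ⟨r, S, hr, hxS⟩ := exists_prefix_of_mem_pathVars hx
    obtain ⟨hl, hS⟩ := hfol r S hr
    set K := Q.component (Q.pathVars r) S with hKdef
    have hxc : x ∈ Q.agreement D w K := by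
      rw [hS] at hxS
      refine preferring_mem (S := Finset.univ.filter fun x => x ∈ K ∧ x ∈ Q.agreement D w K)
        (fun x hx => (Finset.mem_filter.1 hx).2)
        (isSep_agreement hD (hK r S hr) ?_ hw fun x => by simp [hKdef]) hxS
      rintro k ⟨y, hy, hyK⟩ z hz hzn
      exact mem_component_of_conn hyK
        (Conn.of_atom (hl.notMem_of_mem_component hyK) hzn hy hz)
    exact (eq_of_mem_agreement hw hw' (hsh r S hr) hxc).symm

theorem injOn_occurrenceToken_agreeingTree {D : Q.Database}
    (hD : (Q.provenance D).IsReadOnce) :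
    Set.InjOn Q.occurrenceToken (Q.occurrences D (Q.agreeingTree D)) := by
  intro o ho o' ho' h
  obtain ⟨w, hw, p, hp, i, hi, rfl⟩ := mem_occurrences.1 ho
  obtain ⟨w', hw', p', hp', i', hi', rfl⟩ := mem_occurrences.1 ho'
  rw [occurrenceToken_inst hi, occurrenceToken_inst hi'] at h
  have : i = i' := congrArg Sigma.fst h
  subst this
  obtain ⟨hpw', hin⟩ := agreeingTree_prefix hD hw hw' hp hi h
  have : p = p' := (isCanonicalChoice_agreeingTree D w' hw').table_unique hpw' hp' hi hi'
  subst this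
  rw [hin]

theorem exists_assignment_card_tokens (hQ : Q.Connected) (hvar : 0 < Q.numVars) {D : Q.Database}
    (hD : (Q.provenance D).IsReadOnce) :
    ∑ π ∈ Q.prefixInstances D (Q.agreeingTree D), (Q.tablesAt π.1).card = (Q.tokens D).card := by
  classical
  rw [← card_occurrences, ← image_occurrences hQ hvar (isCanonicalChoice_agreeingTree D),
    Finset.card_image_of_injOn (injOn_occurrenceToken_agreeingTree hD)]

end CQ

/-! ## Cuts of the flow graph and factorizations -/

namespace CQ

variable {Q : CQ}

namespace Ordering

theorem suffix_of_mem_leaves {Ω : Q.Ordering} {α β : List Bool} {l r s t : Pos}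
    (h : (β, s, t) ∈ Ω.leaves α l r) : α <:+ β := by
  induction Ω generalizing α l r with
  | single v =>
    simp only [leaves, List.mem_singleton, Prod.mk.injEq] at h
    rw [h.1]
  | seq a b iha ihb =>
    rcases List.mem_append.1 h with h | h
    exacts [(List.suffix_cons _ _).trans (iha h), (List.suffix_cons _ _).trans (ihb h)]
  | par a b iha ihb =>
    rcases List.mem_append.1 h with h | h
    exacts [(List.suffix_cons _ _).trans (iha h), (List.suffix_cons _ _).trans (ihb h)]

theorem leaves_unique {Ω : Q.Ordering} {α β : List Bool} {l r s t s' t' : Pos}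
    (h : (β, s, t) ∈ Ω.leaves α l r) (h' : (β, s', t') ∈ Ω.leaves α l r) : s = s' ∧ t = t' := by
  induction Ω generalizing α l r with
  | single v =>
    simp only [leaves, List.mem_singleton, Prod.mk.injEq] at h h'
    exact ⟨h.2.1.trans h'.2.1.symm, h.2.2.trans h'.2.2.symm⟩
  | seq a b iha ihb =>
    rcases List.mem_append.1 h with h | h <;> rcases List.mem_append.1 h' with h' | h'
    · exact iha h h'
    · exact (suffix_ne (suffix_of_mem_leaves h) (suffix_of_mem_leaves h')).elim
    · exact (suffix_ne (suffix_of_mem_leaves h') (suffix_of_mem_leaves h)).elim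
    · exact ihb h h'
  | par a b iha ihb =>
    rcases List.mem_append.1 h with h | h <;> rcases List.mem_append.1 h' with h' | h'
    · exact iha h h'
    · exact (suffix_ne (suffix_of_mem_leaves h) (suffix_of_mem_leaves h')).elim
    · exact (suffix_ne (suffix_of_mem_leaves h') (suffix_of_mem_leaves h)).elim
    · exact ihb h h'

theorem exists_mem_leaves {Ω : Q.Ordering} (x : Choice Ω) {α β : List Bool}
    (h : β ∈ x.leafSet α) (l r : Pos) : ∃ s t, (β, s, t) ∈ Ω.leaves α l r := by
  induction x generalizing α l r with
  | single v =>
    rw [Choice.leafSet, Finset.mem_singleton] at h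
    exact ⟨l, r, by simp [leaves, h]⟩
  | inl x ih =>
    obtain ⟨s, t, hst⟩ := ih h l (.mid α)
    exact ⟨s, t, List.mem_append_left _ hst⟩
  | inr x ih =>
    obtain ⟨s, t, hst⟩ := ih h (.mid α) r
    exact ⟨s, t, List.mem_append_right _ hst⟩
  | pair x y ihx ihy =>
    rcases Finset.mem_union.1 h with h | h
    · obtain ⟨s, t, hst⟩ := ihx h l r
      exact ⟨s, t, List.mem_append_left _ hst⟩
    · obtain ⟨s, t, hst⟩ := ihy h l r
      exact ⟨s, t, List.mem_append_right _ hst⟩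

namespace IsRunningPrefixes

variable {Ω : Q.Ordering} (hΩ : Ω.IsRunningPrefixes)

include hΩ

theorem tree_mem_mveo (x : Choice Ω) : x.tree ∈ Q.mveo :=
  (hΩ.enumerates _).1 (List.mem_map.2 ⟨_, mem_choices.2 ⟨x, rfl⟩, rfl⟩)

theorem exists_choice {v : Q.Tree} (hv : v ∈ Q.mveo) : ∃ x : Choice Ω, x.tree = v := by
  obtain ⟨c, hc, rfl⟩ := List.mem_map.1 ((hΩ.enumerates v).2 hv)
  obtain ⟨x, rfl⟩ := mem_choices.1 hc
  exact ⟨x, rfl⟩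

theorem leafSet_eq (x : Choice Ω) {c : Finset (List Bool) × Q.Tree} (hc : c ∈ Ω.choices [])
    (h : c.2 = x.tree) : c.1 = x.leafSet [] := by
  have := List.inj_on_of_nodup_map hΩ.nodup hc (mem_choices.2 ⟨x, rfl⟩) h
  rw [this]

/-- The whole ordering needs no rest tree. -/
theorem context : Context Q.mveo Ω where
  extend := ⟨∅, fun x => ⟨by rw [Finset.union_empty]; exact hΩ.tree_mem_mveo x, by simp⟩⟩
  restrict t ht _ := by
    obtain ⟨x, rfl⟩ := hΩ.exists_choice ht
    exact ⟨x, fun _ _ => Iff.rfl⟩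

end IsRunningPrefixes

/-- The connectors before a choice. -/
def Choice.before {Ω : Q.Ordering} (x : Choice Ω) : Pos → Prop
  | .start => True
  | .finish => False
  | .mid β => x.side [] β

theorem Choice.isBefore {Ω : Q.Ordering} (x : Choice Ω) :
    Before x [] .start .finish x.before :=
  ⟨trivial, fun h => h, fun _ _ => Iff.rfl⟩

end Ordering

open _root_.CQ.Ordering

theorem mixing_mveo (hQ : Q.Connected) (hvar : 0 < Q.numVars) : Mixing Q.mveo := by
  intro v₁ h1 v h v₂ h2 p₁ p₂ a b c d e g
  rw [mem_mveo_iff hQ hvar] at h1 h h2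
  obtain ⟨t, ht, m⟩ := h1.exists_mixed h h2 a b c d e g
  exact ⟨t, (mem_mveo_iff hQ hvar).2 ht, m⟩

theorem IsAssignment.isCanonicalChoice (hQ : Q.Connected) (hvar : 0 < Q.numVars) {D : Q.Database}
    {f : Q.Valuation → Q.Tree} (hf : Q.IsAssignment D f) : Q.IsCanonicalChoice D f :=
  fun w hw => (mem_mveo_iff hQ hvar).1 (hf w hw)

theorem isAssignment_agreeingTree (hQ : Q.Connected) (hvar : 0 < Q.numVars) (D : Q.Database) :
    Q.IsAssignment D (Q.agreeingTree D) :=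
  fun w hw => (mem_mveo_iff hQ hvar).2 (isCanonicalChoice_agreeingTree D w hw)

/-- If no token is written twice, then the selected nodes block all paths. -/
theorem not_hasPathAvoiding_selected (hQ : Q.Connected) (hvar : 0 < Q.numVars) {Ω : Q.Ordering}
    (hΩ : Ω.IsRunningPrefixes) {D : Q.Database} {f : Q.Valuation → Q.Tree}
    (hf : Q.IsAssignment D f) (hinj : Set.InjOn Q.occurrenceToken (Q.occurrences D f)) :
    ¬ Ω.HasPathAvoiding D (Ω.selected D f) := by
  have := nonempty_choice Ω
  have hex : ∀ w ∈ Q.witnesses D, ∃ x : Choice Ω, x.tree = f w := fun w hw =>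
    hΩ.exists_choice (hf w hw)
  choose! x hx using hex
  -- An invariant of the nodes that can be reached: a connector lies before the choice of its
  -- witness, and a plan or prefix node leads only to such connectors, for a prefix node with
  -- respect to every witness that shares it.
  let P : Q.FlowNode → Prop
    | .src => True
    | .tgt => False
    | .conn w c => (x w).before c
    | .plan w α => ∀ l r, (α, l, r) ∈ Ω.leaves [] .start .finish → (x w).before r
    | .pre π => ∀ w ∈ Q.witnesses D, ∀ p, (Q.tablesAt p).Nonempty → Q.inst w p = π → ∀ l r,
        Ω.span p [] .start .finish = some (l, r) → (x w).before r
  have key : ∀ a b, P a → Ω.Edge D a b → b ∉ Ω.selected D f → P b := by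
    intro a b ha hab hb
    cases hab with
    | source w hw => trivial
    | target w hw => exact ha
    | toPlan w hw α l r h =>
      intro l' r' h'
      obtain ⟨rfl, rfl⟩ := leaves_unique h h'
      by_contra hr
      exact hb ⟨w, hw, Or.inl ⟨_, mem_choices.2 ⟨x w, rfl⟩, hx w hw, α,
        (x w).isBefore.mem_leafSet h ha hr, rfl⟩⟩
    | fromPlan w hw α l r h => exact ha l r h
    | toPre w hw p hp l r h =>
      intro w' hw' p' _ hpp l' r' h'
      obtain rfl : p' = p := congrArg Prod.fst hpp
      rw [h, Option.some.injEq, Prod.mk.injEq] at h'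
      obtain ⟨rfl, rfl⟩ := h'
      have hn : p' ∉ f w := fun hm => hb ⟨w, hw, Or.inr ⟨p', hm, hp, rfl⟩⟩
      have hn' : p' ∉ f w' := fun hm => hb ⟨w', hw', Or.inr ⟨p', hm, hp, congrArg FlowNode.pre hpp.symm⟩⟩
      -- As the node is not selected, neither witness has `p'` in its tree. So the whole span of
      -- `p'` lies before the choice of `w` and behind the choice of `w'`.
      by_contra hr
      have ht : (x w).before r := by
        by_contra ht
        exact hn (hx w hw ▸ (x w).isBefore.mem_tree (hΩ.running p') h ha ht)
      have hs : ¬ (x w').before l := fun hs =>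
        hn' (hx w' hw' ▸ (x w').isBefore.mem_tree (hΩ.running p') h hs hr)
      obtain ⟨i, hi⟩ := hp
      have hc := hf.isCanonicalChoice hQ hvar
      obtain ⟨q, hq, hiq⟩ := (hc w hw).exists_tablesAt hQ hvar i
      obtain ⟨q', hq', hiq'⟩ := (hc w' hw').exists_tablesAt hQ hvar i
      -- The shared node means that both witnesses agree on the variables of `i`. The common token
      -- is written only once, so both trees have the same table prefix `q` for `i`.
      have htok : Q.tok w i = Q.tok w' i := by
        rw [← occurrenceToken_inst hi, ← hpp, occurrenceToken_inst hi]
      have := hinj (mem_occurrences.2 ⟨w, hw, q, hq, i, hiq, rfl⟩)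
        (mem_occurrences.2 ⟨w', hw', q', hq', i, hiq', rfl⟩)
        (by rw [occurrenceToken_inst hiq, occurrenceToken_inst hiq', htok])
      have hqq : q = q' := congrArg (fun o => o.1.1) this
      subst hqq
      -- `p'` lies between two choices that have the prefix `q`, so some minimal order contains
      -- both. As both are the table prefix of `i` in it, they coincide.
      obtain ⟨y, hpy, hqy⟩ := exists_common_of_between (x w).isBefore (x w').isBefore h ht hs
        (hx w hw ▸ hq) (hx w' hw' ▸ hq') (hΩ.running q)
      have := ((mem_mveo_iff hQ hvar).1 (hΩ.tree_mem_mveo y)).table_unique hpy hqy hi hiq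
      exact hn (this ▸ hq)
    | fromPre w hw p hp l r h => exact ha w hw p hp rfl l r h
  intro h
  have : ∀ b, Relation.ReflTransGen (fun a b => Ω.Edge D a b ∧ b ∉ Ω.selected D f) .src b → P b := by
    intro b hb
    induction hb with
    | refl => trivial
    | tail _ h ih => exact key _ _ ih h.1 h.2
  exact this _ h

theorem finite_selected (Ω : Q.Ordering) (D : Q.Database) (f : Q.Valuation → Q.Tree) :
    (Ω.selected D f).Finite := by
  classical
  refine Set.Finite.subset (Finset.finite_toSet ((Q.witnesses D).biUnion fun w =>
    ((Ω.choices []).toFinset.biUnion fun c => c.1.image (FlowNode.plan w)) ∪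
      (f w).image fun p => FlowNode.pre (Q.inst w p))) ?_
  rintro n ⟨w, hw, ⟨c, hc, -, α, hα, rfl⟩ | ⟨p, hp, -, rfl⟩⟩
  · simp only [Finset.coe_biUnion, Set.mem_iUnion, Finset.mem_coe]
    exact ⟨w, hw, Finset.mem_union_left _ (Finset.mem_biUnion.2
      ⟨c, List.mem_toFinset.2 hc, Finset.mem_image_of_mem _ hα⟩)⟩
  · simp only [Finset.coe_biUnion, Set.mem_iUnion, Finset.mem_coe]
    exact ⟨w, hw, Finset.mem_union_right _ (Finset.mem_image_of_mem _ hp)⟩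

theorem isCut_selected (hQ : Q.Connected) (hvar : 0 < Q.numVars) {Ω : Q.Ordering}
    (hΩ : Ω.IsRunningPrefixes) {D : Q.Database} {f : Q.Valuation → Q.Tree}
    (hf : Q.IsAssignment D f) (hinj : Set.InjOn Q.occurrenceToken (Q.occurrences D f)) :
    Ω.IsCut D (Ω.selected D f) := by
  refine ⟨finite_selected Ω D f, ?_, not_hasPathAvoiding_selected hQ hvar hΩ hf hinj⟩
  rintro n ⟨w, hw, ⟨c, hc, -, α, hα, rfl⟩ | ⟨p, hp, hi, rfl⟩⟩
  · obtain ⟨x, rfl⟩ := mem_choices.1 hc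
    obtain ⟨s, t, h⟩ := exists_mem_leaves x hα .start .finish
    exact ⟨_, .fromPlan w hw α s t h⟩
  · obtain ⟨x, hx⟩ := hΩ.exists_choice (hf w hw)
    obtain ⟨s, t, h⟩ := exists_span (occurs_iff_choice.2 ⟨x, hx ▸ hp⟩) [] .start .finish
    exact ⟨_, .fromPre w hw p hi s t h⟩

/-- Each cut contains the nodes that some assignment selects. -/
theorem exists_selected_subset (hQ : Q.Connected) (hvar : 0 < Q.numVars) {Ω : Q.Ordering}
    (hΩ : Ω.IsRunningPrefixes) {D : Q.Database} {C : Set Q.FlowNode} (hC : Ω.IsCut D C) :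
    ∃ f, Q.IsAssignment D f ∧ Ω.selected D f ⊆ C := by
  have := nonempty_choice Ω
  have hex : ∀ w ∈ Q.witnesses D, ∃ x : Choice Ω, (∀ β ∈ x.leafSet [], .plan w β ∈ C) ∧
      ∀ p ∈ x.tree, (Q.tablesAt p).Nonempty → .pre (Q.inst w p) ∈ C := by
    intro w hw
    by_contra hno
    have hconn : ∀ c, FlowNode.conn w c ∉ C := fun c hc => hC.2.1 _ hc
    -- Open means not in `C`. A path through the ordering of `w` becomes a path of the flow graph
    -- that avoids `C`.
    have := path_of_open (mixing_mveo hQ hvar)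
      (fun p => (Q.tablesAt p).Nonempty ∧ FlowNode.pre (Q.inst w p) ∉ C)
      (fun β => FlowNode.plan w β ∉ C) (sizeOf Ω) le_rfl hΩ.context hΩ.running [] .start .finish
      fun x => by
        by_contra hx
        push Not at hx
        exact hno ⟨x, hx.1, hx.2⟩
    refine hC.2.2 ?_
    have hpath : ∀ c, Relation.ReflTransGen (Ω.Step
        (fun p => (Q.tablesAt p).Nonempty ∧ FlowNode.pre (Q.inst w p) ∉ C)
        (fun β => FlowNode.plan w β ∉ C) [] .start .finish) .start c →
        Relation.ReflTransGen (fun a b => Ω.Edge D a b ∧ b ∉ C) .src (.conn w c) := by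
      intro c hc
      induction hc with
      | refl => exact Relation.ReflTransGen.single ⟨.source w hw, hconn _⟩
      | tail _ h ih =>
        rcases h with ⟨β, hβ, hV⟩ | ⟨p, ⟨hp, hpC⟩, hsp⟩
        · exact (ih.tail ⟨.toPlan w hw β _ _ hβ, hV⟩).tail ⟨.fromPlan w hw β _ _ hβ, hconn _⟩
        · exact (ih.tail ⟨.toPre w hw p hp _ _ hsp, hpC⟩).tail
            ⟨.fromPre w hw p hp _ _ hsp, hconn _⟩
    exact (hpath _ this).tail ⟨.target w hw, fun h => hC.2.1 _ h⟩
  choose! x hx using hex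
  refine ⟨fun w => (x w).tree, fun w _ => hΩ.tree_mem_mveo (x w), ?_⟩
  rintro n ⟨w, hw, ⟨c, hc, hcw, α, hα, rfl⟩ | ⟨p, hp, hi, rfl⟩⟩
  -- Here it matters that the ordering offers each tree only once: the leaves selected for the tree
  -- are those of the choice `x w`.
  · exact (hx w hw).1 α (hΩ.leafSet_eq (x w) hc hcw ▸ hα)
  · exact (hx w hw).2 p hp hi

theorem cutWeight_mono {C C' : Set Q.FlowNode} (h : C ⊆ C') (hC' : C'.Finite) :
    cutWeight C ≤ cutWeight C' := by
  rw [cutWeight, cutWeight, finsum_mem_eq_finite_toFinset_sum _ (hC'.subset h),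
    finsum_mem_eq_finite_toFinset_sum _ hC']
  exact Finset.sum_le_sum_of_subset (by simpa using h)

theorem exists_isFactorizationOf (D : Q.Database) (f : Q.Valuation → Q.Tree) :
    ∃ φ, Q.IsFactorizationOf D f φ :=
  ⟨_, (Q.prefixInstances D f).toList, Finset.nodup_toList _, by simp, rfl⟩

/-! ### Comparison of factorizations with the number of tokens. -/

section Factorizations

variable (hQ : Q.Connected) (hvar : 0 < Q.numVars) {D : Q.Database} {f : Q.Valuation → Q.Tree}
  (hf : Q.IsAssignment D f)

include hQ hvar hf

theorem IsFactorizationOf.equivalent {φ : Form Q.Token} (h : Q.IsFactorizationOf D f φ) :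
    φ.Equivalent (Q.provenance D) := by
  obtain ⟨L, -, hL, rfl⟩ := h
  exact factor_equivalent (hf.isCanonicalChoice hQ hvar) hL hQ hvar

theorem IsFactorizationOf.len_eq (Ω : Q.Ordering) {φ : Form Q.Token}
    (h : Q.IsFactorizationOf D f φ) : φ.len = cutWeight (Ω.selected D f) := by
  obtain ⟨L, hn, hL, rfl⟩ := h
  rw [len_factor (hf.isCanonicalChoice hQ hvar) hn hL, cutWeight_selected]

theorem card_tokens_le_cutWeight (Ω : Q.Ordering) :
    (Q.tokens D).card ≤ cutWeight (Ω.selected D f) := by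
  obtain ⟨φ, hφ⟩ := exists_isFactorizationOf D f
  rw [← hφ.len_eq hQ hvar hf Ω]
  exact card_tokens_le (hφ.equivalent hQ hvar hf)

theorem IsFactorizationOf.isMinimalFor {Ω : Q.Ordering}
    (hw : cutWeight (Ω.selected D f) ≤ (Q.tokens D).card) {φ : Form Q.Token}
    (h : Q.IsFactorizationOf D f φ) : φ.InReadOnceForm ∧ φ.IsMinimalFor (Q.provenance D) := by
  have he := h.equivalent hQ hvar hf
  rw [← h.len_eq hQ hvar hf Ω] at hw
  exact ⟨inReadOnceForm_of_len_le he hw, he, fun χ hχ => hw.trans (card_tokens_le hχ)⟩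

/-- The map from occurrences onto tokens is surjective, so a length of at most the number of tokens
forces it to be injective. -/
theorem injOn_occurrenceToken {Ω : Q.Ordering}
    (hw : cutWeight (Ω.selected D f) ≤ (Q.tokens D).card) :
    Set.InjOn Q.occurrenceToken (Q.occurrences D f) := by
  classical
  rw [cutWeight_selected, ← card_occurrences,
    ← image_occurrences hQ hvar (hf.isCanonicalChoice hQ hvar)] at hw
  exact Finset.card_image_iff.1 (le_antisymm Finset.card_image_le hw)

end Factorizations

section ReadOnce

variable (hQ : Q.Connected) (hvar : 0 < Q.numVars) {Ω : Q.Ordering} (hΩ : Ω.IsRunningPrefixes)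
  {D : Q.Database} (hD : (Q.provenance D).IsReadOnce)

include hQ hvar hD

theorem cutWeight_agreeingTree (Ω : Q.Ordering) :
    cutWeight (Ω.selected D (Q.agreeingTree D)) = (Q.tokens D).card := by
  rw [cutWeight_selected, exists_assignment_card_tokens hQ hvar hD]

theorem IsMinimalAssignment.cutWeight_le (Ω : Q.Ordering) {f : Q.Valuation → Q.Tree}
    (hf : Q.IsMinimalAssignment D f) : cutWeight (Ω.selected D f) ≤ (Q.tokens D).card := by
  obtain ⟨φ, hφ⟩ := exists_isFactorizationOf D f
  obtain ⟨χ, hχ⟩ := exists_isFactorizationOf D (Q.agreeingTree D)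
  have ha := isAssignment_agreeingTree hQ hvar D
  rw [← cutWeight_agreeingTree hQ hvar hD Ω, ← hφ.len_eq hQ hvar hf.1 Ω,
    ← hχ.len_eq hQ hvar ha Ω]
  exact (hf.2 φ hφ).2 χ (hχ.equivalent hQ hvar ha)

theorem isMinimalAssignment_agreeingTree : Q.IsMinimalAssignment D (Q.agreeingTree D) := by
  have ha := isAssignment_agreeingTree hQ hvar D
  -- The weight of the selected nodes does not depend on the ordering, so any ordering will do.
  exact ⟨ha, fun φ hφ => (hφ.isMinimalFor hQ hvar ha (Ω := .single ∅)
    (cutWeight_agreeingTree hQ hvar hD _).le).2⟩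

include hΩ

theorem isCut_agreeingTree : Ω.IsCut D (Ω.selected D (Q.agreeingTree D)) :=
  isCut_selected hQ hvar hΩ (isAssignment_agreeingTree hQ hvar D)
    (injOn_occurrenceToken_agreeingTree hD)

/-- Any cut contains a selection, which weighs at least the number of tokens. The agreeing trees
attain this number. -/
theorem isMinCut_agreeingTree : Ω.IsMinCut D (Ω.selected D (Q.agreeingTree D)) := by
  refine ⟨isCut_agreeingTree hQ hvar hΩ hD, fun C hC => ?_⟩
  obtain ⟨f, hf, hfC⟩ := exists_selected_subset hQ hvar hΩ hC
  rw [cutWeight_agreeingTree hQ hvar hD]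
  exact (card_tokens_le_cutWeight hQ hvar hf Ω).trans (cutWeight_mono hfC hC.1)

theorem not_hasLeakage : ¬ Ω.HasLeakage D := fun h =>
  h ⟨_, isMinimalAssignment_agreeingTree hQ hvar hD, isCut_agreeingTree hQ hvar hΩ hD⟩

/-- A minimal assignment is no longer than the agreeing trees, so it also writes each token once.
The absence of paths therefore holds for every minimal assignment. -/
theorem not_hasLeakagePath : ¬ Ω.HasLeakagePath D := fun ⟨_, hf, h⟩ =>
  not_hasPathAvoiding_selected hQ hvar hΩ hf.1
    (injOn_occurrenceToken hQ hvar hf.1 (hf.cutWeight_le hQ hvar hD Ω)) h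

/-- The weight of the selection lies between the number of tokens and the weight of `C`, and these
two are equal. -/
theorem factorization_of_isMinCut {C : Set Q.FlowNode} (hC : Ω.IsMinCut D C)
    {f : Q.Valuation → Q.Tree} (hf : Q.IsAssignment D f) (hfC : Ω.selected D f ⊆ C)
    {φ : Form Q.Token} (hφ : Q.IsFactorizationOf D f φ) :
    φ.InReadOnceForm ∧ φ.IsMinimalFor (Q.provenance D) ∧ φ.len = cutWeight C := by
  have h1 := cutWeight_mono hfC hC.1.1
  have h2 := hC.2 _ (isCut_agreeingTree hQ hvar hΩ hD)
  rw [cutWeight_agreeingTree hQ hvar hD] at h2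
  have h3 := hφ.isMinimalFor hQ hvar hf (h1.trans h2)
  refine ⟨h3.1, h3.2, ?_⟩
  rw [hφ.len_eq hQ hvar hf Ω]
  exact le_antisymm h1 (h2.trans (card_tokens_le_cutWeight hQ hvar hf Ω))

end ReadOnce

end CQ

/-! ## Polynomial-time functions -/

namespace Data

theorem size_pos (d : Data) : 0 < d.size := by cases d <;> simp [size]

theorem size_hd_le (d : Data) : d.hd.size ≤ d.size := by cases d <;> simp [hd, size]; omega

theorem size_tl_le (d : Data) : d.tl.size ≤ d.size := by cases d <;> simp [tl, size]; omega

theorem size_ofBool_le (b : Bool) : (ofBool b).size ≤ 3 := by cases b <;> simp [ofBool, size]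

@[simp] theorem toList_ofList {A : Type} (e : A → Data) (l : List A) :
    (ofList e l).toList = l.map e := by
  induction l with
  | nil => rfl
  | cons a l ih => simp [ofList, toList, ih]

theorem size_ofList {A : Type} (e : A → Data) (l : List A) :
    (ofList e l).size = 1 + (l.map fun a => (e a).size + 1).sum := by
  induction l with
  | nil => rfl
  | cons a l ih => simp only [ofList, size, ih, List.map_cons, List.sum_cons]; omega

theorem length_lt_size {A : Type} (e : A → Data) (l : List A) :
    l.length < (ofList e l).size := by
  induction l with
  | nil => exact size_pos _
  | cons a l ih => simp only [ofList, size, List.length_cons]; omega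

theorem size_lt_of_mem {A : Type} (e : A → Data) {l : List A} {a : A} (h : a ∈ l) :
    (e a).size < (ofList e l).size := by
  induction l with
  | nil => simp at h
  | cons b l ih =>
    simp only [ofList, size]
    rcases List.mem_cons.1 h with rfl | h
    · omega
    · have := ih h; omega

theorem size_ofList_append {A : Type} (e : A → Data) (l l' : List A) :
    (ofList e (l ++ l')).size + 1 = (ofList e l).size + (ofList e l').size := by
  simp only [size_ofList, List.map_append, List.sum_append]; omega

theorem ofList_injective {A : Type} {e : A → Data} (he : Function.Injective e) :
    Function.Injective (ofList e) := fun l l' h => by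
  have := congrArg toList h
  rw [toList_ofList, toList_ofList] at this
  exact he.list_map this

theorem ofBool_injective : Function.Injective ofBool := by
  intro a b h; cases a <;> cases b <;> simp [ofBool] at h ⊢

theorem ofNat_injective : Function.Injective ofNat := by
  intro a b h
  have key : ∀ n : ℕ, n.bits.foldr (fun b k => Nat.bit b k) 0 = n := by
    intro n
    induction n using Nat.binaryRec' with
    | zero => simp
    | bit b n hb ih => rw [Nat.bits_append_bit n b hb, List.foldr_cons, ih]
  rw [← key a, ← key b, ofList_injective ofBool_injective h]

theorem ofOption_injective {A : Type} {e : A → Data} (he : Function.Injective e) :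
    Function.Injective (ofOption e) := by
  intro a b h
  cases a <;> cases b <;> simp [ofOption] at h ⊢
  exact he h

end Data

namespace Prog

/-- Time bounds also bound the size of the output, which is needed to compose programs. The factor
`2` covers `eq`, whose output may have size `3` after `2` steps. -/
theorem size_eval_le (P : Prog) (x : Data) : (P.eval x).size ≤ 2 * P.time x := by
  induction P generalizing x with
  | id => simp only [eval, time]; omega
  | nil => simp only [eval, time, Data.size]; omega
  | hd => have := x.size_hd_le; simp only [eval, time]; omega
  | tl => have := x.size_tl_le; simp only [eval, time]; omega
  | eq =>
    have := Data.size_ofBool_le (decide (x.hd = x.tl))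
    have := x.size_pos
    simp only [eval, time]; omega
  | cons f g hf hg => have := hf x; have := hg x; simp only [eval, time, Data.size]; omega
  | comp f g hf hg => have := hf (g.eval x); simp only [eval, time]; omega
  | ite c f g hc hf hg =>
    have := hf x
    have := hg x
    simp only [eval, time]
    split_ifs <;> omega
  | fold f hf =>
    simp only [eval, time]
    -- The growth of the state is charged to the steps counted after the counter value `t`.
    have key : ∀ (l : List Data) (s : Data) (t : ℕ),
        (l.foldl (fun s e => f.eval (.cons s e)) s).size + 2 * t ≤ s.size +
          2 * (l.foldl (fun (s : Data × ℕ) e => (f.eval (.cons s.1 e),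
            s.2 + f.time (.cons s.1 e) + 1)) (s, t)).2 := by
      intro l
      induction l with
      | nil => simp
      | cons e l ih =>
        intro s t
        have h1 := ih (f.eval (.cons s e)) (t + f.time (.cons s e) + 1)
        have h2 := hf (.cons s e)
        simp only [List.foldl_cons]
        omega
    have h1 := key x.tl.toList x.hd 0
    have h2 := x.size_hd_le
    omega

end Prog

open Polynomial

theorem Polynomial.eval_le_eval_of_le (q : ℕ[X]) {m n : ℕ} (h : m ≤ n) : q.eval m ≤ q.eval n := by
  rw [eval_eq_sum_range, eval_eq_sum_range]
  exact Finset.sum_le_sum fun i _ => Nat.mul_le_mul_left _ (Nat.pow_le_pow_left h i)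

/-- The constant `c` is the sum of the coefficients. The additive `c` is for arguments at which the
leading power vanishes. -/
theorem Polynomial.exists_bound (q : ℕ[X]) : ∃ c k : ℕ, ∀ n, q.eval n ≤ c * n ^ k + c := by
  refine ⟨∑ i ∈ Finset.range (q.natDegree + 1), q.coeff i, q.natDegree, fun n => ?_⟩
  rw [eval_eq_sum_range, ← Nat.mul_succ, Finset.sum_mul]
  refine Finset.sum_le_sum fun i hi => Nat.mul_le_mul_left _ ?_
  rcases Nat.eq_zero_or_pos n with rfl | hn
  · rcases Nat.eq_zero_or_pos i with rfl | hi
    · simp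
    · rw [zero_pow hi.ne']; exact Nat.zero_le _
  · exact (Nat.pow_le_pow_right hn (Nat.le_of_lt_succ (Finset.mem_range.1 hi))).trans
      (Nat.le_succ _)

/-! ### Encodings and closure properties of polynomial time. -/

/-- Types with an encoding by binary trees. -/
class Coded (A : Type) where
  code : A → Data

/-- Different values have different codes. -/
class Coded.Faithful (A : Type) [Coded A] : Prop where
  injective : Function.Injective (Coded.code : A → Data)

open Coded

namespace Coded

instance : Coded Bool := ⟨Data.ofBool⟩
instance : Coded ℕ := ⟨Data.ofNat⟩

section

variable {A B : Type} [Coded A] [Coded B]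

instance : Coded (A × B) := ⟨fun a => .cons (code a.1) (code a.2)⟩
instance : Coded (List A) := ⟨Data.ofList code⟩
instance : Coded (Option A) := ⟨Data.ofOption code⟩
instance {n : ℕ} : Coded (Fin n → A) := ⟨fun f => Data.ofList code (List.ofFn f)⟩
instance {p : A → Prop} : Coded {a // p a} := ⟨fun a => code a.1⟩

theorem code_mk (a : A) (b : B) : code (a, b) = .cons (code a) (code b) := rfl
theorem code_nil : code ([] : List A) = .nil := rfl
theorem code_cons (a : A) (l : List A) : code (a :: l) = .cons (code a) (code l) := rfl
theorem code_fun {n : ℕ} (f : Fin n → A) : code f = code (List.ofFn f) := rfl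

end

instance {n : ℕ} : Coded (Finset (Fin n)) := ⟨fun S => code fun x => decide (x ∈ S)⟩

open Classical in
noncomputable instance {n : ℕ} : Coded (Set (Fin n)) := ⟨fun S => code fun x => decide (x ∈ S)⟩

section

variable {A B : Type} [Coded A] [Coded B] [Faithful A] [Faithful B]

theorem code_inj {a b : A} : code a = code b ↔ a = b := Faithful.injective.eq_iff

instance : Faithful Bool := ⟨Data.ofBool_injective⟩
instance : Faithful ℕ := ⟨Data.ofNat_injective⟩
instance : Faithful (A × B) := ⟨fun a b h => by
  simp only [code, Data.cons.injEq] at h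
  exact Prod.ext (Faithful.injective h.1) (Faithful.injective h.2)⟩
instance : Faithful (List A) := ⟨Data.ofList_injective Faithful.injective⟩
instance : Faithful (Option A) := ⟨Data.ofOption_injective Faithful.injective⟩
instance {n : ℕ} : Faithful (Fin n → A) := ⟨fun _ _ h =>
  List.ofFn_injective (Data.ofList_injective Faithful.injective h)⟩
instance {p : A → Prop} : Faithful {a // p a} := ⟨fun _ _ h =>
  Subtype.ext (Faithful.injective h)⟩
instance {n : ℕ} : Faithful (Finset (Fin n)) := ⟨fun S T h => by
  have := Faithful.injective (A := Fin n → Bool) h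
  ext x
  simpa using congrFun this x⟩
instance {n : ℕ} : Faithful (Set (Fin n)) := ⟨fun S T h => by
  have := Faithful.injective (A := Fin n → Bool) h
  ext x
  simpa using congrFun this x⟩

end

end Coded

/-- `F` is computed by a program in polynomial time. -/
def PolyTime {A B : Type} [Coded A] [Coded B] (F : A → B) : Prop :=
  ∃ (P : Prog) (q : ℕ[X]), ∀ a, P.eval (code a) = code (F a) ∧ P.time (code a) ≤ q.eval (code a).size

/-- `p` is decided by a program in polynomial time. -/
def PolyPred {A : Type} [Coded A] (p : A → Prop) : Prop :=
  ∃ b : A → Bool, PolyTime b ∧ ∀ a, b a = true ↔ p a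

namespace PolyTime

variable {A B C S Y : Type} [Coded A] [Coded B] [Coded C] [Coded S] [Coded Y]

/-- Programs see codes only. So a constructor whose code is a pair of known codes is computed by a
program for pairs. -/
theorem congr_code {F : A → B} (hF : PolyTime F) {G : A → C} (h : ∀ a, code (G a) = code (F a)) :
    PolyTime G := by
  obtain ⟨P, q, hP⟩ := hF
  exact ⟨P, q, fun a => by rw [h]; exact hP a⟩

theorem congr {F G : A → B} (hF : PolyTime F) (h : ∀ a, G a = F a) : PolyTime G :=
  hF.congr_code fun a => by rw [h]

theorem of_code {F : A → B} (h : ∀ a, code (F a) = code a) : PolyTime F :=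
  ⟨.id, X + 1, fun a => ⟨(h a).symm, by simp [Prog.time]⟩⟩

protected theorem id : PolyTime (fun a : A => a) := of_code fun _ => rfl

theorem size_le {F : A → B} (hF : PolyTime F) :
    ∃ q : ℕ[X], ∀ a, (code (F a)).size ≤ q.eval (code a).size := by
  obtain ⟨P, q, hP⟩ := hF
  refine ⟨2 * q, fun a => ?_⟩
  have := P.size_eval_le (code a)
  rw [(hP a).1] at this
  rw [eval_mul, show (2 : ℕ[X]) = C 2 from rfl, eval_C]
  exact this.trans (Nat.mul_le_mul_left _ (hP a).2)

/-- The second program runs on the output of the first one, whose size is polynomially bounded by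
`size_le`. -/
theorem comp {F : B → C} {G : A → B} (hF : PolyTime F) (hG : PolyTime G) :
    PolyTime fun a => F (G a) := by
  obtain ⟨s, hs⟩ := hG.size_le
  obtain ⟨P, p, hP⟩ := hF
  obtain ⟨R, q, hR⟩ := hG
  refine ⟨.comp P R, q + p.comp s + 1, fun a => ⟨?_, ?_⟩⟩
  · rw [Prog.eval, (hR a).1, (hP _).1]
  · simp only [Prog.time, (hR a).1, eval_add, eval_comp, eval_one]
    have h1 := (hP (G a)).2.trans (p.eval_le_eval_of_le (hs a))
    have h2 := (hR a).2
    omega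

theorem mk {F : A → B} {G : A → C} (hF : PolyTime F) (hG : PolyTime G) :
    PolyTime fun a => (F a, G a) := by
  obtain ⟨P, p, hP⟩ := hF
  obtain ⟨R, q, hR⟩ := hG
  refine ⟨.cons P R, p + q + 1, fun a => ⟨?_, ?_⟩⟩
  · rw [Prog.eval, (hR a).1, (hP a).1]; rfl
  · simp only [Prog.time, eval_add, eval_one]
    have h1 := (hP a).2
    have h2 := (hR a).2
    omega

theorem fst {F : A → B × C} (hF : PolyTime F) : PolyTime fun a => (F a).1 :=
  comp (F := Prod.fst) ⟨.hd, X + 1, fun a => ⟨rfl, by simp [Prog.time]⟩⟩ hF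

theorem snd {F : A → B × C} (hF : PolyTime F) : PolyTime fun a => (F a).2 :=
  comp (F := Prod.snd) ⟨.tl, X + 1, fun a => ⟨rfl, by simp [Prog.time]⟩⟩ hF

theorem const_data (d : Data) : ∃ (P : Prog) (q : ℕ[X]), ∀ x, P.eval x = d ∧
    P.time x ≤ q.eval x.size := by
  induction d with
  | nil => exact ⟨.nil, X + 1, fun x => ⟨rfl, by simp [Prog.time]⟩⟩
  | cons a b ha hb =>
    obtain ⟨P, p, hP⟩ := ha
    obtain ⟨R, q, hR⟩ := hb
    refine ⟨.cons P R, p + q + 1, fun x => ⟨?_, ?_⟩⟩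
    · rw [Prog.eval, (hR x).1, (hP x).1]
    · simp only [Prog.time, eval_add, eval_one]
      have h1 := (hP x).2
      have h2 := (hR x).2
      omega

theorem const (b : B) : PolyTime fun _ : A => b := by
  obtain ⟨P, q, h⟩ := const_data (code b)
  exact ⟨P, q, fun a => h _⟩

theorem cons {F : A → B} {G : A → List B} (hF : PolyTime F) (hG : PolyTime G) :
    PolyTime fun a => F a :: G a :=
  (hF.mk hG).congr_code fun _ => rfl

open Classical in
theorem ite {p : A → Prop} {F G : A → B} (hp : PolyPred p) (hF : PolyTime F) (hG : PolyTime G) :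
    PolyTime fun a => if p a then F a else G a := by
  obtain ⟨b, ⟨N, n, hN⟩, hb⟩ := hp
  obtain ⟨P, p, hP⟩ := hF
  obtain ⟨R, q, hR⟩ := hG
  refine ⟨.ite N P R, n + p + q + 1, fun a => ?_⟩
  have h1 := (hN a).2
  have h2 := (hP a).2
  have h3 := (hR a).2
  simp only [Prog.eval, Prog.time, (hN a).1, eval_add, eval_one]
  by_cases h : b a = true
  · rw [if_pos ((hb a).1 h), h, if_neg (by simp [code, Data.ofBool]),
      if_neg (by simp [code, Data.ofBool])]
    exact ⟨(hP a).1, by omega⟩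
  · have hc : (code false : Data) = .nil := rfl
    rw [if_neg fun h' => h ((hb a).2 h'), Bool.eq_false_iff.2 h, if_pos hc, if_pos hc]
    exact ⟨(hR a).1, by omega⟩

/-- A loop whose state grows by a polynomial in each round. -/
theorem foldl {l : A → List Y} {s : A → S} {f : A → S → Y → S} (hl : PolyTime l)
    (hs : PolyTime s) (hf : PolyTime fun p : A × S × Y => f p.1 p.2.1 p.2.2)
    (hg : ∃ g : ℕ[X], ∀ a t x, (code (f a t x)).size ≤ (code t).size + g.eval (code (a, x)).size) :
    PolyTime fun a => (l a).foldl (f a) (s a) := by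
  obtain ⟨g, hg⟩ := hg
  obtain ⟨ql, hql⟩ := hl.size_le
  obtain ⟨qs, hqs⟩ := hs.size_le
  obtain ⟨PL, tl, hPL⟩ := hl
  obtain ⟨PS, ts, hPS⟩ := hs
  obtain ⟨PF, tf, hPF⟩ := hf
  -- `SB` bounds the state in all rounds, `IN` the input of one round, and `ST` the time of one
  -- round. Growth by an additive amount that does not depend on the state keeps the state
  -- polynomial, and the constants `20` are slack for the rearranging instructions.
  set SB : ℕ[X] := qs + ql * g.comp (X + ql + 1) with hSB
  set IN : ℕ[X] := X + SB + ql + 2 with hIN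
  set ST : ℕ[X] := 20 * IN + 20 + tf.comp IN with hST
  -- The loop body sees only the state and the entry, so the input `a` is carried along as the first
  -- part of the state.
  let step : Prog := .cons (.comp .hd .hd)
    (.comp PF (.cons (.comp .hd .hd) (.cons (.comp .tl .hd) .tl)))
  have hstep : ∀ (a : A) (t : S) (x : Y), step.eval (.cons (.cons (code a) (code t)) (code x)) =
      .cons (code a) (code (f a t x)) := by
    intro a t x
    simp only [step, Prog.eval, Data.hd, Data.tl]
    exact congrArg _ (hPF (a, t, x)).1
  have htime : ∀ (a : A) (t : S) (x : Y), x ∈ l a → (code t).size ≤ SB.eval (code a).size →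
      step.time (.cons (.cons (code a) (code t)) (code x)) ≤ ST.eval (code a).size := by
    intro a t x hx ht
    have hxs : (code x).size < ql.eval (code a).size :=
      (Data.size_lt_of_mem code hx).trans_le (hql a)
    have h1 := (hPF (a, t, x)).2
    have h2 : (code (a, t, x)).size ≤ IN.eval (code a).size := by
      simp only [code_mk, Data.size, hIN, eval_add, eval_X, eval_ofNat]
      omega
    have h3 := tf.eval_le_eval_of_le h2
    simp only [code_mk, Data.size] at h1 h2
    simp only [step, Prog.time, Prog.eval, Data.hd, Data.tl, Data.size, hST, eval_add, eval_mul,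
      eval_ofNat, eval_comp]
    have h1' : PF.time (.cons (code a) (.cons (code t) (code x))) ≤
      tf.eval ((code a).size + ((code t).size + (code x).size + 1) + 1) := h1
    simp only [code_mk, Data.size] at h3
    omega
  clear_value ST
  -- Here `l'` is the part of the list that has been processed. Its length controls the present size
  -- of the state.
  have hfold : ∀ (l' l'' : List Y) (a : A) (t : S) (n : ℕ), l' ++ l'' = l a →
      (code t).size ≤ qs.eval (code a).size +
        l'.length * (g.comp (X + ql + 1)).eval (code a).size →
      (l''.map code).foldl (fun s e => step.eval (.cons s e)) (.cons (code a) (code t)) =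
        .cons (code a) (code (l''.foldl (f a) t)) ∧
      ((l''.map code).foldl (fun (s : Data × ℕ) e => (step.eval (.cons s.1 e),
        s.2 + step.time (.cons s.1 e) + 1)) (.cons (code a) (code t), n)).2 ≤
          n + l''.length * (ST.eval (code a).size + 1) := by
    intro l' l''
    induction l'' generalizing l' with
    | nil => intro a t n _ _; simp
    | cons x l'' ih =>
      intro a t n hll ht
      have hx : x ∈ l a := by rw [← hll]; simp
      have hlen : l'.length ≤ ql.eval (code a).size := by
        have h1 := (Data.length_lt_size code (l a)).trans_le (hql a)
        rw [← hll, List.length_append] at h1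
        omega
      have htS : (code t).size ≤ SB.eval (code a).size := by
        refine ht.trans ?_
        rw [hSB, eval_add, eval_mul]
        exact Nat.add_le_add_left (Nat.mul_le_mul_right _ hlen) _
      have hT := htime a t x hx htS
      simp only [List.map_cons, List.foldl_cons, hstep]
      have hgr : (code (f a t x)).size ≤ qs.eval (code a).size +
          (l' ++ [x]).length * (g.comp (X + ql + 1)).eval (code a).size := by
        have h1 := hg a t x
        have h2 : (code (a, x)).size ≤ (X + ql + 1 : ℕ[X]).eval (code a).size := by
          have : (code x).size < ql.eval (code a).size :=
            (Data.size_lt_of_mem code hx).trans_le (hql a)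
          simp only [code_mk, Data.size, eval_add, eval_X, eval_one]
          omega
        have h3 := g.eval_le_eval_of_le h2
        rw [List.length_append, List.length_singleton, Nat.add_mul, Nat.one_mul, eval_comp]
        rw [eval_comp] at ht
        omega
      obtain ⟨e1, e2⟩ := ih (l' ++ [x]) a (f a t x)
        (n + step.time (.cons (.cons (code a) (code t)) (code x)) + 1) (by simpa using hll) hgr
      refine ⟨e1, e2.trans ?_⟩
      rw [List.length_cons, Nat.succ_mul]
      omega
  refine ⟨.comp .tl (.comp (.fold step) (.cons (.cons .id PS) PL)),
    3 * (X + qs + ql + 3 + ql * (ST + 1)) + X + ts + tl + 20, fun a => ?_⟩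
  obtain ⟨e1, e2⟩ := hfold [] (l a) a (s a) 0 rfl (by simpa using hqs a)
  have hL : (code (l a)).toList = (l a).map code := Data.toList_ofList _ _
  have hin : (Prog.cons (.cons .id PS) PL).eval (code a) =
      .cons (.cons (code a) (code (s a))) (code (l a)) := by
    simp only [Prog.eval, (hPS a).1, (hPL a).1]
  have ev : (Prog.fold step).eval (.cons (.cons (code a) (code (s a))) (code (l a))) =
      .cons (code a) (code ((l a).foldl (f a) (s a))) := by
    simp only [Prog.eval, Data.tl, Data.hd, hL]
    exact e1
  have tm : (Prog.fold step).time (.cons (.cons (code a) (code (s a))) (code (l a))) ≤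
      (X + qs + ql + 3 + ql * (ST + 1)).eval (code a).size := by
    have h3 := hqs a
    have h4 := hql a
    have : (l a).length * (ST.eval (code a).size + 1) ≤ (ql * (ST + 1)).eval (code a).size := by
      rw [eval_mul, eval_add, eval_one]
      exact Nat.mul_le_mul_right _ ((Data.length_lt_size code (l a)).le.trans h4)
    simp only [Prog.time, Data.tl, Data.hd, hL, Data.size]
    rw [eval_add, eval_add, eval_add, eval_add, eval_X, eval_ofNat]
    omega
  have hcomp : (Prog.comp (.fold step) (.cons (.cons .id PS) PL)).eval (code a) =
      (Prog.fold step).eval (.cons (.cons (code a) (code (s a))) (code (l a))) := by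
    rw [← hin]; rfl
  constructor
  · rw [Prog.eval, hcomp, ev]
    rfl
  · have hsz := (Prog.fold step).size_eval_le (.cons (.cons (code a) (code (s a))) (code (l a)))
    have h1 := (hPS a).2
    have h2 := (hPL a).2
    have ht : ∀ P R : Prog, ∀ x, (Prog.comp P R).time x = R.time x + P.time (R.eval x) + 1 :=
      fun _ _ _ => rfl
    have hc : (Prog.cons (.cons .id PS) PL).time (code a) =
        (code a).size + 1 + PS.time (code a) + 1 + PL.time (code a) + 1 := rfl
    have htl : ∀ x, Prog.tl.time x = x.size + 1 := fun _ => rfl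
    rw [ht, ht, hcomp, hin, hc, htl, eval_add, eval_add, eval_add, eval_add, eval_mul,
      eval_ofNat, eval_ofNat, eval_X]
    omega

end PolyTime

/-! ## Operations that preserve polynomial time -/

namespace PolyPred

variable {A B Y : Type} [Coded A] [Coded B] [Coded Y]

theorem congr {p q : A → Prop} (hp : PolyPred p) (h : ∀ a, q a ↔ p a) : PolyPred q :=
  hp.imp fun _ hb => ⟨hb.1, fun a => (hb.2 a).trans (h a).symm⟩

theorem comp {p : B → Prop} {F : A → B} (hp : PolyPred p) (hF : PolyTime F) :
    PolyPred fun a => p (F a) :=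
  let ⟨b, hb, h⟩ := hp
  ⟨fun a => b (F a), PolyTime.comp hb hF, fun a => h (F a)⟩

open Classical in
theorem const (p : Prop) : PolyPred fun _ : A => p :=
  ⟨fun _ => decide p, PolyTime.const _, by simp⟩

theorem eq [Faithful B] {F G : A → B} (hF : PolyTime F) (hG : PolyTime G) :
    PolyPred fun a => F a = G a := by
  classical
  obtain ⟨P, p, hP⟩ := hF.mk hG
  obtain ⟨s, hs⟩ := (hF.mk hG).size_le
  refine ⟨fun a => decide (F a = G a), ⟨.comp .eq P, p + s + 2, fun a => ⟨?_, ?_⟩⟩, by simp⟩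
  · rw [Prog.eval, (hP a).1]
    simp only [Prog.eval, code_mk, Data.hd, Data.tl, code_inj]
    rfl
  · have h1 := (hP a).2
    have h2 := hs a
    rw [Prog.time, (hP a).1, Prog.time, eval_add, eval_add, eval_ofNat]
    dsimp only at h2 ⊢
    omega

open Classical in
theorem of_ite {p q r : A → Prop} (hp : PolyPred p) (hq : PolyPred q) (hr : PolyPred r) :
    PolyPred fun a => if p a then q a else r a := by
  obtain ⟨b, hb, h⟩ := hq
  obtain ⟨c, hc, h'⟩ := hr
  refine ⟨_, PolyTime.ite hp hb hc, fun a => ?_⟩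
  dsimp only
  split_ifs
  exacts [h a, h' a]

theorem not {p : A → Prop} (hp : PolyPred p) : PolyPred fun a => ¬ p a :=
  (of_ite hp (const False) (const True)).congr fun a => by by_cases h : p a <;> simp [h]

theorem and {p q : A → Prop} (hp : PolyPred p) (hq : PolyPred q) : PolyPred fun a => p a ∧ q a :=
  (of_ite hp hq (const False)).congr fun a => by by_cases h : p a <;> simp [h]

theorem imp {p q : A → Prop} (hp : PolyPred p) (hq : PolyPred q) : PolyPred fun a => p a → q a :=
  (of_ite hp hq (const True)).congr fun a => by by_cases h : p a <;> simp [h]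

/-- A quantifier over a fixed finite type is unrolled in the program. -/
theorem forall_finite {ι : Type} [Finite ι] {p : ι → A → Prop} (hp : ∀ i, PolyPred (p i)) :
    PolyPred fun a => ∀ i, p i a := by
  classical
  have := Fintype.ofFinite ι
  have key : ∀ s : Finset ι, PolyPred fun a => ∀ i ∈ s, p i a := by
    intro s
    induction s using Finset.induction_on with
    | empty => exact (const True).congr fun a => by simp
    | insert i s _ ih => exact ((hp i).and ih).congr fun a => by simp
  exact (key Finset.univ).congr fun a => by simp

theorem exists_finite {ι : Type} [Finite ι] {p : ι → A → Prop} (hp : ∀ i, PolyPred (p i)) :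
    PolyPred fun a => ∃ i, p i a :=
  (forall_finite fun i => (hp i).not).not.congr fun a => by simp

theorem forall_mem {l : A → List Y} {p : A → Y → Prop} (hl : PolyTime l)
    (hp : PolyPred fun b : A × Y => p b.1 b.2) : PolyPred fun a => ∀ x ∈ l a, p a x := by
  classical
  refine ⟨_, PolyTime.foldl (s := fun _ => true) (f := fun a b x => if p a x then b else false)
    hl (PolyTime.const true) ?_ ⟨0, fun a t x => ?_⟩, fun a => ?_⟩
  · exact PolyTime.ite (hp.comp ((PolyTime.fst .id).mk (PolyTime.snd (PolyTime.snd .id))))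
      (PolyTime.fst (PolyTime.snd .id)) (PolyTime.const false)
  · split_ifs
    · exact Nat.le_add_right _ _
    · cases t
      · exact Nat.le_add_right _ _
      · exact (by simp [code, Data.ofBool, Data.size])
  · have key : ∀ (l : List Y) (b : Bool),
        l.foldl (fun b x => if p a x then b else false) b = true ↔ b = true ∧ ∀ x ∈ l, p a x := by
      intro l
      induction l with
      | nil => simp
      | cons x l ih =>
        intro b
        rw [List.foldl_cons, ih, List.forall_mem_cons]
        by_cases h : p a x <;> simp [h]
    exact (key (l a) true).trans (by simp)

theorem exists_mem {l : A → List Y} {p : A → Y → Prop} (hl : PolyTime l)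
    (hp : PolyPred fun b : A × Y => p b.1 b.2) : PolyPred fun a => ∃ x ∈ l a, p a x :=
  (forall_mem hl (p := fun a x => ¬ p a x) hp.not).not.congr fun a => by simp

theorem mem [Faithful Y] {x : A → Y} {l : A → List Y} (hx : PolyTime x) (hl : PolyTime l) :
    PolyPred fun a => x a ∈ l a :=
  (exists_mem hl (p := fun a y => x a = y)
    (eq (hx.comp (PolyTime.fst .id)) (PolyTime.snd .id))).congr fun a => by simp

end PolyPred

namespace PolyTime

variable {A B C Y : Type} [Coded A] [Coded B] [Coded C] [Coded Y]

/-- The values of `κ` are finitely many and independent of the input, so one program for each value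
is stored together with the tests. Nothing is required of `G` as a function of the index, which may
be defined by choice. -/
theorem finite_cases {ι : Type} [Finite ι] {κ : A → ι} (hκ : ∀ i, PolyPred fun a => κ a = i)
    {G : ι → A → B} (hG : ∀ i, PolyTime (G i)) : PolyTime fun a => G (κ a) a := by
  classical
  have := Fintype.ofFinite ι
  rcases isEmpty_or_nonempty ι with hι | ⟨⟨i₀⟩⟩
  · exact ⟨.nil, 0, fun a => (hι.false (κ a)).elim⟩
  have key : ∀ s : Finset ι, ∃ F : A → B, PolyTime F ∧ ∀ a, κ a ∈ s → F a = G (κ a) a := by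
    intro s
    induction s using Finset.induction_on with
    | empty => exact ⟨G i₀, hG i₀, by simp⟩
    | insert i s _ ih =>
      obtain ⟨F, hF, h⟩ := ih
      refine ⟨_, ite (hκ i) (hG i) hF, fun a ha => ?_⟩
      by_cases hi : κ a = i
      · rw [if_pos hi, hi]
      · rw [if_neg hi, h a ((Finset.mem_insert.1 ha).resolve_left hi)]
  obtain ⟨F, hF, h⟩ := key Finset.univ
  exact hF.congr fun a => (h a (Finset.mem_univ _)).symm

/-! ### Lists -/

theorem tail {l : A → List Y} (hl : PolyTime l) : PolyTime fun a => (l a).tail :=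
  comp (F := List.tail) ⟨.tl, X + 1, fun l => ⟨by cases l <;> rfl, by simp [Prog.time]⟩⟩ hl

theorem headD {l : A → List Y} (hl : PolyTime l) (d : Y) : PolyTime fun a => (l a).headD d := by
  obtain ⟨P, q, hP⟩ := const_data (code d)
  refine comp (F := fun l : List Y => l.headD d) ⟨.ite .id .hd P, 2 * X + q + 3, fun l => ?_⟩ hl
  cases l with
  | nil =>
    have := (hP (code ([] : List Y))).2
    refine ⟨by simpa [Prog.eval, code_nil] using (hP _).1, ?_⟩
    simp only [Prog.time, Prog.eval, code_nil, if_pos, eval_add, eval_mul, eval_X,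
      eval_ofNat] at this ⊢
    omega
  | cons a l =>
    refine ⟨by simp [Prog.eval, code_cons, Data.hd], ?_⟩
    have hne : ¬ Prog.id.eval (code (a :: l)) = .nil := by simp [Prog.eval, code_cons]
    rw [Prog.time, if_neg hne, Prog.time, Prog.time]
    simp only [eval_add, eval_mul, eval_X, eval_ofNat]
    omega

/-- A loop that puts one new entry in front of the state in each round. -/
theorem foldl_cons {l : A → List Y} {s : A → List B} {G : A → Y → B} (hl : PolyTime l)
    (hs : PolyTime s) (hG : PolyTime fun p : A × Y => G p.1 p.2) :
    PolyTime fun a => (l a).foldl (fun t x => G a x :: t) (s a) := by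
  obtain ⟨q, hq⟩ := hG.size_le
  refine foldl (f := fun a t x => G a x :: t) hl hs ?_ ⟨q + 1, fun a t x => ?_⟩
  · exact cons (hG.comp ((fst .id).mk (snd (snd .id)))) (fst (snd .id))
  · have := hq (a, x)
    rw [code_cons, Data.size, eval_add, eval_one]
    dsimp only at this
    omega

theorem reverse {l : A → List Y} (hl : PolyTime l) : PolyTime fun a => (l a).reverse :=
  (foldl_cons (G := fun _ x => x) hl (const []) (snd .id)).congr fun a => by
    simp

theorem append {l l' : A → List Y} (hl : PolyTime l) (hl' : PolyTime l') :
    PolyTime fun a => l a ++ l' a :=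
  (foldl_cons (G := fun _ x => x) hl.reverse hl' (snd .id)).congr fun a => by
    simp

theorem map {l : A → List Y} {G : A → Y → B} (hl : PolyTime l)
    (hG : PolyTime fun p : A × Y => G p.1 p.2) : PolyTime fun a => (l a).map (G a) :=
  (foldl_cons hl.reverse (const []) hG).congr fun a => by
    rw [List.foldl_reverse]
    induction l a with
    | nil => rfl
    | cons x l ih => rw [List.map_cons, ih]; rfl

open Classical in
theorem filter {l : A → List Y} {p : A → Y → Prop} (hl : PolyTime l)
    (hp : PolyPred fun b : A × Y => p b.1 b.2) :
    PolyTime fun a => (l a).filter fun x => decide (p a x) := by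
  refine (foldl (s := fun _ => []) (f := fun a t x => if p a x then x :: t else t) hl.reverse
    (const []) ?_ ⟨X + 1, fun a t x => ?_⟩).congr fun a => ?_
  · exact ite (hp.comp ((fst .id).mk (snd (snd .id)))) (cons (snd (snd .id)) (fst (snd .id)))
      (fst (snd .id))
  · split_ifs
    · rw [code_cons, Data.size, code_mk, Data.size, eval_add, eval_X, eval_one]
      omega
    · exact Nat.le_add_right _ _
  · rw [List.foldl_reverse]
    induction l a with
    | nil => rfl
    | cons x l ih =>
      rw [List.foldr_cons, ← ih]
      by_cases h : p a x <;> simp [h]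

theorem flatMap {l : A → List Y} {G : A → Y → List B} (hl : PolyTime l)
    (hG : PolyTime fun p : A × Y => G p.1 p.2) : PolyTime fun a => (l a).flatMap (G a) := by
  obtain ⟨q, hq⟩ := hG.size_le
  refine (foldl (s := fun _ => []) (f := fun a t x => G a x ++ t) hl.reverse
    (const []) ?_ ⟨q, fun a t x => ?_⟩).congr fun a => ?_
  · exact append (hG.comp ((fst .id).mk (snd (snd .id)))) (fst (snd .id))
  · have h1 : (code (G a x ++ t)).size + 1 = (code (G a x)).size + (code t).size :=
      Data.size_ofList_append _ _ _
    have := hq (a, x)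
    dsimp only at this
    omega
  · rw [List.foldl_reverse]
    induction l a with
    | nil => rfl
    | cons x l ih => rw [List.flatMap_cons, ih]; rfl

theorem dedup [DecidableEq Y] [Faithful Y] {l : A → List Y} (hl : PolyTime l) :
    PolyTime fun a => (l a).dedup := by
  refine (foldl (s := fun _ => [])
    (f := fun (_ : A) (t : List Y) (x : Y) => if x ∈ t then t else x :: t) hl.reverse (const []) ?_ ⟨X + 1, fun a t x => ?_⟩).congr fun a => ?_
  · refine (ite (PolyPred.mem (A := A × List Y × Y) (snd (snd .id)) (fst (snd .id)))
      (fst (snd .id)) (cons (snd (snd .id)) (fst (snd .id)))).congr fun _ => ?_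
    congr
  · split_ifs
    · exact Nat.le_add_right _ _
    · rw [code_cons, Data.size, code_mk, Data.size, eval_add, eval_X, eval_one]
      omega
  · rw [List.foldl_reverse]
    induction l a with
    | nil => rfl
    | cons x l ih =>
      rw [List.foldr_cons, ← ih]
      by_cases h : x ∈ l <;> simp [h]

/-- A list of fixed length whose entries are computed one by one. -/
theorem map_list {ι : Type} (l : List ι) {F : ι → A → B} (hF : ∀ i ∈ l, PolyTime (F i)) :
    PolyTime fun a => l.map fun i => F i a := by
  induction l with
  | nil => exact const []
  | cons i l ih =>
    exact cons (hF i (by simp)) (ih fun j hj => hF j (List.mem_cons_of_mem _ hj))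

theorem flatMap_list {ι : Type} (l : List ι) {F : ι → A → List B}
    (hF : ∀ i ∈ l, PolyTime (F i)) : PolyTime fun a => l.flatMap fun i => F i a := by
  induction l with
  | nil => exact const []
  | cons i l ih =>
    exact append (hF i (by simp)) (ih fun j hj => hF j (List.mem_cons_of_mem _ hj))

/-! ### Functions on `Fin n` -/

theorem pi {n : ℕ} {F : A → Fin n → B} (hF : ∀ j, PolyTime fun a => F a j) : PolyTime F :=
  (map_list (List.finRange n) (F := fun j a => F a j) fun j _ => hF j).congr_code fun a => by
    rw [code_fun, List.ofFn_eq_map]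

theorem apply {n : ℕ} {F : A → Fin n → B} (hF : PolyTime F) (j : Fin n) :
    PolyTime fun a => F a j := by
  refine comp (F := fun f : Fin n → B => f j) ?_ hF
  clear hF F
  induction n with
  | zero => exact j.elim0
  | succ n ih =>
    have hcode : ∀ f : Fin (n + 1) → B, code f = .cons (code (f 0)) (code (Fin.tail f)) := by
      intro f
      rw [code_fun, List.ofFn_succ]
      rfl
    refine Fin.cases ?_ (fun j => ?_) j
    · exact ⟨.hd, X + 1, fun f => ⟨by rw [hcode]; rfl, by simp [Prog.time]⟩⟩
    · refine comp (F := fun f : Fin n → B => f j) (G := Fin.tail) ?_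
        ⟨.tl, X + 1, fun f => ⟨by rw [hcode]; rfl, by simp [Prog.time]⟩⟩
      exact ih j

theorem some {F : A → B} (hF : PolyTime F) : PolyTime fun a => Option.some (F a) :=
  ((const ([] : List Bool)).mk hF).congr_code fun _ => rfl

end PolyTime

/-! ## The algorithm -/

theorem PolyPred.finite_cases {A ι : Type} [Coded A] [Finite ι] {κ : A → ι}
    (hκ : ∀ i, PolyPred fun a => κ a = i) {p : ι → A → Prop} (hp : ∀ i, PolyPred (p i)) :
    PolyPred fun a => p (κ a) a := by
  choose b hb h using hp
  exact ⟨fun a => b (κ a) a, PolyTime.finite_cases hκ hb, fun a => h (κ a) a⟩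

theorem PolyTime.getD {A B : Type} [Coded A] [Coded B] {F : A → Option B} (hF : PolyTime F)
    (d : B) : PolyTime fun a => (F a).getD d := by
  obtain ⟨P, q, hP⟩ := PolyTime.const_data (code d)
  refine comp (F := fun o : Option B => o.getD d) ⟨.ite .id .tl P, 2 * X + q + 3, fun o => ?_⟩ hF
  have hn : (code (none : Option B)) = .nil := rfl
  have hs : ∀ b : B, code (Option.some b) = .cons .nil (code b) := fun _ => rfl
  cases o with
  | none =>
    have := (hP (code (none : Option B))).2
    refine ⟨by simpa [Prog.eval, hn] using (hP _).1, ?_⟩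
    simp only [Prog.time, Prog.eval, hn, if_pos, eval_add, eval_mul, eval_X, eval_ofNat] at this ⊢
    omega
  | some b =>
    refine ⟨by simp [Prog.eval, hs, Data.tl], ?_⟩
    have hne : ¬ Prog.id.eval (code (Option.some b)) = .nil := by simp [Prog.eval, hs]
    rw [Prog.time, if_neg hne, Prog.time, Prog.time]
    simp only [eval_add, eval_mul, eval_X, eval_ofNat]
    omega

/-- All functions on `Fin n` with values in a list. -/
def List.allFunctions {A : Type} : (n : ℕ) → List A → List (Fin n → A)
  | 0, _ => [Fin.elim0]
  | n + 1, l => l.flatMap fun a => (allFunctions n l).map fun f => Fin.cons a f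

theorem List.mem_allFunctions {A : Type} {n : ℕ} {l : List A} {f : Fin n → A} :
    f ∈ allFunctions n l ↔ ∀ i, f i ∈ l := by
  induction n with
  | zero => simp [allFunctions]; exact funext fun i => i.elim0
  | succ n ih =>
    simp only [allFunctions, mem_flatMap, mem_map]
    constructor
    · rintro ⟨a, ha, g, hg, rfl⟩ i
      refine Fin.cases ha (fun i => ?_) i
      exact ih.1 hg i
    · intro h
      exact ⟨f 0, h 0, Fin.tail f, ih.2 fun i => h i.succ, Fin.cons_self_tail f⟩

/-- The number `n` is fixed, so the number of functions is polynomial in the length of the list. -/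
theorem PolyTime.allFunctions {A B : Type} [Coded A] [Coded B] {l : A → List B} (hl : PolyTime l)
    (n : ℕ) : PolyTime fun a => List.allFunctions n (l a) := by
  induction n with
  | zero => exact const _
  | succ n ih =>
    refine flatMap hl (map (ih.comp (fst .id)) ?_)
    refine ((snd (fst .id)).mk (snd .id)).congr_code fun p => ?_
    rw [code_fun, List.ofFn_cons]
    rfl

namespace CQ

variable {Q : CQ}

instance : Coded (Form Q.Token) := ⟨Q.encForm⟩
instance : Coded Q.FlowNode := ⟨Q.encNode⟩
instance : Coded Q.Listing := ⟨Q.encListing⟩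
instance : Coded Data := ⟨fun d => d⟩

section Formulas

variable {A : Type} [Coded A]

theorem polyTime_lit {i : Q.Atom} {t : A → Fin (Q.arity i) → ℕ} (ht : PolyTime t) :
    PolyTime fun a => (Form.lit ⟨i, t a⟩ : Form Q.Token) :=
  ((PolyTime.const 2).mk ((PolyTime.const (i : ℕ)).mk ht)).congr_code fun _ => rfl

theorem polyTime_and {F G : A → Form Q.Token} (hF : PolyTime F) (hG : PolyTime G) :
    PolyTime fun a => Form.and (F a) (G a) :=
  ((PolyTime.const 3).mk (hF.mk hG)).congr_code fun _ => rfl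

theorem polyTime_or {F G : A → Form Q.Token} (hF : PolyTime F) (hG : PolyTime G) :
    PolyTime fun a => Form.or (F a) (G a) :=
  ((PolyTime.const 4).mk (hF.mk hG)).congr_code fun _ => rfl

/-- `bigAnd` does not end with a constant. So the loop starts with the last entry and puts the
others in front of it, in reverse order. -/
theorem polyTime_bigAnd {l : A → List (Form Q.Token)} (hl : PolyTime l) :
    PolyTime fun a => Form.bigAnd (l a) := by
  refine (PolyTime.foldl (s := fun a => (l a).reverse.headD .top)
    (f := fun (_ : A) s e => Form.and e s) hl.reverse.tail (hl.reverse.headD .top)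
    (polyTime_and (.snd (.snd .id)) (.fst (.snd .id)))
    ⟨X + C ((Data.ofNat 3).size + 2), fun a t x => ?_⟩).congr fun a => ?_
  · have : (code (Form.and x t)).size =
        (Data.ofNat 3).size + ((code x).size + (code t).size + 1) + 1 := rfl
    rw [this, eval_add, eval_X, eval_C, code_mk, Data.size]
    omega
  · rw [← List.reverse_reverse (l a)]
    cases (l a).reverse with
    | nil => rfl
    | cons b r =>
      simp only [List.reverse_reverse, List.tail_cons, List.headD_cons]
      induction r using List.reverseRecOn with
      | nil => rfl
      | append_singleton r c ih =>
        have : (b :: (r ++ [c])).reverse = c :: (b :: r).reverse := by simp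
        rw [this, List.foldl_concat, ← ih]
        cases h : (b :: r).reverse with
        | nil => simp at h
        | cons d s => rfl

theorem polyTime_bigOr {l : A → List (Form Q.Token)} (hl : PolyTime l) :
    PolyTime fun a => Form.bigOr (l a) := by
  refine (PolyTime.foldl (s := fun a => (l a).reverse.headD .bot)
    (f := fun (_ : A) s e => Form.or e s) hl.reverse.tail (hl.reverse.headD .bot)
    (polyTime_or (.snd (.snd .id)) (.fst (.snd .id)))
    ⟨X + C ((Data.ofNat 4).size + 2), fun a t x => ?_⟩).congr fun a => ?_
  · have : (code (Form.or x t)).size =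
        (Data.ofNat 4).size + ((code x).size + (code t).size + 1) + 1 := rfl
    rw [this, eval_add, eval_X, eval_C, code_mk, Data.size]
    omega
  · rw [← List.reverse_reverse (l a)]
    cases (l a).reverse with
    | nil => rfl
    | cons b r =>
      simp only [List.reverse_reverse, List.tail_cons, List.headD_cons]
      induction r using List.reverseRecOn with
      | nil => rfl
      | append_singleton r c ih =>
        have : (b :: (r ++ [c])).reverse = c :: (b :: r).reverse := by simp
        rw [this, List.foldl_concat, ← ih]
        cases h : (b :: r).reverse with
        | nil => simp at h
        | cons d s => rfl

end Formulas

/-! ### The list of witnesses -/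

/-- The type of the tuples depends on the atom. Reading all relations as plain data gives a function
on `Fin n` with one type of values, to which `apply` applies. -/
theorem polyTime_relation (i : Q.Atom) : PolyTime fun I : Q.Listing => I i := by
  have h : PolyTime fun (I : Q.Listing) (i : Q.Atom) => (code (I i) : Data) :=
    PolyTime.of_code fun I => by
      change Data.ofList (fun d => d) (List.ofFn fun i => code (I i)) = _
      rfl
  exact (h.apply i).congr_code fun _ => rfl

/-- The constants of a listed database. -/
def constants (I : Q.Listing) : List ℕ :=
  (List.finRange Q.numAtoms).flatMap fun i => (I i).flatMap List.ofFn

theorem mem_constants {I : Q.Listing} {c : ℕ} : c ∈ constants I ↔ c ∈ Q.adom I.toDatabase := by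
  simp [constants, adom, Listing.toDatabase, List.mem_ofFn]

theorem polyTime_constants : PolyTime (constants : Q.Listing → List ℕ) :=
  PolyTime.flatMap_list _ fun i _ => PolyTime.flatMap (polyTime_relation i)
    ((PolyTime.snd .id).congr_code fun _ => rfl)

/-- The witnesses, as a list. -/
def witnessList (I : Q.Listing) : List Q.Valuation :=
  (List.allFunctions Q.numVars (constants I)).filter fun w =>
    decide (∀ i, (fun j => w (Q.args i j)) ∈ I i)

theorem mem_witnessList {I : Q.Listing} {w : Q.Valuation} :
    w ∈ witnessList I ↔ w ∈ Q.witnesses I.toDatabase := by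
  simp [witnessList, witnesses, List.mem_allFunctions, mem_constants, Listing.toDatabase]

/-- The query is fixed, so all valuations by constants of the database can be listed and tested. -/
theorem polyTime_witnessList : PolyTime (witnessList : Q.Listing → List Q.Valuation) := by
  refine (PolyTime.filter (p := fun (I : Q.Listing) w => ∀ i, (fun j => w (Q.args i j)) ∈ I i)
    (polyTime_constants.allFunctions Q.numVars) ?_).congr fun I => ?_
  · exact PolyPred.forall_finite fun i => PolyPred.mem
      (PolyTime.pi fun j => (PolyTime.snd .id).apply (Q.args i j))
      ((polyTime_relation i).comp (.fst .id))
  · exact List.filter_congr fun w _ => decide_eq_decide.2 Iff.rfl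

/-! ### The choice of the trees -/

/-- The agreement sets for a list of witnesses. -/
def listAgreement (W : List Q.Valuation) (w : Q.Valuation) (K : Set Q.Var) : Set Q.Var :=
  {x | ∀ u ∈ W, ∀ w' ∈ W, Q.Shares K w u → Q.Shares K u w' → w' x = w x}

theorem listAgreement_eq {D : Q.Database} {W : List Q.Valuation}
    (hW : ∀ w, w ∈ W ↔ w ∈ Q.witnesses D) (w : Q.Valuation) :
    listAgreement W w = Q.agreement D w := by
  funext K
  ext x
  simp only [listAgreement, agreement, hW]

theorem polyPred_shares {A : Type} [Coded A] {w u : A → Q.Valuation} (hw : PolyTime w)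
    (hu : PolyTime u) (K : Set Q.Var) : PolyPred fun a => Q.Shares K (w a) (u a) :=
  (PolyPred.exists_finite fun i => (PolyPred.const (∃ x ∈ Q.vars i, x ∈ K)).and
    (PolyPred.forall_finite fun x => (PolyPred.const (x ∈ Q.vars i)).imp (PolyPred.eq (hw.apply x) (hu.apply x)))).congr fun a => by
      simp only [Shares, tok_eq_iff]

/-- There are finitely many sets `K` and variables `x`. For each of them, membership in the
agreement set is a loop over pairs of witnesses. -/
theorem polyPred_listAgreement_eq (κ : Set Q.Var → Set Q.Var) :
    PolyPred fun a : List Q.Valuation × Q.Valuation => listAgreement a.1 a.2 = κ := by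
  have h : ∀ K x, PolyPred fun a : List Q.Valuation × Q.Valuation =>
      x ∈ listAgreement a.1 a.2 K := fun K x =>
    PolyPred.forall_mem (.fst .id) (PolyPred.forall_mem (.fst (.fst .id))
      ((polyPred_shares (.snd (.fst (.fst .id))) (.snd (.fst .id)) K).imp
        ((polyPred_shares (.snd (.fst .id)) (.snd .id) K).imp
          (PolyPred.eq ((PolyTime.snd .id).apply x)
            ((PolyTime.snd (.fst (.fst .id))).apply x)))))
  refine (PolyPred.forall_finite fun K => PolyPred.forall_finite fun x =>
    ((h K x).imp (PolyPred.const (x ∈ κ K))).and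
      ((PolyPred.const (x ∈ κ K)).imp (h K x))).congr fun a => ?_
  simp only [funext_iff, Set.ext_iff, iff_def]

/-! ### The cut -/

open Classical in
/-- The nodes that are selected for `w` if it uses the tree of the preference `κ`. -/
noncomputable def nodesOf (Ω : Q.Ordering) (κ : Set Q.Var → Set Q.Var) (w : Q.Valuation) :
    List Q.FlowNode :=
  ((Ω.choices []).filter fun c => decide (c.2 = Q.strategyTree (Q.preferring κ))).flatMap
    (fun c => c.1.toList.map fun α => .plan w α) ++
  ((Q.strategyTree (Q.preferring κ)).filter fun p => (Q.tablesAt p).Nonempty).toList.map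
    fun p => .pre (Q.inst w p)

theorem polyTime_inst {A : Type} [Coded A] {w : A → Q.Valuation} (hw : PolyTime w)
    (p : Q.Path) : PolyTime fun a => (Q.inst (w a) p).2 := by
  refine PolyTime.pi fun x => ?_
  by_cases hx : x ∈ Q.pathVars p
  · exact (hw.apply x).some.congr fun a => if_pos hx
  · exact (PolyTime.const none).congr fun a => if_neg hx

theorem polyTime_nodesOf (Ω : Q.Ordering) (κ : Set Q.Var → Set Q.Var) {A : Type} [Coded A]
    {w : A → Q.Valuation} (hw : PolyTime w) : PolyTime fun a => nodesOf Ω κ (w a) := by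
  refine PolyTime.append (PolyTime.flatMap_list _ fun c _ => PolyTime.map_list _ fun α _ => ?_)
    (PolyTime.map_list _ fun p _ => ?_)
  · exact ((PolyTime.const 3).mk (hw.mk (PolyTime.const α))).congr_code fun _ => rfl
  · exact ((PolyTime.const 4).mk ((PolyTime.const p).mk (polyTime_inst hw p))).congr_code
      fun _ => rfl

/-- The nodes that are selected for the witnesses in `W`. -/
noncomputable def cutList (Ω : Q.Ordering) (W : List Q.Valuation) : List Q.FlowNode :=
  W.flatMap fun w => nodesOf Ω (listAgreement W w) w

/-- The tree of a witness depends only on its agreement function, of which there are finitely many.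
So the noncomputable choice of separators is made beforehand for each of them. -/
theorem polyTime_cutList (Ω : Q.Ordering) : PolyTime (cutList Ω) :=
  PolyTime.flatMap .id (PolyTime.finite_cases polyPred_listAgreement_eq
    fun κ => polyTime_nodesOf Ω κ (.snd .id))

theorem mem_cutList {Ω : Q.Ordering} {D : Q.Database} {W : List Q.Valuation}
    (hW : ∀ w, w ∈ W ↔ w ∈ Q.witnesses D) (n : Q.FlowNode) :
    n ∈ cutList Ω W ↔ n ∈ Ω.selected D (Q.agreeingTree D) := by
  simp only [cutList, List.mem_flatMap, hW, nodesOf, listAgreement_eq hW, List.mem_append,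
    List.mem_filter, decide_eq_true_eq, List.mem_map, Finset.mem_toList, Finset.mem_filter]
  refine exists_congr fun w => and_congr_right fun _ => or_congr ?_ ?_
  · exact exists_congr fun c => by
      simp only [agreeingTree, and_assoc, eq_comm (a := n)]
  · exact exists_congr fun p => by
      simp only [agreeingTree, and_assoc, eq_comm (a := n)]

/-! ### The factorization -/

/-- Instances of legal paths. -/
abbrev LInst (Q : CQ) : Type := {p : Q.Path // Q.IsLegal p} × (Q.Var → Option ℕ)

def LInst.toPInst (π : Q.LInst) : Q.PInst := (π.1.1, π.2)

theorem LInst.toPInst_injective : Function.Injective (LInst.toPInst : Q.LInst → Q.PInst) := by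
  intro a b h
  simp only [toPInst, Prod.mk.injEq] at h
  exact Prod.ext (Subtype.ext h.1) h.2

/-- With finitely many possible paths, everything that depends on the path of an instance is a
finite case distinction. Only the values vary with the database. -/
instance : Finite {p : Q.Path // Q.IsLegal p} := Q.finite_isLegal.to_subtype

theorem isLegal_of_mem_strategyTree {σ : Q.Path → Set Q.Var → Finset Q.Var} {p : Q.Path}
    (hp : p ∈ Q.strategyTree σ) : Q.IsLegal p :=
  fun r S hr => ((mem_strategyTree.1 hp).2 r S hr).1

/-- The prefix instances of `w` if it uses the tree of the preference `κ`. -/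
noncomputable def instancesOf (κ : Set Q.Var → Set Q.Var) (w : Q.Valuation) : List Q.LInst :=
  (Q.strategyTree (Q.preferring κ)).attach.toList.map fun p =>
    (⟨p.1, isLegal_of_mem_strategyTree p.2⟩, (Q.inst w p.1).2)

open Classical in
/-- The prefix instances of the witnesses in `W`. -/
noncomputable def instanceList (W : List Q.Valuation) : List Q.LInst :=
  (W.flatMap fun w => instancesOf (listAgreement W w) w).dedup

theorem polyTime_instanceList : PolyTime (instanceList : List Q.Valuation → List Q.LInst) :=
  PolyTime.dedup (PolyTime.flatMap (G := fun W w => instancesOf (listAgreement W w) w) .id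
    (PolyTime.finite_cases polyPred_listAgreement_eq (G := fun κ a => instancesOf κ a.2) fun _ =>
      PolyTime.map_list _ fun _ _ => (PolyTime.const _).mk (polyTime_inst (.snd .id) _)))

theorem mem_instanceList {D : Q.Database} {W : List Q.Valuation}
    (hW : ∀ w, w ∈ W ↔ w ∈ Q.witnesses D) (π : Q.PInst) :
    π ∈ (instanceList W).map LInst.toPInst ↔ π ∈ Q.prefixInstances D (Q.agreeingTree D) := by
  rw [mem_prefixInstances]
  have ht : ∀ w, Q.agreeingTree D w = Q.strategyTree (Q.preferring (listAgreement W w)) :=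
    fun w => by rw [agreeingTree, listAgreement_eq hW]
  simp only [ht, instanceList, instancesOf, List.mem_map, List.mem_dedup, List.mem_flatMap, hW,
    Finset.mem_toList, Finset.mem_attach, true_and]
  constructor
  · rintro ⟨_, ⟨w, hw, p, rfl⟩, rfl⟩
    exact ⟨w, hw, p.1, p.2, rfl⟩
  · rintro ⟨w, hw, p, hp, rfl⟩
    exact ⟨_, ⟨w, hw, ⟨p, hp⟩, rfl⟩, rfl⟩

theorem nodup_instanceList (W : List Q.Valuation) :
    ((instanceList W).map LInst.toPInst).Nodup :=
  (List.nodup_dedup _).map LInst.toPInst_injective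

section Factor

variable {A : Type} [Coded A]

theorem polyPred_path {π : A → Q.LInst} (hπ : PolyTime π) (p : {p : Q.Path // Q.IsLegal p}) :
    PolyPred fun a => (π a).1 = p :=
  PolyPred.eq hπ.fst (PolyTime.const p)

theorem polyTime_tokensAt {π : A → Q.LInst} (hπ : PolyTime π) :
    PolyTime fun a => Q.tokensAt (π a).toPInst :=
  PolyTime.finite_cases (polyPred_path hπ)
    (G := fun p a => Q.tokensAt (LInst.toPInst (p, (π a).2))) fun p =>
      (PolyTime.map_list ((List.finRange Q.numAtoms).filter fun i => decide (i ∈ Q.tablesAt p.1))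
        fun i _ => polyTime_lit (PolyTime.pi fun j =>
          (hπ.snd.apply (Q.args i j)).getD 0)).congr fun _ => rfl

theorem polyPred_isChild {π π' : A → Q.LInst} (hπ : PolyTime π) (hπ' : PolyTime π') :
    PolyPred fun a => Q.IsChild (π a).toPInst (π' a).toPInst :=
  PolyPred.finite_cases (polyPred_path hπ)
    (p := fun p a => Q.IsChild (LInst.toPInst (p, (π a).2)) (π' a).toPInst) fun p =>
    PolyPred.finite_cases (polyPred_path hπ')
      (p := fun p' a => Q.IsChild (LInst.toPInst (p, (π a).2)) (LInst.toPInst (p', (π' a).2)))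
      fun p' => ((PolyPred.const (∃ S, p'.1 = p.1 ++ [S])).and (PolyPred.forall_finite fun x =>
        (PolyPred.const (x ∈ Q.pathVars p.1)).imp
          (PolyPred.eq (hπ'.snd.apply x) (hπ.snd.apply x)))).congr fun _ => Iff.rfl

/-- The component that the child `π'` of `π` eliminates. -/
def childComponent (π π' : Q.LInst) : Set Q.Var :=
  Q.component (Q.pathVars π.1.1) (π'.1.1.getLastD ∅)

theorem polyTime_childComponent {π π' : A → Q.LInst} (hπ : PolyTime π) (hπ' : PolyTime π') :
    PolyTime fun a => childComponent (π a) (π' a) :=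
  PolyTime.finite_cases (polyPred_path hπ)
    (G := fun p a => Q.component (Q.pathVars p.1) ((π' a).1.1.getLastD ∅)) fun p =>
    PolyTime.finite_cases (polyPred_path hπ')
      (G := fun p' _ => Q.component (Q.pathVars p.1) (p'.1.getLastD ∅)) fun _ => PolyTime.const _

end Factor

open Classical in
/-- The children of `π`. -/
noncomputable def childList (L : List Q.LInst) (π : Q.LInst) : List Q.LInst :=
  L.filter fun π' => decide (Q.IsChild π.toPInst π'.toPInst)

open Classical in
theorem factorAt_succ_map (L : List Q.LInst) (k : ℕ) (π : Q.LInst) :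
    Q.factorAt (L.map LInst.toPInst) (k + 1) π.toPInst =
      Form.bigAnd (Q.tokensAt π.toPInst ++
        ((childList L π).map (childComponent π)).dedup.map fun K =>
          Form.bigOr (((childList L π).filter fun π' => decide (childComponent π π' = K)).map
            fun π' => Q.factorAt (L.map LInst.toPInst) k π'.toPInst)) := by
  rw [factorAt]
  simp only [List.filter_map, List.map_map]
  rfl

/-- The depth is a constant of the query, so the polynomial may grow with each level of the
recursion. -/
theorem polyTime_factorAt (k : ℕ) : PolyTime fun a : List Q.LInst × Q.LInst =>
    Q.factorAt (a.1.map LInst.toPInst) k a.2.toPInst := by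
  induction k with
  | zero => exact polyTime_bigAnd (polyTime_tokensAt (.snd .id))
  | succ k ih =>
    have hc : PolyTime fun a : List Q.LInst × Q.LInst => childList a.1 a.2 :=
      PolyTime.filter (.fst .id) (polyPred_isChild (.snd (.fst .id)) (.snd .id))
    refine (polyTime_bigAnd (PolyTime.append (polyTime_tokensAt (.snd .id)) (PolyTime.map
      (PolyTime.dedup (hc.map (G := fun a π' => childComponent a.2 π') (polyTime_childComponent (.snd (.fst .id)) (.snd .id))))
      (G := fun a K => Form.bigOr (((childList a.1 a.2).filter
        fun π' => @decide (childComponent a.2 π' = K) (Classical.propDecidable _)).map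
            fun π' => Q.factorAt (a.1.map LInst.toPInst) k π'.toPInst)) (polyTime_bigOr
        (PolyTime.map (PolyTime.filter (hc.comp (.fst .id)) (PolyPred.eq
          (polyTime_childComponent (.snd (.fst (.fst .id))) (.snd .id)) (.snd (.fst .id))))
          (ih.comp ((PolyTime.fst (.fst (.fst .id))).mk (.snd .id)))))))).congr fun a => ?_
    exact factorAt_succ_map a.1 k a.2

theorem polyTime_factor : PolyTime fun L : List Q.LInst => Q.factor (L.map LInst.toPInst) := by
  refine (polyTime_bigOr (PolyTime.map
    (G := fun L π => Q.factorAt (L.map LInst.toPInst) Q.numVars π.toPInst)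
    (PolyTime.filter (p := fun (_ : List Q.LInst) π => π.1.1.length = 1) .id
    (PolyPred.finite_cases (polyPred_path (.snd .id)) (p := fun p _ => p.1.length = 1)
      fun _ => PolyPred.const _)) (polyTime_factorAt Q.numVars))).congr fun L => ?_
  rw [factor, List.filter_map, List.map_map]
  congr 2
  refine List.filter_congr fun π _ => ?_
  exact decide_eq_decide.2 Iff.rfl

/-- The program evaluates the agreeing trees on any database. Only the correctness of its output
needs the read-once property. -/
theorem exists_program (Ω : Q.Ordering) : ∃ (P : Prog) (c k : ℕ), ∀ I : Q.Listing,
    P.time (Q.encListing I) ≤ c * (Q.encListing I).size ^ k + c ∧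
    P.eval (Q.encListing I) = Q.encOutput (cutList Ω (witnessList I))
      (Q.factor ((instanceList (witnessList I)).map LInst.toPInst)) := by
  obtain ⟨P, q, h⟩ := ((polyTime_cutList Ω).mk
    (polyTime_factor.comp polyTime_instanceList)).comp (polyTime_witnessList (Q := Q))
  obtain ⟨c, k, hq⟩ := q.exists_bound
  exact ⟨P, c, k, fun I => ⟨(h I).2.trans (hq _), (h I).1⟩⟩

end CQ

theorem mainTheorem2 (Q : CQ) (hconn : Q.Connected) (hvar : 0 < Q.numVars) :
    (∃ Ω : Q.Ordering, Ω.IsRunningPrefixes) ∧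
    ∀ Ω : Q.Ordering, Ω.IsRunningPrefixes →
      (∀ D : Q.Database, (Q.provenance D).IsReadOnce →
        ¬ Ω.HasLeakage D ∧ ¬ Ω.HasLeakagePath D ∧
        ∀ C : Set Q.FlowNode, Ω.IsMinCut D C →
          (∃ f, Q.IsAssignment D f ∧ Ω.selected D f ⊆ C) ∧
          ∀ f, Q.IsAssignment D f → Ω.selected D f ⊆ C →
            ∀ φ, Q.IsFactorizationOf D f φ →
              φ.InReadOnceForm ∧ φ.IsMinimalFor (Q.provenance D) ∧
              φ.len = CQ.Ordering.cutWeight C) ∧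
      ∃ (P : Prog) (c k : ℕ), ∀ I : Q.Listing,
        P.time (Q.encListing I) ≤ c * (Q.encListing I).size ^ k + c ∧
        ((Q.provenance I.toDatabase).IsReadOnce →
          ∃ (C : List Q.FlowNode) (f : Q.Valuation → Q.Tree) (φ : Form Q.Token),
            P.eval (Q.encListing I) = Q.encOutput C φ ∧
            Ω.IsMinCut I.toDatabase {n | n ∈ C} ∧
            Q.IsAssignment I.toDatabase f ∧ Ω.selected I.toDatabase f ⊆ {n | n ∈ C} ∧
            Q.IsFactorizationOf I.toDatabase f φ ∧
            φ.InReadOnceForm ∧ φ.IsMinimalFor (Q.provenance I.toDatabase)) := by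
  refine ⟨CQ.exists_isRunningPrefixes hconn hvar, fun Ω hΩ => ⟨fun D hD =>
    ⟨CQ.not_hasLeakage hconn hvar hΩ hD, CQ.not_hasLeakagePath hconn hvar hΩ hD, fun C hC =>
      ⟨CQ.exists_selected_subset hconn hvar hΩ hC.1, fun f hf hfC φ hφ =>
        CQ.factorization_of_isMinCut hconn hvar hΩ hD hC hf hfC hφ⟩⟩, ?_⟩⟩
  obtain ⟨P, c, k, h⟩ := CQ.exists_program Ω
  refine ⟨P, c, k, fun I => ⟨(h I).1, fun hD => ?_⟩⟩
  have hW : ∀ w, w ∈ CQ.witnessList I ↔ w ∈ Q.witnesses I.toDatabase :=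
    fun w => CQ.mem_witnessList
  -- The computed cut is exactly the selection of the agreeing trees, so the computed formula is a
  -- factorization that this cut yields.
  have hC : {n | n ∈ CQ.cutList Ω (CQ.witnessList I)} =
      Ω.selected I.toDatabase (Q.agreeingTree I.toDatabase) :=
    Set.ext fun n => CQ.mem_cutList hW n
  have ha := CQ.isAssignment_agreeingTree hconn hvar I.toDatabase
  have hφ : Q.IsFactorizationOf I.toDatabase (Q.agreeingTree I.toDatabase)
      (Q.factor ((CQ.instanceList (CQ.witnessList I)).map CQ.LInst.toPInst)) :=
    ⟨_, CQ.nodup_instanceList _, CQ.mem_instanceList hW, rfl⟩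
  refine ⟨_, Q.agreeingTree I.toDatabase, _, (h I).2, ?_, ha, hC.ge, hφ,
    hφ.isMinimalFor hconn hvar ha (CQ.cutWeight_agreeingTree hconn hvar hD Ω).le⟩
  rw [hC]
  exact CQ.isMinCut_agreeingTree hconn hvar hΩ hD
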